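/- Work in four-dimensional Einstein–Maxwell theory with $\Lambda=0$: $R_{\mu\nu}=2\mathcal F_{\mu\sigma}\mathcal F_\nu{}^\sigma-\tfrac12 g_{\mu\nu}\mathcal F_{\rho\sigma}\mathcal F^{\rho\sigma}$, $d\star\mathcal F=0$, $d\mathcal F=0$. Let $r_+>0$ and $q_e^2+q_m^2=r_+^2$, and consider the AdS$_2\times S^2$ near-horizon geometry $$g^{(0)}=-\frac{r^2}{r_+^2}dv^2+2\,dv\,dr+r_+^2\Big(\frac{dx^2}{1-x^2}+(1-x^2)d\phi^2\Big),\qquad \mathcal F^{(0)}=-\frac{q_e}{r_+^2}dv\wedge dr+q_m\,dx\wedge d\phi .$$ A (smooth) transverse deformation is a solution of the Einstein–Maxwell equations linearised at $(g^{(0)},\mathcal F^{(0)})$ of the form $$g^{(1)}=r^3F\,dv^2+2r^2h_a\,dv\,dx^a+r\gamma_{ab}\,dx^adx^b,\qquad \mathcal F^{(1)}=r\Psi\,dv\wedge dr+r^2W_a\,dv\wedge dx^a+Z_a\,dr\wedge dx^a+\tfrac12rB_{ab}\,dx^a\wedge dx^b$$ with $F,h_a,\gamma_{ab},\Psi,W_a,Z_a,B_{ab}$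 smooth tensor fields on $S^2$. It is axisymmetric if these are invariant under $\partial_\phi$, and static if $dh=0$ and $dF=0$. Two deformations are gauge equivalent if they differ by $(-\mathcal L_\xi g^{(0)},-\mathcal L_\xi\mathcal F^{(0)})$ with $\xi=\tfrac12f\,\partial_v-\tfrac12r\,D^af\,\partial_a$ for a smooth function $f$ on $S^2$, where $D$ is the Levi-Civita connection of the metric $r_+^2\big(\tfrac{dx^2}{1-x^2}+(1-x^2)d\phi^2\big)$ on $S^2$ and indices are raised with this metric. The moduli space is the space of deformations modulo gauge. (i) The axisymmetric deformations form a real vector space whose moduli space has dimension 3, and the static axisymmetric ones form a subspace whose moduli space has dimension 2. Every axisymmetric deformation is gauge equivalent, for exactly one $(K_1,K_2,K_3)\in\mathbb R^3$, to the deformation $$\gamma=\Big(\frac{K_2}{1-x^2}+K_3\Big)dx^2+4K_1(1-x^2)\,dx\,d\phi+K_2(1-x^2)\,d\phi^2,\qquad Z=\frac{K_1}{r_+^2}\big(q_m x\,dx+q_e x(1-x^2)\,d\phi\big),$$ $$h=\frac{K_3x}{2r_+^2}dx+\frac{2K_1x(1-x^2)}{r_+^2}d\phi,\qquad F=\frac{3K_2+K_3}{3r_+^4},\qquad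 \Psi=\frac{K_1q_m(1-3x^2)}{r_+^4}+\frac{q_e(2K_2+K_3(1-x^2))}{2r_+^4},$$ $W=\tfrac12d\Psi$, $B=dZ$; all values of $(K_1,K_2,K_3)$ occur, and the deformation is static if and only if $K_1=0$. (ii) The moduli space of static axisymmetric deformations contains the following solutions. For each of them there are coordinates $t=v+T(r,x)$, $\varrho=R(r,x)$, $y=Y(r,x)$, $\psi=k\phi+\Omega v+S(r,x)$ (with constants $k>0$ and $\Omega$), where $(t,\varrho,y,\psi)$ are the coordinates in which the solution is given, such that in the coordinates $(v,r,x,\phi)$ the solution extends smoothly through the horizon $r=0$, its pull-back by $(v,r,x,\phi)\mapsto(v/\varepsilon,\varepsilon r,x,\phi)$ is $(g^{(0)},\mathcal F^{(0)})+\varepsilon\,(g^{(1)},\mathcal F^{(1)})+o(\varepsilon)$, and $(g^{(1)},\mathcal F^{(1)})$ is a static axisymmetric deformation with $K_1=0$ and the stated $K_2,K_3$: - extreme Reissner–Nordström with charges $q_e,q_m$: $K_2=2r_+$, $K_3=0$; - every extreme Ernst solution, with parameters $e>0$ and $b$, $e^2b^2<4$, duality-rotated to the charges $(q_e,q_m)$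 (electric for $q_m=0$, magnetic for $q_e=0$), whose horizon radius $\frac{e(4+b^2e^2)^2}{4(4-b^2e^2)}$ equals $r_+$: $$K_2=\frac{2e(4+b^2e^2)^3}{(4-b^2e^2)^3},\qquad K_3=\frac{12b^2e^3(4+b^2e^2)^3}{(4-b^2e^2)^4};$$ - the extreme Kerr–Melvin solution (the case of extreme Kerr–Newman–Melvin with uncharged seed) with rotation parameter $a>0$ and external field $b$ satisfying $a^2b^2=1$ and $2a=r_+$, duality-rotated to the charges $(q_e,q_m)$: $K_2=0$, $K_3=6a>0$. Here the solutions are, with $u$ the unit complex number for which the charges are $(q_e,q_m)$: Reissner–Nordström, $-(1-\tfrac{r_+}{\varrho})^2dt^2+(1-\tfrac{r_+}{\varrho})^{-2}d\varrho^2+\varrho^2\big(\tfrac{dy^2}{1-y^2}+(1-y^2)d\psi^2\big)$, $\varrho>r_+$, $\mathcal F=-\tfrac{q_e}{\varrho^2}dt\wedge d\varrho+q_m\,dy\wedge d\psi$. The other two have the form $-N\,dt^2+P\,d\varrho^2+Q\,dy^2+X(d\psi-\omega\,dt)^2$ and $$\mathcal F=d(\mathrm{Re}\,\Phi)\wedge(d\psi-\omega\,dt)+\Big(-\sqrt{\tfrac{NP}{QX}}\,\partial_y(\mathrm{Im}\,\Phi)\,d\varrho+\sqrt{\tfrac{NQ}{PX}}\,\partial_\varrho(\mathrm{Im}\,\Phi)\,dy\Big)\wedge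 dt .$$ Ernst: with $A=\frac{b}{1+e^2b^2/4}$, $\mathcal Q=\frac{(\varrho-e)^2(1-A^2\varrho^2)}{\varrho^2}$, $\mathcal P=(1+Aey)^2$, $\sigma=1+A\varrho y$, $X_0=\mathcal P\varrho^2(1-y^2)/\sigma^2$, $\mathcal D=(1+\tfrac12eby)^2+\tfrac14b^2X_0$, one has $N=\mathcal D^2\mathcal Q/\sigma^2$, $P=\mathcal D^2/(\mathcal Q\sigma^2)$, $Q=\mathcal D^2\varrho^2/(\mathcal P(1-y^2)\sigma^2)$, $X=X_0/\mathcal D^2$, $\omega=0$, $\Phi=u\,\frac{ey+\frac b2(X_0+e^2y^2)}{\mathcal D}$, on $e<\varrho<1/|A|$, where $u=(q_m-iq_e)/r_+$. Kerr–Melvin: with $\Delta=(\varrho-a)^2$, $\rho^2=\varrho^2+a^2y^2$, $\mathcal A=(\varrho^2+a^2)^2-\Delta a^2(1-y^2)$, $\Lambda=1+\frac{b^2\mathcal A(1-y^2)}{4\rho^2}-\tfrac i2a^2b^2y\big(3-y^2+\tfrac{a^2}{\rho^2}(1-y^2)^2\big)$, one has $N=|\Lambda|^2\rho^2\Delta/\mathcal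 A$, $P=|\Lambda|^2\rho^2/\Delta$, $Q=|\Lambda|^2\rho^2/(1-y^2)$, $X=\mathcal A(1-y^2)/(\rho^2|\Lambda|^2)$, $\Phi=\tfrac{2u}{b}(1-\Lambda^{-1})$, on $\varrho>a$, where $u=ab(q_e+iq_m)/r_+$ and $$\omega=\frac{a}{\varrho^2+a^2}\Big\{1-a^4b^4-\Delta\Big[\frac{\rho^2}{\mathcal A}+\frac{b^4}{16}\Big(-8a\varrho y^2(3-y^2)-6a\varrho(1-y^2)^2+\frac{2a^3(1-y^2)^3}{\mathcal A}[\varrho(\varrho^2+a^2)+2a^3]+\frac{4a^4y^2}{\mathcal A}[(\varrho^2+a^2)(3-y^2)^2-4a^2(1-y^2)]\Big)\Big]\Big\}.$$ In each case $-1<y<1$, and the horizon $r=0$ is at $\varrho=r_+$, $e$, $a$ respectively. -/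

import Mathlib

open scoped ContDiff Topology

noncomputable section

namespace ExtremeHorizon

/-! ### Coordinate tensor calculus and the Einstein–Maxwell equations in four dimensions -/

/-- A point of a four-dimensional coordinate patch. -/
abbrev Pt : Type := Fin 4 → ℝ

/-- A covariant 2-tensor field, given by its components in a four-dimensional chart. -/
abbrev TensorField : Type := Pt → Matrix (Fin 4) (Fin 4) ℝ

/-- The partial derivative `∂_μ f` at `p`. -/
def pd (μ : Fin 4) (f : Pt → ℝ) (p : Pt) : ℝ :=
  deriv (fun s => f (Function.update p μ s)) (p μ)

/-- The Christoffel symbol `Γ^ρ_{μν}` of the metric `g`. -/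
def christoffel (g : TensorField) (ρ μ ν : Fin 4) (p : Pt) : ℝ :=
  (1 / 2) * ∑ σ, (g p)⁻¹ ρ σ *
    (pd μ (fun q => g q ν σ) p + pd ν (fun q => g q μ σ) p - pd σ (fun q => g q μ ν) p)

/-- The Ricci tensor `R_{μν}` of the metric `g`. -/
def ricci (g : TensorField) (μ ν : Fin 4) (p : Pt) : ℝ :=
  ∑ ρ, (pd ρ (christoffel g ρ μ ν) p - pd ν (christoffel g ρ ρ μ) p
    + ∑ l, (christoffel g ρ ρ l p * christoffel g l μ ν p
      - christoffel g ρ ν l p * christoffel g l ρ μ p))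

/-- `F_{μσ} F_ν{}^σ`. -/
def maxwellSq (g F : TensorField) (μ ν : Fin 4) (p : Pt) : ℝ :=
  ∑ σ, ∑ τ, (g p)⁻¹ σ τ * F p μ σ * F p ν τ

/-- Left minus right hand side of the Einstein equation
`R_{μν} = 2 F_{μσ} F_ν{}^σ - (1/2) g_{μν} F_{ρσ} F^{ρσ}` (zero cosmological constant). -/
def einsteinResidual (g F : TensorField) (μ ν : Fin 4) (p : Pt) : ℝ :=
  ricci g μ ν p - 2 * maxwellSq g F μ ν p
    + (1 / 2) * g p μ ν * ∑ α, ∑ β, (g p)⁻¹ α β * maxwellSq g F α β p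

/-- `g^{μν} ∇_ν F_{μρ}`, whose vanishing is the Maxwell equation `d ⋆ F = 0`. -/
def maxwellResidual (g F : TensorField) (ρ : Fin 4) (p : Pt) : ℝ :=
  ∑ μ, ∑ ν, (g p)⁻¹ μ ν *
    (pd ν (fun q => F q μ ρ) p
      - ∑ l, (christoffel g l ν μ p * F p l ρ + christoffel g l ν ρ p * F p μ l))

/-- The components of `dF`. -/
def bianchiResidual (F : TensorField) (μ ν ρ : Fin 4) (p : Pt) : ℝ :=
  pd μ (fun q => F q ν ρ) p + pd ν (fun q => F q ρ μ) p + pd ρ (fun q => F q μ ν) p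

/-- The Lie derivative of a covariant 2-tensor field along the vector field `ξ`. -/
def lieDeriv (ξ : Pt → Fin 4 → ℝ) (T : TensorField) : TensorField := fun p =>
  Matrix.of fun μ ν => ∑ ρ, (ξ p ρ * pd ρ (fun q => T q μ ν) p
    + T p ρ ν * pd μ (fun q => ξ q ρ) p + T p μ ρ * pd ν (fun q => ξ q ρ) p)

/-- The pull-back of a covariant 2-tensor field by a map of coordinate patches. -/
def pullback (χ : Pt → Pt) (T : TensorField) : TensorField := fun p =>
  Matrix.of fun μ ν => ∑ α, ∑ β,
    pd μ (fun q => χ q α) p * pd ν (fun q => χ q β) p * T (χ p) α β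

/-! ### Smooth tensor fields on the two-sphere in the coordinates `(x, φ)`, `-1 < x < 1` -/

/-- The point of the unit sphere in `ℝ³` with polar coordinates `(x, φ)`, `x = cos θ`. -/
def spherePoint (x φ : ℝ) : Fin 3 → ℝ :=
  ![√(1 - x ^ 2) * Real.cos φ, √(1 - x ^ 2) * Real.sin φ, x]

/-- The coordinate vectors `∂_x` (index `0`) and `∂_φ` (index `1`) of the sphere, as vectors
in `ℝ³`. -/
def sphereFrame (x φ : ℝ) : Fin 2 → Fin 3 → ℝ :=
  ![![-x / √(1 - x ^ 2) * Real.cos φ, -x / √(1 - x ^ 2) * Real.sin φ, 1],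
    ![-√(1 - x ^ 2) * Real.sin φ, √(1 - x ^ 2) * Real.cos φ, 0]]

/-- `u` is (the coordinate expression of) a smooth function on the whole sphere, poles included:
it is the restriction of a smooth function defined around the sphere in `ℝ³`. -/
def SmoothScalar (u : ℝ → ℝ → ℝ) : Prop :=
  ∃ A : (Fin 3 → ℝ) → ℝ, ContDiffOn ℝ ∞ A {0}ᶜ ∧
    ∀ x ∈ Set.Ioo (-1 : ℝ) 1, ∀ φ, u x φ = A (spherePoint x φ)

/-- `w_a` are the components of a smooth 1-form on the whole sphere: it is the pull-back to the
sphere of a smooth 1-form defined around it in `ℝ³`. -/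
def SmoothCovector (w : ℝ → ℝ → Fin 2 → ℝ) : Prop :=
  ∃ A : (Fin 3 → ℝ) → Fin 3 → ℝ, ContDiffOn ℝ ∞ A {0}ᶜ ∧
    ∀ x ∈ Set.Ioo (-1 : ℝ) 1, ∀ φ a,
      w x φ a = ∑ i, A (spherePoint x φ) i * sphereFrame x φ a i

/-- `t_{ab}` are the components of a smooth covariant 2-tensor field on the whole sphere. -/
def SmoothTensor (t : ℝ → ℝ → Matrix (Fin 2) (Fin 2) ℝ) : Prop :=
  ∃ A : (Fin 3 → ℝ) → Fin 3 → Fin 3 → ℝ, ContDiffOn ℝ ∞ A {0}ᶜ ∧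
    ∀ x ∈ Set.Ioo (-1 : ℝ) 1, ∀ φ a b,
      t x φ a b = ∑ i, ∑ j,
        A (spherePoint x φ) i j * sphereFrame x φ a i * sphereFrame x φ b j

/-! ### The near-horizon geometry `AdS₂ × S²`, in coordinates `(v, r, x, φ)` -/

/-- The region `-1 < x < 1` on which the coordinates `(v, r, x, φ)` are used. -/
def patch : Set Pt := {p | p 2 ∈ Set.Ioo (-1 : ℝ) 1}

/-- `-(r²/r₊²) dv² + 2 dv dr + r₊² (dx²/(1-x²) + (1-x²) dφ²)`. -/
def nhMetric (rp : ℝ) : TensorField := fun p =>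
  !![-(p 1) ^ 2 / rp ^ 2, 1, 0, 0;
     1, 0, 0, 0;
     0, 0, rp ^ 2 / (1 - (p 2) ^ 2), 0;
     0, 0, 0, rp ^ 2 * (1 - (p 2) ^ 2)]

/-- `-(q_e/r₊²) dv ∧ dr + q_m dx ∧ dφ`. -/
def nhMaxwell (qe qm rp : ℝ) : TensorField := fun _ =>
  !![0, -qe / rp ^ 2, 0, 0;
     qe / rp ^ 2, 0, 0, 0;
     0, 0, 0, qm;
     0, 0, -qm, 0]

/-! ### First order data and transverse deformations -/

/-- First order data `(F, h_a, γ_{ab}, Ψ, W_a, Z_a, B_{ab})` on the sphere, as functions of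
`(x, φ)`. -/
abbrev FirstOrderData : Type :=
  (ℝ → ℝ → ℝ) × (ℝ → ℝ → Fin 2 → ℝ) × (ℝ → ℝ → Matrix (Fin 2) (Fin 2) ℝ) ×
  (ℝ → ℝ → ℝ) × (ℝ → ℝ → Fin 2 → ℝ) × (ℝ → ℝ → Fin 2 → ℝ) ×
  (ℝ → ℝ → Matrix (Fin 2) (Fin 2) ℝ)

namespace FirstOrderData

def F (D : FirstOrderData) : ℝ → ℝ → ℝ := D.1
def h (D : FirstOrderData) : ℝ → ℝ → Fin 2 → ℝ := D.2.1
def γ (D : FirstOrderData) : ℝ → ℝ → Matrix (Fin 2) (Fin 2) ℝ := D.2.2.1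
def Ψ (D : FirstOrderData) : ℝ → ℝ → ℝ := D.2.2.2.1
def W (D : FirstOrderData) : ℝ → ℝ → Fin 2 → ℝ := D.2.2.2.2.1
def Z (D : FirstOrderData) : ℝ → ℝ → Fin 2 → ℝ := D.2.2.2.2.2.1
def B (D : FirstOrderData) : ℝ → ℝ → Matrix (Fin 2) (Fin 2) ℝ := D.2.2.2.2.2.2

/-- `g⁽¹⁾ = r³ F dv² + 2 r² h_a dv dx^a + r γ_{ab} dx^a dx^b`. -/
def metric (D : FirstOrderData) : TensorField := fun p =>
  let r := p 1
  let h := D.h (p 2) (p 3)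
  let γ := D.γ (p 2) (p 3)
  !![r ^ 3 * D.F (p 2) (p 3), 0, r ^ 2 * h 0, r ^ 2 * h 1;
     0, 0, 0, 0;
     r ^ 2 * h 0, 0, r * γ 0 0, r * γ 0 1;
     r ^ 2 * h 1, 0, r * γ 1 0, r * γ 1 1]

/-- `F⁽¹⁾ = r Ψ dv ∧ dr + r² W_a dv ∧ dx^a + Z_a dr ∧ dx^a + (1/2) r B_{ab} dx^a ∧ dx^b`. -/
def maxwell (D : FirstOrderData) : TensorField := fun p =>
  let r := p 1
  let Ψ := D.Ψ (p 2) (p 3)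
  let W := D.W (p 2) (p 3)
  let Z := D.Z (p 2) (p 3)
  let B := D.B (p 2) (p 3)
  !![0, r * Ψ, r ^ 2 * W 0, r ^ 2 * W 1;
     -(r * Ψ), 0, Z 0, Z 1;
     -(r ^ 2 * W 0), -Z 0, r * B 0 0, r * B 0 1;
     -(r ^ 2 * W 1), -Z 1, r * B 1 0, r * B 1 1]

/-- The data are smooth tensor fields on the whole sphere, `γ` is symmetric and `B` is a
2-form. -/
def IsSmooth (D : FirstOrderData) : Prop :=
  SmoothScalar D.F ∧ SmoothCovector D.h ∧ SmoothTensor D.γ ∧ SmoothScalar D.Ψ ∧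
  SmoothCovector D.W ∧ SmoothCovector D.Z ∧ SmoothTensor D.B ∧
  ∀ x ∈ Set.Ioo (-1 : ℝ) 1, ∀ φ a b,
    D.γ x φ a b = D.γ x φ b a ∧ D.B x φ a b = -D.B x φ b a

/-- The data are invariant under the axial Killing field `∂_φ`. -/
def IsAxisymmetric (D : FirstOrderData) : Prop :=
  ∀ x ∈ Set.Ioo (-1 : ℝ) 1, ∀ φ φ' : ℝ,
    D.F x φ = D.F x φ' ∧ D.h x φ = D.h x φ' ∧ D.γ x φ = D.γ x φ' ∧ D.Ψ x φ = D.Ψ x φ' ∧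
    D.W x φ = D.W x φ' ∧ D.Z x φ = D.Z x φ' ∧ D.B x φ = D.B x φ'

/-- Staticity of a deformation: `dh⁽¹⁾ = h⁽⁰⁾ ∧ h⁽¹⁾` and `dF⁽¹⁾ = 2 F⁽¹⁾ h⁽⁰⁾`, which is the
first order part of hypersurface orthogonality of `∂_v`; here `h⁽⁰⁾ = 0`. -/
def IsStatic (D : FirstOrderData) : Prop :=
  ∀ x ∈ Set.Ioo (-1 : ℝ) 1, ∀ φ,
    deriv (fun s => D.h s φ 1) x - deriv (fun s => D.h x s 0) φ = 0 ∧
    deriv (fun s => D.F s φ) x = 0 ∧ deriv (fun s => D.F x s) φ = 0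

end FirstOrderData

/-- `D` is a smooth transverse deformation of `AdS₂ × S²`: the perturbation
`(g⁽¹⁾, F⁽¹⁾)` built from `D` solves the Einstein–Maxwell equations linearised at the
near-horizon geometry. -/
def IsTransverseDeformation (qe qm rp : ℝ) (D : FirstOrderData) : Prop :=
  D.IsSmooth ∧ ∀ p ∈ patch,
    (∀ μ ν, HasDerivAt (fun ε : ℝ => einsteinResidual (nhMetric rp + ε • D.metric)
      (nhMaxwell qe qm rp + ε • D.maxwell) μ ν p) 0 0) ∧
    (∀ ρ, HasDerivAt (fun ε : ℝ => maxwellResidual (nhMetric rp + ε • D.metric)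
      (nhMaxwell qe qm rp + ε • D.maxwell) ρ p) 0 0) ∧
    ∀ μ ν ρ, bianchiResidual D.maxwell μ ν ρ p = 0

/-- The vector field `ξ = (1/2) f ∂_v + (1/4) r² h⁽⁰⁾_a D^a f ∂_r - (1/2) r D^a f ∂_a`
generating the gauge transformations; here `h⁽⁰⁾ = 0`. -/
def gaugeField (rp : ℝ) (f : ℝ → ℝ → ℝ) : Pt → Fin 4 → ℝ := fun p =>
  ![(1 / 2) * f (p 2) (p 3),
    0,
    -(1 / 2) * p 1 * ((1 - (p 2) ^ 2) / rp ^ 2 * deriv (fun s => f s (p 3)) (p 2)),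
    -(1 / 2) * p 1 * (1 / (rp ^ 2 * (1 - (p 2) ^ 2)) * deriv (fun s => f (p 2) s) (p 3))]

/-- `D` is pure gauge: `(g⁽¹⁾, F⁽¹⁾) = (-𝓛_ξ g⁽⁰⁾, -𝓛_ξ F⁽⁰⁾)` for some smooth function `f` on
the sphere. -/
def IsPureGauge (qe qm rp : ℝ) (D : FirstOrderData) : Prop :=
  ∃ f : ℝ → ℝ → ℝ, SmoothScalar f ∧ ∀ p ∈ patch,
    D.metric p = -lieDeriv (gaugeField rp f) (nhMetric rp) p ∧
    D.maxwell p = -lieDeriv (gaugeField rp f) (nhMaxwell qe qm rp) p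

def GaugeEquivalent (qe qm rp : ℝ) (D D' : FirstOrderData) : Prop :=
  IsPureGauge qe qm rp (D - D')

/-- Smooth axisymmetric transverse deformations. -/
def axisymmetricDeformations (qe qm rp : ℝ) : Set FirstOrderData :=
  {D | IsTransverseDeformation qe qm rp D ∧ D.IsAxisymmetric}

/-- Smooth, static and axisymmetric transverse deformations. -/
def staticDeformations (qe qm rp : ℝ) : Set FirstOrderData :=
  {D | D ∈ axisymmetricDeformations qe qm rp ∧ D.IsStatic}

/-- The representative with parameters `(K₁, K₂, K₃)`. -/
def normalForm (qe qm rp K₁ K₂ K₃ : ℝ) : FirstOrderData :=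
  (fun _ _ => (3 * K₂ + K₃) / (3 * rp ^ 4),
   fun x _ => ![K₃ * x / (2 * rp ^ 2), 2 * K₁ * x * (1 - x ^ 2) / rp ^ 2],
   fun x _ => !![K₂ / (1 - x ^ 2) + K₃, 2 * K₁ * (1 - x ^ 2);
                 2 * K₁ * (1 - x ^ 2), K₂ * (1 - x ^ 2)],
   fun x _ => K₁ * qm * (1 - 3 * x ^ 2) / rp ^ 4
      + qe * (2 * K₂ + K₃ * (1 - x ^ 2)) / (2 * rp ^ 4),
   fun x _ => ![-3 * K₁ * qm * x / rp ^ 4 - qe * K₃ * x / (2 * rp ^ 4), 0],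
   fun x _ => ![K₁ * qm * x / rp ^ 2, K₁ * qe * x * (1 - x ^ 2) / rp ^ 2],
   fun x _ => !![0, K₁ * qe * (1 - 3 * x ^ 2) / rp ^ 2;
                 -(K₁ * qe * (1 - 3 * x ^ 2) / rp ^ 2), 0])

/-! ### The transverse deformation of a spacetime with an extreme horizon -/

/-- The map `(v, r, x, φ) ↦ (v/ε, ε r, x, φ)`. -/
def scaling (ε : ℝ) : Pt → Pt := fun p => ![p 0 / ε, ε * p 1, p 2, p 3]

/-- The stationary and axisymmetric spacetime `(g, F)`, given in coordinates `(t, ϱ, y, ψ)` with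
Killing fields `∂_t`, `∂_ψ` on the exterior region `(ϱ, y) ∈ ext`, has at `ϱ = ϱ₀` an extreme
horizon with near-horizon geometry `AdS₂ × S²` and transverse deformation `D`.

That is, there are coordinates `(v, r, x, φ)` given by
`t = v + T(r,x)`, `ϱ = R(r,x)`, `y = Y(r,x)`, `ψ = k φ + Ω v + S(r,x)`,
in which `(g, F)` (called `(G, H)`) extends smoothly through the horizon `r = 0`, with
`φ_ε^* G = g⁽⁰⁾ + ε g⁽¹⁾ + o(ε)` and `φ_ε^* H = F⁽⁰⁾ + ε F⁽¹⁾ + o(ε)` for the scaling maps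
`φ_ε`, where `(g⁽¹⁾, F⁽¹⁾)` is built from `D`. Because `g⁽¹⁾` has the Gaussian null form, the
coordinates are Gaussian null to first order in `r`. -/
def HasTransverseDeformation (g F : TensorField) (ext : Set (ℝ × ℝ)) (ϱ₀ : ℝ)
    (qe qm rp : ℝ) (D : FirstOrderData) : Prop :=
  ∃ (δ k Ω : ℝ) (T R Y S : ℝ × ℝ → ℝ) (G H : ℝ × ℝ → Matrix (Fin 4) (Fin 4) ℝ),
    0 < δ ∧ 0 < k ∧
    (∀ u ∈ [T, R, Y, S], ContDiffOn ℝ ∞ u (Set.Ioo 0 δ ×ˢ Set.Ioo (-1) 1)) ∧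
    Set.InjOn (fun q => (R q, Y q)) (Set.Ioo 0 δ ×ˢ Set.Ioo (-1) 1) ∧
    Set.MapsTo (fun q => (R q, Y q)) (Set.Ioo 0 δ ×ˢ Set.Ioo (-1) 1) ext ∧
    (∀ x ∈ Set.Ioo (-1 : ℝ) 1, Filter.Tendsto (fun r => R (r, x)) (𝓝[>] 0) (𝓝 ϱ₀)) ∧
    (∀ μ ν, ContDiffOn ℝ ∞ (fun q => G q μ ν) (Set.Ioo (-δ) δ ×ˢ Set.Ioo (-1) 1)) ∧
    (∀ μ ν, ContDiffOn ℝ ∞ (fun q => H q μ ν) (Set.Ioo (-δ) δ ×ˢ Set.Ioo (-1) 1)) ∧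
    (let χ : Pt → Pt := fun p =>
       ![p 0 + T (p 1, p 2), R (p 1, p 2), Y (p 1, p 2), k * p 3 + Ω * p 0 + S (p 1, p 2)]
     ∀ p ∈ patch, p 1 ∈ Set.Ioo 0 δ →
       pullback χ g p = G (p 1, p 2) ∧ pullback χ F p = H (p 1, p 2)) ∧
    ∀ p ∈ patch, ∀ μ ν,
      Filter.Tendsto (fun ε : ℝ => ε⁻¹ *
          (pullback (scaling ε) (fun q => G (q 1, q 2)) p μ ν - nhMetric rp p μ ν))
        (𝓝[≠] 0) (𝓝 (D.metric p μ ν)) ∧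
      Filter.Tendsto (fun ε : ℝ => ε⁻¹ *
          (pullback (scaling ε) (fun q => H (q 1, q 2)) p μ ν - nhMaxwell qe qm rp p μ ν))
        (𝓝[≠] 0) (𝓝 (D.maxwell p μ ν))

/-- `(g, F)` gives rise to the point `(K₁, K₂, K₃)`, with `K₁ = 0`, of the moduli space of smooth
static axisymmetric transverse deformations. -/
def IsContainedInModuliSpace (g F : TensorField) (ext : Set (ℝ × ℝ)) (ϱ₀ : ℝ)
    (qe qm rp K₂ K₃ : ℝ) : Prop :=
  ∃ D ∈ staticDeformations qe qm rp, HasTransverseDeformation g F ext ϱ₀ qe qm rp D ∧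
    GaugeEquivalent qe qm rp D (normalForm qe qm rp 0 K₂ K₃)

/-! ### The known solutions, in coordinates `(t, r, x, φ)` -/

/-- `-N dt² + P dr² + Q dx² + X (dφ + w dt)²`, all coefficients functions of `(r, x)`. -/
def circularMetric (N P Q X w : ℝ → ℝ → ℝ) : TensorField := fun p =>
  let r := p 1
  let x := p 2
  !![-N r x + X r x * w r x ^ 2, 0, 0, X r x * w r x;
     0, P r x, 0, 0;
     0, 0, Q r x, 0;
     X r x * w r x, 0, 0, X r x]

/-- The Maxwell field on `circularMetric N P Q X w` with complex Ernst potential `Φ` relative to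
`m = ∂_φ`, that is `F(·, m) = d Re Φ` and (for a choice of orientation) `(⋆F)(·, m) = d Im Φ`:
`F = d(Re Φ) ∧ (dφ + w dt)
  + (-√(NP/(QX)) ∂_x(Im Φ) dr + √(NQ/(PX)) ∂_r(Im Φ) dx) ∧ dt`. -/
def circularMaxwell (N P Q X w : ℝ → ℝ → ℝ) (Φ : ℝ → ℝ → ℂ) : TensorField := fun p =>
  let r := p 1
  let x := p 2
  let a := deriv (fun s => (Φ s x).re) r
  let b := deriv (fun s => (Φ r s).re) x
  let Er := w r x * a
    - √(N r x * P r x / (Q r x * X r x)) * deriv (fun s => (Φ r s).im) x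
  let Ex := w r x * b
    + √(N r x * Q r x / (P r x * X r x)) * deriv (fun s => (Φ s x).im) r
  !![0, -Er, -Ex, 0;
     Er, 0, 0, a;
     Ex, 0, 0, b;
     0, -a, -b, 0]

/-- Extreme Reissner–Nordström metric with horizon radius `r₊`. -/
def rnMetric (rp : ℝ) : TensorField :=
  circularMetric (fun r _ => (1 - rp / r) ^ 2) (fun r _ => 1 / (1 - rp / r) ^ 2)
    (fun r x => r ^ 2 / (1 - x ^ 2)) (fun r x => r ^ 2 * (1 - x ^ 2)) (fun _ _ => 0)

/-- `-(q_e/r²) dt ∧ dr + q_m dx ∧ dφ`. -/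
def rnMaxwell (qe qm : ℝ) : TensorField := fun p =>
  !![0, -qe / (p 1) ^ 2, 0, 0;
     qe / (p 1) ^ 2, 0, 0, 0;
     0, 0, 0, qm;
     0, 0, -qm, 0]

def rnExterior (rp : ℝ) : Set (ℝ × ℝ) := Set.Ioi rp ×ˢ Set.Ioo (-1) 1

/-- Acceleration parameter of the extreme Ernst solution, fixed by regularity on the axis. -/
def ernstA (e b : ℝ) : ℝ := b / (1 + e ^ 2 * b ^ 2 / 4)

def ernstQ (e b r : ℝ) : ℝ := (r - e) ^ 2 * (1 - ernstA e b ^ 2 * r ^ 2) / r ^ 2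

def ernstP (e b x : ℝ) : ℝ := (1 + ernstA e b * e * x) ^ 2

/-- The squared norm of `∂_φ` in the charged C-metric. -/
def ernstX₀ (e b r x : ℝ) : ℝ :=
  ernstP e b x * r ^ 2 * (1 - x ^ 2) / (1 + ernstA e b * r * x) ^ 2

def ernstD (e b r x : ℝ) : ℝ := (1 + e * b * x / 2) ^ 2 + b ^ 2 / 4 * ernstX₀ e b r x

def ernstCoeffN (e b r x : ℝ) : ℝ :=
  ernstD e b r x ^ 2 * ernstQ e b r / (1 + ernstA e b * r * x) ^ 2

def ernstCoeffP (e b r x : ℝ) : ℝ :=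
  ernstD e b r x ^ 2 / (ernstQ e b r * (1 + ernstA e b * r * x) ^ 2)

def ernstCoeffQ (e b r x : ℝ) : ℝ :=
  ernstD e b r x ^ 2 * r ^ 2 / (ernstP e b x * (1 - x ^ 2) * (1 + ernstA e b * r * x) ^ 2)

def ernstCoeffX (e b r x : ℝ) : ℝ := ernstX₀ e b r x / ernstD e b r x ^ 2

/-- Extreme Ernst metric with charge parameter `e` and external field `b`. -/
def ernstMetric (e b : ℝ) : TensorField :=
  circularMetric (ernstCoeffN e b) (ernstCoeffP e b) (ernstCoeffQ e b) (ernstCoeffX e b)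
    (fun _ _ => 0)

/-- Maxwell field of the extreme Ernst solution. The unit complex number `u` is the
electric-magnetic duality angle: `u = ±1` is the magnetic, `u = ±i` the electric solution. -/
def ernstMaxwell (u : ℂ) (e b : ℝ) : TensorField :=
  circularMaxwell (ernstCoeffN e b) (ernstCoeffP e b) (ernstCoeffQ e b) (ernstCoeffX e b)
    (fun _ _ => 0)
    (fun r x => u * (((e * x + b / 2 * (ernstX₀ e b r x + e ^ 2 * x ^ 2)) /
      ernstD e b r x : ℝ) : ℂ))

/-- The region between the black hole horizon `r = e` and the acceleration horizon
`r = 1/|A|`. -/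
def ernstExterior (e b : ℝ) : Set (ℝ × ℝ) :=
  {r | e < r ∧ |ernstA e b| * r < 1} ×ˢ Set.Ioo (-1) 1

/-- Horizon radius of the extreme Ernst solution. -/
def ernstRadius (e b : ℝ) : ℝ := e * (4 + b ^ 2 * e ^ 2) ^ 2 / (4 * (4 - b ^ 2 * e ^ 2))

def kmΔ (a r : ℝ) : ℝ := (r - a) ^ 2

def kmρsq (a r x : ℝ) : ℝ := r ^ 2 + a ^ 2 * x ^ 2

def km𝒜 (a r x : ℝ) : ℝ := (r ^ 2 + a ^ 2) ^ 2 - kmΔ a r * a ^ 2 * (1 - x ^ 2)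

def kmΛ (a b r x : ℝ) : ℂ :=
  ⟨1 + b ^ 2 * km𝒜 a r x * (1 - x ^ 2) / (4 * kmρsq a r x),
   -(1 / 2) * a ^ 2 * b ^ 2 * x * (3 - x ^ 2 + a ^ 2 / kmρsq a r x * (1 - x ^ 2) ^ 2)⟩

/-- The angular velocity function of the extreme Kerr–Melvin solution. -/
def kmω (a b r x : ℝ) : ℝ :=
  a / (r ^ 2 + a ^ 2) * ((1 - b ^ 4 * a ^ 4) - kmΔ a r * (kmρsq a r x / km𝒜 a r x
    + b ^ 4 / 16 * (-8 * a * r * x ^ 2 * (3 - x ^ 2) - 6 * a * r * (1 - x ^ 2) ^ 2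
      + 2 * a ^ 3 * (1 - x ^ 2) ^ 3 / km𝒜 a r x * (r * (r ^ 2 + a ^ 2) + 2 * a ^ 3)
      + 4 * a ^ 4 * x ^ 2 / km𝒜 a r x *
          ((r ^ 2 + a ^ 2) * (3 - x ^ 2) ^ 2 - 4 * a ^ 2 * (1 - x ^ 2)))))

def kmCoeffN (a b r x : ℝ) : ℝ :=
  Complex.normSq (kmΛ a b r x) * kmρsq a r x * kmΔ a r / km𝒜 a r x

def kmCoeffP (a b r x : ℝ) : ℝ := Complex.normSq (kmΛ a b r x) * kmρsq a r x / kmΔ a r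

def kmCoeffQ (a b r x : ℝ) : ℝ := Complex.normSq (kmΛ a b r x) * kmρsq a r x / (1 - x ^ 2)

def kmCoeffX (a b r x : ℝ) : ℝ :=
  km𝒜 a r x * (1 - x ^ 2) / (kmρsq a r x * Complex.normSq (kmΛ a b r x))

/-- Extreme Kerr–Melvin metric (the uncharged-seed case of extreme Kerr–Newman–Melvin) with
rotation parameter `a` and external field `b`. -/
def kerrMelvinMetric (a b : ℝ) : TensorField :=
  circularMetric (kmCoeffN a b) (kmCoeffP a b) (kmCoeffQ a b) (kmCoeffX a b)
    (fun r x => -kmω a b r x)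

/-- Maxwell field of the extreme Kerr–Melvin solution, with Ernst potential
`(2/b) (1 - 1/Λ)` up to the electric-magnetic duality angle `u`. -/
def kerrMelvinMaxwell (u : ℂ) (a b : ℝ) : TensorField :=
  circularMaxwell (kmCoeffN a b) (kmCoeffP a b) (kmCoeffQ a b) (kmCoeffX a b)
    (fun r x => -kmω a b r x) (fun r x => u * (2 / b * (1 - 1 / kmΛ a b r x)))

def kerrMelvinExterior (a : ℝ) : Set (ℝ × ℝ) := Set.Ioi a ×ˢ Set.Ioo (-1) 1

end ExtremeHorizon

end

open ExtremeHorizon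

open scoped ContDiff Topology

noncomputable section

namespace ExtremeHorizon

/-! ### Partial derivatives -/

/-! Classification. The perturbation has weight one under `(v, r) ↦ (v/ε, εr)`, so for axisymmetric
data every component of the linearised equations is a power of `r` times an expression in `x`. The
problem is a system of ordinary differential equations on `-1 < x < 1`
(`isTransverseDeformation_iff`, resting on `linEinstein_metric` and `linMaxwell_metric`).

Two charge-rotated combinations of `Z` decouple this system. For `ζ = qm (1 - x²) Z₀ + qe Z₁` the
`rφ` Einstein equation gives `4ζ = -rp² ((1 - x²) h₁'' + 4 h₁)`, and the Maxwell and Bianchi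
equations give `ζ'' = rp² h₁''/2`. So `ζ - rp² h₁/2` is affine. It vanishes at both poles, hence
identically, which leaves `(1 - x²) h₁'' + 6 h₁ = 0`. For the other combination put `ν = 4 (qe (1 -
x²) Z₀ - qm Z₁ + rp² (1 - x²) h₀)` and `n = γ₁₁/(1 - x²) + 2 rp² x h₀`. Then `(1 - x²) n' = ν` and
`ν' = 6 (rp⁴ F - n)` with `F` constant, so `ν` solves the same Legendre-type equation. Its solutions
regular at a pole are the multiples of `x (1 - x²)` (`eq_mul_of_legendre`). The two multiples and
the integration constant of `n` are, up to normalisation, `K₁`, `K₃` and `K₂`. All other components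
are then determined, except `h₀`, which stays arbitrary (`exists_isStandard`); conversely every such
profile solves the equations (`IsStandard.isSolution`).

The freedom in `h₀` is the gauge freedom. The difference of two solutions with equal moduli has `h =
h₀ dx`, and a smooth axisymmetric 1-form of this kind has a potential that is smooth across the
poles (`SmoothCovector.exists_potential`); that potential, rescaled, is the gauge function.
Conversely a gauge function relating axisymmetric data cannot depend on `φ`, because its
`φ`-derivative is constant in `φ` and it is periodic; then `h₁` and `n` are gauge invariant, and
they determine the moduli (`eq_of_gaugeEquivalent_normalForm`). Hence the normal forms are a linear
slice for the gauge action, and the dimensions follow.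

Examples. All three solutions have the form `-s² n dt² + (n V²/s² + l) ds² + Q dz² + X (dψ - s³ w
dt)²` near the horizon `s = 0`. With `dt = θ - (V/s²) ds` the poles cancel, so the fields extend
smoothly in ingoing coordinates. Composing with the scaling map and assigning the weights `ε⁻¹, ε,
1, 1` to the coordinates gives a family of tensors that is differentiable at `ε = 0`; its value
there is the near-horizon geometry and its derivative is the first order data (`pull_scale`,
`tendsto_inv_mul_pullback`). The shift of `s`, the bending of `z` and the delay of `t` are chosen so
that this derivative is in Gaussian null form and equals the normal form itself. What remains for
each solution is the list `HorizonData.IsRegular` of values and first `s`-derivatives on the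
horizon, which are rational identities. -/

lemma hasDerivAt_comp_update {f : Pt → ℝ} {p : Pt} (hf : DifferentiableAt ℝ f p) (μ : Fin 4) :
    HasDerivAt (fun s => f (Function.update p μ s)) (fderiv ℝ f p (Pi.single μ 1)) (p μ) := by
  have h := hasDerivAt_update p μ (p μ)
  have hf' : HasFDerivAt f (fderiv ℝ f p) (Function.update p μ (p μ)) := by
    rw [Function.update_eq_self]; exact hf.hasFDerivAt
  exact hf'.comp_hasDerivAt (p μ) h

lemma pd_eq_fderiv {f : Pt → ℝ} {p : Pt} (hf : DifferentiableAt ℝ f p) (μ : Fin 4) :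
    pd μ f p = fderiv ℝ f p (Pi.single μ 1) :=
  (hasDerivAt_comp_update hf μ).deriv

lemma pd_congr {f g : Pt → ℝ} {p : Pt} (h : f =ᶠ[𝓝 p] g) (μ : Fin 4) : pd μ f p = pd μ g p := by
  unfold pd
  apply Filter.EventuallyEq.deriv_eq
  have hc : ContinuousAt (Function.update p μ) (p μ) := (hasDerivAt_update p μ (p μ)).continuousAt
  have : Filter.Tendsto (Function.update p μ) (𝓝 (p μ)) (𝓝 p) := by
    simpa [ContinuousAt, Function.update_eq_self] using hc
  exact this.eventually h

lemma pd_congr_on {f g : Pt → ℝ} {U : Set Pt} (hU : IsOpen U) (h : Set.EqOn f g U) {p : Pt}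
    (hp : p ∈ U) (μ : Fin 4) : pd μ f p = pd μ g p :=
  pd_congr (h.eventuallyEq_of_mem (hU.mem_nhds hp)) μ

lemma contDiffOn_pd {f : Pt → ℝ} {U : Set Pt} (hU : IsOpen U) (hf : ContDiffOn ℝ ∞ f U)
    (μ : Fin 4) : ContDiffOn ℝ ∞ (pd μ f) U := by
  have h : ContDiffOn ℝ ∞ (fun q => fderiv ℝ f q (Pi.single μ 1)) U :=
    (hf.fderiv_of_isOpen hU (m := ∞) (by simp)).clm_apply contDiffOn_const
  refine h.congr fun q hq => ?_
  exact pd_eq_fderiv ((hf.contDiffAt (hU.mem_nhds hq)).differentiableAt (by simp)) μ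

/-- Derivatives of a jointly `C²` function along two directions commute. -/
lemma hasDerivAt_pd_of_contDiffAt {f : ℝ × Pt → ℝ} {p : Pt} (hf : ContDiffAt ℝ 2 f (0, p))
    {f' : Pt → ℝ} (hf' : ∀ᶠ q in 𝓝 p, HasDerivAt (fun ε => f (ε, q)) (f' q) 0) (μ : Fin 4) :
    HasDerivAt (fun ε => pd μ (fun q => f (ε, q)) p) (pd μ f' p) 0 := by
  have hD : ContDiffAt ℝ 1 (fderiv ℝ f) (0, p) := hf.fderiv_right (by norm_num)
  have hD' : HasFDerivAt (fderiv ℝ f) (fderiv ℝ (fderiv ℝ f) (0, p)) (0, p) :=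
    (hD.differentiableAt (by simp)).hasFDerivAt
  have hev : ∀ᶠ z in 𝓝 ((0 : ℝ), p), DifferentiableAt ℝ f z := by
    have : ∀ᶠ z in 𝓝 ((0 : ℝ), p), ContDiffAt ℝ 2 f z := hf.eventually (by simp)
    exact this.mono fun z hz => hz.differentiableAt (by simp)
  have hi : ∀ ε q, HasFDerivAt (fun q : Pt => ((ε : ℝ), q))
      (ContinuousLinearMap.inr ℝ ℝ Pt) q := fun ε q => hasFDerivAt_prodMk_right ε q
  have hl : ∀ q : Pt, ∀ ε, HasDerivAt (fun ε : ℝ => (ε, q)) ((1 : ℝ), (0 : Pt)) ε := fun q ε =>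
    (hasDerivAt_id ε).prodMk (hasDerivAt_const ε q)
  have h1 : (fun ε => pd μ (fun q => f (ε, q)) p) =ᶠ[𝓝 0]
      fun ε => fderiv ℝ f (ε, p) (0, Pi.single μ 1) := by
    have : Filter.Tendsto (fun ε : ℝ => (ε, p)) (𝓝 0) (𝓝 (0, p)) := (hl p 0).continuousAt
    filter_upwards [this.eventually hev] with ε hε
    have hd := hε.hasFDerivAt.comp p (hi ε p)
    rw [pd_eq_fderiv (f := fun q => f (ε, q)) hd.differentiableAt]
    change fderiv ℝ (f ∘ fun q : Pt => (ε, q)) p _ = _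
    rw [hd.fderiv]; simp
  have h2 : f' =ᶠ[𝓝 p] fun q => fderiv ℝ f (0, q) (1, 0) := by
    have : Filter.Tendsto (fun q : Pt => ((0 : ℝ), q)) (𝓝 p) (𝓝 (0, p)) := (hi 0 p).continuousAt
    filter_upwards [this.eventually hev, hf'] with q hq hq'
    exact hq'.unique (hq.hasFDerivAt.comp_hasDerivAt (0 : ℝ) (hl q 0))
  have h3 : pd μ f' p = fderiv ℝ (fderiv ℝ f) (0, p) (0, Pi.single μ 1) (1, 0) := by
    have hd := ((ContinuousLinearMap.apply ℝ ℝ ((1 : ℝ), (0 : Pt))).hasFDerivAt).comp p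
      (hD'.comp p (hi 0 p))
    rw [pd_congr h2, pd_eq_fderiv (f := fun q => fderiv ℝ f (0, q) (1, 0)) hd.differentiableAt]
    exact congrArg (fun L => L (Pi.single μ 1)) hd.fderiv
  have h4 : HasDerivAt (fun ε => fderiv ℝ f (ε, p) (0, Pi.single μ 1))
      (fderiv ℝ (fderiv ℝ f) (0, p) (1, 0) (0, Pi.single μ 1)) 0 :=
    ((ContinuousLinearMap.apply ℝ ℝ ((0 : ℝ), (Pi.single μ 1 : Pt))).hasFDerivAt).comp_hasDerivAt
      (0 : ℝ) (hD'.comp_hasDerivAt (0 : ℝ) (hl p 0))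
  -- Both orders of differentiation are now entries of the second derivative at `(0, p)`; the `C²`
  -- hypothesis makes it symmetric.
  have hs := hf.isSymmSndFDerivAt (by simp)
  rw [h3, hs.eq]
  exact h4.congr_of_eventuallyEq h1

/-! ### Inverse matrices -/

lemma contDiffAt_det {E : Type*} [NormedAddCommGroup E] [NormedSpace ℝ E] {n : WithTop ℕ∞}
    {M : E → Matrix (Fin 4) (Fin 4) ℝ} {z : E}
    (hM : ∀ i j, ContDiffAt ℝ n (fun z => M z i j) z) : ContDiffAt ℝ n (fun z => (M z).det) z := by
  simp only [Matrix.det_apply]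
  refine ContDiffAt.sum fun σ _ => ?_
  simp only [Units.smul_def, zsmul_eq_mul]
  exact contDiffAt_const.mul (contDiffAt_prod fun i _ => hM _ _)

/-- Cramer's rule: an entry of the inverse is a quotient of two determinants, the numerator being
that of the matrix with one row replaced by a unit vector. -/
lemma contDiffAt_inv_entry {E : Type*} [NormedAddCommGroup E] [NormedSpace ℝ E] {n : WithTop ℕ∞}
    {M : E → Matrix (Fin 4) (Fin 4) ℝ} {z : E}
    (hM : ∀ i j, ContDiffAt ℝ n (fun z => M z i j) z) (hdet : (M z).det ≠ 0) (i j : Fin 4) :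
    ContDiffAt ℝ n (fun z => (M z)⁻¹ i j) z := by
  have h : ∀ z, (M z)⁻¹ i j = ((M z).det)⁻¹ * ((M z).updateRow j (Pi.single i 1)).det := by
    intro z
    rw [Matrix.inv_def, Matrix.smul_apply, Matrix.adjugate_apply, Ring.inverse_eq_inv', smul_eq_mul]
  simp only [h]
  refine ((contDiffAt_det hM).inv hdet).mul (contDiffAt_det fun k l => ?_)
  by_cases hk : k = j
  · subst hk
    simp only [Matrix.updateRow_self]
    exact contDiffAt_const
  · simp only [Matrix.updateRow_ne hk]
    exact hM k l

/-- The resolvent identity `(A + εB)⁻¹ - A⁻¹ = -ε (A + εB)⁻¹ B A⁻¹` gives the difference quotient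
exactly, and continuity of the inverse gives its limit. -/
lemma hasDerivAt_inv_entry {A B : Matrix (Fin 4) (Fin 4) ℝ} (hA : A.det ≠ 0) (i j : Fin 4) :
    HasDerivAt (fun ε : ℝ => (A + ε • B)⁻¹ i j) ((-(A⁻¹ * B * A⁻¹)) i j) 0 := by
  have hc : ∀ i j, ContDiffAt ℝ 1 (fun ε : ℝ => (A + ε • B) i j) 0 := by
    intro i j
    simp only [Matrix.add_apply, Matrix.smul_apply, smul_eq_mul]
    fun_prop
  have hdet0 : (A + (0 : ℝ) • B).det ≠ 0 := by simpa using hA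
  have hev : ∀ᶠ ε : ℝ in 𝓝 0, (A + ε • B).det ≠ 0 :=
    (contDiffAt_det hc).continuousAt.eventually_ne hdet0
  have hinv : ∀ k l, Filter.Tendsto (fun ε : ℝ => (A + ε • B)⁻¹ k l) (𝓝 0) (𝓝 (A⁻¹ k l)) := by
    intro k l
    have := (contDiffAt_inv_entry hc hdet0 k l).continuousAt.tendsto
    simpa using this
  rw [hasDerivAt_iff_tendsto_slope]
  have hlim : Filter.Tendsto (fun ε : ℝ => (-((A + ε • B)⁻¹ * B * A⁻¹)) i j) (𝓝[≠] 0)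
      (𝓝 ((-(A⁻¹ * B * A⁻¹)) i j)) := by
    apply Filter.Tendsto.mono_left _ nhdsWithin_le_nhds
    simp only [Matrix.neg_apply, Matrix.mul_apply]
    refine (tendsto_finsetSum _ fun k _ => Filter.Tendsto.mul_const _
      (tendsto_finsetSum _ fun l _ => Filter.Tendsto.mul_const _ (hinv i l))).neg
  refine hlim.congr' ?_
  filter_upwards [nhdsWithin_le_nhds hev, self_mem_nhdsWithin] with ε hε hne
  have hne : ε ≠ 0 := hne
  have hu : IsUnit (A + ε • B).det := hε.isUnit
  have huA : IsUnit A.det := hA.isUnit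
  have key : (A + ε • B)⁻¹ - A⁻¹ = ε • -((A + ε • B)⁻¹ * B * A⁻¹) := by
    have h1 : (A + ε • B)⁻¹ * (A + ε • B) * A⁻¹ = A⁻¹ := by
      rw [Matrix.nonsing_inv_mul _ hu, Matrix.one_mul]
    rw [Matrix.mul_add, Matrix.add_mul, Matrix.mul_assoc, Matrix.mul_nonsing_inv _ huA,
      Matrix.mul_one, Matrix.mul_smul, Matrix.smul_mul] at h1
    rw [smul_neg, sub_eq_iff_eq_add, ← sub_eq_neg_add, eq_sub_iff_add_eq]
    exact h1
  have := congrFun (congrFun key i) j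
  simp only [Matrix.sub_apply, Matrix.smul_apply, smul_eq_mul] at this
  rw [slope_def_field, sub_zero]
  simp only [zero_smul, add_zero]
  rw [this]; field_simp

/-! ### Linearisation of the Einstein–Maxwell equations -/

/-- The components of `T` are smooth on `U`. -/
def SmoothTensorOn (U : Set Pt) (T : TensorField) : Prop :=
  ∀ μ ν, ContDiffOn ℝ ∞ (fun q => T q μ ν) U

/-- `∂_μ g_{νσ} + ∂_ν g_{μσ} - ∂_σ g_{μν}`. -/
def koszul (g : TensorField) (μ ν σ : Fin 4) (p : Pt) : ℝ :=
  pd μ (fun q => g q ν σ) p + pd ν (fun q => g q μ σ) p - pd σ (fun q => g q μ ν) p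

/-- The first variation of the inverse metric. -/
def linInverse (g₀ g₁ : TensorField) : TensorField := fun p => -((g₀ p)⁻¹ * g₁ p * (g₀ p)⁻¹)

/-- The first variation of the Christoffel symbols. -/
def linChristoffel (g₀ g₁ : TensorField) (ρ μ ν : Fin 4) (p : Pt) : ℝ :=
  (1 / 2) * ∑ σ, (linInverse g₀ g₁ p ρ σ * koszul g₀ μ ν σ p
    + (g₀ p)⁻¹ ρ σ * koszul g₁ μ ν σ p)

/-- The first variation of the Ricci tensor. -/
def linRicci (g₀ g₁ : TensorField) (μ ν : Fin 4) (p : Pt) : ℝ :=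
  ∑ ρ, (pd ρ (linChristoffel g₀ g₁ ρ μ ν) p - pd ν (linChristoffel g₀ g₁ ρ ρ μ) p
    + ∑ l, ((linChristoffel g₀ g₁ ρ ρ l p * christoffel g₀ l μ ν p
        + christoffel g₀ ρ ρ l p * linChristoffel g₀ g₁ l μ ν p)
      - (linChristoffel g₀ g₁ ρ ν l p * christoffel g₀ l ρ μ p
        + christoffel g₀ ρ ν l p * linChristoffel g₀ g₁ l ρ μ p)))

/-- The first variation of `F_{μσ} F_ν{}^σ`. -/
def linMaxwellSq (g₀ g₁ F₀ F₁ : TensorField) (μ ν : Fin 4) (p : Pt) : ℝ :=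
  ∑ σ, ∑ τ, ((linInverse g₀ g₁ p σ τ * F₀ p μ σ + (g₀ p)⁻¹ σ τ * F₁ p μ σ) * F₀ p ν τ
    + (g₀ p)⁻¹ σ τ * F₀ p μ σ * F₁ p ν τ)

/-- The first variation of `einsteinResidual`. -/
def linEinstein (g₀ g₁ F₀ F₁ : TensorField) (μ ν : Fin 4) (p : Pt) : ℝ :=
  linRicci g₀ g₁ μ ν p - 2 * linMaxwellSq g₀ g₁ F₀ F₁ μ ν p
    + ((1 / 2) * g₁ p μ ν * (∑ α, ∑ β, (g₀ p)⁻¹ α β * maxwellSq g₀ F₀ α β p)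
    + (1 / 2) * g₀ p μ ν * ∑ α, ∑ β, (linInverse g₀ g₁ p α β * maxwellSq g₀ F₀ α β p
        + (g₀ p)⁻¹ α β * linMaxwellSq g₀ g₁ F₀ F₁ α β p))

/-- The first variation of `maxwellResidual`. -/
def linMaxwell (g₀ g₁ F₀ F₁ : TensorField) (ρ : Fin 4) (p : Pt) : ℝ :=
  ∑ μ, ∑ ν, (linInverse g₀ g₁ p μ ν *
      (pd ν (fun q => F₀ q μ ρ) p
        - ∑ l, (christoffel g₀ l ν μ p * F₀ p l ρ + christoffel g₀ l ν ρ p * F₀ p μ l))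
    + (g₀ p)⁻¹ μ ν * (pd ν (fun q => F₁ q μ ρ) p
        - ∑ l, ((linChristoffel g₀ g₁ l ν μ p * F₀ p l ρ + christoffel g₀ l ν μ p * F₁ p l ρ)
          + (linChristoffel g₀ g₁ l ν ρ p * F₀ p μ l + christoffel g₀ l ν ρ p * F₁ p μ l))))

section Linearisation

variable {U : Set Pt} {g₀ g₁ F₀ F₁ : TensorField}

lemma SmoothTensorOn.differentiableAt {T : TensorField} (hT : SmoothTensorOn U T) (hU : IsOpen U)
    {p : Pt} (hp : p ∈ U) (μ ν : Fin 4) : DifferentiableAt ℝ (fun q => T q μ ν) p :=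
  ((hT μ ν).contDiffAt (hU.mem_nhds hp)).differentiableAt (by simp)

lemma pd_add_smul (hU : IsOpen U) (h₀ : SmoothTensorOn U g₀) (h₁ : SmoothTensorOn U g₁) {p : Pt}
    (hp : p ∈ U) (ε : ℝ) (κ μ ν : Fin 4) : pd κ (fun q => (g₀ + ε • g₁) q μ ν) p
      = pd κ (fun q => g₀ q μ ν) p + ε * pd κ (fun q => g₁ q μ ν) p := by
  have d₀ := h₀.differentiableAt hU hp μ ν
  have d₁ := h₁.differentiableAt hU hp μ ν
  have h := (hasDerivAt_comp_update d₀ κ).add ((hasDerivAt_comp_update d₁ κ).const_mul ε)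
  rw [pd_eq_fderiv d₀, pd_eq_fderiv d₁]
  exact h.deriv

/-- The Koszul combination is linear in the metric, so `ε` enters nonlinearly only through the
inverse metric. -/
lemma christoffel_add_smul (hU : IsOpen U) (h₀ : SmoothTensorOn U g₀) (h₁ : SmoothTensorOn U g₁)
    {p : Pt} (hp : p ∈ U) (ε : ℝ) (ρ μ ν : Fin 4) : christoffel (g₀ + ε • g₁) ρ μ ν p
      = (1 / 2) * ∑ σ, (g₀ p + ε • g₁ p)⁻¹ ρ σ * (koszul g₀ μ ν σ p + ε * koszul g₁ μ ν σ p) := by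
  simp only [christoffel, pd_add_smul hU h₀ h₁ hp]
  congr 1
  refine Finset.sum_congr rfl fun σ _ => ?_
  simp only [Pi.add_apply, Pi.smul_apply, koszul]
  ring

lemma hasDerivAt_christoffel (hU : IsOpen U) (h₀ : SmoothTensorOn U g₀) (h₁ : SmoothTensorOn U g₁)
    {p : Pt} (hp : p ∈ U) (hdet : (g₀ p).det ≠ 0) (ρ μ ν : Fin 4) :
    HasDerivAt (fun ε : ℝ => christoffel (g₀ + ε • g₁) ρ μ ν p)
      (linChristoffel g₀ g₁ ρ μ ν p) 0 := by
  simp only [christoffel_add_smul hU h₀ h₁ hp]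
  refine HasDerivAt.const_mul _ (HasDerivAt.fun_sum fun σ _ => ?_)
  have h := (hasDerivAt_inv_entry (B := g₁ p) hdet ρ σ).mul
    (((hasDerivAt_id (0 : ℝ)).mul_const (koszul g₁ μ ν σ p)).const_add (koszul g₀ μ ν σ p))
  refine HasDerivAt.congr_deriv h ?_
  simp [linInverse]

lemma contDiffOn_koszul {g : TensorField} (hU : IsOpen U) (h : SmoothTensorOn U g)
    (μ ν σ : Fin 4) : ContDiffOn ℝ ∞ (koszul g μ ν σ) U :=
  ((contDiffOn_pd hU (h ν σ) μ).add (contDiffOn_pd hU (h μ σ) ν)).sub (contDiffOn_pd hU (h μ ν) σ)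

/-- Joint smoothness in `(ε, p)` is what allows the `ε`-derivative to pass through the coordinate
derivatives in the Ricci tensor. -/
lemma contDiffAt_christoffel (hU : IsOpen U) (h₀ : SmoothTensorOn U g₀)
    (h₁ : SmoothTensorOn U g₁) {p : Pt} (hp : p ∈ U) (hdet : (g₀ p).det ≠ 0) (ρ μ ν : Fin 4) :
    ContDiffAt ℝ ∞ (fun z : ℝ × Pt => christoffel (g₀ + z.1 • g₁) ρ μ ν z.2) (0, p) := by
  have hsnd : ∀ {f : Pt → ℝ}, ContDiffOn ℝ ∞ f U →
      ContDiffAt ℝ ∞ (fun z : ℝ × Pt => f z.2) (0, p) := fun {f} hf =>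
    ContDiffAt.comp (g := f) (f := Prod.snd) ((0 : ℝ), p) (hf.contDiffAt (hU.mem_nhds hp))
      contDiffAt_snd
  have hform : ContDiffAt ℝ ∞ (fun z : ℝ × Pt => (1 / 2) * ∑ σ, (g₀ z.2 + z.1 • g₁ z.2)⁻¹ ρ σ *
      (koszul g₀ μ ν σ z.2 + z.1 * koszul g₁ μ ν σ z.2)) (0, p) := by
    refine contDiffAt_const.mul (ContDiffAt.sum fun σ _ => ContDiffAt.mul ?_ ?_)
    · refine contDiffAt_inv_entry (M := fun z : ℝ × Pt => g₀ z.2 + z.1 • g₁ z.2) (fun i j => ?_)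
        (by simpa using hdet) ρ σ
      simp only [Matrix.add_apply, Matrix.smul_apply, smul_eq_mul]
      exact (hsnd (h₀ i j)).add (contDiffAt_fst.mul (hsnd (h₁ i j)))
    · exact (hsnd (contDiffOn_koszul hU h₀ μ ν σ)).add
        (contDiffAt_fst.mul (hsnd (contDiffOn_koszul hU h₁ μ ν σ)))
  refine hform.congr_of_eventuallyEq ?_
  have : ∀ᶠ z in 𝓝 ((0 : ℝ), p), z.2 ∈ U := continuousAt_snd (hU.mem_nhds hp)
  filter_upwards [this] with z hz
  exact christoffel_add_smul hU h₀ h₁ hz z.1 ρ μ ν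

lemma hasDerivAt_pd_christoffel (hU : IsOpen U) (h₀ : SmoothTensorOn U g₀)
    (h₁ : SmoothTensorOn U g₁) (hdet : ∀ q ∈ U, (g₀ q).det ≠ 0) {p : Pt} (hp : p ∈ U)
    (κ ρ μ ν : Fin 4) :
    HasDerivAt (fun ε : ℝ => pd κ (christoffel (g₀ + ε • g₁) ρ μ ν) p)
      (pd κ (linChristoffel g₀ g₁ ρ μ ν) p) 0 := by
  refine hasDerivAt_pd_of_contDiffAt
    (f := fun z : ℝ × Pt => christoffel (g₀ + z.1 • g₁) ρ μ ν z.2)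
    ((contDiffAt_christoffel hU h₀ h₁ hp (hdet p hp) ρ μ ν).of_le (by norm_cast)) ?_ κ
  filter_upwards [hU.mem_nhds hp] with q hq
  exact hasDerivAt_christoffel hU h₀ h₁ hq (hdet q hq) ρ μ ν

lemma hasDerivAt_entry (T₀ T₁ : TensorField) (p : Pt) (μ ν : Fin 4) :
    HasDerivAt (fun ε : ℝ => (T₀ + ε • T₁) p μ ν) (T₁ p μ ν) 0 := by
  have h := ((hasDerivAt_id (0 : ℝ)).mul_const (T₁ p μ ν)).const_add (T₀ p μ ν)
  simpa using h

lemma hasDerivAt_inverse {p : Pt} (hdet : (g₀ p).det ≠ 0) (μ ν : Fin 4) :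
    HasDerivAt (fun ε : ℝ => ((g₀ + ε • g₁) p)⁻¹ μ ν) (linInverse g₀ g₁ p μ ν) 0 :=
  hasDerivAt_inv_entry hdet μ ν

lemma hasDerivAt_ricci (hU : IsOpen U) (h₀ : SmoothTensorOn U g₀) (h₁ : SmoothTensorOn U g₁)
    (hdet : ∀ q ∈ U, (g₀ q).det ≠ 0) {p : Pt} (hp : p ∈ U) (μ ν : Fin 4) :
    HasDerivAt (fun ε : ℝ => ricci (g₀ + ε • g₁) μ ν p) (linRicci g₀ g₁ μ ν p) 0 := by
  have hd := hasDerivAt_pd_christoffel hU h₀ h₁ hdet hp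
  have hc := hasDerivAt_christoffel hU h₀ h₁ hp (hdet p hp)
  refine HasDerivAt.fun_sum fun ρ _ => ((hd _ _ _ _).sub (hd _ _ _ _)).add
    (HasDerivAt.fun_sum fun l _ => ?_)
  refine HasDerivAt.congr_deriv (((hc ρ ρ l).mul (hc l μ ν)).sub ((hc ρ ν l).mul (hc l ρ μ))) ?_
  simp

lemma hasDerivAt_maxwellSq {p : Pt} (hdet : (g₀ p).det ≠ 0) (μ ν : Fin 4) :
    HasDerivAt (fun ε : ℝ => maxwellSq (g₀ + ε • g₁) (F₀ + ε • F₁) μ ν p)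
      (linMaxwellSq g₀ g₁ F₀ F₁ μ ν p) 0 := by
  refine HasDerivAt.fun_sum fun σ _ => HasDerivAt.fun_sum fun τ _ => ?_
  refine HasDerivAt.congr_deriv (((hasDerivAt_inverse (g₁ := g₁) hdet σ τ).mul (hasDerivAt_entry F₀ F₁ p μ σ)).mul
    (hasDerivAt_entry F₀ F₁ p ν τ)) ?_
  simp

lemma hasDerivAt_einsteinResidual (hU : IsOpen U) (h₀ : SmoothTensorOn U g₀)
    (h₁ : SmoothTensorOn U g₁) (hdet : ∀ q ∈ U, (g₀ q).det ≠ 0) {p : Pt} (hp : p ∈ U)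
    (μ ν : Fin 4) :
    HasDerivAt (fun ε : ℝ => einsteinResidual (g₀ + ε • g₁) (F₀ + ε • F₁) μ ν p)
      (linEinstein g₀ g₁ F₀ F₁ μ ν p) 0 := by
  have hm : ∀ α β, HasDerivAt (fun ε : ℝ => maxwellSq (g₀ + ε • g₁) (F₀ + ε • F₁) α β p)
      (linMaxwellSq g₀ g₁ F₀ F₁ α β p) 0 := hasDerivAt_maxwellSq (hdet p hp)
  have hs : HasDerivAt (fun ε : ℝ => ∑ α, ∑ β, ((g₀ + ε • g₁) p)⁻¹ α β *
      maxwellSq (g₀ + ε • g₁) (F₀ + ε • F₁) α β p)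
      (∑ α, ∑ β, (linInverse g₀ g₁ p α β * maxwellSq g₀ F₀ α β p
        + (g₀ p)⁻¹ α β * linMaxwellSq g₀ g₁ F₀ F₁ α β p)) 0 := by
    refine HasDerivAt.fun_sum fun α _ => HasDerivAt.fun_sum fun β _ => ?_
    refine HasDerivAt.congr_deriv ((hasDerivAt_inverse (g₁ := g₁) (hdet p hp) α β).mul (hm α β)) ?_
    simp
  have h := ((hasDerivAt_ricci hU h₀ h₁ hdet hp μ ν).sub ((hm μ ν).const_mul 2)).add
    (((hasDerivAt_entry g₀ g₁ p μ ν).const_mul (1 / 2)).mul hs)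
  refine HasDerivAt.congr_deriv h ?_
  simp [linEinstein]

lemma hasDerivAt_maxwellResidual (hU : IsOpen U) (h₀ : SmoothTensorOn U g₀)
    (h₁ : SmoothTensorOn U g₁) (k₀ : SmoothTensorOn U F₀) (k₁ : SmoothTensorOn U F₁)
    (hdet : ∀ q ∈ U, (g₀ q).det ≠ 0) {p : Pt} (hp : p ∈ U) (ρ : Fin 4) :
    HasDerivAt (fun ε : ℝ => maxwellResidual (g₀ + ε • g₁) (F₀ + ε • F₁) ρ p)
      (linMaxwell g₀ g₁ F₀ F₁ ρ p) 0 := by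
  have hc := hasDerivAt_christoffel hU h₀ h₁ hp (hdet p hp)
  have he := hasDerivAt_entry F₀ F₁ p
  have hpd : ∀ κ α β, HasDerivAt (fun ε : ℝ => pd κ (fun q => (F₀ + ε • F₁) q α β) p)
      (pd κ (fun q => F₁ q α β) p) 0 := by
    intro κ α β
    simp only [pd_add_smul hU k₀ k₁ hp]
    simpa using ((hasDerivAt_id (0 : ℝ)).mul_const (pd κ (fun q => F₁ q α β) p)).const_add
      (pd κ (fun q => F₀ q α β) p)
  refine HasDerivAt.fun_sum fun μ _ => HasDerivAt.fun_sum fun ν _ => ?_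
  refine HasDerivAt.congr_deriv ((hasDerivAt_inverse (g₁ := g₁) (hdet p hp) μ ν).mul ((hpd ν μ ρ).sub
    (HasDerivAt.fun_sum fun l (_ : l ∈ Finset.univ) =>
      ((hc l ν μ).mul (he l ρ)).add ((hc l ν ρ).mul (he μ l))))) ?_
  simp

end Linearisation

/-! ### Axisymmetric perturbations of the near-horizon geometry -/

/-- The components of axisymmetric first order data, as functions of `x`. -/
structure Profile where
  F : ℝ → ℝ
  h₀ : ℝ → ℝ
  h₁ : ℝ → ℝ
  γ₀₀ : ℝ → ℝ
  γ₀₁ : ℝ → ℝ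
  γ₁₁ : ℝ → ℝ
  Ψ : ℝ → ℝ
  W₀ : ℝ → ℝ
  W₁ : ℝ → ℝ
  Z₀ : ℝ → ℝ
  Z₁ : ℝ → ℝ
  B : ℝ → ℝ

namespace Profile

/-- The metric perturbation with profile `P`. -/
def metric (P : Profile) : TensorField := fun p =>
  !![p 1 ^ 3 * P.F (p 2), 0, p 1 ^ 2 * P.h₀ (p 2), p 1 ^ 2 * P.h₁ (p 2);
     0, 0, 0, 0;
     p 1 ^ 2 * P.h₀ (p 2), 0, p 1 * P.γ₀₀ (p 2), p 1 * P.γ₀₁ (p 2);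
     p 1 ^ 2 * P.h₁ (p 2), 0, p 1 * P.γ₀₁ (p 2), p 1 * P.γ₁₁ (p 2)]

/-- The Maxwell perturbation with profile `P`. -/
def maxwell (P : Profile) : TensorField := fun p =>
  !![0, p 1 * P.Ψ (p 2), p 1 ^ 2 * P.W₀ (p 2), p 1 ^ 2 * P.W₁ (p 2);
     -(p 1 * P.Ψ (p 2)), 0, P.Z₀ (p 2), P.Z₁ (p 2);
     -(p 1 ^ 2 * P.W₀ (p 2)), -P.Z₀ (p 2), 0, p 1 * P.B (p 2);
     -(p 1 ^ 2 * P.W₁ (p 2)), -P.Z₁ (p 2), -(p 1 * P.B (p 2)), 0]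

/-- All components are smooth on `-1 < x < 1`. -/
def IsSmooth (P : Profile) : Prop :=
  ∀ u ∈ [P.F, P.h₀, P.h₁, P.γ₀₀, P.γ₀₁, P.γ₁₁, P.Ψ, P.W₀, P.W₁, P.Z₀, P.Z₁, P.B],
    ContDiffOn ℝ ∞ u (Set.Ioo (-1) 1)

/-- The power of `r` in the first variation of `Γ^ρ_{μν}` for `ρ = v`. -/
def christoffelExponentV : Matrix (Fin 4) (Fin 4) ℕ :=
  !![2, 0, 1, 1;
    0, 0, 0, 0;
    1, 0, 0, 0;
    1, 0, 0, 0]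

/-- The power of `r` in the first variation of `Γ^ρ_{μν}` for `ρ = r`. -/
def christoffelExponentR : Matrix (Fin 4) (Fin 4) ℕ :=
  !![4, 2, 3, 3;
    2, 0, 1, 1;
    3, 1, 2, 2;
    3, 1, 2, 2]

/-- The power of `r` in the first variation of `Γ^ρ_{μν}` for `ρ = x`. -/
def christoffelExponentX : Matrix (Fin 4) (Fin 4) ℕ :=
  !![3, 1, 0, 2;
    1, 0, 0, 0;
    0, 0, 1, 1;
    2, 0, 1, 1]

/-- The power of `r` in the first variation of `Γ^ρ_{μν}` for `ρ = φ`. -/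
def christoffelExponentPhi : Matrix (Fin 4) (Fin 4) ℕ :=
  !![3, 1, 2, 0;
    1, 0, 0, 0;
    2, 0, 1, 1;
    0, 0, 1, 1]

/-- The power of `r` in the first variation of `Γ^ρ_{μν}`. -/
def christoffelExponent : Fin 4 → Matrix (Fin 4) (Fin 4) ℕ :=
  ![christoffelExponentV, christoffelExponentR, christoffelExponentX, christoffelExponentPhi]

/-- The coefficient of the power of `r` in the first variation of `Γ^ρ_{μν}` for `ρ = v`. -/
def christoffelCoeffV (_rp : ℝ) (P : Profile) (x : ℝ) : Matrix (Fin 4) (Fin 4) ℝ :=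
  !![-((3 / 2) * P.F x), 0, -P.h₀ x, -P.h₁ x;
    0, 0, 0, 0;
    -P.h₀ x, 0, -((1 / 2) * P.γ₀₀ x), -((1 / 2) * P.γ₀₁ x);
    -P.h₁ x, 0, -((1 / 2) * P.γ₀₁ x), -((1 / 2) * P.γ₁₁ x)]

/-- The coefficient of the power of `r` in the first variation of `Γ^ρ_{μν}` for `ρ = r`. -/
def christoffelCoeffR (rp : ℝ) (P : Profile) (x : ℝ) : Matrix (Fin 4) (Fin 4) ℝ :=
  !![-((5 / 2) * (rp ^ 2)⁻¹ * P.F x), (3 / 2) * P.F x, (1 / 2) * deriv P.F x - (rp ^ 2)⁻¹ * P.h₀ x,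
  -((rp ^ 2)⁻¹ * P.h₁ x);
    (3 / 2) * P.F x, 0, P.h₀ x, P.h₁ x;
    (1 / 2) * deriv P.F x - (rp ^ 2)⁻¹ * P.h₀ x, P.h₀ x,
      deriv P.h₀ x - (1 / 2) * (rp ^ 2)⁻¹ * P.γ₀₀ x - (1 - x ^ 2)⁻¹ * x * P.h₀ x,
      (1 / 2) * deriv P.h₁ x - (1 / 2) * (rp ^ 2)⁻¹ * P.γ₀₁ x + (1 - x ^ 2)⁻¹ * x * P.h₁ x;
    -((rp ^ 2)⁻¹ * P.h₁ x), P.h₁ x,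
      (1 / 2) * deriv P.h₁ x - (1 / 2) * (rp ^ 2)⁻¹ * P.γ₀₁ x + (1 - x ^ 2)⁻¹ * x * P.h₁ x,
      -((1 / 2) * (rp ^ 2)⁻¹ * P.γ₁₁ x) - (1 - x ^ 2) * x * P.h₀ x]

/-- The coefficient of the power of `r` in the first variation of `Γ^ρ_{μν}` for `ρ = x`. -/
def christoffelCoeffX (rp : ℝ) (P : Profile) (x : ℝ) : Matrix (Fin 4) (Fin 4) ℝ :=
  !![-((1 / 2) * (rp ^ 2)⁻¹ * (1 - x ^ 2) * deriv P.F x) - (rp ^ 4)⁻¹ * (1 - x ^ 2) * P.h₀ x,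
  (rp ^ 2)⁻¹ * (1 - x ^ 2) * P.h₀ x, 0, -((1 / 2) * (rp ^ 2)⁻¹ * (1 - x ^ 2) * deriv P.h₁ x);
    (rp ^ 2)⁻¹ * (1 - x ^ 2) * P.h₀ x, 0, (1 / 2) * (rp ^ 2)⁻¹ * (1 - x ^ 2) * P.γ₀₀ x,
      (1 / 2) * (rp ^ 2)⁻¹ * (1 - x ^ 2) * P.γ₀₁ x;
    0, (1 / 2) * (rp ^ 2)⁻¹ * (1 - x ^ 2) * P.γ₀₀ x,
      (1 / 2) * (rp ^ 2)⁻¹ * (1 - x ^ 2) * deriv P.γ₀₀ x - (rp ^ 2)⁻¹ * x * P.γ₀₀ x,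
      (rp ^ 2)⁻¹ * x * P.γ₀₁ x;
    -((1 / 2) * (rp ^ 2)⁻¹ * (1 - x ^ 2) * deriv P.h₁ x),
      (1 / 2) * (rp ^ 2)⁻¹ * (1 - x ^ 2) * P.γ₀₁ x, (rp ^ 2)⁻¹ * x * P.γ₀₁ x,
      -((1 / 2) * (rp ^ 2)⁻¹ * (1 - x ^ 2) * deriv P.γ₁₁ x) - (rp ^ 2)⁻¹ * (1
      - x ^ 2) ^ 2 * x * P.γ₀₀ x]

/-- The coefficient of the power of `r` in the first variation of `Γ^ρ_{μν}` for `ρ = φ`. -/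
def christoffelCoeffPhi (rp : ℝ) (P : Profile) (x : ℝ) : Matrix (Fin 4) (Fin 4) ℝ :=
  !![-((rp ^ 4)⁻¹ * (1 - x ^ 2)⁻¹ * P.h₁ x), (rp ^ 2)⁻¹ * (1 - x ^ 2)⁻¹ * P.h₁ x,
  (1 / 2) * (rp ^ 2)⁻¹ * (1 - x ^ 2)⁻¹ * deriv P.h₁ x, 0;
    (rp ^ 2)⁻¹ * (1 - x ^ 2)⁻¹ * P.h₁ x, 0, (1 / 2) * (rp ^ 2)⁻¹ * (1 - x ^ 2)⁻¹ * P.γ₀₁ x,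
      (1 / 2) * (rp ^ 2)⁻¹ * (1 - x ^ 2)⁻¹ * P.γ₁₁ x;
    (1 / 2) * (rp ^ 2)⁻¹ * (1 - x ^ 2)⁻¹ * deriv P.h₁ x,
      (1 / 2) * (rp ^ 2)⁻¹ * (1 - x ^ 2)⁻¹ * P.γ₀₁ x,
      (rp ^ 2)⁻¹ * (1 - x ^ 2)⁻¹ * deriv P.γ₀₁ x - (rp ^ 2)⁻¹ * (1 - x ^ 2)⁻¹ ^ 2 * x * P.γ₀₁ x,
      (1 / 2) * (rp ^ 2)⁻¹ * (1 - x ^ 2)⁻¹ * deriv P.γ₁₁ x + (rp ^ 2)⁻¹ * (1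
      - x ^ 2)⁻¹ ^ 2 * x * P.γ₁₁ x;
    0, (1 / 2) * (rp ^ 2)⁻¹ * (1 - x ^ 2)⁻¹ * P.γ₁₁ x,
      (1 / 2) * (rp ^ 2)⁻¹ * (1 - x ^ 2)⁻¹ * deriv P.γ₁₁ x + (rp ^ 2)⁻¹ * (1
      - x ^ 2)⁻¹ ^ 2 * x * P.γ₁₁ x, -((rp ^ 2)⁻¹ * x * P.γ₀₁ x)]

/-- The coefficient of the power of `r` in the first variation of `Γ^ρ_{μν}`. -/
def christoffelCoeff (rp : ℝ) (P : Profile) (x : ℝ) : Fin 4 → Matrix (Fin 4) (Fin 4) ℝ :=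
  ![christoffelCoeffV rp P x, christoffelCoeffR rp P x, christoffelCoeffX rp P x, christoffelCoeffPhi rp P x]

/-- The `x`-derivative of `christoffelCoeff` for `ρ = v`. -/
def christoffelCoeffDerivV (_rp : ℝ) (P : Profile) (x : ℝ) : Matrix (Fin 4) (Fin 4) ℝ :=
  !![-((3 / 2) * deriv P.F x), 0, -deriv P.h₀ x, -deriv P.h₁ x;
    0, 0, 0, 0;
    -deriv P.h₀ x, 0, -((1 / 2) * deriv P.γ₀₀ x), -((1 / 2) * deriv P.γ₀₁ x);
    -deriv P.h₁ x, 0, -((1 / 2) * deriv P.γ₀₁ x), -((1 / 2) * deriv P.γ₁₁ x)]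

/-- The `x`-derivative of `christoffelCoeff` for `ρ = r`. -/
def christoffelCoeffDerivR (rp : ℝ) (P : Profile) (x : ℝ) : Matrix (Fin 4) (Fin 4) ℝ :=
  !![-((5 / 2) * (rp ^ 2)⁻¹ * deriv P.F x), (3 / 2) * deriv P.F x,
  (1 / 2) * deriv (deriv P.F) x - (rp ^ 2)⁻¹ * deriv P.h₀ x, -((rp ^ 2)⁻¹ * deriv P.h₁ x);
    (3 / 2) * deriv P.F x, 0, deriv P.h₀ x, deriv P.h₁ x;
    (1 / 2) * deriv (deriv P.F) x - (rp ^ 2)⁻¹ * deriv P.h₀ x, deriv P.h₀ x,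
      deriv (deriv P.h₀) x - (1 / 2) * (rp ^ 2)⁻¹ * deriv P.γ₀₀ x - (1
      - x ^ 2)⁻¹ * x * deriv P.h₀ x + (1 - x ^ 2)⁻¹ * P.h₀ x - 2 * (1 - x ^ 2)⁻¹ ^ 2 * P.h₀ x,
      (1 / 2) * deriv (deriv P.h₁) x - (1 / 2) * (rp ^ 2)⁻¹ * deriv P.γ₀₁ x + (1
      - x ^ 2)⁻¹ * x * deriv P.h₁ x - (1 - x ^ 2)⁻¹ * P.h₁ x + 2 * (1 - x ^ 2)⁻¹ ^ 2 * P.h₁ x;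
    -((rp ^ 2)⁻¹ * deriv P.h₁ x), deriv P.h₁ x,
      (1 / 2) * deriv (deriv P.h₁) x - (1 / 2) * (rp ^ 2)⁻¹ * deriv P.γ₀₁ x + (1
      - x ^ 2)⁻¹ * x * deriv P.h₁ x - (1 - x ^ 2)⁻¹ * P.h₁ x + 2 * (1 - x ^ 2)⁻¹ ^ 2 * P.h₁ x,
      -((1 / 2) * (rp ^ 2)⁻¹ * deriv P.γ₁₁ x) - (1 - x ^ 2) * x * deriv P.h₀ x - 3 * (1
      - x ^ 2) * P.h₀ x + 2 * P.h₀ x]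

/-- The `x`-derivative of `christoffelCoeff` for `ρ = x`. -/
def christoffelCoeffDerivX (rp : ℝ) (P : Profile) (x : ℝ) : Matrix (Fin 4) (Fin 4) ℝ :=
  !![(rp ^ 2)⁻¹ * x * deriv P.F x - (1 / 2) * (rp ^ 2)⁻¹ * (1 - x ^ 2) * deriv (deriv P.F) x
  - (rp ^ 4)⁻¹ * (1 - x ^ 2) * deriv P.h₀ x + 2 * (rp ^ 4)⁻¹ * x * P.h₀ x,
  (rp ^ 2)⁻¹ * (1 - x ^ 2) * deriv P.h₀ x - 2 * (rp ^ 2)⁻¹ * x * P.h₀ x, 0,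
  (rp ^ 2)⁻¹ * x * deriv P.h₁ x - (1 / 2) * (rp ^ 2)⁻¹ * (1 - x ^ 2) * deriv (deriv P.h₁) x;
    (rp ^ 2)⁻¹ * (1 - x ^ 2) * deriv P.h₀ x - 2 * (rp ^ 2)⁻¹ * x * P.h₀ x, 0,
      (1 / 2) * (rp ^ 2)⁻¹ * (1 - x ^ 2) * deriv P.γ₀₀ x - (rp ^ 2)⁻¹ * x * P.γ₀₀ x,
      (1 / 2) * (rp ^ 2)⁻¹ * (1 - x ^ 2) * deriv P.γ₀₁ x - (rp ^ 2)⁻¹ * x * P.γ₀₁ x;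
    0, (1 / 2) * (rp ^ 2)⁻¹ * (1 - x ^ 2) * deriv P.γ₀₀ x - (rp ^ 2)⁻¹ * x * P.γ₀₀ x,
      -(2 * (rp ^ 2)⁻¹ * x * deriv P.γ₀₀ x) + (1 / 2) * (rp ^ 2)⁻¹ * (1
      - x ^ 2) * deriv (deriv P.γ₀₀) x - (rp ^ 2)⁻¹ * P.γ₀₀ x,
      (rp ^ 2)⁻¹ * x * deriv P.γ₀₁ x + (rp ^ 2)⁻¹ * P.γ₀₁ x;
    (rp ^ 2)⁻¹ * x * deriv P.h₁ x - (1 / 2) * (rp ^ 2)⁻¹ * (1 - x ^ 2) * deriv (deriv P.h₁) x,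
      (1 / 2) * (rp ^ 2)⁻¹ * (1 - x ^ 2) * deriv P.γ₀₁ x - (rp ^ 2)⁻¹ * x * P.γ₀₁ x,
      (rp ^ 2)⁻¹ * x * deriv P.γ₀₁ x + (rp ^ 2)⁻¹ * P.γ₀₁ x,
      (rp ^ 2)⁻¹ * x * deriv P.γ₁₁ x - (1 / 2) * (rp ^ 2)⁻¹ * (1
      - x ^ 2) * deriv (deriv P.γ₁₁) x + 4 * (rp ^ 2)⁻¹ * (1 - x ^ 2) * P.γ₀₀ x
      - (rp ^ 2)⁻¹ * (1 - x ^ 2) ^ 2 * x * deriv P.γ₀₀ x - 5 * (rp ^ 2)⁻¹ * (1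
      - x ^ 2) ^ 2 * P.γ₀₀ x]

/-- The `x`-derivative of `christoffelCoeff` for `ρ = φ`. -/
def christoffelCoeffDerivPhi (rp : ℝ) (P : Profile) (x : ℝ) : Matrix (Fin 4) (Fin 4) ℝ :=
  !![-((rp ^ 4)⁻¹ * (1 - x ^ 2)⁻¹ * deriv P.h₁ x) - 2 * (rp ^ 4)⁻¹ * (1
  - x ^ 2)⁻¹ ^ 2 * x * P.h₁ x,
  (rp ^ 2)⁻¹ * (1 - x ^ 2)⁻¹ * deriv P.h₁ x + 2 * (rp ^ 2)⁻¹ * (1 - x ^ 2)⁻¹ ^ 2 * x * P.h₁ x,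
  (1 / 2) * (rp ^ 2)⁻¹ * (1 - x ^ 2)⁻¹ * deriv (deriv P.h₁) x + (rp ^ 2)⁻¹ * (1
  - x ^ 2)⁻¹ ^ 2 * x * deriv P.h₁ x, 0;
    (rp ^ 2)⁻¹ * (1 - x ^ 2)⁻¹ * deriv P.h₁ x + 2 * (rp ^ 2)⁻¹ * (1 - x ^ 2)⁻¹ ^ 2 * x * P.h₁ x,
      0,
      (1 / 2) * (rp ^ 2)⁻¹ * (1 - x ^ 2)⁻¹ * deriv P.γ₀₁ x + (rp ^ 2)⁻¹ * (1
      - x ^ 2)⁻¹ ^ 2 * x * P.γ₀₁ x,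
      (1 / 2) * (rp ^ 2)⁻¹ * (1 - x ^ 2)⁻¹ * deriv P.γ₁₁ x + (rp ^ 2)⁻¹ * (1
      - x ^ 2)⁻¹ ^ 2 * x * P.γ₁₁ x;
    (1 / 2) * (rp ^ 2)⁻¹ * (1 - x ^ 2)⁻¹ * deriv (deriv P.h₁) x + (rp ^ 2)⁻¹ * (1
      - x ^ 2)⁻¹ ^ 2 * x * deriv P.h₁ x,
      (1 / 2) * (rp ^ 2)⁻¹ * (1 - x ^ 2)⁻¹ * deriv P.γ₀₁ x + (rp ^ 2)⁻¹ * (1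
      - x ^ 2)⁻¹ ^ 2 * x * P.γ₀₁ x,
      (rp ^ 2)⁻¹ * (1 - x ^ 2)⁻¹ * deriv (deriv P.γ₀₁) x + (rp ^ 2)⁻¹ * (1
      - x ^ 2)⁻¹ ^ 2 * x * deriv P.γ₀₁ x + 3 * (rp ^ 2)⁻¹ * (1 - x ^ 2)⁻¹ ^ 2 * P.γ₀₁ x
      - 4 * (rp ^ 2)⁻¹ * (1 - x ^ 2)⁻¹ ^ 3 * P.γ₀₁ x,
      (1 / 2) * (rp ^ 2)⁻¹ * (1 - x ^ 2)⁻¹ * deriv (deriv P.γ₁₁) x + 2 * (rp ^ 2)⁻¹ * (1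
      - x ^ 2)⁻¹ ^ 2 * x * deriv P.γ₁₁ x - 3 * (rp ^ 2)⁻¹ * (1 - x ^ 2)⁻¹ ^ 2 * P.γ₁₁ x
      + 4 * (rp ^ 2)⁻¹ * (1 - x ^ 2)⁻¹ ^ 3 * P.γ₁₁ x;
    0,
      (1 / 2) * (rp ^ 2)⁻¹ * (1 - x ^ 2)⁻¹ * deriv P.γ₁₁ x + (rp ^ 2)⁻¹ * (1
      - x ^ 2)⁻¹ ^ 2 * x * P.γ₁₁ x,
      (1 / 2) * (rp ^ 2)⁻¹ * (1 - x ^ 2)⁻¹ * deriv (deriv P.γ₁₁) x + 2 * (rp ^ 2)⁻¹ * (1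
      - x ^ 2)⁻¹ ^ 2 * x * deriv P.γ₁₁ x - 3 * (rp ^ 2)⁻¹ * (1 - x ^ 2)⁻¹ ^ 2 * P.γ₁₁ x
      + 4 * (rp ^ 2)⁻¹ * (1 - x ^ 2)⁻¹ ^ 3 * P.γ₁₁ x,
      -((rp ^ 2)⁻¹ * x * deriv P.γ₀₁ x) - (rp ^ 2)⁻¹ * P.γ₀₁ x]

/-- The `x`-derivative of `christoffelCoeff`. -/
def christoffelCoeffDeriv (rp : ℝ) (P : Profile) (x : ℝ) : Fin 4 → Matrix (Fin 4) (Fin 4) ℝ :=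
  ![christoffelCoeffDerivV rp P x, christoffelCoeffDerivR rp P x, christoffelCoeffDerivX rp P x, christoffelCoeffDerivPhi rp P x]

end Profile

/-! ### Partial derivatives of the background and of the perturbation, which depend on `r` and `x`
only. -/

lemma forall_fin_four {p : Fin 4 → Prop} (h₀ : p 0) (h₁ : p 1) (h₂ : p 2) (h₃ : p 3) :
    ∀ i, p i := by
  intro i
  fin_cases i
  exacts [h₀, h₁, h₂, h₃]

lemma isOpen_patch : IsOpen patch :=
  isOpen_Ioo.preimage (continuous_apply (2 : Fin 4))

lemma one_sub_sq_pos {x : ℝ} (hx : x ∈ Set.Ioo (-1 : ℝ) 1) : 0 < 1 - x ^ 2 := by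
  nlinarith [hx.1, hx.2]

lemma pd_zero_of_coords (G : ℝ → ℝ → ℝ) (p : Pt) : pd 0 (fun q => G (q 1) (q 2)) p = 0 := by
  simp [pd]

lemma pd_three_of_coords (G : ℝ → ℝ → ℝ) (p : Pt) : pd 3 (fun q => G (q 1) (q 2)) p = 0 := by
  simp [pd]

lemma pd_one_of_coords (G : ℝ → ℝ → ℝ) (p : Pt) :
    pd 1 (fun q => G (q 1) (q 2)) p = deriv (fun s => G s (p 2)) (p 1) := by
  simp [pd]

lemma pd_two_of_coords (G : ℝ → ℝ → ℝ) (p : Pt) :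
    pd 2 (fun q => G (q 1) (q 2)) p = deriv (fun s => G (p 1) s) (p 2) := by
  simp [pd]

/-- The partial derivatives of a tensor field whose components depend on `r` and `x` only. -/
lemma pd_eq_of_coords {T : ℝ → ℝ → Matrix (Fin 4) (Fin 4) ℝ}
    {T' : Fin 4 → Matrix (Fin 4) (Fin 4) ℝ} {p : Pt} (h₀ : T' 0 = 0) (h₃ : T' 3 = 0)
    (h₁ : ∀ μ ν, deriv (fun s => T s (p 2) μ ν) (p 1) = T' 1 μ ν)
    (h₂ : ∀ μ ν, deriv (fun s => T (p 1) s μ ν) (p 2) = T' 2 μ ν) (κ μ ν : Fin 4) :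
    pd κ (fun q => T (q 1) (q 2) μ ν) p = T' κ μ ν := by
  revert κ
  refine forall_fin_four ?_ ?_ ?_ ?_
  · rw [pd_zero_of_coords (fun r x => T r x μ ν), h₀]; rfl
  · rw [pd_one_of_coords (fun r x => T r x μ ν), h₁]
  · rw [pd_two_of_coords (fun r x => T r x μ ν), h₂]
  · rw [pd_three_of_coords (fun r x => T r x μ ν), h₃]; rfl

/-- The partial derivatives of the components of the near-horizon metric. -/
def nhMetricDeriv (rp r x : ℝ) : Fin 4 → Matrix (Fin 4) (Fin 4) ℝ :=
  ![0, !![-(2 * r) / rp ^ 2, 0, 0, 0; 0, 0, 0, 0; 0, 0, 0, 0; 0, 0, 0, 0],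
    !![0, 0, 0, 0; 0, 0, 0, 0; 0, 0, rp ^ 2 * (2 * x * (1 - x ^ 2)⁻¹ ^ 2), 0;
      0, 0, 0, -(rp ^ 2 * (2 * x))], 0]

lemma hasDerivAt_inv_one_sub_sq {x : ℝ} (hx : 1 - x ^ 2 ≠ 0) :
    HasDerivAt (fun x : ℝ => (1 - x ^ 2)⁻¹) (2 * x * (1 - x ^ 2)⁻¹ ^ 2) x := by
  have h : HasDerivAt (fun x : ℝ => 1 - x ^ 2) (-(2 * x)) x := by
    simpa using (hasDerivAt_pow 2 x).const_sub 1
  refine (h.inv hx).congr_deriv ?_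
  field_simp

lemma pd_nhMetric (rp : ℝ) {p : Pt} (hp : p ∈ patch) (κ μ ν : Fin 4) :
    pd κ (fun q => nhMetric rp q μ ν) p = nhMetricDeriv rp (p 1) (p 2) κ μ ν := by
  have hx := (one_sub_sq_pos hp).ne'
  refine pd_eq_of_coords (T := fun r x => nhMetric rp ![0, r, x, 0]) rfl rfl ?_ ?_ κ μ ν <;>
    refine forall_fin_four ?_ ?_ ?_ ?_ <;> refine forall_fin_four ?_ ?_ ?_ ?_ <;>
    simp [nhMetric, nhMetricDeriv, div_eq_mul_inv, -mul_eq_mul_left_iff]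
  simp [(hasDerivAt_inv_one_sub_sq hx).deriv]

namespace Profile

variable {P : Profile}

/-- The partial derivatives of the components of `P.metric`. -/
def metricDeriv (P : Profile) (r x : ℝ) : Fin 4 → Matrix (Fin 4) (Fin 4) ℝ :=
  ![0,
    !![3 * r ^ 2 * P.F x, 0, 2 * r * P.h₀ x, 2 * r * P.h₁ x;
       0, 0, 0, 0;
       2 * r * P.h₀ x, 0, P.γ₀₀ x, P.γ₀₁ x;
       2 * r * P.h₁ x, 0, P.γ₀₁ x, P.γ₁₁ x],
    !![r ^ 3 * deriv P.F x, 0, r ^ 2 * deriv P.h₀ x, r ^ 2 * deriv P.h₁ x;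
       0, 0, 0, 0;
       r ^ 2 * deriv P.h₀ x, 0, r * deriv P.γ₀₀ x, r * deriv P.γ₀₁ x;
       r ^ 2 * deriv P.h₁ x, 0, r * deriv P.γ₀₁ x, r * deriv P.γ₁₁ x], 0]

/-- The partial derivatives of the components of `P.maxwell`. -/
def maxwellDeriv (P : Profile) (r x : ℝ) : Fin 4 → Matrix (Fin 4) (Fin 4) ℝ :=
  ![0,
    !![0, P.Ψ x, 2 * r * P.W₀ x, 2 * r * P.W₁ x;
       -P.Ψ x, 0, 0, 0;
       -(2 * r * P.W₀ x), 0, 0, P.B x;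
       -(2 * r * P.W₁ x), 0, -P.B x, 0],
    !![0, r * deriv P.Ψ x, r ^ 2 * deriv P.W₀ x, r ^ 2 * deriv P.W₁ x;
       -(r * deriv P.Ψ x), 0, deriv P.Z₀ x, deriv P.Z₁ x;
       -(r ^ 2 * deriv P.W₀ x), -deriv P.Z₀ x, 0, r * deriv P.B x;
       -(r ^ 2 * deriv P.W₁ x), -deriv P.Z₁ x, -(r * deriv P.B x), 0], 0]

lemma pd_metric (p : Pt) (κ μ ν : Fin 4) :
    pd κ (fun q => P.metric q μ ν) p = P.metricDeriv (p 1) (p 2) κ μ ν := by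
  refine pd_eq_of_coords (T := fun r x => P.metric ![0, r, x, 0]) rfl rfl ?_ ?_ κ μ ν <;>
    refine forall_fin_four ?_ ?_ ?_ ?_ <;> refine forall_fin_four ?_ ?_ ?_ ?_ <;>
    simp [metric, metricDeriv]

lemma pd_maxwell (p : Pt) (κ μ ν : Fin 4) :
    pd κ (fun q => P.maxwell q μ ν) p = P.maxwellDeriv (p 1) (p 2) κ μ ν := by
  refine pd_eq_of_coords (T := fun r x => P.maxwell ![0, r, x, 0]) rfl rfl ?_ ?_ κ μ ν <;>
    refine forall_fin_four ?_ ?_ ?_ ?_ <;> refine forall_fin_four ?_ ?_ ?_ ?_ <;>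
    simp [maxwell, maxwellDeriv]

end Profile

/-! ### Inverse metric and Christoffel symbols of the background, and their first variations. -/

set_option linter.unusedSimpArgs false
set_option linter.unusedTactic false
set_option linter.unreachableTactic false

/-- The inverse of the near-horizon metric. -/
def nhInverse (rp r x : ℝ) : Matrix (Fin 4) (Fin 4) ℝ :=
  !![0, 1, 0, 0;
     1, r ^ 2 * (rp ^ 2)⁻¹, 0, 0;
     0, 0, (1 - x ^ 2) * (rp ^ 2)⁻¹, 0;
     0, 0, 0, (1 - x ^ 2)⁻¹ * (rp ^ 2)⁻¹]

/-- The Christoffel symbols of the near-horizon metric. -/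
def nhChristoffel (rp r x : ℝ) : Fin 4 → Matrix (Fin 4) (Fin 4) ℝ :=
  ![!![r * (rp ^ 2)⁻¹, 0, 0, 0; 0, 0, 0, 0; 0, 0, 0, 0; 0, 0, 0, 0],
    !![r ^ 3 * (rp ^ 4)⁻¹, -(r * (rp ^ 2)⁻¹), 0, 0; -(r * (rp ^ 2)⁻¹), 0, 0, 0;
      0, 0, 0, 0; 0, 0, 0, 0],
    !![0, 0, 0, 0; 0, 0, 0, 0; 0, 0, x * (1 - x ^ 2)⁻¹, 0; 0, 0, 0, x * (1 - x ^ 2)],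
    !![0, 0, 0, 0; 0, 0, 0, 0; 0, 0, 0, -(x * (1 - x ^ 2)⁻¹); 0, 0, -(x * (1 - x ^ 2)⁻¹), 0]]

section

variable {rp : ℝ} {p : Pt}

lemma nhMetric_mul_nhInverse (hrp : 0 < rp) (hp : p ∈ patch) :
    nhMetric rp p * nhInverse rp (p 1) (p 2) = 1 := by
  have hx := (one_sub_sq_pos hp).ne'
  ext i j
  revert i j
  refine forall_fin_four ?_ ?_ ?_ ?_ <;> refine forall_fin_four ?_ ?_ ?_ ?_ <;>
    simp [nhMetric, nhInverse, Matrix.mul_apply, Fin.sum_univ_four] <;> field_simp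
  ring

lemma inv_nhMetric (hrp : 0 < rp) (hp : p ∈ patch) :
    (nhMetric rp p)⁻¹ = nhInverse rp (p 1) (p 2) :=
  Matrix.inv_eq_right_inv (nhMetric_mul_nhInverse hrp hp)

lemma det_nhMetric_ne_zero (hrp : 0 < rp) (hp : p ∈ patch) : (nhMetric rp p).det ≠ 0 := by
  intro h
  have := congrArg Matrix.det (nhMetric_mul_nhInverse hrp hp)
  simp [h] at this

lemma christoffel_nhMetric (hrp : 0 < rp) (hp : p ∈ patch) (ρ μ ν : Fin 4) :
    christoffel (nhMetric rp) ρ μ ν p = nhChristoffel rp (p 1) (p 2) ρ μ ν := by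
  have hx := (one_sub_sq_pos hp).ne'
  simp only [christoffel, inv_nhMetric hrp hp, pd_nhMetric rp hp, Fin.sum_univ_four]
  revert ρ μ ν
  refine forall_fin_four ?_ ?_ ?_ ?_ <;> refine forall_fin_four ?_ ?_ ?_ ?_ <;>
    refine forall_fin_four ?_ ?_ ?_ ?_ <;>
    simp only [nhInverse, nhMetricDeriv, nhChristoffel, Matrix.of_apply, Matrix.cons_val,
      Matrix.zero_apply, Matrix.neg_apply, zero_mul, mul_zero, add_zero, zero_add, sub_zero, neg_zero] <;>
    first | done | ring1 | (field_simp; done) | (field_simp; ring1)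

namespace Profile

variable {P : Profile}

/-- The first variation of the inverse metric. -/
def inverseVariation (rp : ℝ) (P : Profile) (r x : ℝ) : Matrix (Fin 4) (Fin 4) ℝ :=
  !![0, 0, 0, 0;
     0, -(r ^ 3 * P.F x), -((rp ^ 2)⁻¹ * (1 - x ^ 2) * r ^ 2 * P.h₀ x),
       -((rp ^ 2)⁻¹ * (1 - x ^ 2)⁻¹ * r ^ 2 * P.h₁ x);
     0, -((rp ^ 2)⁻¹ * (1 - x ^ 2) * r ^ 2 * P.h₀ x),
       -((rp ^ 4)⁻¹ * (1 - x ^ 2) ^ 2 * r * P.γ₀₀ x), -((rp ^ 4)⁻¹ * r * P.γ₀₁ x);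
     0, -((rp ^ 2)⁻¹ * (1 - x ^ 2)⁻¹ * r ^ 2 * P.h₁ x), -((rp ^ 4)⁻¹ * r * P.γ₀₁ x),
       -((rp ^ 4)⁻¹ * (1 - x ^ 2)⁻¹ ^ 2 * r * P.γ₁₁ x)]

lemma linInverse_metric (hrp : 0 < rp) (hp : p ∈ patch) :
    linInverse (nhMetric rp) P.metric p = inverseVariation rp P (p 1) (p 2) := by
  have hx := (one_sub_sq_pos hp).ne'
  simp only [linInverse, inv_nhMetric hrp hp]
  ext i j
  revert i j
  refine forall_fin_four ?_ ?_ ?_ ?_ <;> refine forall_fin_four ?_ ?_ ?_ ?_ <;>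
    simp only [nhInverse, inverseVariation, metric, Matrix.mul_apply, Fin.sum_univ_four,
      Matrix.of_apply, Matrix.cons_val,
      Matrix.zero_apply, Matrix.neg_apply, zero_mul, mul_zero, add_zero, zero_add, sub_zero, neg_zero] <;>
    first | done | ring1 | (field_simp; done) | (field_simp; ring1)

/-- Because the background is invariant and the perturbation has weight one under `(v, r) ↦ (v/ε,
εr)`, each component is a single monomial in `r`. This lets the `r`-dependence be tabulated by
exponents and leaves only functions of `x` to differentiate. -/
lemma linChristoffel_metric (hrp : 0 < rp) (hp : p ∈ patch) (ρ μ ν : Fin 4) :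
    linChristoffel (nhMetric rp) P.metric ρ μ ν p
      = p 1 ^ christoffelExponent ρ μ ν * christoffelCoeff rp P (p 2) ρ μ ν := by
  have hx := (one_sub_sq_pos hp).ne'
  simp only [linChristoffel, koszul, inv_nhMetric hrp hp, pd_nhMetric rp hp, Fin.sum_univ_four,
    linInverse_metric hrp hp, pd_metric]
  revert ρ μ ν
  refine forall_fin_four ?_ ?_ ?_ ?_
  · refine forall_fin_four ?_ ?_ ?_ ?_ <;> refine forall_fin_four ?_ ?_ ?_ ?_ <;>
      simp only [nhInverse, nhMetricDeriv, inverseVariation, metricDeriv, christoffelExponent,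
      christoffelCoeff, christoffelExponentV, christoffelCoeffV, Matrix.of_apply, Matrix.cons_val,
      Matrix.zero_apply, Matrix.neg_apply, zero_mul, mul_zero, add_zero, zero_add, sub_zero, neg_zero] <;>
    first | done | ring1 | (field_simp; done) | (field_simp; ring1)
  · refine forall_fin_four ?_ ?_ ?_ ?_ <;> refine forall_fin_four ?_ ?_ ?_ ?_ <;>
      simp only [nhInverse, nhMetricDeriv, inverseVariation, metricDeriv, christoffelExponent,
      christoffelCoeff, christoffelExponentR, christoffelCoeffR, Matrix.of_apply, Matrix.cons_val,
      Matrix.zero_apply, Matrix.neg_apply, zero_mul, mul_zero, add_zero, zero_add, sub_zero, neg_zero] <;>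
    first | done | ring1 | (field_simp; done) | (field_simp; ring1)
  · refine forall_fin_four ?_ ?_ ?_ ?_ <;> refine forall_fin_four ?_ ?_ ?_ ?_ <;>
      simp only [nhInverse, nhMetricDeriv, inverseVariation, metricDeriv, christoffelExponent,
      christoffelCoeff, christoffelExponentX, christoffelCoeffX, Matrix.of_apply, Matrix.cons_val,
      Matrix.zero_apply, Matrix.neg_apply, zero_mul, mul_zero, add_zero, zero_add, sub_zero, neg_zero] <;>
    first | done | ring1 | (field_simp; done) | (field_simp; ring1)
  · refine forall_fin_four ?_ ?_ ?_ ?_ <;> refine forall_fin_four ?_ ?_ ?_ ?_ <;>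
      simp only [nhInverse, nhMetricDeriv, inverseVariation, metricDeriv, christoffelExponent,
      christoffelCoeff, christoffelExponentPhi, christoffelCoeffPhi, Matrix.of_apply, Matrix.cons_val,
      Matrix.zero_apply, Matrix.neg_apply, zero_mul, mul_zero, add_zero, zero_add, sub_zero, neg_zero] <;>
    first | done | ring1 | (field_simp; done) | (field_simp; ring1)

lemma hasDerivAt_of_contDiffOn {u : ℝ → ℝ} (hu : ContDiffOn ℝ ∞ u (Set.Ioo (-1) 1)) {x : ℝ}
    (hx : x ∈ Set.Ioo (-1 : ℝ) 1) : HasDerivAt u (deriv u x) x :=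
  ((hu.contDiffAt (isOpen_Ioo.mem_nhds hx)).differentiableAt (by simp)).hasDerivAt

lemma contDiffOn_deriv {u : ℝ → ℝ} (hu : ContDiffOn ℝ ∞ u (Set.Ioo (-1) 1)) :
    ContDiffOn ℝ ∞ (deriv u) (Set.Ioo (-1) 1) :=
  hu.deriv_of_isOpen isOpen_Ioo (by simp)

lemma hasDerivAt_christoffelCoeff (hP : P.IsSmooth) {x : ℝ} (hx : x ∈ Set.Ioo (-1 : ℝ) 1)
    (ρ μ ν : Fin 4) :
    HasDerivAt (fun x => christoffelCoeff rp P x ρ μ ν) (christoffelCoeffDeriv rp P x ρ μ ν) x := by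
  have hc := (one_sub_sq_pos hx).ne'
  have hi := hasDerivAt_inv_one_sub_sq hc
  have hq : HasDerivAt (fun x : ℝ => 1 - x ^ 2) (-(2 * x)) x := by
    simpa using (hasDerivAt_pow 2 x).const_sub 1
  have hq2 : HasDerivAt (fun x : ℝ => (1 - x ^ 2) ^ 2) (-(4 * x * (1 - x ^ 2))) x :=
    (hq.fun_pow 2).congr_deriv (by norm_num; ring)
  have hi2 : HasDerivAt (fun x : ℝ => (1 - x ^ 2)⁻¹ ^ 2) (4 * x * (1 - x ^ 2)⁻¹ ^ 3) x :=
    (hi.fun_pow 2).congr_deriv (by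
      simp only [Nat.cast_ofNat, Nat.add_one_sub_one, pow_one]; ring)
  simp only [IsSmooth, List.forall_mem_cons] at hP
  obtain ⟨hF, h0, h1, g00, g01, g11, -⟩ := hP
  have F1 := hasDerivAt_of_contDiffOn hF hx
  have F2 := hasDerivAt_of_contDiffOn (contDiffOn_deriv hF) hx
  have h01 := hasDerivAt_of_contDiffOn h0 hx
  have h02 := hasDerivAt_of_contDiffOn (contDiffOn_deriv h0) hx
  have h11 := hasDerivAt_of_contDiffOn h1 hx
  have h12 := hasDerivAt_of_contDiffOn (contDiffOn_deriv h1) hx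
  have g001 := hasDerivAt_of_contDiffOn g00 hx
  have g002 := hasDerivAt_of_contDiffOn (contDiffOn_deriv g00) hx
  have g011 := hasDerivAt_of_contDiffOn g01 hx
  have g012 := hasDerivAt_of_contDiffOn (contDiffOn_deriv g01) hx
  have g111 := hasDerivAt_of_contDiffOn g11 hx
  have g112 := hasDerivAt_of_contDiffOn (contDiffOn_deriv g11) hx
  clear hF h0 h1 g00 g01 g11
  revert ρ μ ν
  refine forall_fin_four ?_ ?_ ?_ ?_ <;> refine forall_fin_four ?_ ?_ ?_ ?_ <;>
    refine forall_fin_four ?_ ?_ ?_ ?_ <;>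
    simp only [christoffelCoeff, christoffelCoeffDeriv, christoffelCoeffV, christoffelCoeffR,
      christoffelCoeffX, christoffelCoeffPhi, christoffelCoeffDerivV, christoffelCoeffDerivR,
      christoffelCoeffDerivX, christoffelCoeffDerivPhi, Matrix.of_apply, Matrix.cons_val] <;>
    -- The derivative is assembled from the shape of the expression; what remains is the comparison
    -- with the tabulated value.
    refine HasDerivAt.congr_deriv (by
      repeat' first
        | exact hasDerivAt_const _ _
        | assumption
        | exact hasDerivAt_id' _
        | apply HasDerivAt.fun_add
        | apply HasDerivAt.fun_sub
        | apply HasDerivAt.fun_neg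
        | apply HasDerivAt.fun_mul) ?_ <;>
    first
      | done
      | ring1
      | (field_simp; done)
      | (field_simp; ring1)

/-- When the exponent is `0`, the truncated subtraction in the `r`-derivative is harmless, since the
factor in front vanishes. -/
lemma pd_linChristoffel_metric (hrp : 0 < rp) (hP : P.IsSmooth) (hp : p ∈ patch)
    (κ ρ μ ν : Fin 4) :
    pd κ (linChristoffel (nhMetric rp) P.metric ρ μ ν) p
      = ![0, christoffelExponent ρ μ ν * p 1 ^ (christoffelExponent ρ μ ν - 1) *
            christoffelCoeff rp P (p 2) ρ μ ν,
          p 1 ^ christoffelExponent ρ μ ν * christoffelCoeffDeriv rp P (p 2) ρ μ ν, 0] κ := by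
  set G : ℝ → ℝ → ℝ := fun r x => r ^ christoffelExponent ρ μ ν * christoffelCoeff rp P x ρ μ ν
    with hG
  rw [pd_congr_on isOpen_patch (g := fun q => G (q 1) (q 2))
    (fun q hq => linChristoffel_metric hrp hq ρ μ ν) hp]
  revert κ
  refine forall_fin_four ?_ ?_ ?_ ?_
  · exact pd_zero_of_coords G p
  · exact (pd_one_of_coords G p).trans ((hasDerivAt_pow _ _).mul_const _).deriv
  · exact (pd_two_of_coords G p).trans
      ((hasDerivAt_christoffelCoeff hP hp ρ μ ν).const_mul _).deriv
  · exact pd_three_of_coords G p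

end Profile
end

/-! ### First variations of the Einstein and Maxwell residuals. -/

set_option linter.unusedSimpArgs false
set_option linter.unusedTactic false
set_option linter.unreachableTactic false

lemma pd_nhMaxwell (qe qm rp : ℝ) (p : Pt) (κ μ ν : Fin 4) :
    pd κ (fun q => nhMaxwell qe qm rp q μ ν) p = 0 := by
  simp [pd, nhMaxwell]

namespace Profile

/-- The `vv` component of the first variation of `einsteinResidual`. -/
def einsteinVV (qe qm rp : ℝ) (P : Profile) (r x : ℝ) : ℝ :=
  (rp ^ 2)⁻¹ * r ^ 3 * x * deriv P.F x - (1 / 2) * (rp ^ 2)⁻¹ * (1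
  - x ^ 2) * r ^ 3 * deriv (deriv P.F) x - 2 * (rp ^ 6)⁻¹ * r ^ 3 * P.B x * qm
  - 4 * (rp ^ 2)⁻¹ * r ^ 3 * P.F x + (rp ^ 4)⁻¹ * r ^ 3 * P.F x * qe ^ 2
  + (rp ^ 4)⁻¹ * r ^ 3 * P.F x * qm ^ 2 + 2 * (rp ^ 4)⁻¹ * r ^ 3 * P.Ψ x * qe - (rp ^ 4)⁻¹ * (1
  - x ^ 2) * r ^ 3 * deriv P.h₀ x + 2 * (rp ^ 4)⁻¹ * r ^ 3 * x * P.h₀ x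
  + (1 / 2) * (rp ^ 6)⁻¹ * (1 - x ^ 2)⁻¹ * r ^ 3 * P.γ₁₁ x + (1 / 2) * (rp ^ 6)⁻¹ * (1
  - x ^ 2) * r ^ 3 * P.γ₀₀ x + (rp ^ 8)⁻¹ * (1 - x ^ 2)⁻¹ * r ^ 3 * P.γ₁₁ x * qm ^ 2
  + (rp ^ 8)⁻¹ * (1 - x ^ 2) * r ^ 3 * P.γ₀₀ x * qm ^ 2

/-- The `vr` component of the first variation of `einsteinResidual`. -/
def einsteinVR (qe qm rp : ℝ) (P : Profile) (r x : ℝ) : ℝ :=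
  2 * (rp ^ 4)⁻¹ * r * P.B x * qm + 3 * r * P.F x - 2 * (rp ^ 2)⁻¹ * r * P.Ψ x * qe
  + (rp ^ 2)⁻¹ * (1 - x ^ 2) * r * deriv P.h₀ x - 2 * (rp ^ 2)⁻¹ * r * x * P.h₀ x
  - (1 / 2) * (rp ^ 4)⁻¹ * (1 - x ^ 2)⁻¹ * r * P.γ₁₁ x - (1 / 2) * (rp ^ 4)⁻¹ * (1
  - x ^ 2) * r * P.γ₀₀ x - (rp ^ 6)⁻¹ * (1 - x ^ 2)⁻¹ * r * P.γ₁₁ x * qm ^ 2 - (rp ^ 6)⁻¹ * (1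
  - x ^ 2) * r * P.γ₀₀ x * qm ^ 2

/-- The `vx` component of the first variation of `einsteinResidual`. -/
def einsteinVX (qe qm rp : ℝ) (P : Profile) (r x : ℝ) : ℝ :=
  (3 / 2) * r ^ 2 * deriv P.F x - 2 * (rp ^ 2)⁻¹ * r ^ 2 * P.W₀ x * qe - 2 * (rp ^ 2)⁻¹ * (1
  - x ^ 2)⁻¹ * r ^ 2 * P.W₁ x * qm - (rp ^ 2)⁻¹ * r ^ 2 * P.h₀ x
  - 2 * (rp ^ 4)⁻¹ * r ^ 2 * P.Z₀ x * qe - 2 * (rp ^ 4)⁻¹ * (1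
  - x ^ 2)⁻¹ * r ^ 2 * P.h₁ x * qe * qm - (rp ^ 4)⁻¹ * r ^ 2 * P.h₀ x * qe ^ 2
  + (rp ^ 4)⁻¹ * r ^ 2 * P.h₀ x * qm ^ 2

/-- The `vφ` component of the first variation of `einsteinResidual`. -/
def einsteinVPhi (qe qm rp : ℝ) (P : Profile) (r x : ℝ) : ℝ :=
  2 * (rp ^ 2)⁻¹ * (1 - x ^ 2) * r ^ 2 * P.W₀ x * qm - 2 * (rp ^ 2)⁻¹ * r ^ 2 * P.W₁ x * qe
  - (1 / 2) * (rp ^ 2)⁻¹ * (1 - x ^ 2) * r ^ 2 * deriv (deriv P.h₁) x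
  - (rp ^ 2)⁻¹ * r ^ 2 * P.h₁ x - 2 * (rp ^ 4)⁻¹ * r ^ 2 * P.Z₁ x * qe + 2 * (rp ^ 4)⁻¹ * (1
  - x ^ 2) * r ^ 2 * P.h₀ x * qe * qm - (rp ^ 4)⁻¹ * r ^ 2 * P.h₁ x * qe ^ 2
  + (rp ^ 4)⁻¹ * r ^ 2 * P.h₁ x * qm ^ 2

/-- The `rx` component of the first variation of `einsteinResidual`. -/
def einsteinRX (qe qm rp : ℝ) (P : Profile) (_r x : ℝ) : ℝ :=
  2 * (rp ^ 2)⁻¹ * P.Z₀ x * qe - 2 * (rp ^ 2)⁻¹ * (1 - x ^ 2)⁻¹ * P.Z₁ x * qm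
  - (1 / 2) * (rp ^ 2)⁻¹ * (1 - x ^ 2)⁻¹ * deriv P.γ₁₁ x - (1 / 2) * (rp ^ 2)⁻¹ * (1
  - x ^ 2)⁻¹ ^ 2 * x * P.γ₁₁ x - (1 / 2) * (rp ^ 2)⁻¹ * x * P.γ₀₀ x + P.h₀ x

/-- The `rφ` component of the first variation of `einsteinResidual`. -/
def einsteinRPhi (qe qm rp : ℝ) (P : Profile) (_r x : ℝ) : ℝ :=
  2 * (rp ^ 2)⁻¹ * (1 - x ^ 2) * P.Z₀ x * qm + 2 * (rp ^ 2)⁻¹ * P.Z₁ x * qe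
  + (1 / 2) * (rp ^ 2)⁻¹ * (1 - x ^ 2) * deriv P.γ₀₁ x - (rp ^ 2)⁻¹ * x * P.γ₀₁ x + P.h₁ x

/-- The `xx` component of the first variation of `einsteinResidual`. -/
def einsteinXX (qe qm rp : ℝ) (P : Profile) (r x : ℝ) : ℝ :=
  2 * r * deriv P.h₀ x - 2 * (rp ^ 2)⁻¹ * (1 - x ^ 2)⁻¹ * r * P.B x * qm + 2 * (1
  - x ^ 2)⁻¹ * r * P.Ψ x * qe - (1 / 2) * (rp ^ 2)⁻¹ * r * x * deriv P.γ₀₀ x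
  - (1 / 2) * (rp ^ 2)⁻¹ * (1 - x ^ 2)⁻¹ * r * deriv (deriv P.γ₁₁) x + (rp ^ 2)⁻¹ * (1
  - x ^ 2)⁻¹ * r * P.γ₀₀ x - (1 / 2) * (rp ^ 2)⁻¹ * (1 - x ^ 2)⁻¹ ^ 2 * r * x * deriv P.γ₁₁ x
  - (rp ^ 2)⁻¹ * (1 - x ^ 2)⁻¹ ^ 3 * r * P.γ₁₁ x - 2 * (rp ^ 2)⁻¹ * r * P.γ₀₀ x
  + (rp ^ 4)⁻¹ * (1 - x ^ 2)⁻¹ ^ 2 * r * P.γ₁₁ x * qm ^ 2 - (rp ^ 4)⁻¹ * r * P.γ₀₀ x * qe ^ 2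
  - 2 * (1 - x ^ 2)⁻¹ * r * x * P.h₀ x

/-- The `xφ` component of the first variation of `einsteinResidual`. -/
def einsteinXPhi (qe qm rp : ℝ) (P : Profile) (r x : ℝ) : ℝ :=
  r * deriv P.h₁ x - (rp ^ 4)⁻¹ * r * P.γ₀₁ x * qe ^ 2 - (rp ^ 4)⁻¹ * r * P.γ₀₁ x * qm ^ 2
  + 2 * (1 - x ^ 2)⁻¹ * r * x * P.h₁ x

/-- The `φφ` component of the first variation of `einsteinResidual`. -/
def einsteinPhiPhi (qe qm rp : ℝ) (P : Profile) (r x : ℝ) : ℝ :=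
  -(2 * (rp ^ 2)⁻¹ * (1 - x ^ 2) * r * P.B x * qm) + 2 * (1 - x ^ 2) * r * P.Ψ x * qe
  - (1 / 2) * (rp ^ 2)⁻¹ * r * x * deriv P.γ₁₁ x - (rp ^ 2)⁻¹ * (1 - x ^ 2)⁻¹ * r * P.γ₁₁ x
  - (1 / 2) * (rp ^ 2)⁻¹ * (1 - x ^ 2) * r * deriv (deriv P.γ₁₁) x + (rp ^ 2)⁻¹ * (1
  - x ^ 2) * r * P.γ₀₀ x - (1 / 2) * (rp ^ 2)⁻¹ * (1 - x ^ 2) ^ 2 * r * x * deriv P.γ₀₀ x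
  - 2 * (rp ^ 2)⁻¹ * (1 - x ^ 2) ^ 2 * r * P.γ₀₀ x + (rp ^ 4)⁻¹ * (1
  - x ^ 2) ^ 2 * r * P.γ₀₀ x * qm ^ 2 - (rp ^ 4)⁻¹ * r * P.γ₁₁ x * qe ^ 2 - 2 * (1
  - x ^ 2) * r * x * P.h₀ x

/-- The components of the first variation of `einsteinResidual`. -/
def einsteinVariation (qe qm rp : ℝ) (P : Profile) (r x : ℝ) : Matrix (Fin 4) (Fin 4) ℝ :=
  !![einsteinVV qe qm rp P r x, einsteinVR qe qm rp P r x, einsteinVX qe qm rp P r x,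
  einsteinVPhi qe qm rp P r x;
    einsteinVR qe qm rp P r x, 0, einsteinRX qe qm rp P r x, einsteinRPhi qe qm rp P r x;
    einsteinVX qe qm rp P r x, einsteinRX qe qm rp P r x, einsteinXX qe qm rp P r x,
      einsteinXPhi qe qm rp P r x;
    einsteinVPhi qe qm rp P r x, einsteinRPhi qe qm rp P r x, einsteinXPhi qe qm rp P r x,
      einsteinPhiPhi qe qm rp P r x]

/-- The `v` component of the first variation of `maxwellResidual`. -/
def maxwellV (qe qm rp : ℝ) (P : Profile) (r x : ℝ) : ℝ :=
  -((rp ^ 2)⁻¹ * r ^ 2 * P.Ψ x) - (rp ^ 2)⁻¹ * (1 - x ^ 2) * r ^ 2 * deriv P.W₀ x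
  + 2 * (rp ^ 2)⁻¹ * r ^ 2 * x * P.W₀ x - (rp ^ 4)⁻¹ * r ^ 2 * deriv P.h₁ x * qm
  - (rp ^ 4)⁻¹ * (1 - x ^ 2) * r ^ 2 * deriv P.h₀ x * qe
  + 2 * (rp ^ 4)⁻¹ * r ^ 2 * x * P.h₀ x * qe + (1 / 2) * (rp ^ 6)⁻¹ * (1
  - x ^ 2)⁻¹ * r ^ 2 * P.γ₁₁ x * qe + (1 / 2) * (rp ^ 6)⁻¹ * (1 - x ^ 2) * r ^ 2 * P.γ₀₀ x * qe

/-- The `r` component of the first variation of `maxwellResidual`. -/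
def maxwellR (qe _qm rp : ℝ) (P : Profile) (_r x : ℝ) : ℝ :=
  P.Ψ x - (rp ^ 2)⁻¹ * (1 - x ^ 2) * deriv P.Z₀ x + 2 * (rp ^ 2)⁻¹ * x * P.Z₀ x
  - (1 / 2) * (rp ^ 4)⁻¹ * (1 - x ^ 2)⁻¹ * P.γ₁₁ x * qe - (1 / 2) * (rp ^ 4)⁻¹ * (1
  - x ^ 2) * P.γ₀₀ x * qe

/-- The `x` component of the first variation of `maxwellResidual`. -/
def maxwellX (qe qm rp : ℝ) (P : Profile) (r x : ℝ) : ℝ :=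
  2 * (rp ^ 2)⁻¹ * r * P.Z₀ x + 2 * (rp ^ 2)⁻¹ * (1 - x ^ 2)⁻¹ * r * P.h₁ x * qm
  + 2 * (rp ^ 2)⁻¹ * r * P.h₀ x * qe + 2 * r * P.W₀ x

/-- The `φ` component of the first variation of `maxwellResidual`. -/
def maxwellPhi (qe qm rp : ℝ) (P : Profile) (r x : ℝ) : ℝ :=
  (rp ^ 2)⁻¹ * (1 - x ^ 2) * r * deriv P.B x + 2 * (rp ^ 2)⁻¹ * r * P.Z₁ x - 2 * (rp ^ 2)⁻¹ * (1
  - x ^ 2) * r * P.h₀ x * qm + 2 * (rp ^ 2)⁻¹ * r * P.h₁ x * qe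
  - (1 / 2) * (rp ^ 4)⁻¹ * r * deriv P.γ₁₁ x * qm - (rp ^ 4)⁻¹ * (1
  - x ^ 2)⁻¹ * r * x * P.γ₁₁ x * qm + (rp ^ 4)⁻¹ * (1 - x ^ 2) * r * x * P.γ₀₀ x * qm
  - (1 / 2) * (rp ^ 4)⁻¹ * (1 - x ^ 2) ^ 2 * r * deriv P.γ₀₀ x * qm + 2 * r * P.W₁ x

/-- The components of the first variation of `maxwellResidual`. -/
def maxwellVariation (qe qm rp : ℝ) (P : Profile) (r x : ℝ) : Fin 4 → ℝ :=
  ![maxwellV qe qm rp P r x, maxwellR qe qm rp P r x, maxwellX qe qm rp P r x, maxwellPhi qe qm rp P r x]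

variable {qe qm rp : ℝ} {p : Pt} {P : Profile}

set_option maxHeartbeats 2000000 in
-- The relation between the charges and the radius is not used here, so `qe²` and `qm²` remain
-- separate in the table. The `rr` entry is identically zero: the sphere part of the metric
-- perturbation is linear in `r`, and `Z` enters the `rr` source only quadratically.
lemma linEinstein_metric (hrp : 0 < rp) (hP : P.IsSmooth) (hp : p ∈ patch) (μ ν : Fin 4) :
    linEinstein (nhMetric rp) P.metric (nhMaxwell qe qm rp) P.maxwell μ ν p
      = einsteinVariation qe qm rp P (p 1) (p 2) μ ν := by
  have hx := (one_sub_sq_pos hp).ne'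
  simp only [linEinstein, linRicci, linMaxwellSq, maxwellSq, inv_nhMetric hrp hp,
    pd_linChristoffel_metric hrp hP hp, linChristoffel_metric hrp hp, linInverse_metric hrp hp,
    christoffel_nhMetric hrp hp, Fin.sum_univ_four]
  revert μ ν
  refine forall_fin_four ?_ ?_ ?_ ?_ <;> refine forall_fin_four ?_ ?_ ?_ ?_ <;>
    simp only [christoffelCoeff, christoffelCoeffDeriv, christoffelCoeffV, christoffelCoeffR,
      christoffelCoeffX, christoffelCoeffPhi, christoffelCoeffDerivV, christoffelCoeffDerivR,
      christoffelCoeffDerivX, christoffelCoeffDerivPhi, christoffelExponent, christoffelExponentV,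
      christoffelExponentR, christoffelExponentX, christoffelExponentPhi, nhInverse,
      inverseVariation, nhMetric, metric, nhMaxwell, maxwell, nhChristoffel, einsteinVariation,
      einsteinVV, einsteinVR, einsteinVX, einsteinVPhi, einsteinRX, einsteinRPhi, einsteinXX,
      einsteinXPhi, einsteinPhiPhi,
      Matrix.of_apply, Matrix.cons_val, Matrix.zero_apply, zero_mul, mul_zero, add_zero, zero_add,
      sub_zero, neg_zero, Nat.cast_zero, Nat.cast_one, Nat.cast_ofNat, pow_zero, pow_one, one_mul,
      Nat.add_one_sub_one, Nat.reduceSub, tsub_self, sub_self] <;>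
    first | done | ring1 | (field_simp; done) | (field_simp; ring1)

lemma linMaxwell_metric (hrp : 0 < rp) (hp : p ∈ patch) (μ : Fin 4) :
    linMaxwell (nhMetric rp) P.metric (nhMaxwell qe qm rp) P.maxwell μ p
      = maxwellVariation qe qm rp P (p 1) (p 2) μ := by
  have hx := (one_sub_sq_pos hp).ne'
  simp only [linMaxwell, inv_nhMetric hrp hp, pd_maxwell, pd_nhMaxwell,
    linChristoffel_metric hrp hp, linInverse_metric hrp hp,
    christoffel_nhMetric hrp hp, Fin.sum_univ_four]
  revert μ
  refine forall_fin_four ?_ ?_ ?_ ?_ <;>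
    simp only [christoffelCoeff, christoffelCoeffV, christoffelCoeffR,
      christoffelCoeffX, christoffelCoeffPhi, christoffelExponent, christoffelExponentV,
      christoffelExponentR, christoffelExponentX, christoffelExponentPhi, nhInverse,
      inverseVariation, nhMaxwell, maxwell, maxwellDeriv, nhChristoffel, maxwellVariation,
      maxwellV, maxwellR, maxwellX, maxwellPhi,
      Matrix.of_apply, Matrix.cons_val, Matrix.zero_apply, zero_mul, mul_zero, add_zero, zero_add,
      sub_zero, neg_zero, pow_zero, pow_one, one_mul, sub_self] <;>
    first | done | ring1 | (field_simp; done) | (field_simp; ring1)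

end Profile

/-! ### Locality of the field equations -/

section Locality

variable {U : Set Pt} {g g' F F' : TensorField} {p : Pt}

/-- First order data and their profile agree only on the open patch `-1 < x < 1`. Agreement of the
Christoffel symbols on an open set, rather than at a point, is required because the Ricci tensor
differentiates them. -/
lemma christoffel_eqOn (hU : IsOpen U) (h : Set.EqOn g g' U) (ρ μ ν : Fin 4) :
    Set.EqOn (christoffel g ρ μ ν) (christoffel g' ρ μ ν) U := by
  intro q hq
  have hpd : ∀ κ α β, pd κ (fun q => g q α β) q = pd κ (fun q => g' q α β) q := fun κ α β =>
    pd_congr_on hU (fun q hq => by simp only [h hq]) hq κ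
  simp only [christoffel, hpd, h hq]

lemma einsteinResidual_congr (hU : IsOpen U) (h : Set.EqOn g g' U) (hp : p ∈ U)
    (hF : F p = F' p) (μ ν : Fin 4) :
    einsteinResidual g F μ ν p = einsteinResidual g' F' μ ν p := by
  have hc : ∀ ρ μ ν, christoffel g ρ μ ν p = christoffel g' ρ μ ν p := fun ρ μ ν =>
    christoffel_eqOn hU h ρ μ ν hp
  have hd : ∀ κ ρ μ ν, pd κ (christoffel g ρ μ ν) p = pd κ (christoffel g' ρ μ ν) p :=
    fun κ ρ μ ν => pd_congr_on hU (christoffel_eqOn hU h ρ μ ν) hp κ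
  simp only [einsteinResidual, ricci, maxwellSq, hc, hd, h hp, hF]

lemma maxwellResidual_congr (hU : IsOpen U) (h : Set.EqOn g g' U) (hF : Set.EqOn F F' U)
    (hp : p ∈ U) (ρ : Fin 4) : maxwellResidual g F ρ p = maxwellResidual g' F' ρ p := by
  have hc : ∀ ρ μ ν, christoffel g ρ μ ν p = christoffel g' ρ μ ν p := fun ρ μ ν =>
    christoffel_eqOn hU h ρ μ ν hp
  have hpd : ∀ κ α β, pd κ (fun q => F q α β) p = pd κ (fun q => F' q α β) p := fun κ α β =>
    pd_congr_on hU (fun q hq => by simp only [hF hq]) hp κ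
  simp only [maxwellResidual, hc, hpd, h hp, hF hp]

lemma bianchiResidual_congr (hU : IsOpen U) (hF : Set.EqOn F F' U) (hp : p ∈ U) (μ ν ρ : Fin 4) :
    bianchiResidual F μ ν ρ p = bianchiResidual F' μ ν ρ p := by
  have hpd : ∀ κ α β, pd κ (fun q => F q α β) p = pd κ (fun q => F' q α β) p := fun κ α β =>
    pd_congr_on hU (fun q hq => by simp only [hF hq]) hp κ
  simp only [bianchiResidual, hpd]

end Locality

/-! ### Smooth tensor fields on the sphere in coordinates -/

lemma spherePoint_ne_zero {x : ℝ} (hx : x ∈ Set.Icc (-1 : ℝ) 1) (φ : ℝ) : spherePoint x φ ≠ 0 := by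
  intro h
  have h0 : √(1 - x ^ 2) * Real.cos φ = 0 := congrFun h 0
  have h1 : √(1 - x ^ 2) * Real.sin φ = 0 := congrFun h 1
  have h2 : x = 0 := congrFun h 2
  subst h2
  simp only [ne_eq, OfNat.ofNat_ne_zero, not_false_eq_true, zero_pow, sub_zero, Real.sqrt_one,
    one_mul] at h0 h1
  have := Real.sin_sq_add_cos_sq φ
  rw [h0, h1] at this
  norm_num at this

lemma contDiffOn_sqrt_one_sub_sq :
    ContDiffOn ℝ ∞ (fun x : ℝ => √(1 - x ^ 2)) (Set.Ioo (-1) 1) := by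
  refine ContDiffOn.sqrt (by fun_prop) fun x hx => (one_sub_sq_pos hx).ne'

lemma contDiffOn_spherePoint_comp {E : Type*} [NormedAddCommGroup E] [NormedSpace ℝ E]
    {A : (Fin 3 → ℝ) → E} (hA : ContDiffOn ℝ ∞ A {0}ᶜ) :
    ContDiffOn ℝ ∞ (fun z : ℝ × ℝ => A (spherePoint z.1 z.2)) (Set.Ioo (-1) 1 ×ˢ Set.univ) := by
  refine hA.comp (g := A) (f := fun z : ℝ × ℝ => spherePoint z.1 z.2) ?_ ?_
  · rw [contDiffOn_pi]
    have hs : ContDiffOn ℝ ∞ (fun z : ℝ × ℝ => √(1 - z.1 ^ 2)) (Set.Ioo (-1) 1 ×ˢ Set.univ) :=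
      contDiffOn_sqrt_one_sub_sq.comp contDiffOn_fst fun z hz => hz.1
    intro i
    fin_cases i
    · exact hs.mul (Real.contDiff_cos.comp_contDiffOn contDiffOn_snd)
    · exact hs.mul (Real.contDiff_sin.comp_contDiffOn contDiffOn_snd)
    · exact contDiffOn_fst
  · intro z hz
    exact spherePoint_ne_zero (Set.Ioo_subset_Icc_self hz.1) z.2

lemma contDiffOn_sphereFrame (a : Fin 2) (i : Fin 3) :
    ContDiffOn ℝ ∞ (fun x : ℝ => sphereFrame x 0 a i) (Set.Ioo (-1) 1) := by
  have hs := contDiffOn_sqrt_one_sub_sq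
  have hq : ContDiffOn ℝ ∞ (fun x : ℝ => -x / √(1 - x ^ 2)) (Set.Ioo (-1) 1) :=
    contDiffOn_id.neg.div hs fun x hx => (Real.sqrt_pos.2 (one_sub_sq_pos hx)).ne'
  fin_cases a <;> fin_cases i
  · exact hq.mul contDiffOn_const
  · exact hq.mul contDiffOn_const
  · exact contDiffOn_const
  · exact hs.neg.mul contDiffOn_const
  · exact hs.mul contDiffOn_const
  · exact contDiffOn_const

lemma contDiffOn_meridian {E : Type*} [NormedAddCommGroup E] [NormedSpace ℝ E]
    {A : (Fin 3 → ℝ) → E} (hA : ContDiffOn ℝ ∞ A {0}ᶜ) :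
    ContDiffOn ℝ ∞ (fun x : ℝ => A (spherePoint x 0)) (Set.Ioo (-1) 1) :=
  (contDiffOn_spherePoint_comp hA).comp (f := fun x : ℝ => (x, (0 : ℝ)))
    (contDiffOn_id.prodMk contDiffOn_const) fun _ hx => ⟨hx, Set.mem_univ _⟩

lemma SmoothScalar.contDiffOn {u : ℝ → ℝ → ℝ} (hu : SmoothScalar u) :
    ContDiffOn ℝ ∞ (fun x => u x 0) (Set.Ioo (-1) 1) := by
  obtain ⟨A, hA, h⟩ := hu
  exact (contDiffOn_meridian hA).congr fun x hx => h x hx 0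

lemma SmoothCovector.contDiffOn {w : ℝ → ℝ → Fin 2 → ℝ} (hw : SmoothCovector w) (a : Fin 2) :
    ContDiffOn ℝ ∞ (fun x => w x 0 a) (Set.Ioo (-1) 1) := by
  obtain ⟨A, hA, h⟩ := hw
  refine ContDiffOn.congr (f := fun x => ∑ i, A (spherePoint x 0) i * sphereFrame x 0 a i) ?_
    fun x hx => h x hx 0 a
  refine ContDiffOn.sum fun i _ => ContDiffOn.mul ?_ (contDiffOn_sphereFrame a i)
  exact contDiffOn_pi.1 (contDiffOn_meridian hA) i

lemma SmoothTensor.contDiffOn {t : ℝ → ℝ → Matrix (Fin 2) (Fin 2) ℝ} (ht : SmoothTensor t)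
    (a b : Fin 2) : ContDiffOn ℝ ∞ (fun x => t x 0 a b) (Set.Ioo (-1) 1) := by
  obtain ⟨A, hA, h⟩ := ht
  refine ContDiffOn.congr (f := fun x => ∑ i, ∑ j,
    A (spherePoint x 0) i j * sphereFrame x 0 a i * sphereFrame x 0 b j) ?_
    fun x hx => h x hx 0 a b
  refine ContDiffOn.sum fun i _ => ContDiffOn.sum fun j _ => ContDiffOn.mul (ContDiffOn.mul ?_
    (contDiffOn_sphereFrame a i)) (contDiffOn_sphereFrame b j)
  exact contDiffOn_pi.1 (contDiffOn_pi.1 (contDiffOn_meridian hA) i) j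

/-! ### The profile of axisymmetric first order data -/

/-- The profile of first order data along the meridian `φ = 0`. -/
def FirstOrderData.profile (D : FirstOrderData) : Profile where
  F x := D.F x 0
  h₀ x := D.h x 0 0
  h₁ x := D.h x 0 1
  γ₀₀ x := D.γ x 0 0 0
  γ₀₁ x := D.γ x 0 0 1
  γ₁₁ x := D.γ x 0 1 1
  Ψ x := D.Ψ x 0
  W₀ x := D.W x 0 0
  W₁ x := D.W x 0 1
  Z₀ x := D.Z x 0 0
  Z₁ x := D.Z x 0 1
  B x := D.B x 0 0 1

namespace FirstOrderData

variable {D : FirstOrderData}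

lemma IsSmooth.profile (hD : D.IsSmooth) : D.profile.IsSmooth := by
  obtain ⟨hF, hh, hγ, hΨ, hW, hZ, hB, -⟩ := hD
  simp only [Profile.IsSmooth, List.forall_mem_cons, FirstOrderData.profile]
  exact ⟨hF.contDiffOn, hh.contDiffOn 0, hh.contDiffOn 1, hγ.contDiffOn 0 0, hγ.contDiffOn 0 1,
    hγ.contDiffOn 1 1, hΨ.contDiffOn, hW.contDiffOn 0, hW.contDiffOn 1, hZ.contDiffOn 0,
    hZ.contDiffOn 1, hB.contDiffOn 0 1, by simp⟩

lemma metric_eqOn_profile (hD : D.IsSmooth) (ha : D.IsAxisymmetric) :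
    Set.EqOn D.metric D.profile.metric patch := by
  intro p hp
  obtain ⟨hF, hh, hγ, -⟩ := ha (p 2) hp (p 3) 0
  have hs := (hD.2.2.2.2.2.2.2 (p 2) hp 0 1 0).1
  simp only [FirstOrderData.metric, Profile.metric, hF, hh, hγ, hs, FirstOrderData.profile]

lemma maxwell_eqOn_profile (hD : D.IsSmooth) (ha : D.IsAxisymmetric) :
    Set.EqOn D.maxwell D.profile.maxwell patch := by
  intro p hp
  obtain ⟨-, -, -, hΨ, hW, hZ, hB⟩ := ha (p 2) hp (p 3) 0
  have hs := fun a b => (hD.2.2.2.2.2.2.2 (p 2) hp 0 a b).2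
  have h0 : D.B (p 2) 0 0 0 = 0 := by linarith [hs 0 0]
  have h1 : D.B (p 2) 0 1 1 = 0 := by linarith [hs 1 1]
  have h2 := hs 1 0
  simp only [FirstOrderData.maxwell, Profile.maxwell, hΨ, hW, hZ, hB, h0, h1, h2, mul_zero, mul_neg,
    FirstOrderData.profile]

end FirstOrderData

/-! ### Reduction of the linearised equations to ordinary differential equations. -/

lemma smoothTensorOn_nhMetric (rp : ℝ) : SmoothTensorOn patch (nhMetric rp) := by
  have h1 : ContDiffOn ℝ ∞ (fun q : Pt => q 1) patch := contDiffOn_pi.1 contDiffOn_id 1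
  have h2 : ContDiffOn ℝ ∞ (fun q : Pt => q 2) patch := contDiffOn_pi.1 contDiffOn_id 2
  have hc : ContDiffOn ℝ ∞ (fun q : Pt => 1 - q 2 ^ 2) patch := contDiffOn_const.sub (h2.pow 2)
  have hi : ContDiffOn ℝ ∞ (fun q : Pt => rp ^ 2 / (1 - q 2 ^ 2)) patch :=
    contDiffOn_const.div hc fun q hq => (one_sub_sq_pos hq).ne'
  refine forall_fin_four ?_ ?_ ?_ ?_ <;> refine forall_fin_four ?_ ?_ ?_ ?_ <;>
    simp only [nhMetric, Matrix.of_apply, Matrix.cons_val] <;>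
    first
      | exact contDiffOn_const
      | exact hi
      | exact contDiffOn_const.mul hc
      | exact (h1.pow 2).neg.div_const _

lemma smoothTensorOn_nhMaxwell (qe qm rp : ℝ) : SmoothTensorOn patch (nhMaxwell qe qm rp) :=
  fun _ _ => contDiffOn_const

lemma Profile.IsSmooth.smoothTensorOn {P : Profile} (hP : P.IsSmooth) :
    SmoothTensorOn patch P.metric ∧ SmoothTensorOn patch P.maxwell := by
  have h1 : ContDiffOn ℝ ∞ (fun q : Pt => q 1) patch := contDiffOn_pi.1 contDiffOn_id 1
  have h2 : ContDiffOn ℝ ∞ (fun q : Pt => q 2) patch := contDiffOn_pi.1 contDiffOn_id 2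
  have hc : ∀ u : ℝ → ℝ, ContDiffOn ℝ ∞ u (Set.Ioo (-1) 1) →
      ContDiffOn ℝ ∞ (fun q : Pt => u (q 2)) patch := fun u hu =>
    hu.comp (g := u) (f := fun q : Pt => q 2) h2 fun q hq => hq
  simp only [Profile.IsSmooth, List.forall_mem_cons] at hP
  obtain ⟨hF, h0, h1', g00, g01, g11, hΨ, hW0, hW1, hZ0, hZ1, hB, -⟩ := hP
  constructor
  · refine forall_fin_four ?_ ?_ ?_ ?_ <;> refine forall_fin_four ?_ ?_ ?_ ?_ <;>
      simp only [Profile.metric, Matrix.of_apply, Matrix.cons_val] <;>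
      first
        | exact contDiffOn_const
        | exact (h1.pow _).mul (hc _ (by assumption))
        | exact h1.mul (hc _ (by assumption))
  · refine forall_fin_four ?_ ?_ ?_ ?_ <;> refine forall_fin_four ?_ ?_ ?_ ?_ <;>
      simp only [Profile.maxwell, Matrix.of_apply, Matrix.cons_val] <;>
      first
        | exact contDiffOn_const
        | exact hc _ (by assumption)
        | exact (hc _ (by assumption)).neg
        | exact (h1.pow _).mul (hc _ (by assumption))
        | exact ((h1.pow _).mul (hc _ (by assumption))).neg
        | exact h1.mul (hc _ (by assumption))
        | exact (h1.mul (hc _ (by assumption))).neg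

/-- The linearised Einstein–Maxwell equations for an axisymmetric perturbation. -/
def Profile.IsSolution (qe qm rp : ℝ) (P : Profile) : Prop :=
  ∀ x ∈ Set.Ioo (-1 : ℝ) 1,
    (∀ r μ ν, P.einsteinVariation qe qm rp r x μ ν = 0) ∧
    (∀ r μ, P.maxwellVariation qe qm rp r x μ = 0) ∧
    deriv P.Ψ x = 2 * P.W₀ x ∧ P.W₁ x = 0 ∧ P.B x = deriv P.Z₁ x

lemma Profile.bianchiResidual_maxwell_eq_zero_iff {P : Profile} :
    (∀ p ∈ patch, ∀ μ ν ρ, bianchiResidual P.maxwell μ ν ρ p = 0) ↔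
      ∀ x ∈ Set.Ioo (-1 : ℝ) 1, deriv P.Ψ x = 2 * P.W₀ x ∧ P.W₁ x = 0 ∧ P.B x = deriv P.Z₁ x := by
  simp only [bianchiResidual, Profile.pd_maxwell]
  constructor
  · intro h x hx
    -- At `r = 1` the powers of `r` disappear; the components `vrx`, `vrφ` and `rxφ` carry the three
    -- conditions.
    have hp : (![0, 1, x, 0] : Pt) ∈ patch := hx
    have h₁ := h _ hp 0 1 2
    have h₂ := h _ hp 0 1 3
    have h₃ := h _ hp 1 2 3
    simp only [Profile.maxwellDeriv, Matrix.of_apply, Matrix.cons_val, Matrix.zero_apply] at h₁ h₂ h₃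
    exact ⟨by linarith, by linarith, by linarith⟩
  · intro h p hp
    -- The remaining component `vxφ` asks for `W₁' = 0`, which follows since `W₁` vanishes on an
    -- open interval.
    have hW : deriv P.W₁ (p 2) = 0 := by
      have : P.W₁ =ᶠ[𝓝 (p 2)] fun _ => 0 := by
        filter_upwards [isOpen_Ioo.mem_nhds hp] with x hx using (h x hx).2.1
      rw [this.deriv_eq, deriv_const]
    obtain ⟨h₁, h₂, h₃⟩ := h _ hp
    refine forall_fin_four ?_ ?_ ?_ ?_ <;> refine forall_fin_four ?_ ?_ ?_ ?_ <;>
      refine forall_fin_four ?_ ?_ ?_ ?_ <;>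
      simp only [Profile.maxwellDeriv, Matrix.of_apply, Matrix.cons_val, Matrix.zero_apply, hW, h₁,
        h₂, h₃] <;> ring1

/-- The residuals have the tabulated expressions as derivatives at `ε = 0`. By uniqueness of
derivatives the linearised equations hold exactly when those expressions vanish, and axisymmetry
makes the meridian `φ = 0` sufficient. -/
theorem isTransverseDeformation_iff {qe qm rp : ℝ} (hrp : 0 < rp) {D : FirstOrderData}
    (hD : D.IsSmooth) (ha : D.IsAxisymmetric) :
    IsTransverseDeformation qe qm rp D ↔ D.profile.IsSolution qe qm rp := by
  have hP := hD.profile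
  have hg : ∀ ε : ℝ, Set.EqOn (nhMetric rp + ε • D.metric) (nhMetric rp + ε • D.profile.metric)
      patch := fun ε p hp => by
    simp only [Pi.add_apply, Pi.smul_apply, D.metric_eqOn_profile hD ha hp]
  have hF : ∀ ε : ℝ, Set.EqOn (nhMaxwell qe qm rp + ε • D.maxwell)
      (nhMaxwell qe qm rp + ε • D.profile.maxwell) patch := fun ε p hp => by
    simp only [Pi.add_apply, Pi.smul_apply, D.maxwell_eqOn_profile hD ha hp]
  have hdet : ∀ q ∈ patch, (nhMetric rp q).det ≠ 0 := fun q hq => det_nhMetric_ne_zero hrp hq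
  have hE : ∀ p ∈ patch, ∀ μ ν, HasDerivAt (fun ε : ℝ => einsteinResidual
      (nhMetric rp + ε • D.metric) (nhMaxwell qe qm rp + ε • D.maxwell) μ ν p)
      (D.profile.einsteinVariation qe qm rp (p 1) (p 2) μ ν) 0 := by
    intro p hp μ ν
    rw [← Profile.linEinstein_metric hrp hP hp]
    refine (hasDerivAt_einsteinResidual isOpen_patch (smoothTensorOn_nhMetric rp)
      hP.smoothTensorOn.1 hdet hp μ ν).congr_of_eventuallyEq (Filter.Eventually.of_forall fun ε => ?_)
    exact einsteinResidual_congr isOpen_patch (hg ε) hp (hF ε hp) μ ν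
  have hM : ∀ p ∈ patch, ∀ ρ, HasDerivAt (fun ε : ℝ => maxwellResidual
      (nhMetric rp + ε • D.metric) (nhMaxwell qe qm rp + ε • D.maxwell) ρ p)
      (D.profile.maxwellVariation qe qm rp (p 1) (p 2) ρ) 0 := by
    intro p hp ρ
    rw [← Profile.linMaxwell_metric hrp hp]
    refine (hasDerivAt_maxwellResidual isOpen_patch (smoothTensorOn_nhMetric rp)
      hP.smoothTensorOn.1 (smoothTensorOn_nhMaxwell qe qm rp) hP.smoothTensorOn.2 hdet hp
      ρ).congr_of_eventuallyEq (Filter.Eventually.of_forall fun ε => ?_)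
    exact maxwellResidual_congr isOpen_patch (hg ε) (hF ε) hp ρ
  have hB : (∀ p ∈ patch, ∀ μ ν ρ, bianchiResidual D.maxwell μ ν ρ p = 0) ↔
      ∀ p ∈ patch, ∀ μ ν ρ, bianchiResidual D.profile.maxwell μ ν ρ p = 0 :=
    forall₂_congr fun p hp => forall₃_congr fun μ ν ρ => by
      rw [bianchiResidual_congr isOpen_patch (D.maxwell_eqOn_profile hD ha) hp]
  rw [Profile.bianchiResidual_maxwell_eq_zero_iff] at hB
  constructor
  · intro h x hx
    refine ⟨fun r μ ν => ?_, fun r μ => ?_, hB.1 (fun p hp => (h.2 p hp).2.2) x hx⟩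
    · exact (hE ![0, r, x, 0] hx μ ν).unique ((h.2 _ hx).1 μ ν)
    · exact (hM ![0, r, x, 0] hx μ).unique ((h.2 _ hx).2.1 μ)
  · intro h
    refine ⟨hD, fun p hp => ⟨fun μ ν => ?_, fun ρ => ?_, hB.2 (fun x hx => (h x hx).2.2) p hp⟩⟩
    · exact (hE p hp μ ν).congr_deriv ((h _ hp).1 _ μ ν)
    · exact (hM p hp ρ).congr_deriv ((h _ hp).2.1 _ ρ)

/-! ### Ordinary differential equations on `-1 < x < 1` -/

lemma eq_of_hasDerivAt_zero {u : ℝ → ℝ} (h : ∀ x ∈ Set.Ioo (-1 : ℝ) 1, HasDerivAt u 0 x) :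
    ∃ c, ∀ x ∈ Set.Ioo (-1 : ℝ) 1, u x = c :=
  isOpen_Ioo.exists_is_const_of_deriv_eq_zero isPreconnected_Ioo
    (fun x hx => (h x hx).differentiableAt.differentiableWithinAt) fun x hx => (h x hx).deriv

lemma deriv_eq_of_eqOn {u w : ℝ → ℝ} {w' x : ℝ} (hx : x ∈ Set.Ioo (-1 : ℝ) 1)
    (h : ∀ s ∈ Set.Ioo (-1 : ℝ) 1, u s = w s) (hw : HasDerivAt w w' x) : deriv u x = w' := by
  have : u =ᶠ[𝓝 x] w := by
    filter_upwards [isOpen_Ioo.mem_nhds hx] with s hs using h s hs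
  rw [this.deriv_eq, hw.deriv]

lemma hasDerivAt_eq_zero_of_eqOn {u : ℝ → ℝ} {u' x : ℝ} (hx : x ∈ Set.Ioo (-1 : ℝ) 1)
    (h : ∀ s ∈ Set.Ioo (-1 : ℝ) 1, u s = 0) (hu : HasDerivAt u u' x) : u' = 0 := by
  rw [← hu.deriv]
  exact deriv_eq_of_eqOn hx h (hasDerivAt_const _ _)

lemma hasDerivAt_one_sub_sq (x : ℝ) : HasDerivAt (fun x : ℝ => 1 - x ^ 2) (-(2 * x)) x := by
  simpa using (hasDerivAt_pow 2 x).const_sub 1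

lemma hasDerivAt_sq (x : ℝ) : HasDerivAt (fun x : ℝ => x ^ 2) (2 * x) x := by
  simpa using hasDerivAt_pow 2 x

/-- The filter of approach to a pole is non-trivial. -/
lemma neBot_nhdsWithin_pole {s : ℝ} (hs : s ^ 2 = 1) : (𝓝[Set.Ioo (-1 : ℝ) 1] s).NeBot := by
  rw [← mem_closure_iff_nhdsWithin_neBot, closure_Ioo (by norm_num)]
  constructor <;> nlinarith

lemma tendsto_pole (s : ℝ) : Filter.Tendsto (fun x : ℝ => x) (𝓝[Set.Ioo (-1 : ℝ) 1] s) (𝓝 s) :=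
  Filter.tendsto_id.mono_left nhdsWithin_le_nhds

lemma tendsto_one_sub_sq_pole {s : ℝ} (hs : s ^ 2 = 1) :
    Filter.Tendsto (fun x : ℝ => 1 - x ^ 2) (𝓝[Set.Ioo (-1 : ℝ) 1] s) (𝓝 0) := by
  have := ((tendsto_pole s).pow 2).const_sub 1
  rwa [hs, sub_self] at this

lemma eq_zero_of_tendsto_pole {u : ℝ → ℝ} {c s : ℝ} (hs : s ^ 2 = 1)
    (h : ∀ x ∈ Set.Ioo (-1 : ℝ) 1, u x = c)
    (hu : Filter.Tendsto u (𝓝[Set.Ioo (-1 : ℝ) 1] s) (𝓝 0)) : c = 0 := by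
  have := neBot_nhdsWithin_pole hs
  refine tendsto_nhds_unique (tendsto_const_nhds (x := c)) (hu.congr' ?_)
  filter_upwards [self_mem_nhdsWithin] with x hx using h x hx

/-- The solutions of `(1 - x²) y'' + 6 y = 0` that are regular at the pole. -/
lemma eq_mul_of_legendre {y y₁ : ℝ → ℝ}
    (hy : ∀ x ∈ Set.Ioo (-1 : ℝ) 1, HasDerivAt y (y₁ x) x)
    (hy₁ : ∀ x ∈ Set.Ioo (-1 : ℝ) 1, HasDerivAt y₁ (-(6 * y x * (1 - x ^ 2)⁻¹)) x)
    (l : Filter.Tendsto y (𝓝[Set.Ioo (-1 : ℝ) 1] 1) (𝓝 0))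
    (l₁ : Filter.Tendsto (fun x => (1 - x ^ 2) * y₁ x) (𝓝[Set.Ioo (-1 : ℝ) 1] 1) (𝓝 0)) :
    ∃ K, ∀ x ∈ Set.Ioo (-1 : ℝ) 1, y x = K * x * (1 - x ^ 2) := by
  -- This is the Wronskian of `y` with the polynomial solution `x (1 - x²)`. It is constant, and
  -- regularity at the pole makes the constant zero.
  have hw : ∀ x ∈ Set.Ioo (-1 : ℝ) 1,
      HasDerivAt (fun x => x * ((1 - x ^ 2) * y₁ x) - (1 - 3 * x ^ 2) * y x) 0 x := by
    intro x hx
    have hc := (one_sub_sq_pos hx).ne'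
    have h := (((hasDerivAt_id' x).fun_mul ((hasDerivAt_one_sub_sq x).fun_mul (hy₁ x hx))).fun_sub
      ((((hasDerivAt_sq x).const_mul 3).const_sub 1).fun_mul (hy x hx)))
    refine h.congr_deriv ?_
    field_simp
    ring
  obtain ⟨w, hw⟩ := eq_of_hasDerivAt_zero hw
  have hw0 : w = 0 := by
    refine eq_zero_of_tendsto_pole (one_pow 2) hw ?_
    have := ((tendsto_pole 1).mul l₁).sub (((((tendsto_pole 1).pow 2).const_mul 3).const_sub 1).mul l)
    simpa using this
  subst hw0
  -- For `y = K x (1 - x²)` this expression equals `K`. It replaces the quotient `y / (x (1 - x²))`,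
  -- which is undefined at the interior zero `x = 0`.
  have hm : ∀ x ∈ Set.Ioo (-1 : ℝ) 1, HasDerivAt (fun x => y₁ x * (1 - x ^ 2)⁻¹
      + 2 * x * (y x * ((1 - x ^ 2)⁻¹ * (1 - x ^ 2)⁻¹))) 0 x := by
    intro x hx
    have hc := (one_sub_sq_pos hx).ne'
    have hi := hasDerivAt_inv_one_sub_sq hc
    have h := ((hy₁ x hx).fun_mul hi).fun_add (((hasDerivAt_id' x).const_mul 2).fun_mul
      ((hy x hx).fun_mul (hi.fun_mul hi)))
    refine h.congr_deriv ?_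
    have := hw x hx
    field_simp
    linear_combination 4 * this
  obtain ⟨K, hK⟩ := eq_of_hasDerivAt_zero hm
  refine ⟨K, fun x hx => ?_⟩
  have hc := (one_sub_sq_pos hx).ne'
  have h₁ := hw x hx
  rw [← hK x hx]
  field_simp
  linear_combination -h₁

/-! ### Behaviour of smooth tensor fields at the poles -/

section Poles

variable {s : ℝ}

lemma tendsto_sqrt_pole (hs : s ^ 2 = 1) :
    Filter.Tendsto (fun x : ℝ => √(1 - x ^ 2)) (𝓝[Set.Ioo (-1 : ℝ) 1] s) (𝓝 0) := by
  have := (tendsto_one_sub_sq_pole hs).sqrt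
  rwa [Real.sqrt_zero] at this

lemma tendsto_comp_spherePoint {E : Type*} [NormedAddCommGroup E] [NormedSpace ℝ E]
    {A : (Fin 3 → ℝ) → E} (hA : ContDiffOn ℝ ∞ A {0}ᶜ) (hs : s ^ 2 = 1) :
    Filter.Tendsto (fun x : ℝ => A (spherePoint x 0)) (𝓝[Set.Ioo (-1 : ℝ) 1] s)
      (𝓝 (A (spherePoint s 0))) := by
  have hmem : s ∈ Set.Icc (-1 : ℝ) 1 := by constructor <;> nlinarith
  have hA' : ContinuousAt A (spherePoint s 0) :=
    (hA.contDiffAt (isOpen_compl_singleton.mem_nhds (spherePoint_ne_zero hmem 0))).continuousAt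
  have hc : Continuous fun x : ℝ => spherePoint x 0 := by
    refine continuous_pi fun i => ?_
    fin_cases i <;> simp [spherePoint] <;> fun_prop
  exact (hA'.tendsto.comp hc.continuousAt.tendsto).mono_left nhdsWithin_le_nhds

/-- On the meridian `∂_x` grows like `1/√(1 - x²)` at a pole while `∂_φ` shrinks like `√(1 - x²)`. A
factor `1 - x²` therefore suffices to tame an `x` index, and a `φ` index vanishes by itself; the
next three limits follow the same count. -/
lemma SmoothCovector.tendsto_zero {w : ℝ → ℝ → Fin 2 → ℝ} (hw : SmoothCovector w)
    (hs : s ^ 2 = 1) :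
    Filter.Tendsto (fun x => (1 - x ^ 2) * w x 0 0) (𝓝[Set.Ioo (-1 : ℝ) 1] s) (𝓝 0) := by
  obtain ⟨A, hA, h⟩ := hw
  have hl := tendsto_pi_nhds.1 (tendsto_comp_spherePoint hA hs)
  have := (((tendsto_pole s).neg.mul (tendsto_sqrt_pole hs)).mul (hl 0)).add
    ((tendsto_one_sub_sq_pole hs).mul (hl 2))
  simp only [mul_zero, zero_mul, add_zero] at this
  refine this.congr' ?_
  filter_upwards [self_mem_nhdsWithin] with x hx
  have hp := one_sub_sq_pos hx
  have hq := Real.mul_self_sqrt hp.le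
  have hq' := (Real.sqrt_pos.2 hp).ne'
  rw [h x hx, Fin.sum_univ_three]
  simp only [sphereFrame, Matrix.cons_val, Real.cos_zero, Real.sin_zero]
  field_simp
  linear_combination (-A (spherePoint x 0) 0 * x) * hq

lemma SmoothCovector.tendsto_one {w : ℝ → ℝ → Fin 2 → ℝ} (hw : SmoothCovector w)
    (hs : s ^ 2 = 1) :
    Filter.Tendsto (fun x => w x 0 1) (𝓝[Set.Ioo (-1 : ℝ) 1] s) (𝓝 0) := by
  obtain ⟨A, hA, h⟩ := hw
  have hl := tendsto_pi_nhds.1 (tendsto_comp_spherePoint hA hs)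
  have := (hl 1).mul (tendsto_sqrt_pole hs)
  simp only [mul_zero] at this
  refine this.congr' ?_
  filter_upwards [self_mem_nhdsWithin] with x hx
  rw [h x hx, Fin.sum_univ_three]
  simp only [sphereFrame, Matrix.cons_val, Real.cos_zero, Real.sin_zero]
  ring

lemma SmoothTensor.tendsto_zero_one {t : ℝ → ℝ → Matrix (Fin 2) (Fin 2) ℝ} (ht : SmoothTensor t)
    (hs : s ^ 2 = 1) :
    Filter.Tendsto (fun x => (1 - x ^ 2) * t x 0 0 1) (𝓝[Set.Ioo (-1 : ℝ) 1] s) (𝓝 0) := by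
  obtain ⟨A, hA, h⟩ := ht
  have hl := fun i j => tendsto_pi_nhds.1 (tendsto_pi_nhds.1 (tendsto_comp_spherePoint hA hs) i) j
  have := (tendsto_one_sub_sq_pole hs).mul (((tendsto_pole s).neg.mul (hl 0 1)).add
    ((hl 2 1).mul (tendsto_sqrt_pole hs)))
  simp only [zero_mul] at this
  refine this.congr' ?_
  filter_upwards [self_mem_nhdsWithin] with x hx
  have hq' := (Real.sqrt_pos.2 (one_sub_sq_pos hx)).ne'
  rw [h x hx]
  simp only [sphereFrame, Matrix.cons_val, Real.cos_zero, Real.sin_zero, Fin.sum_univ_three]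
  field_simp
  ring

lemma SmoothTensor.tendsto_one_one {t : ℝ → ℝ → Matrix (Fin 2) (Fin 2) ℝ} (ht : SmoothTensor t)
    (hs : s ^ 2 = 1) :
    Filter.Tendsto (fun x => t x 0 1 1) (𝓝[Set.Ioo (-1 : ℝ) 1] s) (𝓝 0) := by
  obtain ⟨A, hA, h⟩ := ht
  have hl := fun i j => tendsto_pi_nhds.1 (tendsto_pi_nhds.1 (tendsto_comp_spherePoint hA hs) i) j
  have := ((hl 1 1).mul (tendsto_sqrt_pole hs)).mul (tendsto_sqrt_pole hs)
  simp only [mul_zero] at this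
  refine this.congr' ?_
  filter_upwards [self_mem_nhdsWithin] with x hx
  rw [h x hx]
  simp only [sphereFrame, Matrix.cons_val, Real.cos_zero, Real.sin_zero, Fin.sum_univ_three]
  ring

end Poles

/-! ### Classification of the axisymmetric deformations -/

namespace Profile

/-- The general solution of the linearised equations that is regular at the poles, in terms of the
three moduli and of the arbitrary function `P.h₀`. -/
structure IsStandard (qe qm rp : ℝ) (K : ℝ × ℝ × ℝ) (P : Profile) : Prop where
  F : ∀ x ∈ Set.Ioo (-1 : ℝ) 1, P.F x = (3 * K.2.1 + K.2.2) / (3 * rp ^ 4)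
  h₁ : ∀ x ∈ Set.Ioo (-1 : ℝ) 1, P.h₁ x = 2 * K.1 / rp ^ 2 * (x * (1 - x ^ 2))
  γ₀₀ : ∀ x ∈ Set.Ioo (-1 : ℝ) 1, P.γ₀₀ x = 2 * rp ^ 2 * deriv P.h₀ x
    + (K.2.1 + x * (K.2.2 * x - 2 * rp ^ 2 * P.h₀ x)) * (1 - x ^ 2)⁻¹
  γ₀₁ : ∀ x ∈ Set.Ioo (-1 : ℝ) 1, P.γ₀₁ x = 2 * K.1 * (1 - x ^ 2)
  γ₁₁ : ∀ x ∈ Set.Ioo (-1 : ℝ) 1,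
    P.γ₁₁ x = (K.2.1 + x * (K.2.2 * x - 2 * rp ^ 2 * P.h₀ x)) * (1 - x ^ 2)
  Ψ : ∀ x ∈ Set.Ioo (-1 : ℝ) 1, P.Ψ x = K.1 * qm / rp ^ 4 * (1 - 3 * x ^ 2)
    + qe / (2 * rp ^ 4) * (2 * K.2.1 + K.2.2 * (1 - x ^ 2))
  W₀ : ∀ x ∈ Set.Ioo (-1 : ℝ) 1,
    P.W₀ x = (-3 * K.1 * qm / rp ^ 4 - qe * K.2.2 / (2 * rp ^ 4)) * x
  W₁ : ∀ x ∈ Set.Ioo (-1 : ℝ) 1, P.W₁ x = 0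
  Z₀ : ∀ x ∈ Set.Ioo (-1 : ℝ) 1, P.Z₀ x = K.1 * qm / rp ^ 2 * x
    + qe / (2 * rp ^ 2) * (K.2.2 * x - 2 * rp ^ 2 * P.h₀ x)
  Z₁ : ∀ x ∈ Set.Ioo (-1 : ℝ) 1, P.Z₁ x = K.1 * qe / rp ^ 2 * (x * (1 - x ^ 2))
    - qm / (2 * rp ^ 2) * ((1 - x ^ 2) * (K.2.2 * x - 2 * rp ^ 2 * P.h₀ x))
  B : ∀ x ∈ Set.Ioo (-1 : ℝ) 1, P.B x = K.1 * qe / rp ^ 2 * (1 - 3 * x ^ 2)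
    - qm / (2 * rp ^ 2) * ((1 - x ^ 2) * (K.2.2 - 2 * rp ^ 2 * deriv P.h₀ x)
      - 2 * x * (K.2.2 * x - 2 * rp ^ 2 * P.h₀ x))

/-- The regularity at the poles shared by the profiles of smooth data. -/
structure IsRegular (P : Profile) : Prop where
  h₀ : ∀ s : ℝ, s ^ 2 = 1 →
    Filter.Tendsto (fun x => (1 - x ^ 2) * P.h₀ x) (𝓝[Set.Ioo (-1 : ℝ) 1] s) (𝓝 0)
  h₁ : ∀ s : ℝ, s ^ 2 = 1 → Filter.Tendsto P.h₁ (𝓝[Set.Ioo (-1 : ℝ) 1] s) (𝓝 0)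
  γ₀₁ : ∀ s : ℝ, s ^ 2 = 1 →
    Filter.Tendsto (fun x => (1 - x ^ 2) * P.γ₀₁ x) (𝓝[Set.Ioo (-1 : ℝ) 1] s) (𝓝 0)
  γ₁₁ : ∀ s : ℝ, s ^ 2 = 1 → Filter.Tendsto P.γ₁₁ (𝓝[Set.Ioo (-1 : ℝ) 1] s) (𝓝 0)
  Z₀ : ∀ s : ℝ, s ^ 2 = 1 →
    Filter.Tendsto (fun x => (1 - x ^ 2) * P.Z₀ x) (𝓝[Set.Ioo (-1 : ℝ) 1] s) (𝓝 0)
  Z₁ : ∀ s : ℝ, s ^ 2 = 1 → Filter.Tendsto P.Z₁ (𝓝[Set.Ioo (-1 : ℝ) 1] s) (𝓝 0)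

variable {qe qm rp : ℝ} {P : Profile}

namespace IsSolution

/-- The `x` and `r` Maxwell equations and the `xφ` Einstein equation are solved for `W₀`, `Ψ` and
`γ₀₁`, so that these components can be eliminated from all the others. -/
lemma maxwellX_eq (hrp : 0 < rp) (h : P.IsSolution qe qm rp) {x : ℝ}
    (hx : x ∈ Set.Ioo (-1 : ℝ) 1) :
    rp ^ 2 * P.W₀ x = -(P.Z₀ x + qm * P.h₁ x * (1 - x ^ 2)⁻¹ + qe * P.h₀ x) := by
  have h1 : P.maxwellX qe qm rp 1 x = 0 := (h x hx).2.1 1 2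
  have hc := (one_sub_sq_pos hx).ne'
  simp only [maxwellX] at h1
  field_simp at h1 ⊢
  linear_combination h1 / 2

lemma maxwellR_eq (hrp : 0 < rp) (h : P.IsSolution qe qm rp) {x : ℝ}
    (hx : x ∈ Set.Ioo (-1 : ℝ) 1) :
    P.Ψ x = (1 - x ^ 2) * (rp ^ 2)⁻¹ * deriv P.Z₀ x - 2 * (rp ^ 2)⁻¹ * (x * P.Z₀ x)
      + qe / (2 * rp ^ 4) * (P.γ₁₁ x * (1 - x ^ 2)⁻¹ + (1 - x ^ 2) * P.γ₀₀ x) := by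
  have h1 : P.maxwellR qe qm rp 1 x = 0 := (h x hx).2.1 1 1
  have hc := (one_sub_sq_pos hx).ne'
  simp only [maxwellR] at h1
  field_simp at h1 ⊢
  linear_combination h1

lemma γ₀₁_eq (hrp : 0 < rp) (hq : qe ^ 2 + qm ^ 2 = rp ^ 2) (h : P.IsSolution qe qm rp) {x : ℝ}
    (hx : x ∈ Set.Ioo (-1 : ℝ) 1) :
    P.γ₀₁ x = rp ^ 2 * (deriv P.h₁ x + 2 * x * (P.h₁ x * (1 - x ^ 2)⁻¹)) := by
  have h1 : P.einsteinXPhi qe qm rp 1 x = 0 := (h x hx).1 1 2 3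
  have hc := (one_sub_sq_pos hx).ne'
  simp only [einsteinXPhi] at h1
  field_simp at h1 ⊢
  have h2 : rp ^ 2 * ((1 - x ^ 2) * P.γ₀₁ x
      - rp ^ 2 * ((1 - x ^ 2) * deriv P.h₁ x + 2 * (P.h₁ x * x))) = 0 := by
    linear_combination -h1 - (1 - x ^ 2) * P.γ₀₁ x * hq
  have h3 := (mul_eq_zero.1 h2).resolve_left (by positivity)
  linear_combination h3

/-- The `rφ` Einstein equation after elimination of `γ₀₁`. The bracket on the left is the
combination `ζ`, in which the charges appear only as a rotation of `((1 - x²) Z₀, Z₁)`. -/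
lemma zeta_eq (hrp : 0 < rp) (hq : qe ^ 2 + qm ^ 2 = rp ^ 2) (hs : P.IsSmooth)
    (h : P.IsSolution qe qm rp) {x : ℝ} (hx : x ∈ Set.Ioo (-1 : ℝ) 1) :
    4 * (qm * ((1 - x ^ 2) * P.Z₀ x) + qe * P.Z₁ x)
      = -(rp ^ 2 * ((1 - x ^ 2) * deriv (deriv P.h₁) x + 4 * P.h₁ x)) := by
  simp only [Profile.IsSmooth, List.forall_mem_cons] at hs
  obtain ⟨-, -, sh1, -⟩ := hs
  have hc := (one_sub_sq_pos hx).ne'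
  have d1 := hasDerivAt_of_contDiffOn sh1 hx
  have d2 := hasDerivAt_of_contDiffOn (contDiffOn_deriv sh1) hx
  have hd : deriv P.γ₀₁ x = _ := deriv_eq_of_eqOn hx (fun s hs' => γ₀₁_eq hrp hq h hs')
    ((d2.fun_add (((hasDerivAt_id' x).const_mul 2).fun_mul
      (d1.fun_mul (hasDerivAt_inv_one_sub_sq hc)))).const_mul (rp ^ 2))
  have h1 : P.einsteinRPhi qe qm rp 1 x = 0 := (h x hx).1 1 1 3
  simp only [einsteinRPhi, hd, γ₀₁_eq hrp hq h hx] at h1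
  field_simp at h1 ⊢
  have h2 : (1 - x ^ 2) * (4 * (qm * ((1 - x ^ 2) * P.Z₀ x) + qe * P.Z₁ x)
      + (rp ^ 2 * ((1 - x ^ 2) * deriv (deriv P.h₁) x + 4 * P.h₁ x))) = 0 := by
    linear_combination h1
  have h3 := (mul_eq_zero.1 h2).resolve_left hc
  linear_combination h3

/-- The left-hand side is `ζ''`. The equation is `qe` times the `φ` Maxwell equation minus `qm`
times the derivative of the `r` Maxwell equation, with `Ψ' = 2 W₀` and `B = Z₁'` from Bianchi. The
terms in `γ₀₀` and `γ₁₁` cancel, and the undifferentiated `ζ` left over is replaced through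
`zeta_eq`. -/
lemma zeta_second_deriv_eq (hrp : 0 < rp) (hq : qe ^ 2 + qm ^ 2 = rp ^ 2) (hs : P.IsSmooth)
    (h : P.IsSolution qe qm rp) {x : ℝ} (hx : x ∈ Set.Ioo (-1 : ℝ) 1) :
    qm * ((1 - x ^ 2) * deriv (deriv P.Z₀) x - 4 * x * deriv P.Z₀ x - 2 * P.Z₀ x)
      + qe * deriv (deriv P.Z₁) x = rp ^ 2 / 2 * deriv (deriv P.h₁) x := by
  have hz := zeta_eq hrp hq hs h hx
  simp only [Profile.IsSmooth, List.forall_mem_cons] at hs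
  obtain ⟨-, -, -, sg00, -, sg11, -, -, -, sZ0, sZ1, -⟩ := hs
  have hc := (one_sub_sq_pos hx).ne'
  have z1 := hasDerivAt_of_contDiffOn sZ0 hx
  have z2 := hasDerivAt_of_contDiffOn (contDiffOn_deriv sZ0) hx
  have g0 := hasDerivAt_of_contDiffOn sg00 hx
  have g1 := hasDerivAt_of_contDiffOn sg11 hx
  have hd : deriv P.Ψ x = _ := deriv_eq_of_eqOn hx (fun s hs' => maxwellR_eq hrp h hs')
    (((((hasDerivAt_one_sub_sq x).mul_const _).fun_mul z2).fun_sub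
      (((hasDerivAt_id' x).fun_mul z1).const_mul _)).fun_add
      (((g1.fun_mul (hasDerivAt_inv_one_sub_sq hc)).fun_add
        ((hasDerivAt_one_sub_sq x).fun_mul g0)).const_mul _))
  have hB : deriv P.B x = deriv (deriv P.Z₁) x := deriv_eq_of_eqOn hx
    (fun s hs' => (h s hs').2.2.2.2) (hasDerivAt_of_contDiffOn (contDiffOn_deriv sZ1) hx)
  have hM : P.maxwellPhi qe qm rp 1 x = 0 := (h x hx).2.1 1 3
  have hX := maxwellX_eq hrp h hx
  obtain ⟨-, -, hΨ, hW, -⟩ := h x hx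
  simp only [maxwellPhi, hB, hW] at hM
  rw [hΨ] at hd
  have hW0 : P.W₀ x = -(P.Z₀ x + qm * P.h₁ x * (1 - x ^ 2)⁻¹ + qe * P.h₀ x) / rp ^ 2 := by
    rw [← hX]; field_simp
  rw [hW0] at hd
  have hp : (1 - x ^ 2) ^ 2 ≠ 0 := pow_ne_zero 2 hc
  field_simp at hd hM hz ⊢
  have hp' : (1 - x ^ 2) ^ 2 * rp ^ 2 ≠ 0 := mul_ne_zero hp (by positivity)
  refine sub_eq_zero.1 ((mul_eq_zero.1 ?_).resolve_left hp')
  linear_combination qe * hM - qm * hd - (1 - x ^ 2) * rp ^ 2 * hz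
    - 4 * (1 - x ^ 2) * rp ^ 2 * P.h₁ x * hq

/-- The rotational part of the solution is determined by one modulus. -/
lemma exists_h₁_eq (hrp : 0 < rp) (hq : qe ^ 2 + qm ^ 2 = rp ^ 2) (hs : P.IsSmooth)
    (hr : P.IsRegular) (h : P.IsSolution qe qm rp) :
    ∃ K, ∀ x ∈ Set.Ioo (-1 : ℝ) 1, P.h₁ x = K * x * (1 - x ^ 2) ∧
      qm * ((1 - x ^ 2) * P.Z₀ x) + qe * P.Z₁ x = rp ^ 2 / 2 * P.h₁ x := by
  have hs' := hs
  simp only [Profile.IsSmooth, List.forall_mem_cons] at hs'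
  obtain ⟨-, -, sh1, -, -, -, -, -, -, sZ0, sZ1, -⟩ := hs'
  -- The function `ζ - rp² h₁/2` has vanishing second derivative, so it is `a x + b`; its limits at
  -- the two poles force `a = b = 0`.
  have L1 : ∀ x ∈ Set.Ioo (-1 : ℝ) 1, HasDerivAt
      (fun x => qm * ((1 - x ^ 2) * P.Z₀ x) + qe * P.Z₁ x - rp ^ 2 / 2 * P.h₁ x)
      (qm * (-(2 * x) * P.Z₀ x + (1 - x ^ 2) * deriv P.Z₀ x) + qe * deriv P.Z₁ x
        - rp ^ 2 / 2 * deriv P.h₁ x) x := fun x hx =>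
    (((((hasDerivAt_one_sub_sq x).fun_mul (hasDerivAt_of_contDiffOn sZ0 hx)).const_mul qm).fun_add
      ((hasDerivAt_of_contDiffOn sZ1 hx).const_mul qe)).fun_sub
      ((hasDerivAt_of_contDiffOn sh1 hx).const_mul (rp ^ 2 / 2)))
  have L2 : ∀ x ∈ Set.Ioo (-1 : ℝ) 1, HasDerivAt
      (fun x => qm * (-(2 * x) * P.Z₀ x + (1 - x ^ 2) * deriv P.Z₀ x) + qe * deriv P.Z₁ x
        - rp ^ 2 / 2 * deriv P.h₁ x) 0 x := by
    intro x hx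
    have z0 := hasDerivAt_of_contDiffOn sZ0 hx
    have z0' := hasDerivAt_of_contDiffOn (contDiffOn_deriv sZ0) hx
    have z1' := hasDerivAt_of_contDiffOn (contDiffOn_deriv sZ1) hx
    have h1' := hasDerivAt_of_contDiffOn (contDiffOn_deriv sh1) hx
    refine HasDerivAt.congr_deriv ((((((((hasDerivAt_id' x).const_mul 2).fun_neg.fun_mul z0).fun_add
      ((hasDerivAt_one_sub_sq x).fun_mul z0')).const_mul qm).fun_add (z1'.const_mul qe)).fun_sub
      (h1'.const_mul (rp ^ 2 / 2)))) ?_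
    linear_combination zeta_second_deriv_eq hrp hq hs h hx
  obtain ⟨a, ha⟩ := eq_of_hasDerivAt_zero L2
  have L3 : ∀ x ∈ Set.Ioo (-1 : ℝ) 1, HasDerivAt (fun x =>
      qm * ((1 - x ^ 2) * P.Z₀ x) + qe * P.Z₁ x - rp ^ 2 / 2 * P.h₁ x - a * x) 0 x := by
    intro x hx
    refine HasDerivAt.congr_deriv ((L1 x hx).fun_sub ((hasDerivAt_id' x).const_mul a)) ?_
    linear_combination ha x hx
  obtain ⟨b, hb⟩ := eq_of_hasDerivAt_zero L3
  have lim : ∀ s : ℝ, s ^ 2 = 1 → a * s + b = 0 := by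
    intro s h2
    have hl := ((((hr.Z₀ s h2).const_mul qm).add ((hr.Z₁ s h2).const_mul qe)).sub
      ((hr.h₁ s h2).const_mul (rp ^ 2 / 2))).sub ((tendsto_pole s).const_mul a)
    have hl' := hl.add_const (a * s)
    simp only [mul_zero, add_zero, sub_self, zero_sub, neg_add_cancel] at hl'
    rw [add_comm]
    exact eq_zero_of_tendsto_pole (c := b + a * s) h2 (fun x hx => by rw [hb x hx]) hl'
  have h1 := lim 1 (by norm_num)
  have h2 := lim (-1) (by norm_num)
  have hb0 : b = 0 := by linarith
  have ha0 : a = 0 := by linarith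
  subst hb0 ha0
  have hz : ∀ x ∈ Set.Ioo (-1 : ℝ) 1,
      qm * ((1 - x ^ 2) * P.Z₀ x) + qe * P.Z₁ x = rp ^ 2 / 2 * P.h₁ x := fun x hx => by
    linear_combination hb x hx
  -- With `ζ = rp² h₁/2` the identity `zeta_eq` becomes `(1 - x²) h₁'' + 6 h₁ = 0`.
  obtain ⟨K, hK⟩ := eq_mul_of_legendre (y := P.h₁) (y₁ := deriv P.h₁)
    (fun x hx => hasDerivAt_of_contDiffOn sh1 hx) (fun x hx => by
      refine HasDerivAt.congr_deriv (hasDerivAt_of_contDiffOn (contDiffOn_deriv sh1) hx) ?_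
      have hc := (one_sub_sq_pos hx).ne'
      have h3 := zeta_eq hrp hq hs h hx
      rw [hz x hx] at h3
      have h4 : rp ^ 2 * ((1 - x ^ 2) * deriv (deriv P.h₁) x + 6 * P.h₁ x) = 0 := by
        linear_combination h3
      have h5 := (mul_eq_zero.1 h4).resolve_left (by positivity)
      field_simp
      linear_combination h5) (hr.h₁ 1 (by norm_num)) (by
      -- The polar limit of `(1 - x²) h₁'` is not among the regularity conditions; it is read off
      -- from `γ₀₁`, in which `h₁'` occurs.
      have hl := ((hr.γ₀₁ 1 (by norm_num)).const_mul (rp ^ 2)⁻¹).sub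
        (((tendsto_pole 1).const_mul 2).mul (hr.h₁ 1 (by norm_num)))
      simp only [mul_zero, sub_self] at hl
      refine hl.congr' ?_
      filter_upwards [self_mem_nhdsWithin] with x hx
      have hc := (one_sub_sq_pos hx).ne'
      rw [γ₀₁_eq hrp hq h hx]
      field_simp
      ring)
  exact ⟨K, fun x hx => ⟨hK x hx, hz x hx⟩⟩

/-- In the `vx` Einstein equation the substitution for `W₀` cancels `Z₀` and `h₁`, and the
coefficient of `h₀` is a multiple of `qe² + qm² - rp²`. -/
lemma deriv_F_eq_zero (hrp : 0 < rp) (hq : qe ^ 2 + qm ^ 2 = rp ^ 2)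
    (h : P.IsSolution qe qm rp) {x : ℝ} (hx : x ∈ Set.Ioo (-1 : ℝ) 1) : deriv P.F x = 0 := by
  have h1 : P.einsteinVX qe qm rp 1 x = 0 := (h x hx).1 1 0 2
  have hX := maxwellX_eq hrp h hx
  have hW := (h x hx).2.2.2.1
  have hc := (one_sub_sq_pos hx).ne'
  have hW0 : P.W₀ x = -(P.Z₀ x + qm * P.h₁ x * (1 - x ^ 2)⁻¹ + qe * P.h₀ x) / rp ^ 2 := by
    rw [← hX]; field_simp
  simp only [einsteinVX, hW, hW0] at h1
  have hp : (1 - x ^ 2) * rp ^ 4 * 3 ≠ 0 := mul_ne_zero (mul_ne_zero hc (by positivity)) (by simp)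
  refine (mul_eq_zero.1 ?_).resolve_left hp
  field_simp at h1
  linear_combination h1 - 2 * (1 - x ^ 2) * P.h₀ x * hq

/-- This is the trace-free part of the sphere block: in the difference of the rescaled `xx` and `φφ`
equations `Ψ`, `B` and all derivatives of `γ` drop out. -/
lemma γ₀₀_eq (hrp : 0 < rp) (hq : qe ^ 2 + qm ^ 2 = rp ^ 2)
    (h : P.IsSolution qe qm rp) {x : ℝ} (hx : x ∈ Set.Ioo (-1 : ℝ) 1) :
    (1 - x ^ 2) ^ 2 * P.γ₀₀ x = 2 * rp ^ 2 * (1 - x ^ 2) ^ 2 * deriv P.h₀ x + P.γ₁₁ x := by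
  have h1 : P.einsteinXX qe qm rp 1 x = 0 := (h x hx).1 1 2 2
  have h2 : P.einsteinPhiPhi qe qm rp 1 x = 0 := (h x hx).1 1 3 3
  have hc := (one_sub_sq_pos hx).ne'
  have h3 : (1 - x ^ 2) * P.einsteinXX qe qm rp 1 x
      - (1 - x ^ 2)⁻¹ * P.einsteinPhiPhi qe qm rp 1 x
      = 2 * (1 - x ^ 2) * deriv P.h₀ x + (P.γ₁₁ x * (1 - x ^ 2)⁻¹ - (1 - x ^ 2) * P.γ₀₀ x)
        * (qe ^ 2 + qm ^ 2) / rp ^ 4 := by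
    simp only [einsteinXX, einsteinPhiPhi]
    field_simp
    ring
  rw [h1, h2, hq] at h3
  field_simp at h3
  linear_combination h3

/-- `ν = (1 - x²) n'` for `n = γ₁₁ / (1 - x²) + 2 r₊² x h₀`. -/
lemma hasDerivAt_trace (hrp : 0 < rp) (hq : qe ^ 2 + qm ^ 2 = rp ^ 2) (hs : P.IsSmooth)
    (h : P.IsSolution qe qm rp) {x : ℝ} (hx : x ∈ Set.Ioo (-1 : ℝ) 1) :
    HasDerivAt (fun x => P.γ₁₁ x * (1 - x ^ 2)⁻¹ + 2 * rp ^ 2 * (x * P.h₀ x))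
      (4 * (qe * ((1 - x ^ 2) * P.Z₀ x) - qm * P.Z₁ x + rp ^ 2 * ((1 - x ^ 2) * P.h₀ x))
        * (1 - x ^ 2)⁻¹) x := by
  simp only [Profile.IsSmooth, List.forall_mem_cons] at hs
  obtain ⟨-, sh0, -, -, -, sg11, -⟩ := hs
  have hc := (one_sub_sq_pos hx).ne'
  have g1 := hasDerivAt_of_contDiffOn sg11 hx
  have h0 := hasDerivAt_of_contDiffOn sh0 hx
  refine HasDerivAt.congr_deriv ((g1.fun_mul (hasDerivAt_inv_one_sub_sq hc)).fun_add
    (((hasDerivAt_id' x).fun_mul h0).const_mul _)) ?_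
  have h1 : P.einsteinRX qe qm rp 1 x = 0 := (h x hx).1 1 1 2
  have h2 := γ₀₀_eq hrp hq h hx
  simp only [einsteinRX] at h1
  field_simp at h1 ⊢
  linear_combination -h1 - x * h2

/-- The `vr` Einstein equation after elimination of `Ψ`, `B` and `γ₀₀`. Together with
`hasDerivAt_trace` it closes the system for the pair `(n, ν)`. -/
lemma hasDerivAt_nu (hrp : 0 < rp) (hq : qe ^ 2 + qm ^ 2 = rp ^ 2) (hs : P.IsSmooth)
    (h : P.IsSolution qe qm rp) {x : ℝ} (hx : x ∈ Set.Ioo (-1 : ℝ) 1) :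
    HasDerivAt (fun x => 4 * (qe * ((1 - x ^ 2) * P.Z₀ x) - qm * P.Z₁ x
        + rp ^ 2 * ((1 - x ^ 2) * P.h₀ x)))
      (6 * (rp ^ 4 * P.F x - (P.γ₁₁ x * (1 - x ^ 2)⁻¹ + 2 * rp ^ 2 * (x * P.h₀ x)))) x := by
  simp only [Profile.IsSmooth, List.forall_mem_cons] at hs
  obtain ⟨-, sh0, -, -, -, -, -, -, -, sZ0, sZ1, -⟩ := hs
  have hc := (one_sub_sq_pos hx).ne'
  have z0 := hasDerivAt_of_contDiffOn sZ0 hx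
  have z1 := hasDerivAt_of_contDiffOn sZ1 hx
  have h0 := hasDerivAt_of_contDiffOn sh0 hx
  refine HasDerivAt.congr_deriv ((((((hasDerivAt_one_sub_sq x).fun_mul z0).const_mul qe).fun_sub
    (z1.const_mul qm)).fun_add (((hasDerivAt_one_sub_sq x).fun_mul h0).const_mul
      (rp ^ 2))).const_mul 4) ?_
  have h1 : P.einsteinVR qe qm rp 1 x = 0 := (h x hx).1 1 0 1
  have h2 := γ₀₀_eq hrp hq h hx
  have h3 := maxwellR_eq hrp h hx
  have h4 := (h x hx).2.2.2.2
  have h5 : P.γ₀₀ x = 2 * rp ^ 2 * deriv P.h₀ x + P.γ₁₁ x / (1 - x ^ 2) ^ 2 := by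
    field_simp
    linear_combination h2
  have h6 : qm ^ 2 = rp ^ 2 - qe ^ 2 := by linarith
  simp only [einsteinVR, h3, h4, h5, h6] at h1
  field_simp at h1 ⊢
  refine sub_eq_zero.1 ((mul_eq_zero.1 ?_).resolve_left (pow_ne_zero 2 hrp.ne'))
  linear_combination -h1

/-- After the rotational sector has given one constant, the pair `(n, ν)` gives the other two. Then
`Z₀` and `Z₁` are recovered from their two rotated combinations, and the remaining components from
the elimination formulas; no equation restricts `h₀`. -/
theorem exists_isStandard (hrp : 0 < rp) (hq : qe ^ 2 + qm ^ 2 = rp ^ 2) (hs : P.IsSmooth)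
    (hr : P.IsRegular) (h : P.IsSolution qe qm rp) : ∃ K, P.IsStandard qe qm rp K := by
  obtain ⟨κ, hκ⟩ := exists_h₁_eq hrp hq hs hr h
  have hs' := hs
  simp only [Profile.IsSmooth, List.forall_mem_cons] at hs'
  obtain ⟨sF, sh0, -, -, -, -, -, -, -, -, -, -⟩ := hs'
  obtain ⟨f, hf⟩ := eq_of_hasDerivAt_zero (u := P.F) fun x hx => by
    rw [← deriv_F_eq_zero hrp hq h hx]
    exact hasDerivAt_of_contDiffOn sF hx
  have hnu : ∀ x ∈ Set.Ioo (-1 : ℝ) 1, HasDerivAt (fun x => 6 * (rp ^ 4 * f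
      - (P.γ₁₁ x * (1 - x ^ 2)⁻¹ + 2 * rp ^ 2 * (x * P.h₀ x))))
      (-(6 * (4 * (qe * ((1 - x ^ 2) * P.Z₀ x) - qm * P.Z₁ x + rp ^ 2 * ((1 - x ^ 2) * P.h₀ x)))
        * (1 - x ^ 2)⁻¹)) x := fun x hx =>
    HasDerivAt.congr_deriv (((hasDerivAt_trace hrp hq hs h hx).const_sub (rp ^ 4 * f)).const_mul 6)
      (by ring)
  have hnu' : ∀ x ∈ Set.Ioo (-1 : ℝ) 1, HasDerivAt (fun x => 4 * (qe * ((1 - x ^ 2) * P.Z₀ x)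
      - qm * P.Z₁ x + rp ^ 2 * ((1 - x ^ 2) * P.h₀ x))) (6 * (rp ^ 4 * f
      - (P.γ₁₁ x * (1 - x ^ 2)⁻¹ + 2 * rp ^ 2 * (x * P.h₀ x)))) x := fun x hx => by
    have := hasDerivAt_nu hrp hq hs h hx
    rwa [hf x hx] at this
  have h1 : (1 : ℝ) ^ 2 = 1 := one_pow 2
  -- The equation is applied to `y = ν` and `y₁ = 6 (rp⁴ f - n)`: indeed `ν' = y₁` and `y₁' = -6 n'
  -- = -6 ν/(1 - x²)`. The polar limit of `(1 - x²) y₁` comes from those of `γ₁₁` and `(1 - x²) h₀`.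
  obtain ⟨k, hk⟩ := eq_mul_of_legendre hnu' hnu (by
      have := ((((hr.Z₀ 1 h1).const_mul qe).sub ((hr.Z₁ 1 h1).const_mul qm)).add
        ((hr.h₀ 1 h1).const_mul (rp ^ 2))).const_mul 4
      simpa using this) (by
      have := ((((tendsto_one_sub_sq_pole h1).const_mul (rp ^ 4 * f)).sub (hr.γ₁₁ 1 h1)).sub
        (((tendsto_pole 1).mul (hr.h₀ 1 h1)).const_mul (2 * rp ^ 2))).const_mul 6
      simp only [mul_zero, sub_zero] at this
      refine this.congr' ?_
      filter_upwards [self_mem_nhdsWithin] with x hx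
      have hc := (one_sub_sq_pos hx).ne'
      field_simp
      ring)
  have hn : ∀ x ∈ Set.Ioo (-1 : ℝ) 1, HasDerivAt (fun x => P.γ₁₁ x * (1 - x ^ 2)⁻¹
      + 2 * rp ^ 2 * (x * P.h₀ x) - k / 2 * x ^ 2) 0 x := fun x hx => by
    refine HasDerivAt.congr_deriv ((hasDerivAt_trace hrp hq hs h hx).fun_sub
      ((hasDerivAt_sq x).const_mul (k / 2))) ?_
    have hc := (one_sub_sq_pos hx).ne'
    rw [hk x hx]
    field_simp
    ring
  obtain ⟨K₂, hK₂⟩ := eq_of_hasDerivAt_zero hn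
  -- At `x = 0` one has `ν'(0) = k` and `n(0) = K₂`, which ties the constant `F` to the moduli.
  have hF : rp ^ 4 * f = K₂ + k / 6 := by
    have h0 : (0 : ℝ) ∈ Set.Ioo (-1 : ℝ) 1 := by norm_num
    have e1 := hasDerivAt_eq_zero_of_eqOn h0 (fun s hs => sub_eq_zero.2 (hk s hs))
      ((hnu' 0 h0).fun_sub (((hasDerivAt_id' 0).const_mul k).fun_mul (hasDerivAt_one_sub_sq 0)))
    have e2 := hK₂ 0 h0
    norm_num at e1 e2
    linarith
  have hg11 : ∀ x ∈ Set.Ioo (-1 : ℝ) 1,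
      P.γ₁₁ x = (K₂ + x * (k / 2 * x - 2 * rp ^ 2 * P.h₀ x)) * (1 - x ^ 2) := fun x hx => by
    have hc := (one_sub_sq_pos hx).ne'
    rw [← hK₂ x hx]
    field_simp
    ring
  have hg00 : ∀ x ∈ Set.Ioo (-1 : ℝ) 1, P.γ₀₀ x = 2 * rp ^ 2 * deriv P.h₀ x
      + (K₂ + x * (k / 2 * x - 2 * rp ^ 2 * P.h₀ x)) * (1 - x ^ 2)⁻¹ := fun x hx => by
    have hc := (one_sub_sq_pos hx).ne'
    have e := γ₀₀_eq hrp hq h hx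
    rw [hg11 x hx] at e
    refine mul_left_cancel₀ (pow_ne_zero 2 hc) (e.trans ?_)
    field_simp
  have hh1 : ∀ x ∈ Set.Ioo (-1 : ℝ) 1,
      P.h₁ x = 2 * (κ * rp ^ 2 / 2) / rp ^ 2 * (x * (1 - x ^ 2)) := fun x hx => by
    rw [(hκ x hx).1]
    field_simp
  -- The two combinations of `((1 - x²) Z₀, Z₁)` form a rotation up to the factor `qe² + qm² = rp²`,
  -- so both components can be solved for.
  have hZ0 : ∀ x ∈ Set.Ioo (-1 : ℝ) 1, P.Z₀ x = (κ * rp ^ 2 / 2) * qm / rp ^ 2 * x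
      + qe / (2 * rp ^ 2) * (k / 2 * x - 2 * rp ^ 2 * P.h₀ x) := fun x hx => by
    have hc := (one_sub_sq_pos hx).ne'
    obtain ⟨e1, e2⟩ := hκ x hx
    rw [e1] at e2
    have e3 := hk x hx
    field_simp
    refine mul_left_cancel₀ hc ?_
    linear_combination 4 * qm * e2 + qe * e3 - 4 * P.Z₀ x * (1 - x ^ 2) * hq
  have hZ1 : ∀ x ∈ Set.Ioo (-1 : ℝ) 1, P.Z₁ x = (κ * rp ^ 2 / 2) * qe / rp ^ 2 * (x * (1 - x ^ 2))
      - qm / (2 * rp ^ 2) * ((1 - x ^ 2) * (k / 2 * x - 2 * rp ^ 2 * P.h₀ x)) := fun x hx => by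
    obtain ⟨e1, e2⟩ := hκ x hx
    rw [e1] at e2
    have e3 := hk x hx
    field_simp
    linear_combination 4 * qe * e2 - qm * e3 - 4 * P.Z₁ x * hq
  have hΨ : ∀ x ∈ Set.Ioo (-1 : ℝ) 1, P.Ψ x = (κ * rp ^ 2 / 2) * qm / rp ^ 4 * (1 - 3 * x ^ 2)
      + qe / (2 * rp ^ 4) * (2 * K₂ + k / 2 * (1 - x ^ 2)) := fun x hx => by
    have hc := (one_sub_sq_pos hx).ne'
    have h0 := hasDerivAt_of_contDiffOn sh0 hx
    have hd : deriv P.Z₀ x = _ := deriv_eq_of_eqOn hx hZ0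
      (((hasDerivAt_id' x).const_mul _).fun_add ((((hasDerivAt_id' x).const_mul _).fun_sub
        (h0.const_mul _)).const_mul _))
    rw [maxwellR_eq hrp h hx, hd, hZ0 x hx, hg00 x hx, hg11 x hx]
    field_simp
    ring
  -- The moduli are normalised by `h₁ = (2 K₁/rp²) x (1 - x²)` and `n = K₂ + K₃ x²`.
  refine ⟨(κ * rp ^ 2 / 2, K₂, k / 2), ?_, hh1, hg00, ?_, hg11, hΨ, ?_, fun x hx => (h x hx).2.2.2.1,
    hZ0, hZ1, ?_⟩
  · intro x hx
    rw [hf x hx]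
    field_simp
    linear_combination 6 * hF
  · intro x hx
    have hc := (one_sub_sq_pos hx).ne'
    have hd : deriv P.h₁ x = _ := deriv_eq_of_eqOn hx hh1
      (((hasDerivAt_id' x).fun_mul (hasDerivAt_one_sub_sq x)).const_mul _)
    rw [γ₀₁_eq hrp hq h hx, hd, hh1 x hx]
    field_simp
    ring
  · intro x hx
    have hd : deriv P.Ψ x = _ := deriv_eq_of_eqOn hx hΨ
      (((((hasDerivAt_sq x).const_mul 3).const_sub 1).const_mul _).fun_add
        ((((hasDerivAt_one_sub_sq x).const_mul _).const_add _).const_mul _))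
    have e := (h x hx).2.2.1
    rw [hd] at e
    field_simp at e ⊢
    linear_combination -e
  · intro x hx
    have h0 := hasDerivAt_of_contDiffOn sh0 hx
    have hd : deriv P.Z₁ x = _ := deriv_eq_of_eqOn hx hZ1
      ((((hasDerivAt_id' x).fun_mul (hasDerivAt_one_sub_sq x)).const_mul _).fun_sub
        (((hasDerivAt_one_sub_sq x).fun_mul (((hasDerivAt_id' x).const_mul _).fun_sub
        (h0.const_mul _))).const_mul _))
    rw [(h x hx).2.2.2.2, hd]
    ring

end IsSolution

set_option linter.unusedSimpArgs false in
-- Direct substitution. The equations are identities in `h₀`, `h₀'` and `h₀''`, as they must be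
-- because `h₀` is pure gauge; the only relation used among the constants is that of the charges.
theorem IsStandard.isSolution (hrp : 0 < rp) (hq : qe ^ 2 + qm ^ 2 = rp ^ 2) (hs : P.IsSmooth)
    {K : ℝ × ℝ × ℝ} (h : P.IsStandard qe qm rp K) : P.IsSolution qe qm rp := by
  simp only [Profile.IsSmooth, List.forall_mem_cons] at hs
  obtain ⟨-, sh0, -⟩ := hs
  intro x hx
  have hc := (one_sub_sq_pos hx).ne'
  have hc' := hasDerivAt_one_sub_sq x
  have hi := hasDerivAt_inv_one_sub_sq hc
  have hx2 := hasDerivAt_sq x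
  have hX := hasDerivAt_id' x
  have a₀ := hasDerivAt_of_contDiffOn sh0 hx
  have a₁ := hasDerivAt_of_contDiffOn (contDiffOn_deriv sh0) hx
  have dF : ∀ s ∈ Set.Ioo (-1 : ℝ) 1, deriv P.F s = 0 := fun s hs =>
    deriv_eq_of_eqOn hs h.F (hasDerivAt_const _ _)
  have ddF : deriv (deriv P.F) x = 0 := deriv_eq_of_eqOn hx dF (hasDerivAt_const _ _)
  have dh₁ : ∀ s ∈ Set.Ioo (-1 : ℝ) 1, deriv P.h₁ s = 2 * K.1 / rp ^ 2 * (1 - 3 * s ^ 2) :=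
    fun s hs => deriv_eq_of_eqOn hs h.h₁ (HasDerivAt.congr_deriv
      (((hasDerivAt_id' s).fun_mul (hasDerivAt_one_sub_sq s)).const_mul _) (by ring))
  have ddh₁ : deriv (deriv P.h₁) x = _ :=
    deriv_eq_of_eqOn hx dh₁ (((hx2.const_mul 3).const_sub 1).const_mul _)
  have dn : ∀ s ∈ Set.Ioo (-1 : ℝ) 1, HasDerivAt (fun s => K.2.1 + s * (K.2.2 * s
      - 2 * rp ^ 2 * P.h₀ s)) (2 * K.2.2 * s - 2 * rp ^ 2 * (P.h₀ s + s * deriv P.h₀ s)) s :=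
    fun s hs => HasDerivAt.congr_deriv (((hasDerivAt_id' s).fun_mul
      (((hasDerivAt_id' s).const_mul _).fun_sub
        ((hasDerivAt_of_contDiffOn sh0 hs).const_mul _))).const_add _) (by ring)
  have dγ₀₀ : deriv P.γ₀₀ x = _ := deriv_eq_of_eqOn hx h.γ₀₀
    ((a₁.const_mul _).fun_add ((dn x hx).fun_mul hi))
  have dγ₀₁ : deriv P.γ₀₁ x = _ := deriv_eq_of_eqOn hx h.γ₀₁ (hc'.const_mul _)
  have dγ₁₁ : ∀ s ∈ Set.Ioo (-1 : ℝ) 1, deriv P.γ₁₁ s = _ := fun s hs =>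
    deriv_eq_of_eqOn hs h.γ₁₁ ((dn s hs).fun_mul (hasDerivAt_one_sub_sq s))
  have ddγ₁₁ : deriv (deriv P.γ₁₁) x = _ := deriv_eq_of_eqOn hx dγ₁₁
    ((((hX.const_mul _).fun_sub ((a₀.fun_add (hX.fun_mul a₁)).const_mul _)).fun_mul hc').fun_add
      ((dn x hx).fun_mul (hX.const_mul 2).fun_neg))
  have dΨ : deriv P.Ψ x = _ := deriv_eq_of_eqOn hx h.Ψ
    ((((hx2.const_mul 3).const_sub 1).const_mul _).fun_add
      (((hc'.const_mul _).const_add _).const_mul _))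
  have dW₀ : deriv P.W₀ x = _ := deriv_eq_of_eqOn hx h.W₀ (hX.const_mul _)
  have dZ₀ : deriv P.Z₀ x = _ := deriv_eq_of_eqOn hx h.Z₀
    ((hX.const_mul _).fun_add (((hX.const_mul _).fun_sub (a₀.const_mul _)).const_mul _))
  have dZ₁ : deriv P.Z₁ x = _ := deriv_eq_of_eqOn hx h.Z₁
    (((hX.fun_mul hc').const_mul _).fun_sub
      ((hc'.fun_mul ((hX.const_mul _).fun_sub (a₀.const_mul _))).const_mul _))
  have dB : deriv P.B x = _ := deriv_eq_of_eqOn hx h.B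
    ((((hx2.const_mul 3).const_sub 1).const_mul _).fun_sub
      (((hc'.fun_mul ((a₁.const_mul _).const_sub _)).fun_sub
        ((hX.const_mul 2).fun_mul ((hX.const_mul _).fun_sub (a₀.const_mul _)))).const_mul _))
  have hq' : qm ^ 2 = rp ^ 2 - qe ^ 2 := by linarith
  refine ⟨fun r => ?_, fun r => ?_, ?_, h.W₁ x hx, ?_⟩
  · refine forall_fin_four ?_ ?_ ?_ ?_ <;> refine forall_fin_four ?_ ?_ ?_ ?_ <;>
    simp only [einsteinVariation, Matrix.of_apply, Matrix.cons_val] <;>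
    simp only [einsteinVV, einsteinVR, einsteinVX, einsteinVPhi, einsteinRX, einsteinRPhi,
      einsteinXX, einsteinXPhi, einsteinPhiPhi, dF x hx, ddF, dh₁ x hx, ddh₁, dγ₀₀, dγ₀₁,
      dγ₁₁ x hx, ddγ₁₁, h.F x hx, h.h₁ x hx, h.γ₀₀ x hx, h.γ₀₁ x hx, h.γ₁₁ x hx, h.Ψ x hx,
      h.W₀ x hx, h.W₁ x hx, h.Z₀ x hx, h.Z₁ x hx, h.B x hx] <;>
    (try field_simp) <;> (try ring_nf) <;> (try simp only [hq']) <;> (try ring1)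
  · refine forall_fin_four ?_ ?_ ?_ ?_ <;>
    simp only [maxwellVariation, Matrix.cons_val] <;>
    simp only [maxwellV, maxwellR, maxwellX, maxwellPhi, dh₁ x hx, dγ₀₀,
      dγ₁₁ x hx, dW₀, dZ₀, dB, h.h₁ x hx, h.γ₀₀ x hx, h.γ₁₁ x hx, h.Ψ x hx,
      h.W₀ x hx, h.W₁ x hx, h.Z₀ x hx, h.Z₁ x hx] <;>
    (try field_simp) <;> (try ring_nf) <;> (try simp only [hq']) <;> (try ring1)
  · rw [dΨ, h.W₀ x hx]
    ring
  · rw [dZ₁, h.B x hx]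
    ring

end Profile

/-! ### Potentials of smooth axisymmetric 1-forms on the sphere -/

/-- The Euclidean length of a vector of `ℝ³`. -/
def radius (y : Fin 3 → ℝ) : ℝ := √(y 0 ^ 2 + y 1 ^ 2 + y 2 ^ 2)

/-- The components of the radial projection of `ℝ³` minus the origin to the unit sphere. -/
def radialProj (i : Fin 3) (y : Fin 3 → ℝ) : ℝ := y i / radius y

lemma sq_sum_pos {y : Fin 3 → ℝ} (hy : y ≠ 0) : 0 < y 0 ^ 2 + y 1 ^ 2 + y 2 ^ 2 := by
  by_contra h
  refine hy (funext fun i => ?_)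
  fin_cases i <;> simp only [Fin.zero_eta, Fin.mk_one, Fin.reduceFinMk, Pi.zero_apply] <;>
    nlinarith [sq_nonneg (y 0), sq_nonneg (y 1), sq_nonneg (y 2)]

lemma radius_pos {y : Fin 3 → ℝ} (hy : y ≠ 0) : 0 < radius y := Real.sqrt_pos.2 (sq_sum_pos hy)

lemma radius_sq {y : Fin 3 → ℝ} (hy : y ≠ 0) : radius y ^ 2 = y 0 ^ 2 + y 1 ^ 2 + y 2 ^ 2 :=
  Real.sq_sqrt (sq_sum_pos hy).le

lemma contDiffOn_radialProj (i : Fin 3) : ContDiffOn ℝ ∞ (radialProj i) {0}ᶜ := by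
  have h : ∀ i, ContDiffOn ℝ ∞ (fun y : Fin 3 → ℝ => y i) {0}ᶜ := fun i =>
    contDiffOn_pi.1 contDiffOn_id i
  refine (h i).div (ContDiffOn.sqrt ((((h 0).pow 2).add ((h 1).pow 2)).add ((h 2).pow 2)) ?_) ?_
  · exact fun y hy => (sq_sum_pos hy).ne'
  · exact fun y hy => (radius_pos hy).ne'

lemma sum_radialProj_sq {y : Fin 3 → ℝ} (hy : y ≠ 0) : ∑ i, radialProj i y * radialProj i y = 1 := by
  have h := (radius_pos hy).ne'
  rw [Fin.sum_univ_three]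
  simp only [radialProj]
  field_simp
  rw [radius_sq hy]

lemma radialProj_ne_zero {y : Fin 3 → ℝ} (hy : y ≠ 0) : (fun i => radialProj i y) ≠ 0 := by
  intro h
  have := sum_radialProj_sq hy
  simp [funext_iff] at h
  simp [h] at this

lemma hasFDerivAt_radialProj {y : Fin 3 → ℝ} (hy : y ≠ 0) (i : Fin 3) :
    HasFDerivAt (radialProj i) (fderiv ℝ (radialProj i) y) y :=
  (((contDiffOn_radialProj i).contDiffAt
    (isOpen_compl_singleton.mem_nhds hy)).differentiableAt (by simp)).hasFDerivAt

/-- The projection takes values in the unit sphere, so its derivative is tangent to the sphere. -/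
lemma sum_radialProj_mul_fderiv {y : Fin 3 → ℝ} (hy : y ≠ 0) (v : Fin 3 → ℝ) :
    ∑ i, radialProj i y * fderiv ℝ (radialProj i) y v = 0 := by
  have h : HasFDerivAt (fun y => ∑ i, radialProj i y * radialProj i y) _ y :=
    HasFDerivAt.fun_sum fun i _ => (hasFDerivAt_radialProj hy i).mul (hasFDerivAt_radialProj hy i)
  have h0 : HasFDerivAt (fun y => ∑ i, radialProj i y * radialProj i y)
      (0 : (Fin 3 → ℝ) →L[ℝ] ℝ) y := by
    refine (hasFDerivAt_const (1 : ℝ) y).congr_of_eventuallyEq ?_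
    filter_upwards [isOpen_compl_singleton.mem_nhds hy] with z hz using sum_radialProj_sq hz
  have e := congrArg (fun L : (Fin 3 → ℝ) →L[ℝ] ℝ => L v) (h.unique h0)
  simp only [Fin.sum_univ_three, add_apply, smul_apply, smul_eq_mul, zero_apply] at e ⊢
  linarith

/-- Polar coordinates of a point of the sphere off the axis. -/
lemma exists_spherePoint_eq {z : Fin 3 → ℝ} (hz : z 0 ^ 2 + z 1 ^ 2 + z 2 ^ 2 = 1)
    (h : z 0 ^ 2 + z 1 ^ 2 ≠ 0) : z 2 ∈ Set.Ioo (-1 : ℝ) 1 ∧ ∃ φ, spherePoint (z 2) φ = z := by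
  have hp : 0 < z 0 ^ 2 + z 1 ^ 2 := lt_of_le_of_ne (by positivity) (Ne.symm h)
  have hc : 1 - z 2 ^ 2 = z 0 ^ 2 + z 1 ^ 2 := by linarith
  refine ⟨⟨by nlinarith, by nlinarith⟩, ?_⟩
  refine ⟨Complex.arg ⟨z 0, z 1⟩, ?_⟩
  have hn : ‖(⟨z 0, z 1⟩ : ℂ)‖ = √(1 - z 2 ^ 2) := by
    rw [hc, Complex.norm_def, Complex.normSq_mk]
    congr 1
    ring
  have h1 := Complex.norm_mul_cos_arg ⟨z 0, z 1⟩
  have h2 := Complex.norm_mul_sin_arg ⟨z 0, z 1⟩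
  rw [hn] at h1 h2
  funext i
  fin_cases i
  · exact h1
  · exact h2
  · rfl

/-- The map `z ↦ σ z₀` is continuous and open, so taking preimages commutes with closure. -/
lemma closure_halfSpace (σ : ℝ) (hσ : σ ≠ 0) :
    closure {z : Fin 3 → ℝ | 0 < σ * z 0} = {z | 0 ≤ σ * z 0} := by
  have h : IsOpenMap fun z : Fin 3 → ℝ => σ * z 0 :=
    (Homeomorph.mulLeft₀ σ hσ).isOpenMap.comp (isOpenMap_eval 0)
  have := h.preimage_closure_eq_closure_preimage (by fun_prop) (Set.Ioi 0)
  rw [closure_Ioi] at this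
  exact this.symm

/-- A continuous function that has the derivative `f'` off a plane through `y`, with `f'`
continuous at `y`, has the derivative `f' y` at `y`. -/
lemma hasFDerivAt_of_hasFDerivAt_off_plane {f : (Fin 3 → ℝ) → ℝ}
    {f' : (Fin 3 → ℝ) → (Fin 3 → ℝ) →L[ℝ] ℝ} {U : Set (Fin 3 → ℝ)} {y : Fin 3 → ℝ}
    (hU : IsOpen U) (hy : y ∈ U) (hf : ContinuousOn f U) (hf' : ContinuousAt f' y)
    (h : ∀ z ∈ U, z 0 ≠ 0 → HasFDerivAt f (f' z) z) : HasFDerivAt f (f' y) y := by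
  obtain ⟨ρ, hρ, hsub⟩ := Metric.nhds_basis_closedBall.mem_iff.1 (hU.mem_nhds hy)
  -- On each open half-ball the function is differentiable and its derivative extends continuously
  -- to `y`. Half-balls are convex, as the extension theorem requires; the complement of the axis
  -- alone would not be.
  have key : ∀ σ : ℝ, σ ≠ 0 →
      HasFDerivWithinAt f (f' y) (closure (Metric.ball y ρ ∩ {z | 0 < σ * z 0})) y := by
    intro σ hσ
    have hb : ∀ z ∈ Metric.ball y ρ ∩ {z : Fin 3 → ℝ | 0 < σ * z 0}, HasFDerivAt f (f' z) z :=
      fun z hz => h z (hsub (Metric.ball_subset_closedBall hz.1)) fun h0 => by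
        have := hz.2
        simp [h0] at this
    have hlin : Convex ℝ {z : Fin 3 → ℝ | 0 < σ * z 0} := by
      intro u hu v hv s t hs ht hst
      simp only [Set.mem_ofPred_eq, Pi.add_apply, Pi.smul_apply, smul_eq_mul] at *
      rcases hs.eq_or_lt with rfl | hs
      · rw [zero_add] at hst
        simpa [hst] using hv
      · nlinarith [mul_pos hs hu, mul_nonneg ht hv.le]
    refine hasFDerivWithinAt_closure_of_tendsto_fderiv
      (fun z hz => (hb z hz).differentiableAt.differentiableWithinAt)
      ((convex_ball y ρ).inter hlin)
      (Metric.isOpen_ball.inter (isOpen_lt continuous_const (by fun_prop))) ?_ ?_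
    · intro z hz
      have hz' : z ∈ U := hsub (Metric.closure_ball_subset_closedBall
        (closure_mono Set.inter_subset_left hz))
      exact (hf.continuousAt (hU.mem_nhds hz')).continuousWithinAt
    · refine (hf'.tendsto.mono_left nhdsWithin_le_nhds).congr' ?_
      filter_upwards [self_mem_nhdsWithin] with z hz using (hb z hz).fderiv.symm
  -- The closures of the two half-balls cover a neighbourhood of `y`.
  refine ((key 1 one_ne_zero).union (key (-1) (by norm_num))).hasFDerivAt ?_
  filter_upwards [Metric.ball_mem_nhds y hρ] with z hz
  rcases le_total 0 (z 0) with h0 | h0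
  · refine Or.inl (Metric.isOpen_ball.inter_closure ⟨hz, ?_⟩)
    rw [closure_halfSpace 1 one_ne_zero]
    simpa using h0
  · refine Or.inr (Metric.isOpen_ball.inter_closure ⟨hz, ?_⟩)
    rw [closure_halfSpace (-1) (by norm_num)]
    simpa using h0

/-- A smooth axisymmetric 1-form without `dφ` component is exact. -/
theorem SmoothCovector.exists_potential {w : ℝ → ℝ → Fin 2 → ℝ} (hw : SmoothCovector w)
    (h₀ : ∀ x ∈ Set.Ioo (-1 : ℝ) 1, ∀ φ, w x φ 0 = w x 0 0)
    (h₁ : ∀ x ∈ Set.Ioo (-1 : ℝ) 1, ∀ φ, w x φ 1 = 0) :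
    ∃ f : ℝ → ℝ, SmoothScalar (fun x _ => f x) ∧
      ∀ x ∈ Set.Ioo (-1 : ℝ) 1, HasDerivAt f (w x 0 0) x := by
  obtain ⟨A, hA, hwA⟩ := hw
  -- The 1-form evaluated on `∂_θ` along the meridian `φ = 0`, with `x = cos θ`.
  set a : ℝ → ℝ := fun θ => A ![Real.sin θ, 0, Real.cos θ] 0 * Real.cos θ
    - A ![Real.sin θ, 0, Real.cos θ] 2 * Real.sin θ with ha
  have hcA : ∀ i, Continuous fun θ : ℝ => A ![Real.sin θ, 0, Real.cos θ] i := by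
    intro i
    have hc : Continuous fun θ : ℝ => (![Real.sin θ, 0, Real.cos θ] : Fin 3 → ℝ) := by
      refine continuous_pi fun j => ?_
      fin_cases j <;> simp <;> fun_prop
    refine (continuous_apply i).comp (hA.continuousOn.comp_continuous hc fun θ h0 => ?_)
    have e0 : Real.sin θ = 0 := congrFun h0 0
    have e2 : Real.cos θ = 0 := congrFun h0 2
    have := Real.sin_sq_add_cos_sq θ
    rw [e0, e2] at this
    norm_num at this
  have hac : Continuous a := ((hcA 0).mul Real.continuous_cos).sub ((hcA 2).mul Real.continuous_sin)
  -- In the angle `θ` the integrand is continuous up to the poles, whereas `w x 0 0` may blow up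
  -- there.
  set f : ℝ → ℝ := fun x => ∫ θ in (0 : ℝ)..Real.arccos x, a θ with hf
  have hfd : ∀ x ∈ Set.Ioo (-1 : ℝ) 1, HasDerivAt f (w x 0 0) x := by
    intro x hx
    have hd := (hac.integral_hasStrictDerivAt 0 (Real.arccos x)).hasDerivAt.comp x
      (Real.hasDerivAt_arccos hx.1.ne' hx.2.ne)
    refine HasDerivAt.congr_deriv hd ?_
    have hs := (Real.sqrt_pos.2 (one_sub_sq_pos hx)).ne'
    have hsp : spherePoint x 0 = ![Real.sin (Real.arccos x), 0, Real.cos (Real.arccos x)] := by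
      rw [Real.sin_arccos, Real.cos_arccos hx.1.le hx.2.le]
      simp [spherePoint]
    rw [hwA x hx, Fin.sum_univ_three, hsp]
    simp only [ha, sphereFrame, Matrix.cons_val, Real.cos_zero, Real.sin_zero]
    rw [← hsp, Real.sin_arccos, Real.cos_arccos hx.1.le hx.2.le]
    field_simp
    ring
  have hfc : Continuous f := by
    have h1 : Continuous fun u => ∫ θ in (0 : ℝ)..u, a θ :=
      continuous_iff_continuousAt.2 fun u =>
        (hac.integral_hasStrictDerivAt 0 u).hasDerivAt.continuousAt
    exact h1.comp Real.continuous_arccos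
  -- The candidate derivative is the pull-back of the ambient 1-form by the radial projection. It is
  -- smooth off the origin, so it only has to be checked off the plane `y₀ = 0`, which contains the
  -- axis and hence the poles.
  set β : (Fin 3 → ℝ) → (Fin 3 → ℝ) →L[ℝ] ℝ := fun y =>
    ∑ i, A (fun j => radialProj j y) i • fderiv ℝ (radialProj i) y with hβ
  have hβs : ContDiffOn ℝ ∞ β {0}ᶜ := by
    refine ContDiffOn.sum fun i _ => ?_
    have h1 := hA.comp (contDiffOn_pi.2 contDiffOn_radialProj) fun y hy => radialProj_ne_zero hy
    exact (contDiffOn_pi.1 h1 i).smul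
      ((contDiffOn_radialProj i).fderiv_of_isOpen isOpen_compl_singleton (by simp))
  have hderiv : ∀ y ∈ ({0}ᶜ : Set (Fin 3 → ℝ)),
      HasFDerivAt (fun y => f (radialProj 2 y)) (β y) y := by
    intro y hy
    refine hasFDerivAt_of_hasFDerivAt_off_plane isOpen_compl_singleton hy ?_
      (hβs.contDiffAt (isOpen_compl_singleton.mem_nhds hy)).continuousAt ?_
    · exact hfc.comp_continuousOn (contDiffOn_radialProj 2).continuousOn
    · intro z hz hz0
      have hzr := (radius_pos hz).ne'
      have hsq := sum_radialProj_sq hz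
      rw [Fin.sum_univ_three] at hsq
      obtain ⟨hx, φ, hφ⟩ := exists_spherePoint_eq (z := fun j => radialProj j z)
        (by linarith) (by
          have : 0 < radialProj 0 z ^ 2 := by
            have : radialProj 0 z ≠ 0 := div_ne_zero hz0 hzr
            positivity
          have := sq_nonneg (radialProj 1 z)
          positivity)
      refine ((hfd _ hx).comp_hasFDerivAt z (hasFDerivAt_radialProj hz 2)).congr_fderiv ?_
      ext1 v
      have hs := (Real.sqrt_pos.2 (one_sub_sq_pos hx)).ne'
      have ht := sum_radialProj_mul_fderiv hz v
      have hw0 := hwA _ hx φ 0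
      have hw1 := hwA _ hx φ 1
      rw [h₀ _ hx φ] at hw0
      rw [h₁ _ hx φ] at hw1
      have e0 : √(1 - radialProj 2 z ^ 2) * Real.cos φ = radialProj 0 z := congrFun hφ 0
      have e1 : √(1 - radialProj 2 z ^ 2) * Real.sin φ = radialProj 1 z := congrFun hφ 1
      simp only [hφ, Fin.sum_univ_three, sphereFrame, Matrix.cons_val] at hw0 hw1 ht
      simp only [hβ, hw0, add_apply, smul_apply, Fin.sum_univ_three, smul_eq_mul]
      rw [← e0, ← e1] at ht
      generalize fderiv ℝ (radialProj 0) z v = u0 at *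
      generalize fderiv ℝ (radialProj 1) z v = u1 at *
      generalize fderiv ℝ (radialProj 2) z v = u2 at *
      generalize A (fun j => radialProj j z) = B at *
      have hcs := Real.sin_sq_add_cos_sq φ
      set S := √(1 - radialProj 2 z ^ 2)
      -- The absence of a `dφ` component: the ambient form is orthogonal to the parallels of
      -- latitude.
      have hw1' : -B 0 * Real.sin φ + B 1 * Real.cos φ = 0 := by
        refine (mul_eq_zero.1 ?_).resolve_left hs
        linear_combination -hw1
      field_simp
      linear_combination -(B 0 * Real.cos φ + B 1 * Real.sin φ) * ht
        - S * (-Real.sin φ * u0 + Real.cos φ * u1) * hw1' + (B 0 * u0 + B 1 * u1) * S * hcs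
  refine ⟨f, ⟨fun y => f (radialProj 2 y), ?_, ?_⟩, hfd⟩
  · rw [contDiffOn_infty_iff_fderiv_of_isOpen isOpen_compl_singleton]
    refine ⟨fun y hy => (hderiv y hy).differentiableAt.differentiableWithinAt, ?_⟩
    exact hβs.congr fun y hy => (hderiv y hy).fderiv
  · intro x hx φ
    have hr : radius (spherePoint x φ) = 1 := by
      rw [radius, Real.sqrt_eq_one]
      have hs := Real.mul_self_sqrt (one_sub_sq_pos hx).le
      simp only [spherePoint, Matrix.cons_val]
      linear_combination (Real.cos φ ^ 2 + Real.sin φ ^ 2) * hs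
        + (1 - x ^ 2) * Real.sin_sq_add_cos_sq φ
    simp only [radialProj, hr, div_one]
    rfl

/-! ### Linear structure of smooth tensor fields on the sphere -/

section Linear

variable (c : ℝ)

lemma SmoothScalar.add_smul {u u' : ℝ → ℝ → ℝ} (h : SmoothScalar u) (h' : SmoothScalar u') :
    SmoothScalar (u + c • u') := by
  obtain ⟨A, hA, e⟩ := h
  obtain ⟨A', hA', e'⟩ := h'
  refine ⟨A + c • A', hA.add (hA'.const_smul c), fun x hx φ => ?_⟩
  simp only [Pi.add_apply, Pi.smul_apply, e x hx φ, e' x hx φ]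

lemma SmoothCovector.add_smul {u u' : ℝ → ℝ → Fin 2 → ℝ} (h : SmoothCovector u)
    (h' : SmoothCovector u') : SmoothCovector (u + c • u') := by
  obtain ⟨A, hA, e⟩ := h
  obtain ⟨A', hA', e'⟩ := h'
  refine ⟨A + c • A', hA.add (hA'.const_smul c), fun x hx φ a => ?_⟩
  simp only [Pi.add_apply, Pi.smul_apply, e x hx φ, e' x hx φ, smul_eq_mul, Finset.mul_sum,
    ← Finset.sum_add_distrib]
  exact Finset.sum_congr rfl fun i _ => by ring

lemma SmoothTensor.add_smul {u u' : ℝ → ℝ → Matrix (Fin 2) (Fin 2) ℝ} (h : SmoothTensor u)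
    (h' : SmoothTensor u') : SmoothTensor (u + c • u') := by
  obtain ⟨A, hA, e⟩ := h
  obtain ⟨A', hA', e'⟩ := h'
  refine ⟨A + c • A', hA.add (hA'.const_smul c), fun x hx φ a b => ?_⟩
  simp only [Pi.add_apply, Pi.smul_apply, Matrix.add_apply, Matrix.smul_apply, e x hx φ, e' x hx φ,
    smul_eq_mul, Finset.mul_sum, ← Finset.sum_add_distrib]
  exact Finset.sum_congr rfl fun i _ => Finset.sum_congr rfl fun j _ => by ring

namespace FirstOrderData

variable {D D' : FirstOrderData}

lemma IsSmooth.add_smul (h : D.IsSmooth) (h' : D'.IsSmooth) : (D + c • D').IsSmooth := by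
  obtain ⟨h1, h2, h3, h4, h5, h6, h7, h8⟩ := h
  obtain ⟨k1, k2, k3, k4, k5, k6, k7, k8⟩ := h'
  refine ⟨h1.add_smul c k1, h2.add_smul c k2, h3.add_smul c k3, h4.add_smul c k4, h5.add_smul c k5,
    h6.add_smul c k6, h7.add_smul c k7, fun x hx φ a b => ⟨?_, ?_⟩⟩
  · change D.γ x φ a b + c * D'.γ x φ a b = D.γ x φ b a + c * D'.γ x φ b a
    rw [(h8 x hx φ a b).1, (k8 x hx φ a b).1]
  · change D.B x φ a b + c * D'.B x φ a b = -(D.B x φ b a + c * D'.B x φ b a)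
    rw [(h8 x hx φ a b).2, (k8 x hx φ a b).2]
    ring

lemma IsAxisymmetric.add_smul (h : D.IsAxisymmetric) (h' : D'.IsAxisymmetric) :
    (D + c • D').IsAxisymmetric := by
  intro x hx φ φ'
  obtain ⟨h1, h2, h3, h4, h5, h6, h7⟩ := h x hx φ φ'
  obtain ⟨k1, k2, k3, k4, k5, k6, k7⟩ := h' x hx φ φ'
  exact ⟨congrArg₂ (fun a b => a + c • b) h1 k1, congrArg₂ (fun a b => a + c • b) h2 k2,
    congrArg₂ (fun a b => a + c • b) h3 k3, congrArg₂ (fun a b => a + c • b) h4 k4,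
    congrArg₂ (fun a b => a + c • b) h5 k5, congrArg₂ (fun a b => a + c • b) h6 k6,
    congrArg₂ (fun a b => a + c • b) h7 k7⟩

end FirstOrderData

lemma isStandard_add_smul {qe qm rp : ℝ} {D D' : FirstOrderData} {K K' : ℝ × ℝ × ℝ}
    (hD : D.IsSmooth) (hD' : D'.IsSmooth) (h : D.profile.IsStandard qe qm rp K)
    (h' : D'.profile.IsStandard qe qm rp K') :
    (D + c • D').profile.IsStandard qe qm rp (K + c • K') := by
  have hd : ∀ x ∈ Set.Ioo (-1 : ℝ) 1, deriv (D + c • D').profile.h₀ x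
      = deriv D.profile.h₀ x + c * deriv D'.profile.h₀ x := fun x hx =>
    ((Profile.hasDerivAt_of_contDiffOn (hD.2.1.contDiffOn 0) hx).fun_add
      ((Profile.hasDerivAt_of_contDiffOn (hD'.2.1.contDiffOn 0) hx).const_mul c)).deriv
  have e0 : ∀ x, (D + c • D').profile.h₀ x = D.profile.h₀ x + c * D'.profile.h₀ x := fun x => rfl
  constructor <;> intro x hx
  · change D.profile.F x + c * D'.profile.F x = _
    rw [h.F x hx, h'.F x hx]; simp; ring
  · change D.profile.h₁ x + c * D'.profile.h₁ x = _
    rw [h.h₁ x hx, h'.h₁ x hx]; simp; ring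
  · change D.profile.γ₀₀ x + c * D'.profile.γ₀₀ x = _
    rw [h.γ₀₀ x hx, h'.γ₀₀ x hx, hd x hx, e0]; simp; ring
  · change D.profile.γ₀₁ x + c * D'.profile.γ₀₁ x = _
    rw [h.γ₀₁ x hx, h'.γ₀₁ x hx]; simp; ring
  · change D.profile.γ₁₁ x + c * D'.profile.γ₁₁ x = _
    rw [h.γ₁₁ x hx, h'.γ₁₁ x hx, e0]; simp; ring
  · change D.profile.Ψ x + c * D'.profile.Ψ x = _
    rw [h.Ψ x hx, h'.Ψ x hx]; simp; ring
  · change D.profile.W₀ x + c * D'.profile.W₀ x = _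
    rw [h.W₀ x hx, h'.W₀ x hx]; simp; ring
  · change D.profile.W₁ x + c * D'.profile.W₁ x = _
    rw [h.W₁ x hx, h'.W₁ x hx]; simp
  · change D.profile.Z₀ x + c * D'.profile.Z₀ x = _
    rw [h.Z₀ x hx, h'.Z₀ x hx, e0]; simp; ring
  · change D.profile.Z₁ x + c * D'.profile.Z₁ x = _
    rw [h.Z₁ x hx, h'.Z₁ x hx, e0]; simp; ring
  · change D.profile.B x + c * D'.profile.B x = _
    rw [h.B x hx, h'.B x hx, hd x hx, e0]; simp; ring

end Linear

lemma FirstOrderData.IsSmooth.isRegular {D : FirstOrderData} (hD : D.IsSmooth) :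
    D.profile.IsRegular := by
  obtain ⟨-, hh, hγ, -, -, hZ, -⟩ := hD
  exact ⟨fun _ => hh.tendsto_zero, fun _ => hh.tendsto_one, fun _ => hγ.tendsto_zero_one,
    fun _ => hγ.tendsto_one_one, fun _ => hZ.tendsto_zero, fun _ => hZ.tendsto_one⟩

/-- The equations are replaced by explicit formulas that are linear in the data and the moduli.
Closure under linear combinations can then be read off. -/
theorem mem_axisymmetricDeformations_iff {qe qm rp : ℝ} (hrp : 0 < rp)
    (hq : qe ^ 2 + qm ^ 2 = rp ^ 2) {D : FirstOrderData} :
    D ∈ axisymmetricDeformations qe qm rp ↔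
      D.IsSmooth ∧ D.IsAxisymmetric ∧ ∃ K, D.profile.IsStandard qe qm rp K := by
  constructor
  · rintro ⟨h, ha⟩
    exact ⟨h.1, ha, ((isTransverseDeformation_iff hrp h.1 ha).1 h).exists_isStandard hrp hq
      h.1.profile h.1.isRegular⟩
  · rintro ⟨hs, ha, K, hK⟩
    exact ⟨(isTransverseDeformation_iff hrp hs ha).2 (hK.isSolution hrp hq hs.profile), ha⟩

/-! ### The normal form -/

section NormalForm

variable {qe qm rp : ℝ} (K₁ K₂ K₃ : ℝ)

lemma contDiffOn_coord (i : Fin 3) : ContDiffOn ℝ ∞ (fun y : Fin 3 → ℝ => y i) {0}ᶜ :=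
  contDiffOn_pi.1 contDiffOn_id i

/-- `a(x) dx + b(x) (1 - x²) dφ` is smooth on the sphere. -/
lemma smoothCovector_of_coeff {w : ℝ → ℝ → Fin 2 → ℝ} {a b : ℝ → ℝ} (ha : ContDiff ℝ ∞ a)
    (hb : ContDiff ℝ ∞ b) (h₀ : ∀ x φ, w x φ 0 = a x)
    (h₁ : ∀ x φ, w x φ 1 = b x * (1 - x ^ 2)) : SmoothCovector w := by
  have h := contDiffOn_coord
  have ha' : ContDiffOn ℝ ∞ (fun y : Fin 3 → ℝ => a (y 2)) {0}ᶜ := ha.comp_contDiffOn (h 2)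
  have hb' : ContDiffOn ℝ ∞ (fun y : Fin 3 → ℝ => b (y 2)) {0}ᶜ := hb.comp_contDiffOn (h 2)
  -- On the sphere `dx = dy₂` and `(1 - x²) dφ = y₀ dy₁ - y₁ dy₀`.
  refine ⟨fun y => ![-(b (y 2) * y 1), b (y 2) * y 0, a (y 2)], ?_, ?_⟩
  · rw [contDiffOn_pi]
    intro i
    fin_cases i
    · exact (hb'.mul (h 1)).neg
    · exact hb'.mul (h 0)
    · exact ha'
  · intro x hx φ i
    have hs := Real.mul_self_sqrt (one_sub_sq_pos hx).le
    have hs' := (Real.sqrt_pos.2 (one_sub_sq_pos hx)).ne'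
    fin_cases i <;> simp only [Fin.zero_eta, Fin.mk_one, h₀, h₁, Fin.sum_univ_three, sphereFrame,
      spherePoint, Matrix.cons_val]
    · ring
    · linear_combination -b x * hs
        - b x * √(1 - x ^ 2) ^ 2 * Real.sin_sq_add_cos_sq φ

lemma isSmooth_normalForm : (normalForm qe qm rp K₁ K₂ K₃).IsSmooth := by
  have h := contDiffOn_coord
  refine ⟨⟨fun _ => _, contDiffOn_const, fun _ _ _ => rfl⟩, ?_, ?_, ?_, ?_, ?_, ?_, ?_⟩
  · exact smoothCovector_of_coeff (a := fun x => K₃ * x / (2 * rp ^ 2))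
      (b := fun x => 2 * K₁ * x / rp ^ 2) (by fun_prop) (by fun_prop) (fun _ _ => rfl)
      (fun x φ => show 2 * K₁ * x * (1 - x ^ 2) / rp ^ 2 = _ by ring)
  -- The `K₂` terms are `K₂` times the unit round metric, the restriction of the Euclidean one; the
  -- `K₃` term is `K₃ dy₂²`; the `K₁` term is `2 K₁` times the symmetrised product of `dy₂` and `y₀
  -- dy₁ - y₁ dy₀`.
  · refine ⟨fun y => ![![K₂, 0, -(2 * K₁ * y 1)], ![0, K₂, 2 * K₁ * y 0],
      ![-(2 * K₁ * y 1), 2 * K₁ * y 0, K₂ + K₃]], ?_, ?_⟩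
    · have h1 : ContDiffOn ℝ ∞ (fun y : Fin 3 → ℝ => -(2 * K₁ * y 1)) {0}ᶜ :=
        (contDiffOn_const.mul (h 1)).neg
      have h0 : ContDiffOn ℝ ∞ (fun y : Fin 3 → ℝ => 2 * K₁ * y 0) {0}ᶜ :=
        contDiffOn_const.mul (h 0)
      rw [contDiffOn_pi]
      intro i
      rw [contDiffOn_pi]
      intro j
      fin_cases i <;> fin_cases j <;> first | exact contDiffOn_const | exact h1 | exact h0
    · intro x hx φ
      have hc := one_sub_sq_pos hx
      have hs := Real.sq_sqrt hc.le
      have hs' := (Real.sqrt_pos.2 hc).ne'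
      have ht := Real.sin_sq_add_cos_sq φ
      refine Fin.forall_fin_two.2 ⟨Fin.forall_fin_two.2 ⟨?_, ?_⟩, Fin.forall_fin_two.2 ⟨?_, ?_⟩⟩ <;>
        simp only [normalForm, FirstOrderData.γ, Fin.sum_univ_three, sphereFrame,
          spherePoint, Matrix.cons_val, Matrix.of_apply]
      · field_simp
        rw [hs]
        linear_combination -((1 - x ^ 2) * K₂ * x ^ 2) * ht
      · field_simp
        rw [hs]
        linear_combination -(2 * K₁ * (1 - x ^ 2)) * ht
      · field_simp
        rw [hs]
        linear_combination -(2 * K₁ * (1 - x ^ 2)) * ht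
      · field_simp
        rw [hs]
        linear_combination -(K₂ * (1 - x ^ 2)) * ht
  · refine ⟨fun y => K₁ * qm * (1 - 3 * y 2 ^ 2) / rp ^ 4
      + qe * (2 * K₂ + K₃ * (1 - y 2 ^ 2)) / (2 * rp ^ 4), ?_, fun _ _ _ => rfl⟩
    exact ContDiff.contDiffOn (by fun_prop)
  · exact smoothCovector_of_coeff (a := fun x => -3 * K₁ * qm * x / rp ^ 4
      - qe * K₃ * x / (2 * rp ^ 4)) (b := fun x => 0) (by fun_prop) (by fun_prop) (fun _ _ => rfl)
      (fun x φ => (zero_mul _).symm)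
  · exact smoothCovector_of_coeff (a := fun x => K₁ * qm * x / rp ^ 2)
      (b := fun x => K₁ * qe * x / rp ^ 2) (by fun_prop) (by fun_prop) (fun _ _ => rfl)
      (fun x φ => show K₁ * qe * x * (1 - x ^ 2) / rp ^ 2 = _ by ring)
  · set β : (Fin 3 → ℝ) → ℝ := fun y => K₁ * qe * (1 - 3 * y 2 ^ 2) / rp ^ 2
    have hβ : ContDiffOn ℝ ∞ β {0}ᶜ := ContDiff.contDiffOn (by fun_prop)
    -- The form `dx ∧ dφ` is minus the contraction of the Euclidean volume form with the position
    -- vector.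
    refine ⟨fun y => ![![0, -(β y * y 2), β y * y 1], ![β y * y 2, 0, -(β y * y 0)],
      ![-(β y * y 1), β y * y 0, 0]], ?_, ?_⟩
    · rw [contDiffOn_pi]
      intro i
      rw [contDiffOn_pi]
      intro j
      fin_cases i <;> fin_cases j <;>
        first | exact contDiffOn_const | exact hβ.mul (h _) | exact (hβ.mul (h _)).neg
    · intro x hx φ
      have hc := one_sub_sq_pos hx
      have hs := Real.sq_sqrt hc.le
      have hs' := (Real.sqrt_pos.2 hc).ne'
      have ht := Real.sin_sq_add_cos_sq φ
      refine Fin.forall_fin_two.2 ⟨Fin.forall_fin_two.2 ⟨?_, ?_⟩, Fin.forall_fin_two.2 ⟨?_, ?_⟩⟩ <;>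
        simp only [normalForm, FirstOrderData.B, Fin.sum_univ_three, sphereFrame,
          spherePoint, Matrix.cons_val, Matrix.of_apply, β]
      · ring
      · field_simp
        rw [hs]
        linear_combination -(K₁ * qe * (1 - 3 * x ^ 2) / rp ^ 2) * ht
      · field_simp
        rw [hs]
        linear_combination (K₁ * qe * (1 - 3 * x ^ 2) / rp ^ 2) * ht
      · ring
  · intro x hx φ
    refine Fin.forall_fin_two.2 ⟨Fin.forall_fin_two.2 ⟨?_, ?_⟩, Fin.forall_fin_two.2 ⟨?_, ?_⟩⟩ <;>
      simp [normalForm, FirstOrderData.γ, FirstOrderData.B]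

lemma isAxisymmetric_normalForm : (normalForm qe qm rp K₁ K₂ K₃).IsAxisymmetric :=
  fun _ _ _ _ => ⟨rfl, rfl, rfl, rfl, rfl, rfl, rfl⟩

lemma isStandard_normalForm (hrp : 0 < rp) :
    (normalForm qe qm rp K₁ K₂ K₃).profile.IsStandard qe qm rp (K₁, K₂, K₃) := by
  have hd : ∀ x, deriv (normalForm qe qm rp K₁ K₂ K₃).profile.h₀ x = K₃ / (2 * rp ^ 2) := fun x =>
    HasDerivAt.deriv (HasDerivAt.congr_deriv
      (((hasDerivAt_id' x).const_mul K₃).div_const (2 * rp ^ 2)) (by ring))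
  have e0 : ∀ x, (normalForm qe qm rp K₁ K₂ K₃).profile.h₀ x = K₃ * x / (2 * rp ^ 2) := fun x => rfl
  constructor <;> intro x hx <;> (try simp only [hd, e0]) <;>
    simp only [FirstOrderData.profile, normalForm, FirstOrderData.F, FirstOrderData.h,
      FirstOrderData.γ, FirstOrderData.Ψ, FirstOrderData.W, FirstOrderData.Z, FirstOrderData.B,
      Matrix.cons_val, Matrix.of_apply] <;>
    have hc := (one_sub_sq_pos hx).ne' <;>
    (try field_simp) <;> (try ring)

theorem normalForm_mem (hrp : 0 < rp) (hq : qe ^ 2 + qm ^ 2 = rp ^ 2) :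
    normalForm qe qm rp K₁ K₂ K₃ ∈ axisymmetricDeformations qe qm rp :=
  (mem_axisymmetricDeformations_iff hrp hq).2 ⟨isSmooth_normalForm _ _ _,
    isAxisymmetric_normalForm _ _ _, _, isStandard_normalForm _ _ _ hrp⟩

end NormalForm

/-! ### Gauge transformations -/

lemma lieDeriv_congr {ξ η : Pt → Fin 4 → ℝ} (T : TensorField) {p : Pt} (hp : p ∈ patch)
    (h : ∀ q ∈ patch, ξ q = η q) : lieDeriv ξ T p = lieDeriv η T p := by
  have hpd : ∀ κ ρ, pd κ (fun q => ξ q ρ) p = pd κ (fun q => η q ρ) p := fun κ ρ =>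
    pd_congr_on isOpen_patch (fun q hq => by rw [h q hq]) hp κ
  ext μ ν
  simp only [lieDeriv, Matrix.of_apply, hpd, h p hp]

lemma lieDeriv_add_smul {ξ η : Pt → Fin 4 → ℝ} (T : TensorField) (c : ℝ) {p : Pt}
    (hξ : ∀ ρ, DifferentiableAt ℝ (fun q => ξ q ρ) p)
    (hη : ∀ ρ, DifferentiableAt ℝ (fun q => η q ρ) p) :
    lieDeriv (ξ + c • η) T p = lieDeriv ξ T p + c • lieDeriv η T p := by
  have hpd : ∀ κ ρ, pd κ (fun q => (ξ + c • η) q ρ) p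
      = pd κ (fun q => ξ q ρ) p + c * pd κ (fun q => η q ρ) p := fun κ ρ => by
    have h := (hasDerivAt_comp_update (hξ ρ) κ).add ((hasDerivAt_comp_update (hη ρ) κ).const_mul c)
    rw [pd_eq_fderiv (hξ ρ), pd_eq_fderiv (hη ρ)]
    exact h.deriv
  ext μ ν
  simp only [lieDeriv, Matrix.of_apply, hpd]
  simp only [Matrix.add_apply, Matrix.smul_apply, Matrix.of_apply, Pi.add_apply, Pi.smul_apply,
    smul_eq_mul, Finset.mul_sum, ← Finset.sum_add_distrib]
  exact Finset.sum_congr rfl fun ρ _ => by ring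

section SmoothScalar

variable {f : ℝ → ℝ → ℝ}

/-- A smooth function on the sphere in coordinates. -/
lemma SmoothScalar.contDiffOn_prod (hf : SmoothScalar f) :
    ContDiffOn ℝ ∞ (fun z : ℝ × ℝ => f z.1 z.2) (Set.Ioo (-1) 1 ×ˢ Set.univ) := by
  obtain ⟨A, hA, h⟩ := hf
  exact (contDiffOn_spherePoint_comp hA).congr fun z hz => h z.1 hz.1 z.2

lemma isOpen_strip : IsOpen (Set.Ioo (-1 : ℝ) 1 ×ˢ (Set.univ : Set ℝ)) :=
  isOpen_Ioo.prod isOpen_univ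

lemma SmoothScalar.contDiffOn_fderiv (hf : SmoothScalar f) (v : ℝ × ℝ) :
    ContDiffOn ℝ ∞ (fun z : ℝ × ℝ => fderiv ℝ (fun z : ℝ × ℝ => f z.1 z.2) z v)
      (Set.Ioo (-1) 1 ×ˢ Set.univ) :=
  (hf.contDiffOn_prod.fderiv_of_isOpen isOpen_strip (by simp)).clm_apply contDiffOn_const

lemma SmoothScalar.hasDerivAt_fst (hf : SmoothScalar f) {x : ℝ} (hx : x ∈ Set.Ioo (-1 : ℝ) 1)
    (φ : ℝ) : HasDerivAt (fun s => f s φ)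
      (fderiv ℝ (fun z : ℝ × ℝ => f z.1 z.2) (x, φ) (1, 0)) x := by
  have h := ((hf.contDiffOn_prod.contDiffAt (isOpen_strip.mem_nhds
    (⟨hx, trivial⟩ : (x, φ) ∈ Set.Ioo (-1 : ℝ) 1 ×ˢ Set.univ))).differentiableAt
    (by simp)).hasFDerivAt
  exact h.comp_hasDerivAt (f := fun s : ℝ => (s, φ)) x
    ((hasDerivAt_id' x).prodMk (hasDerivAt_const x φ))

lemma SmoothScalar.hasDerivAt_snd (hf : SmoothScalar f) {x : ℝ} (hx : x ∈ Set.Ioo (-1 : ℝ) 1)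
    (φ : ℝ) : HasDerivAt (fun s => f x s)
      (fderiv ℝ (fun z : ℝ × ℝ => f z.1 z.2) (x, φ) (0, 1)) φ := by
  have h := ((hf.contDiffOn_prod.contDiffAt (isOpen_strip.mem_nhds
    (⟨hx, trivial⟩ : (x, φ) ∈ Set.Ioo (-1 : ℝ) 1 ×ˢ Set.univ))).differentiableAt
    (by simp)).hasFDerivAt
  exact h.comp_hasDerivAt (f := fun s : ℝ => (x, s)) φ
    ((hasDerivAt_const φ x).prodMk (hasDerivAt_id' φ))

lemma SmoothScalar.contDiffOn_gaugeField (hf : SmoothScalar f) (rp : ℝ) (ρ : Fin 4) :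
    ContDiffOn ℝ ∞ (fun q => gaugeField rp f q ρ) patch := by
  have hq : ∀ i, ContDiffOn ℝ ∞ (fun q : Pt => q i) patch := fun i =>
    contDiffOn_pi.1 contDiffOn_id i
  have hm : Set.MapsTo (fun q : Pt => (q 2, q 3)) patch (Set.Ioo (-1) 1 ×ˢ Set.univ) :=
    fun q hq => ⟨hq, trivial⟩
  have hc : ∀ {u : ℝ × ℝ → ℝ}, ContDiffOn ℝ ∞ u (Set.Ioo (-1) 1 ×ˢ Set.univ) →
      ContDiffOn ℝ ∞ (fun q : Pt => u (q 2, q 3)) patch := fun {u} hu =>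
    hu.comp (g := u) (f := fun q : Pt => (q 2, q 3)) ((hq 2).prodMk (hq 3)) hm
  have hx : ContDiffOn ℝ ∞ (fun q : Pt => deriv (fun s => f s (q 3)) (q 2)) patch :=
    (hc (hf.contDiffOn_fderiv (1, 0))).congr fun q hq => (hf.hasDerivAt_fst hq _).deriv
  have hφ : ContDiffOn ℝ ∞ (fun q : Pt => deriv (fun s => f (q 2) s) (q 3)) patch :=
    (hc (hf.contDiffOn_fderiv (0, 1))).congr fun q hq => (hf.hasDerivAt_snd hq _).deriv
  have h1 : ContDiffOn ℝ ∞ (fun q : Pt => 1 - q 2 ^ 2) patch := contDiffOn_const.sub ((hq 2).pow 2)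
  -- The radius is arbitrary here. For `rp = 0` the convention `1/0 = 0` makes the `φ` component
  -- vanish; otherwise it is a smooth quotient.
  by_cases hrp : rp = 0
  · revert ρ
    refine forall_fin_four ?_ ?_ ?_ ?_ <;> simp only [gaugeField, Matrix.cons_val]
    · exact contDiffOn_const.mul (hc hf.contDiffOn_prod)
    · exact contDiffOn_const
    · exact (contDiffOn_const.mul (hq 1)).mul ((h1.div_const _).mul hx)
    · subst hrp
      simp only [ne_eq, OfNat.ofNat_ne_zero, not_false_eq_true, zero_pow, zero_mul, div_zero,
        mul_zero]
      exact contDiffOn_const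
  · revert ρ
    refine forall_fin_four ?_ ?_ ?_ ?_ <;> simp only [gaugeField, Matrix.cons_val]
    · exact contDiffOn_const.mul (hc hf.contDiffOn_prod)
    · exact contDiffOn_const
    · exact (contDiffOn_const.mul (hq 1)).mul ((h1.div_const _).mul hx)
    · exact (contDiffOn_const.mul (hq 1)).mul ((contDiffOn_const.div (contDiffOn_const.mul h1)
        fun q hq => mul_ne_zero (pow_ne_zero 2 hrp) (one_sub_sq_pos hq).ne').mul hφ)

lemma gaugeField_add_smul {f' : ℝ → ℝ → ℝ} (hf : SmoothScalar f) (hf' : SmoothScalar f')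
    (rp c : ℝ) {p : Pt} (hp : p ∈ patch) :
    gaugeField rp (f + c • f') p = (gaugeField rp f + c • gaugeField rp f') p := by
  have h1 : deriv (fun s => (f + c • f') s (p 3)) (p 2) = deriv (fun s => f s (p 3)) (p 2)
      + c * deriv (fun s => f' s (p 3)) (p 2) := by
    rw [(hf.hasDerivAt_fst hp _).deriv, (hf'.hasDerivAt_fst hp _).deriv]
    exact ((hf.hasDerivAt_fst hp _).add ((hf'.hasDerivAt_fst hp _).const_mul c)).deriv
  have h2 : deriv (fun s => (f + c • f') (p 2) s) (p 3) = deriv (fun s => f (p 2) s) (p 3)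
      + c * deriv (fun s => f' (p 2) s) (p 3) := by
    rw [(hf.hasDerivAt_snd hp _).deriv, (hf'.hasDerivAt_snd hp _).deriv]
    exact ((hf.hasDerivAt_snd hp _).add ((hf'.hasDerivAt_snd hp _).const_mul c)).deriv
  funext ρ
  simp only [gaugeField, h1, h2]
  simp only [gaugeField, Pi.add_apply, Pi.smul_apply, smul_eq_mul]
  revert ρ
  refine forall_fin_four ?_ ?_ ?_ ?_ <;> simp only [Matrix.cons_val] <;> ring

end SmoothScalar

lemma metric_add_smul (D D' : FirstOrderData) (c : ℝ) (p : Pt) :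
    (D + c • D').metric p = D.metric p + c • D'.metric p := by
  have hF : (D + c • D').F = D.F + c • D'.F := rfl
  have hh : (D + c • D').h = D.h + c • D'.h := rfl
  have hγ : (D + c • D').γ = D.γ + c • D'.γ := rfl
  ext μ ν
  simp only [FirstOrderData.metric, hF, hh, hγ, Matrix.add_apply, Matrix.smul_apply, Pi.add_apply,
    Pi.smul_apply, smul_eq_mul]
  revert μ ν
  refine forall_fin_four ?_ ?_ ?_ ?_ <;> refine forall_fin_four ?_ ?_ ?_ ?_ <;>
    simp only [Matrix.of_apply, Matrix.cons_val] <;> ring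

lemma maxwell_add_smul (D D' : FirstOrderData) (c : ℝ) (p : Pt) :
    (D + c • D').maxwell p = D.maxwell p + c • D'.maxwell p := by
  have hΨ : (D + c • D').Ψ = D.Ψ + c • D'.Ψ := rfl
  have hW : (D + c • D').W = D.W + c • D'.W := rfl
  have hZ : (D + c • D').Z = D.Z + c • D'.Z := rfl
  have hB : (D + c • D').B = D.B + c • D'.B := rfl
  ext μ ν
  simp only [FirstOrderData.maxwell, hΨ, hW, hZ, hB, Matrix.add_apply, Matrix.smul_apply,
    Pi.add_apply, Pi.smul_apply, smul_eq_mul]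
  revert μ ν
  refine forall_fin_four ?_ ?_ ?_ ?_ <;> refine forall_fin_four ?_ ?_ ?_ ?_ <;>
    simp only [Matrix.of_apply, Matrix.cons_val] <;> ring

lemma IsPureGauge.add_smul {qe qm rp : ℝ} {D D' : FirstOrderData} (c : ℝ)
    (h : IsPureGauge qe qm rp D) (h' : IsPureGauge qe qm rp D') :
    IsPureGauge qe qm rp (D + c • D') := by
  obtain ⟨f, hf, e⟩ := h
  obtain ⟨f', hf', e'⟩ := h'
  refine ⟨f + c • f', hf.add_smul c hf', fun p hp => ?_⟩
  have hd : ∀ {f}, SmoothScalar f → ∀ ρ, DifferentiableAt ℝ (fun q => gaugeField rp f q ρ) p :=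
    fun {f} hf ρ => ((hf.contDiffOn_gaugeField rp ρ).contDiffAt
      (isOpen_patch.mem_nhds hp)).differentiableAt (by simp)
  have hl : ∀ T, lieDeriv (gaugeField rp (f + c • f')) T p
      = lieDeriv (gaugeField rp f) T p + c • lieDeriv (gaugeField rp f') T p := fun T => by
    rw [lieDeriv_congr T hp fun q hq => gaugeField_add_smul hf hf' rp c hq,
      lieDeriv_add_smul T c (hd hf) (hd hf')]
  rw [hl, hl, metric_add_smul, maxwell_add_smul, (e p hp).1, (e p hp).2, (e' p hp).1, (e' p hp).2]
  constructor <;> module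

lemma isPureGauge_zero (qe qm rp : ℝ) : IsPureGauge qe qm rp 0 := by
  have h0 : SmoothScalar (0 : ℝ → ℝ → ℝ) := ⟨fun _ => 0, contDiffOn_const, fun _ _ _ => rfl⟩
  refine ⟨0, h0, fun p hp => ?_⟩
  have hξ : gaugeField rp 0 = fun _ => 0 := by
    funext q ρ
    revert ρ
    refine forall_fin_four ?_ ?_ ?_ ?_ <;> simp [gaugeField]
  have hl : ∀ T, lieDeriv (gaugeField rp 0) T p = 0 := fun T => by
    ext μ ν
    simp [lieDeriv, hξ, pd]
  rw [hl, hl, neg_zero]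
  constructor <;> ext μ ν <;> revert μ ν <;>
    refine forall_fin_four ?_ ?_ ?_ ?_ <;> refine forall_fin_four ?_ ?_ ?_ ?_ <;>
    simp [FirstOrderData.metric, FirstOrderData.maxwell, FirstOrderData.F, FirstOrderData.h,
      FirstOrderData.γ, FirstOrderData.Ψ, FirstOrderData.W, FirstOrderData.Z, FirstOrderData.B]

section Gauge

variable {qe qm rp : ℝ}

/-- Some components of `𝓛_ξ g⁽⁰⁾` for a general gauge function. -/
lemma lieDeriv_gaugeField_nhMetric (f : ℝ → ℝ → ℝ) {p : Pt} (hp : p ∈ patch) :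
    lieDeriv (gaugeField rp f) (nhMetric rp) p 0 2
      = -(p 1 ^ 2 / rp ^ 2 * (1 / 2 * deriv (fun s => f s (p 3)) (p 2))) ∧
    lieDeriv (gaugeField rp f) (nhMetric rp) p 0 3
      = -(p 1 ^ 2 / rp ^ 2 * (1 / 2 * deriv (fun s => f (p 2) s) (p 3))) ∧
    lieDeriv (gaugeField rp f) (nhMetric rp) p 3 3
      = p 1 * p 2 * (1 - p 2 ^ 2) / rp ^ 2 * rp ^ 2 * deriv (fun s => f s (p 3)) (p 2)
        - p 1 * (rp ^ 2 * (1 - p 2 ^ 2) * (1 / (rp ^ 2 * (1 - p 2 ^ 2))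
          * deriv (fun t => deriv (fun s => f (p 2) s) t) (p 3))) := by
  have h0 : ∀ ρ, pd 0 (fun q => gaugeField rp f q ρ) p = 0 := by
    refine forall_fin_four ?_ ?_ ?_ ?_ <;> simp [pd, gaugeField]
  have h20 : pd 2 (fun q => gaugeField rp f q 0) p = 1 / 2 * deriv (fun s => f s (p 3)) (p 2) := by
    simp [pd, gaugeField]
  have h30 : pd 3 (fun q => gaugeField rp f q 0) p = 1 / 2 * deriv (fun s => f (p 2) s) (p 3) := by
    simp [pd, gaugeField]
  have h33 : pd 3 (fun q => gaugeField rp f q 3) p = -(1 / 2) * p 1 * (1 / (rp ^ 2 * (1 - p 2 ^ 2))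
      * deriv (fun t => deriv (fun s => f (p 2) s) t) (p 3)) := by
    simp [pd, gaugeField]
  have h1 : ∀ κ, pd κ (fun q => gaugeField rp f q 1) p = 0 := by
    intro κ
    simp [pd, gaugeField]
  refine ⟨?_, ?_, ?_⟩ <;>
    simp only [lieDeriv, Matrix.of_apply, Fin.sum_univ_four, pd_nhMetric rp hp, h0, h20, h30, h33,
      h1] <;>
    simp only [nhMetric, nhMetricDeriv, gaugeField, Matrix.of_apply, Matrix.cons_val,
      Matrix.zero_apply] <;> ring

/-- `𝓛_ξ g⁽⁰⁾` and `𝓛_ξ F⁽⁰⁾` for an axisymmetric gauge function. -/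
lemma lieDeriv_gaugeField_axisymmetric (hrp : 0 < rp) {f f' : ℝ → ℝ} {f'' : ℝ} {p : Pt}
    (hp : p ∈ patch) (hf : ∀ x ∈ Set.Ioo (-1 : ℝ) 1, HasDerivAt f (f' x) x)
    (hf' : HasDerivAt f' f'' (p 2)) :
    lieDeriv (gaugeField rp fun x _ => f x) (nhMetric rp) p =
      -!![0, 0, p 1 ^ 2 * (f' (p 2) / (2 * rp ^ 2)), 0;
          0, 0, 0, 0;
          p 1 ^ 2 * (f' (p 2) / (2 * rp ^ 2)), 0,
            p 1 * (f'' - p 2 * f' (p 2) * (1 - p 2 ^ 2)⁻¹), 0;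
          0, 0, 0, -(p 1 * (p 2 * (1 - p 2 ^ 2) * f' (p 2)))] ∧
    lieDeriv (gaugeField rp fun x _ => f x) (nhMaxwell qe qm rp) p =
      -!![0, 0, 0, 0;
          0, 0, -(qe * f' (p 2) / (2 * rp ^ 2)), qm * (1 - p 2 ^ 2) * f' (p 2) / (2 * rp ^ 2);
          0, qe * f' (p 2) / (2 * rp ^ 2), 0,
            p 1 * (qm * ((1 - p 2 ^ 2) * f'' - 2 * p 2 * f' (p 2)) / (2 * rp ^ 2));
          0, -(qm * (1 - p 2 ^ 2) * f' (p 2) / (2 * rp ^ 2)),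
            -(p 1 * (qm * ((1 - p 2 ^ 2) * f'' - 2 * p 2 * f' (p 2)) / (2 * rp ^ 2))), 0] := by
  set ξ : Pt → Fin 4 → ℝ := fun p =>
    ![(1 / 2) * f (p 2), 0, -(1 / 2) * p 1 * ((1 - (p 2) ^ 2) / rp ^ 2 * f' (p 2)), 0] with hξ
  have hcongr : ∀ T, lieDeriv (gaugeField rp fun x _ => f x) T p = lieDeriv ξ T p := fun T =>
    lieDeriv_congr T hp fun q hq => by
      simp [gaugeField, hξ, (hf _ hq).deriv]
  have hc := (one_sub_sq_pos hp).ne'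
  have hpd : ∀ κ ρ, pd κ (fun q => ξ q ρ) p = (![0,
      ![0, 0, -(1 / 2) * ((1 - (p 2) ^ 2) / rp ^ 2 * f' (p 2)), 0],
      ![(1 / 2) * f' (p 2), 0, -(1 / 2) * p 1 * (-(2 * p 2) / rp ^ 2 * f' (p 2)
        + (1 - (p 2) ^ 2) / rp ^ 2 * f''), 0], 0] : Fin 4 → Fin 4 → ℝ) κ ρ := by
    have hd := ((((hasDerivAt_one_sub_sq (p 2)).div_const (rp ^ 2)).fun_mul hf').const_mul
      (-(1 / 2) * p 1)).deriv
    have h22 : pd 2 (fun q => ξ q 2) p = -(1 / 2) * p 1 * (-(2 * p 2) / rp ^ 2 * f' (p 2)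
        + (1 - (p 2) ^ 2) / rp ^ 2 * f'') := by
      rw [← hd]
      simp [pd, hξ]
    have h20 : pd 2 (fun q => ξ q 0) p = (1 / 2) * f' (p 2) := by
      rw [← (hf _ hp).deriv]
      simp [pd, hξ]
    have h12 : pd 1 (fun q => ξ q 2) p = -(1 / 2) * ((1 - (p 2) ^ 2) / rp ^ 2 * f' (p 2)) := by
      simp [pd, hξ]
    refine forall_fin_four ?_ ?_ ?_ ?_ <;> refine forall_fin_four ?_ ?_ ?_ ?_ <;>
      simp only [Matrix.cons_val, h22, h20, h12, Pi.zero_apply] <;> simp [pd, hξ]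
  rw [hcongr, hcongr]
  constructor <;> ext μ ν <;>
    simp only [lieDeriv, Matrix.of_apply, Fin.sum_univ_four, pd_nhMetric rp hp, pd_nhMaxwell, hpd] <;>
    revert μ ν <;>
    refine forall_fin_four ?_ ?_ ?_ ?_ <;> refine forall_fin_four ?_ ?_ ?_ ?_ <;>
    simp only [nhMetric, nhMaxwell, nhMetricDeriv, hξ, Matrix.neg_apply, Matrix.of_apply,
      Matrix.cons_val, Matrix.zero_apply, Pi.zero_apply, zero_mul, mul_zero, add_zero, zero_add,
      neg_zero] <;>
    first | done | ring1 | (field_simp; done) | (field_simp; ring1)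

/-- The difference of two data with the same moduli is pure gauge. -/
theorem gaugeEquivalent_normalForm (hrp : 0 < rp) {D : FirstOrderData} (hD : D.IsSmooth)
    (ha : D.IsAxisymmetric) {K : ℝ × ℝ × ℝ} (hK : D.profile.IsStandard qe qm rp K) :
    GaugeEquivalent qe qm rp D (normalForm qe qm rp K.1 K.2.1 K.2.2) := by
  set N := normalForm qe qm rp K.1 K.2.1 K.2.2 with hN
  have hNs : N.IsSmooth := isSmooth_normalForm _ _ _
  have hE : D - N = D + (-1 : ℝ) • N := by module
  have hEs : (D - N).IsSmooth := hE ▸ hD.add_smul (-1) hNs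
  have hEa : (D - N).IsAxisymmetric := hE ▸ ha.add_smul (-1) (isAxisymmetric_normalForm _ _ _)
  have hEK : (D - N).profile.IsStandard qe qm rp 0 := by
    have := isStandard_add_smul (-1) hD hNs hK (isStandard_normalForm K.1 K.2.1 K.2.2 hrp)
    rw [← hE] at this
    convert this using 1
    module
  unfold GaugeEquivalent
  generalize D - N = E at *
  -- The `vx` component of the gauge variation is `r² f'/(2 rp²)`, so `f` must be a potential of `2
  -- rp² h`. As the moduli of the difference vanish, `h` has no `dφ` component.
  have hw : SmoothCovector (0 + (2 * rp ^ 2) • E.h) :=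
    SmoothCovector.add_smul _ ⟨fun _ => 0, contDiffOn_const, fun _ _ _ _ => by simp⟩ hEs.2.1
  obtain ⟨f, hfs, hf⟩ := hw.exists_potential
    (fun x hx φ => by simp [(hEa x hx φ 0).2.1])
    (fun x hx φ => by
      have : E.h x 0 1 = 0 := (hEK.h₁ x hx).trans (by simp)
      simp [(hEa x hx φ 0).2.1, this])
  refine ⟨fun x _ => f x, hfs, fun p hp => ?_⟩
  have hf1 : ∀ x ∈ Set.Ioo (-1 : ℝ) 1, HasDerivAt f (2 * rp ^ 2 * E.profile.h₀ x) x := fun x hx => by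
    refine (hf x hx).congr_deriv ?_
    simp [FirstOrderData.profile]
  have hf2 : HasDerivAt (fun x => 2 * rp ^ 2 * E.profile.h₀ x)
      (2 * rp ^ 2 * deriv E.profile.h₀ (p 2)) (p 2) :=
    (Profile.hasDerivAt_of_contDiffOn (hEs.2.1.contDiffOn 0) hp).const_mul _
  obtain ⟨e1, e2⟩ := lieDeriv_gaugeField_axisymmetric (qe := qe) (qm := qm) hrp hp hf1 hf2
  have hc := (one_sub_sq_pos hp).ne'
  rw [e1, e2, E.metric_eqOn_profile hEs hEa hp, E.maxwell_eqOn_profile hEs hEa hp, neg_neg, neg_neg]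
  constructor <;>
    simp only [Profile.metric, Profile.maxwell, hEK.F _ hp, hEK.h₁ _ hp, hEK.γ₀₀ _ hp,
      hEK.γ₀₁ _ hp, hEK.γ₁₁ _ hp, hEK.Ψ _ hp, hEK.W₀ _ hp, hEK.W₁ _ hp, hEK.Z₀ _ hp, hEK.Z₁ _ hp,
      hEK.B _ hp, Prod.fst_zero, Prod.snd_zero] <;>
    ext μ ν <;> revert μ ν <;>
    refine forall_fin_four ?_ ?_ ?_ ?_ <;> refine forall_fin_four ?_ ?_ ?_ ?_ <;>
    simp only [Matrix.of_apply, Matrix.cons_val] <;>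
    first | ring1 | field_simp

/-- The moduli are gauge invariant. -/
theorem eq_of_gaugeEquivalent_normalForm (hrp : 0 < rp) {D : FirstOrderData}
    (ha : D.IsAxisymmetric) {K K' : ℝ × ℝ × ℝ} (hK : D.profile.IsStandard qe qm rp K)
    (h : GaugeEquivalent qe qm rp D (normalForm qe qm rp K'.1 K'.2.1 K'.2.2)) : K' = K := by
  obtain ⟨f, hf, h⟩ := h
  set N := normalForm qe qm rp K'.1 K'.2.1 K'.2.2 with hN
  have hE : D - N = D + (-1 : ℝ) • N := by module
  rw [hE] at h
  have hNK := isStandard_normalForm (qe := qe) (qm := qm) K'.1 K'.2.1 K'.2.2 hrp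
  rw [← hN] at hNK
  have hN0 : ∀ x, N.profile.h₀ x = K'.2.2 * x / (2 * rp ^ 2) := fun x => rfl
  have hmem : ∀ x ∈ Set.Ioo (-1 : ℝ) 1, ∀ φ, (![0, 1, x, φ] : Pt) ∈ patch := fun x hx φ => hx
  have hm : ∀ x ∈ Set.Ioo (-1 : ℝ) 1, ∀ φ μ ν, D.metric ![0, 1, x, φ] μ ν
      - N.metric ![0, 1, x, φ] μ ν = -lieDeriv (gaugeField rp f) (nhMetric rp) ![0, 1, x, φ] μ ν := by
    intro x hx φ μ ν
    have := congrFun (congrFun (h _ (hmem x hx φ)).1 μ) ν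
    rw [metric_add_smul] at this
    simp only [Matrix.add_apply, Matrix.smul_apply, smul_eq_mul, Matrix.neg_apply] at this
    rw [← this]
    ring
  have hφ : ∀ x ∈ Set.Ioo (-1 : ℝ) 1, ∀ φ, deriv (fun s => f x s) φ
      = 2 * rp ^ 2 * (D.profile.h₁ x - N.profile.h₁ x) := by
    intro x hx φ
    have := hm x hx φ 0 3
    rw [(lieDeriv_gaugeField_nhMetric f (hmem x hx φ)).2.1] at this
    simp only [FirstOrderData.metric, Matrix.of_apply, Matrix.cons_val,
      (ha x hx φ 0).2.1, one_pow, one_mul] at this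
    have e : D.h x 0 1 - N.h x 0 1 = D.profile.h₁ x - N.profile.h₁ x := rfl
    rw [show N.h x φ 1 = N.h x 0 1 from rfl, e] at this
    rw [this]
    field_simp
  -- The `φ`-derivative of `f` does not depend on `φ`, and it vanishes somewhere by Rolle's theorem,
  -- since `f` is `2π`-periodic. Hence `f` is axisymmetric and `h₁` is gauge invariant.
  have hh₁ : ∀ x ∈ Set.Ioo (-1 : ℝ) 1, D.profile.h₁ x - N.profile.h₁ x = 0 := by
    intro x hx
    obtain ⟨φ, -, hr⟩ := exists_deriv_eq_zero (f := fun s => f x s) (a := 0) (b := 2 * Real.pi)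
      (by positivity) (fun φ _ => (hf.hasDerivAt_snd hx φ).continuousAt.continuousWithinAt) (by
        obtain ⟨A, -, hA⟩ := hf
        simp only [hA x hx, spherePoint, Real.cos_zero, Real.sin_zero, Real.cos_two_pi,
          Real.sin_two_pi])
    rw [hφ x hx φ] at hr
    exact (mul_eq_zero.1 hr).resolve_left (by positivity)
  have hh₀ : ∀ x ∈ Set.Ioo (-1 : ℝ) 1, deriv (fun s => f s 0) x
      = 2 * rp ^ 2 * (D.profile.h₀ x - N.profile.h₀ x) := by
    intro x hx
    have := hm x hx 0 0 2
    rw [(lieDeriv_gaugeField_nhMetric f (hmem x hx 0)).1] at this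
    simp only [FirstOrderData.metric, Matrix.of_apply, Matrix.cons_val, one_pow, one_mul] at this
    have e : D.h x 0 0 - N.h x 0 0 = D.profile.h₀ x - N.profile.h₀ x := rfl
    rw [← e, this]
    field_simp
  -- Equivalently, `γ₁₁ + 2 rp² x (1 - x²) h₀` is gauge invariant. For standard data it equals `(K₂
  -- + K₃ x²)(1 - x²)`.
  have hγ : ∀ x ∈ Set.Ioo (-1 : ℝ) 1, D.profile.γ₁₁ x - N.profile.γ₁₁ x
      = -(x * (1 - x ^ 2) * (2 * rp ^ 2 * (D.profile.h₀ x - N.profile.h₀ x))) := by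
    intro x hx
    have := hm x hx 0 3 3
    rw [(lieDeriv_gaugeField_nhMetric f (hmem x hx 0)).2.2] at this
    have e : D.γ x 0 1 1 - N.γ x 0 1 1 = D.profile.γ₁₁ x - N.profile.γ₁₁ x := rfl
    simp only [FirstOrderData.metric, Matrix.of_apply, Matrix.cons_val, one_mul,
      funext (hφ x hx), deriv_const, mul_zero, sub_zero] at this
    rw [← e, this, hh₀ x hx]
    field_simp
  -- Evaluation at `x = 0` gives `K₂`; evaluation at `x = 1/2` gives `K₁` and `K₃`.
  have m0 : (0 : ℝ) ∈ Set.Ioo (-1 : ℝ) 1 := by norm_num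
  have m1 : (1 / 2 : ℝ) ∈ Set.Ioo (-1 : ℝ) 1 := by norm_num
  have k1 := hh₁ _ m1
  rw [hK.h₁ _ m1, hNK.h₁ _ m1] at k1
  have k2 := hγ _ m0
  rw [hK.γ₁₁ _ m0, hNK.γ₁₁ _ m0] at k2
  have k3 := hγ _ m1
  rw [hK.γ₁₁ _ m1, hNK.γ₁₁ _ m1, hN0] at k3
  field_simp at k1 k3
  norm_num at k1 k2 k3
  ext
  · linarith
  · linarith
  · linarith

end Gauge

/-! ### The moduli spaces -/

section Moduli

variable {qe qm rp : ℝ}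

/-- For standard data `F` is constant and `h₀` is independent of `φ`, so the only possible
obstruction is `h₁'`, a nonzero function times `K₁`. -/
lemma isStatic_iff (hrp : 0 < rp) {D : FirstOrderData} (ha : D.IsAxisymmetric) {K : ℝ × ℝ × ℝ}
    (hK : D.profile.IsStandard qe qm rp K) : D.IsStatic ↔ K.1 = 0 := by
  have hd : ∀ x ∈ Set.Ioo (-1 : ℝ) 1, ∀ φ, deriv (fun s => D.h s φ 1) x
      = 2 * K.1 / rp ^ 2 * (1 - 3 * x ^ 2) := fun x hx φ => by
    refine deriv_eq_of_eqOn (w := fun x => 2 * K.1 / rp ^ 2 * (x * (1 - x ^ 2))) hx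
      (fun s hs => by rw [(ha s hs φ 0).2.1]; exact hK.h₁ s hs) ?_
    exact (((hasDerivAt_id' x).fun_mul (hasDerivAt_one_sub_sq x)).const_mul _).congr_deriv (by ring)
  have hφ : ∀ x ∈ Set.Ioo (-1 : ℝ) 1, ∀ φ, deriv (fun s => D.h x s 0) φ = 0 := fun x hx φ => by
    rw [show (fun s => D.h x s 0) = fun _ => D.h x 0 0 from funext fun s => by
      rw [(ha x hx s 0).2.1], deriv_const]
  constructor
  · intro h
    have h0 : (0 : ℝ) ∈ Set.Ioo (-1 : ℝ) 1 := by norm_num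
    have e := (h 0 h0 0).1
    rw [hd 0 h0, hφ 0 h0] at e
    field_simp at e
    linarith
  · intro h x hx φ
    refine ⟨by rw [hd x hx, hφ x hx, h]; simp, ?_, ?_⟩
    · exact deriv_eq_of_eqOn hx (fun s hs => by rw [(ha s hs φ 0).1]; exact hK.F s hs)
        (hasDerivAt_const _ _)
    · rw [show (fun s => D.F x s) = fun _ => D.F x 0 from funext fun s => (ha x hx s 0).1,
        deriv_const]

/-- The axisymmetric deformations as a vector space. -/
def axisymmetricSubmodule (hrp : 0 < rp) (hq : qe ^ 2 + qm ^ 2 = rp ^ 2) :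
    Submodule ℝ FirstOrderData where
  carrier := axisymmetricDeformations qe qm rp
  zero_mem' := by
    have h := normalForm_mem (qe := qe) (qm := qm) 0 0 0 hrp hq
    have e : normalForm qe qm rp 0 0 0 + (-1 : ℝ) • normalForm qe qm rp 0 0 0 = 0 := by module
    rw [← e]
    rw [mem_axisymmetricDeformations_iff hrp hq] at h ⊢
    obtain ⟨hs, ha, K, hK⟩ := h
    exact ⟨hs.add_smul _ hs, ha.add_smul _ ha, _, isStandard_add_smul _ hs hs hK hK⟩
  add_mem' := by
    intro D D' h h'
    rw [mem_axisymmetricDeformations_iff hrp hq] at h h' ⊢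
    obtain ⟨hs, ha, K, hK⟩ := h
    obtain ⟨hs', ha', K', hK'⟩ := h'
    have e : D + D' = D + (1 : ℝ) • D' := by module
    rw [e]
    exact ⟨hs.add_smul _ hs', ha.add_smul _ ha', _, isStandard_add_smul _ hs hs' hK hK'⟩
  smul_mem' := by
    intro c D h
    rw [mem_axisymmetricDeformations_iff hrp hq] at h ⊢
    obtain ⟨hs, ha, K, hK⟩ := h
    -- Closure is available for expressions of the form `D + c • D'`; this rewriting brings scalar
    -- multiples into that form without appeal to the zero element.
    have e : c • D = D + (c - 1) • D := by module
    rw [e]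
    exact ⟨hs.add_smul _ hs, ha.add_smul _ ha, _, isStandard_add_smul _ hs hs hK hK⟩

/-- The pure gauge data as a vector space. -/
def pureGaugeSubmodule (qe qm rp : ℝ) : Submodule ℝ FirstOrderData where
  carrier := {D | IsPureGauge qe qm rp D}
  zero_mem' := isPureGauge_zero qe qm rp
  add_mem' := by
    intro D D' h h'
    have e : D + D' = D + (1 : ℝ) • D' := by module
    exact e ▸ IsPureGauge.add_smul 1 h h'
  smul_mem' := by
    intro c D h
    have e : c • D = 0 + c • D := by module
    exact e ▸ IsPureGauge.add_smul c (isPureGauge_zero qe qm rp) h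

lemma normalForm_add_smul (K K' : ℝ × ℝ × ℝ) (c : ℝ) :
    normalForm qe qm rp (K + c • K').1 (K + c • K').2.1 (K + c • K').2.2
      = normalForm qe qm rp K.1 K.2.1 K.2.2 + c • normalForm qe qm rp K'.1 K'.2.1 K'.2.2 := by
  simp only [Prod.fst_add, Prod.snd_add, Prod.smul_fst, Prod.smul_snd, smul_eq_mul]
  refine Prod.ext ?_ (Prod.ext ?_ (Prod.ext ?_ (Prod.ext ?_ (Prod.ext ?_ (Prod.ext ?_ ?_))))) <;>
    funext x φ <;>
    simp only [normalForm, Prod.fst_add, Prod.snd_add, Prod.smul_fst, Prod.smul_snd, Pi.add_apply,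
      Pi.smul_apply, smul_eq_mul]
  · ring
  · refine funext (Fin.forall_fin_two.2 ⟨?_, ?_⟩) <;>
      simp only [Pi.add_apply, Pi.smul_apply, smul_eq_mul, Matrix.cons_val] <;> ring
  · refine Matrix.ext (Fin.forall_fin_two.2 ⟨Fin.forall_fin_two.2 ⟨?_, ?_⟩,
      Fin.forall_fin_two.2 ⟨?_, ?_⟩⟩) <;>
      simp only [Matrix.add_apply, Matrix.smul_apply, smul_eq_mul, Matrix.of_apply,
        Matrix.cons_val] <;> ring
  · ring
  · refine funext (Fin.forall_fin_two.2 ⟨?_, ?_⟩) <;>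
      simp only [Pi.add_apply, Pi.smul_apply, smul_eq_mul, Matrix.cons_val] <;> ring
  · refine funext (Fin.forall_fin_two.2 ⟨?_, ?_⟩) <;>
      simp only [Pi.add_apply, Pi.smul_apply, smul_eq_mul, Matrix.cons_val] <;> ring
  · refine Matrix.ext (Fin.forall_fin_two.2 ⟨Fin.forall_fin_two.2 ⟨?_, ?_⟩,
      Fin.forall_fin_two.2 ⟨?_, ?_⟩⟩) <;>
      simp only [Matrix.add_apply, Matrix.smul_apply, smul_eq_mul, Matrix.of_apply,
        Matrix.cons_val] <;> ring

/-- The normal form as a linear function of the moduli. -/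
def normalFormLinear (qe qm rp : ℝ) : (ℝ × ℝ × ℝ) →ₗ[ℝ] FirstOrderData where
  toFun K := normalForm qe qm rp K.1 K.2.1 K.2.2
  map_add' K K' := by
    have h := normalForm_add_smul (qe := qe) (qm := qm) (rp := rp) K K' 1
    rwa [one_smul, one_smul] at h
  map_smul' c K := by
    have h := normalForm_add_smul (qe := qe) (qm := qm) (rp := rp) K K (c - 1)
    rw [show K + (c - 1) • K = c • K by module] at h
    rw [h, RingHom.id_apply]
    module

theorem existsUnique_moduli (hrp : 0 < rp) (hq : qe ^ 2 + qm ^ 2 = rp ^ 2) {D : FirstOrderData} (hD : D ∈ axisymmetricDeformations qe qm rp) :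
    ∃! K : ℝ × ℝ × ℝ, GaugeEquivalent qe qm rp D (normalForm qe qm rp K.1 K.2.1 K.2.2) := by
  obtain ⟨hs, ha, K, hK⟩ := (mem_axisymmetricDeformations_iff hrp hq).1 hD
  exact ⟨K, gaugeEquivalent_normalForm hrp hs ha hK, fun K' h =>
    eq_of_gaugeEquivalent_normalForm hrp ha hK h⟩

theorem isStatic_iff_of_gaugeEquivalent (hrp : 0 < rp) (hq : qe ^ 2 + qm ^ 2 = rp ^ 2)
    {D : FirstOrderData} (hD : D ∈ axisymmetricDeformations qe qm rp) {K₁ K₂ K₃ : ℝ}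
    (h : GaugeEquivalent qe qm rp D (normalForm qe qm rp K₁ K₂ K₃)) : D.IsStatic ↔ K₁ = 0 := by
  obtain ⟨hs, ha, K, hK⟩ := (mem_axisymmetricDeformations_iff hrp hq).1 hD
  have e : (K₁, K₂, K₃) = K := eq_of_gaugeEquivalent_normalForm hrp ha hK h
  rw [isStatic_iff hrp ha hK, ← e]

lemma eq_zero_of_isPureGauge_normalForm (hrp : 0 < rp) {K : ℝ × ℝ × ℝ}
    (h : IsPureGauge qe qm rp (normalForm qe qm rp K.1 K.2.1 K.2.2)) : K = 0 := by
  have h0 : normalForm qe qm rp (0 : ℝ × ℝ × ℝ).1 (0 : ℝ × ℝ × ℝ).2.1 (0 : ℝ × ℝ × ℝ).2.2 = 0 :=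
    (normalFormLinear qe qm rp).map_zero
  refine (eq_of_gaugeEquivalent_normalForm (qe := qe) (qm := qm) (K' := 0) hrp
    (isAxisymmetric_normalForm _ _ _) (isStandard_normalForm K.1 K.2.1 K.2.2 hrp) ?_).symm
  rw [GaugeEquivalent, h0, sub_zero]
  exact h

/-- A linear map into `𝒟` whose image meets `𝒢` trivially, and represents every class modulo `𝒢`,
induces an isomorphism onto the quotient. -/
lemma finrank_quotient_submoduleOf {V W : Type*} [AddCommGroup V] [Module ℝ V] [AddCommGroup W]
    [Module ℝ W] {𝒟 𝒢 : Submodule ℝ V} (Φ : W →ₗ[ℝ] V) (hmem : ∀ K, Φ K ∈ 𝒟)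
    (hinj : ∀ K, Φ K ∈ 𝒢 → K = 0) (hsurj : ∀ D ∈ 𝒟, ∃ K, D - Φ K ∈ 𝒢) :
    Module.finrank ℝ (𝒟 ⧸ 𝒢.submoduleOf 𝒟) = Module.finrank ℝ W := by
  let Ψ : W →ₗ[ℝ] 𝒟 ⧸ 𝒢.submoduleOf 𝒟 := (𝒢.submoduleOf 𝒟).mkQ ∘ₗ Φ.codRestrict 𝒟 hmem
  refine (LinearEquiv.ofBijective Ψ ⟨?_, ?_⟩).finrank_eq.symm
  · rw [← LinearMap.ker_eq_bot, LinearMap.ker_eq_bot']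
    intro K hK
    exact hinj K ((Submodule.Quotient.mk_eq_zero (𝒢.submoduleOf 𝒟)).1 hK)
  · intro q
    obtain ⟨D, rfl⟩ := Submodule.mkQ_surjective _ q
    obtain ⟨K, hK⟩ := hsurj D D.2
    refine ⟨K, ((Submodule.Quotient.eq _).2 ?_).symm⟩
    exact hK

/-- The normal forms are a linear slice for the gauge action: all of `ℝ³` for the axisymmetric
deformations, the plane `K₁ = 0` for the static ones. -/
theorem exists_moduli_spaces (hrp : 0 < rp) (hq : qe ^ 2 + qm ^ 2 = rp ^ 2) :
    ∃ 𝒟 𝒮 𝒢 : Submodule ℝ FirstOrderData,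
      (𝒟 : Set FirstOrderData) = axisymmetricDeformations qe qm rp ∧
      (𝒮 : Set FirstOrderData) = staticDeformations qe qm rp ∧
      (𝒢 : Set FirstOrderData) = {D | IsPureGauge qe qm rp D} ∧
      Module.finrank ℝ (𝒟 ⧸ 𝒢.submoduleOf 𝒟) = 3 ∧
      Module.finrank ℝ (𝒮 ⧸ 𝒢.submoduleOf 𝒮) = 2 := by
  have hst : ∀ {D}, D ∈ staticDeformations qe qm rp ↔ D.IsSmooth ∧ D.IsAxisymmetric ∧
      ∃ K : ℝ × ℝ × ℝ, D.profile.IsStandard qe qm rp K ∧ K.1 = 0 := by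
    intro D
    constructor
    · rintro ⟨h, hS⟩
      obtain ⟨hs, ha, K, hK⟩ := (mem_axisymmetricDeformations_iff hrp hq).1 h
      exact ⟨hs, ha, K, hK, (isStatic_iff hrp ha hK).1 hS⟩
    · rintro ⟨hs, ha, K, hK, h0⟩
      exact ⟨(mem_axisymmetricDeformations_iff hrp hq).2 ⟨hs, ha, K, hK⟩,
        (isStatic_iff hrp ha hK).2 h0⟩
  let 𝒮 : Submodule ℝ FirstOrderData :=
    { carrier := staticDeformations qe qm rp
      zero_mem' := ⟨(axisymmetricSubmodule hrp hq).zero_mem, fun x _ φ => by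
        have h1 : (fun s => (0 : FirstOrderData).h s φ 1) = fun _ => 0 := rfl
        have h2 : (fun s => (0 : FirstOrderData).h x s 0) = fun _ => 0 := rfl
        have h3 : (fun s => (0 : FirstOrderData).F s φ) = fun _ => 0 := rfl
        have h4 : (fun s => (0 : FirstOrderData).F x s) = fun _ => 0 := rfl
        simp [h1, h2, h3, h4]⟩
      add_mem' := by
        intro D D' h h'
        rw [hst] at h h' ⊢
        obtain ⟨hs, ha, K, hK, h0⟩ := h
        obtain ⟨hs', ha', K', hK', h0'⟩ := h'
        have e : D + D' = D + (1 : ℝ) • D' := by module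
        rw [e]
        exact ⟨hs.add_smul _ hs', ha.add_smul _ ha', _, isStandard_add_smul _ hs hs' hK hK',
          by simp [h0, h0']⟩
      smul_mem' := by
        intro c D h
        rw [hst] at h ⊢
        obtain ⟨hs, ha, K, hK, h0⟩ := h
        have e : c • D = D + (c - 1) • D := by module
        rw [e]
        exact ⟨hs.add_smul _ hs, ha.add_smul _ ha, _, isStandard_add_smul _ hs hs hK hK,
          by simp [h0]⟩ }
  refine ⟨axisymmetricSubmodule hrp hq, 𝒮, pureGaugeSubmodule qe qm rp, rfl, rfl, rfl, ?_, ?_⟩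
  · rw [finrank_quotient_submoduleOf (normalFormLinear qe qm rp)]
    · simp
    · exact fun K => normalForm_mem _ _ _ hrp hq
    · exact fun K hK => eq_zero_of_isPureGauge_normalForm hrp hK
    · intro D hD
      obtain ⟨K, hK, -⟩ := existsUnique_moduli hrp hq hD
      exact ⟨K, hK⟩
  · rw [finrank_quotient_submoduleOf ((normalFormLinear qe qm rp).comp (LinearMap.inr ℝ ℝ (ℝ × ℝ)))]
    · simp
    · exact fun K => hst.2 ⟨isSmooth_normalForm _ _ _, isAxisymmetric_normalForm _ _ _, _,
        isStandard_normalForm _ _ _ hrp, rfl⟩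
    · intro K hK
      have := eq_zero_of_isPureGauge_normalForm (K := (0, K)) hrp hK
      exact (Prod.ext_iff.1 this).2
    · intro D hD
      obtain ⟨K, hK, -⟩ := existsUnique_moduli hrp hq hD.1
      have h1 := (isStatic_iff_of_gaugeEquivalent hrp hq hD.1 hK).1 hD.2
      refine ⟨K.2, ?_⟩
      have e : (normalFormLinear qe qm rp).comp (LinearMap.inr ℝ ℝ (ℝ × ℝ)) K.2
          = normalForm qe qm rp K.1 K.2.1 K.2.2 := by
        rw [h1]; rfl
      rw [e]
      exact hK

end Moduli

/-! ### Extreme horizons of circular spacetimes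

A circular spacetime with an extreme horizon at `s = 0` is described by the coefficients of
`-s² n dt² + (n V² / s² + l) ds² + Q dz² + X (dψ - s³ w dt)²` and of the Maxwell field with
potentials `α` and `β`, as functions of the distance `s` from the horizon and of a coordinate `z`
that is adapted to the round sphere. -/

/-- The neighbourhood `|s| < η` of a horizon, in coordinates `(s, z)`. -/
def collar (η : ℝ) : Set (ℝ × ℝ) := Set.Ioo (-η) η ×ˢ Set.Ioo (-1) 1

lemma isOpen_collar (η : ℝ) : IsOpen (collar η) := isOpen_Ioo.prod isOpen_Ioo

/-- The coefficients of a circular spacetime near an extreme horizon, with the parameters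
`p₀, p₁, p₂` of the coordinate change to Gaussian null coordinates. -/
structure HorizonData where
  n : ℝ × ℝ → ℝ
  l : ℝ × ℝ → ℝ
  Q : ℝ × ℝ → ℝ
  X : ℝ × ℝ → ℝ
  w : ℝ × ℝ → ℝ
  μ : ℝ × ℝ → ℝ
  ν : ℝ × ℝ → ℝ
  α : ℝ × ℝ → ℝ
  β : ℝ × ℝ → ℝ
  V : ℝ → ℝ
  k : ℝ
  V₀ : ℝ
  p₀ : ℝ
  p₁ : ℝ
  p₂ : ℝ
  qe : ℝ
  qm : ℝ
  rp : ℝ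
  K₂ : ℝ
  K₃ : ℝ

/-- The partial derivative with respect to `s`. -/
def pds (u : ℝ × ℝ → ℝ) (q : ℝ × ℝ) : ℝ := fderiv ℝ u q (1, 0)

/-- The partial derivative with respect to `z`. -/
def pdz (u : ℝ × ℝ → ℝ) (q : ℝ × ℝ) : ℝ := fderiv ℝ u q (0, 1)

namespace HorizonData

variable (E : HorizonData)

/-- The `r²` coefficient of `s`. -/
def shift (x : ℝ) : ℝ := E.p₀ + E.p₁ * x + E.p₂ * x ^ 2

def shiftDeriv (x : ℝ) : ℝ := E.p₁ + 2 * E.p₂ * x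

/-- The `r` coefficient of `s`. -/
def slope : ℝ := E.V₀ / E.rp ^ 2

/-- The regular part of `t - v`. -/
def delay (x : ℝ) : ℝ := E.rp ^ 4 / E.V₀ * E.shift x - E.K₃ / 4 * x ^ 2

/-- With this value the `dv dx` term of order `ε` is `r² h_x` with `h_x = K₃ x/(2 rp²)`, as in the
normal form. -/
def delayDeriv (x : ℝ) : ℝ := E.rp ^ 4 / E.V₀ * E.shiftDeriv x - E.K₃ / 2 * x

/-- The `r` coefficient of `z`. -/
def bend (x : ℝ) : ℝ := -(E.delayDeriv x * (1 - x ^ 2)) / E.rp ^ 2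

/-- The function `bend` is fixed by the vanishing of the `dr dx` term of order `ε`. The delay
contributes its derivative to that term and the sphere metric contributes `rp² bend/(1 - x²)`. -/
def bendDeriv (x : ℝ) : ℝ :=
  -((E.rp ^ 4 / E.V₀ * (2 * E.p₂) - E.K₃ / 2) * (1 - x ^ 2) - E.delayDeriv x * (2 * x)) / E.rp ^ 2

/-- The conditions on the coefficients at a horizon with the transverse deformation
`normalForm qe qm rp 0 K₂ K₃`. -/
structure IsRegular (η : ℝ) : Prop where
  η_pos : 0 < η
  k_pos : 0 < E.k
  V₀_pos : 0 < E.V₀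
  rp_pos : 0 < E.rp
  smooth : ∀ u ∈ [E.n, E.l, E.Q, E.X, E.w, E.μ, E.ν, E.α, E.β], ContDiffOn ℝ ∞ u (collar η)
  smooth_V : ContDiffOn ℝ ∞ E.V (Set.Ioo (-η) η)
  V_zero : E.V 0 = E.V₀
  -- The value is `rp⁴ F`. Once the `dv dr` term is normalised, the `dv²` term of order `ε` depends
  -- only on `V'(0)`.
  V_deriv : HasDerivAt E.V (E.K₂ + E.K₃ / 3) 0
  n_zero : ∀ z ∈ Set.Ioo (-1 : ℝ) 1, E.n (0, z) = E.rp ^ 2 / E.V₀ ^ 2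
  Q_zero : ∀ z ∈ Set.Ioo (-1 : ℝ) 1, E.Q (0, z) = E.rp ^ 2 * (1 - z ^ 2)⁻¹
  X_zero : ∀ z ∈ Set.Ioo (-1 : ℝ) 1, E.X (0, z) = E.rp ^ 2 / E.k ^ 2 * (1 - z ^ 2)
  μ_zero : ∀ z ∈ Set.Ioo (-1 : ℝ) 1, E.μ (0, z) = E.k / E.V₀
  ν_zero : ∀ z ∈ Set.Ioo (-1 : ℝ) 1, E.ν (0, z) = E.k / (E.V₀ * (1 - z ^ 2))
  α_zero : ∀ z ∈ Set.Ioo (-1 : ℝ) 1, HasDerivAt (fun z => E.α (0, z)) (E.qm / E.k) z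
  β_zero : ∀ z ∈ Set.Ioo (-1 : ℝ) 1, HasDerivAt (fun z => E.β (0, z)) (-(E.qe / E.k)) z
  -- Absence of a `dv dr` correction of order `ε`. For a given solution this condition determines
  -- `shift`.
  n_deriv : ∀ z ∈ Set.Ioo (-1 : ℝ) 1, HasDerivAt (fun s => E.n (s, z))
    (-(2 * E.shift z * E.rp ^ 6 / E.V₀ ^ 4 + E.rp ^ 2 * (E.K₂ + E.K₃ / 3) / E.V₀ ^ 3)) 0
  -- The derivative of a coefficient along the scaling is `r (slope ∂_s + bend ∂_z)`. This and the
  -- following conditions are the required components of the normal form, solved for the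
  -- `s`-derivatives.
  Q_deriv : ∀ z ∈ Set.Ioo (-1 : ℝ) 1, HasDerivAt (fun s => E.Q (s, z))
    ((E.K₂ / (1 - z ^ 2) + E.K₃ - 2 * z * E.rp ^ 2 * E.bend z / (1 - z ^ 2) ^ 2
      - 2 * E.rp ^ 2 * E.bendDeriv z / (1 - z ^ 2)) / E.slope) 0
  X_deriv : ∀ z ∈ Set.Ioo (-1 : ℝ) 1, HasDerivAt (fun s => E.X (s, z))
    ((E.K₂ * (1 - z ^ 2) + 2 * z * E.rp ^ 2 * E.bend z) / (E.k ^ 2 * E.slope)) 0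
  μ_deriv : ∀ z ∈ Set.Ioo (-1 : ℝ) 1, HasDerivAt (fun s => E.μ (s, z))
    (E.k * (E.bendDeriv z / (E.V₀ * E.slope) - (2 * E.shift z / (E.rp ^ 2 * E.slope)
      + (2 * E.K₂ + E.K₃ * (1 - z ^ 2)) / (2 * E.rp ^ 4)) / E.slope ^ 2)) 0
  α_deriv : ∀ z ∈ Set.Ioo (-1 : ℝ) 1, HasDerivAt (fun s => E.α (s, z))
    (-(E.qm / E.k) * E.bend z / E.slope) 0
  β_deriv : ∀ z ∈ Set.Ioo (-1 : ℝ) 1, HasDerivAt (fun s => E.β (s, z))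
    (E.qe / E.k * E.bend z / E.slope) 0

/-! #### The scaled frame and the scaled fields -/

/-- `s / ε` at the point `(ε r, x)`. -/
def dist (ε r x : ℝ) : ℝ := r * (E.slope + E.shift x * (ε * r))

/-- The coordinates `(s, z)` of the point `(ε r, x)`. -/
def point (ε r x : ℝ) : ℝ × ℝ := (ε * E.dist ε r x, x + ε * r * E.bend x)

/-- The components of the 1-forms `ε (dv + τ' dx)`, `ε⁻¹ ds`, `dz`, `dψ`, pulled back by the
scaling map. -/
def frame (ε r x : ℝ) : Matrix (Fin 4) (Fin 4) ℝ :=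
  !![1, 0, ε * E.delayDeriv x, 0;
     0, E.slope + 2 * E.shift x * (ε * r), ε * r ^ 2 * E.shiftDeriv x, 0;
     0, ε * E.bend x, 1 + ε * r * E.bendDeriv x, 0;
     0, 0, 0, E.k]

/-- The components of the metric with respect to `frame`. -/
def metricForm (ε S : ℝ) (q : ℝ × ℝ) : Matrix (Fin 4) (Fin 4) ℝ :=
  !![-(S ^ 2 * E.n q) + ε ^ 4 * (S ^ 6 * E.X q * E.w q ^ 2),
      E.n q * E.V q.1 - ε ^ 4 * (S ^ 4 * E.X q * E.w q ^ 2 * E.V q.1), 0,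
      -(ε ^ 2 * (S ^ 3 * E.X q * E.w q));
     E.n q * E.V q.1 - ε ^ 4 * (S ^ 4 * E.X q * E.w q ^ 2 * E.V q.1),
      ε ^ 2 * E.l q + ε ^ 4 * (S ^ 2 * E.X q * E.w q ^ 2 * E.V q.1 ^ 2), 0,
      ε ^ 2 * (S * E.X q * E.w q * E.V q.1);
     0, 0, E.Q q, 0;
     -(ε ^ 2 * (S ^ 3 * E.X q * E.w q)), ε ^ 2 * (S * E.X q * E.w q * E.V q.1), 0, E.X q]

/-- The electric field along `s`. -/
def electricS (s : ℝ) (q : ℝ × ℝ) : ℝ := -(s ^ 3 * (E.w q * pds E.α q)) - E.μ q * pdz E.β q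

/-- The electric field along `z`, divided by `s²`. -/
def electricZ (s : ℝ) (q : ℝ × ℝ) : ℝ := -(s * (E.w q * pdz E.α q)) + E.ν q * pds E.β q

/-- The components of the Maxwell field with respect to `frame`. -/
def maxwellForm (ε S : ℝ) (q : ℝ × ℝ) : Matrix (Fin 4) (Fin 4) ℝ :=
  !![0, -E.electricS (ε * S) q, -(ε * (S ^ 2 * E.electricZ (ε * S) q)), 0;
     E.electricS (ε * S) q, 0, ε * (E.V q.1 * E.electricZ (ε * S) q), ε * pds E.α q;
     ε * (S ^ 2 * E.electricZ (ε * S) q), -(ε * (E.V q.1 * E.electricZ (ε * S) q)), 0, pdz E.α q;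
     0, -(ε * pds E.α q), -pdz E.α q, 0]

/-- The pull-back of a tensor with components `T` with respect to `frame`. -/
def pull (T : ℝ → ℝ → ℝ × ℝ → Matrix (Fin 4) (Fin 4) ℝ) (ε r x : ℝ) : Matrix (Fin 4) (Fin 4) ℝ :=
  Matrix.of fun μ ν => ∑ a, ∑ b, E.frame ε r x a μ * E.frame ε r x b ν *
    T ε (E.dist ε r x) (E.point ε r x) a b

/-- The metric in the coordinates `(v, r, x, φ)`. -/
def nullMetric (q : ℝ × ℝ) : Matrix (Fin 4) (Fin 4) ℝ := E.pull E.metricForm 1 q.1 q.2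

/-- The Maxwell field in the coordinates `(v, r, x, φ)`. -/
def nullMaxwell (q : ℝ × ℝ) : Matrix (Fin 4) (Fin 4) ℝ := E.pull E.maxwellForm 1 q.1 q.2

lemma dist_scale (ε r x : ℝ) : E.dist 1 (ε * r) x = ε * E.dist ε r x := by
  simp only [dist]; ring

lemma point_scale (ε r x : ℝ) : E.point 1 (ε * r) x = E.point ε r x := by
  simp only [point, dist]
  ext <;> simp only <;> ring

/-- The scaling weights of the coordinates. -/
def weight (ε : ℝ) : Fin 4 → ℝ := ![ε⁻¹, ε, 1, 1]

lemma frame_scale {ε : ℝ} (hε : ε ≠ 0) (r x : ℝ) (a μ : Fin 4) :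
    weight ε μ * E.frame 1 (ε * r) x a μ = weight ε a * E.frame ε r x a μ := by
  revert a μ
  refine forall_fin_four ?_ ?_ ?_ ?_ <;> refine forall_fin_four ?_ ?_ ?_ ?_ <;>
    simp only [frame, weight, Matrix.of_apply, Matrix.cons_val] <;>
    first | ring1 | field_simp

lemma metricForm_scale {ε : ℝ} (hε : ε ≠ 0) (S : ℝ) (q : ℝ × ℝ) (a b : Fin 4) :
    weight ε a * weight ε b * E.metricForm 1 (ε * S) q a b = E.metricForm ε S q a b := by
  revert a b
  refine forall_fin_four ?_ ?_ ?_ ?_ <;> refine forall_fin_four ?_ ?_ ?_ ?_ <;>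
    simp only [metricForm, weight, Matrix.of_apply, Matrix.cons_val] <;>
    (try field_simp) <;> (try ring1)

lemma maxwellForm_scale {ε : ℝ} (hε : ε ≠ 0) (S : ℝ) (q : ℝ × ℝ) (a b : Fin 4) :
    weight ε a * weight ε b * E.maxwellForm 1 (ε * S) q a b = E.maxwellForm ε S q a b := by
  revert a b
  refine forall_fin_four ?_ ?_ ?_ ?_ <;> refine forall_fin_four ?_ ?_ ?_ ?_ <;>
    simp only [maxwellForm, weight, Matrix.of_apply, Matrix.cons_val, one_mul] <;>
    (try field_simp) <;> (try ring1)

/-- The scaling map is singular at `ε = 0`, but the pulled-back tensor coincides for `ε ≠ 0` with a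
family that is regular there: the negative powers of `ε` from `dv` are absorbed by the zeros of the
components at the horizon. -/
lemma pull_scale {T : ℝ → ℝ → ℝ × ℝ → Matrix (Fin 4) (Fin 4) ℝ} {ε : ℝ} (hε : ε ≠ 0)
    (hT : ∀ S q a b, weight ε a * weight ε b * T 1 (ε * S) q a b = T ε S q a b) (r x : ℝ)
    (μ ν : Fin 4) :
    weight ε μ * weight ε ν * E.pull T 1 (ε * r) x μ ν = E.pull T ε r x μ ν := by
  simp only [pull, Matrix.of_apply, dist_scale, point_scale, Finset.mul_sum]
  refine Finset.sum_congr rfl fun a _ => Finset.sum_congr rfl fun b _ => ?_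
  rw [← hT]
  linear_combination (weight ε ν * E.frame 1 (ε * r) x b ν * T 1 (ε * E.dist ε r x)
    (E.point ε r x) a b) * E.frame_scale hε r x a μ + (weight ε a * E.frame ε r x a μ
    * T 1 (ε * E.dist ε r x) (E.point ε r x) a b) * E.frame_scale hε r x b ν

lemma pullback_scaling {ε : ℝ} (T : ℝ × ℝ → Matrix (Fin 4) (Fin 4) ℝ) (p : Pt) (μ ν : Fin 4) :
    pullback (scaling ε) (fun q => T (q 1, q 2)) p μ ν
      = weight ε μ * weight ε ν * T (ε * p 1, p 2) μ ν := by
  have hpd : ∀ κ α, pd κ (fun q => scaling ε q α) p = if κ = α then weight ε α else 0 := by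
    refine forall_fin_four ?_ ?_ ?_ ?_ <;> refine forall_fin_four ?_ ?_ ?_ ?_ <;>
      simp [pd, scaling, weight]
  simp only [pullback, Matrix.of_apply, hpd]
  simp [Finset.sum_ite_eq, scaling]

end HorizonData

/-! ### Derivatives along the scaling at `ε = 0`. -/

lemma mem_collar_zero {η x : ℝ} (hη : 0 < η) (hx : x ∈ Set.Ioo (-1 : ℝ) 1) :
    ((0 : ℝ), x) ∈ collar η := ⟨⟨neg_lt_zero.mpr hη, hη⟩, hx⟩

lemma contDiffOn_pds {u : ℝ × ℝ → ℝ} {U : Set (ℝ × ℝ)} (hU : IsOpen U)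
    (hu : ContDiffOn ℝ ∞ u U) : ContDiffOn ℝ ∞ (pds u) U :=
  (hu.fderiv_of_isOpen hU (by simp)).clm_apply contDiffOn_const

lemma contDiffOn_pdz {u : ℝ × ℝ → ℝ} {U : Set (ℝ × ℝ)} (hU : IsOpen U)
    (hu : ContDiffOn ℝ ∞ u U) : ContDiffOn ℝ ∞ (pdz u) U :=
  (hu.fderiv_of_isOpen hU (by simp)).clm_apply contDiffOn_const

lemma ContDiffOn.differentiableAt_of_isOpen {u : ℝ × ℝ → ℝ} {U : Set (ℝ × ℝ)} {q : ℝ × ℝ}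
    (hu : ContDiffOn ℝ ∞ u U) (hU : IsOpen U) (hq : q ∈ U) : DifferentiableAt ℝ u q :=
  (hu.contDiffAt (hU.mem_nhds hq)).differentiableAt (by simp)

lemma hasDerivAt_pds {u : ℝ × ℝ → ℝ} {s z : ℝ} (hu : DifferentiableAt ℝ u (s, z)) :
    HasDerivAt (fun s => u (s, z)) (pds u (s, z)) s :=
  hu.hasFDerivAt.comp_hasDerivAt s ((hasDerivAt_id' s).prodMk (hasDerivAt_const s z))

lemma hasDerivAt_pdz {u : ℝ × ℝ → ℝ} {s z : ℝ} (hu : DifferentiableAt ℝ u (s, z)) :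
    HasDerivAt (fun z => u (s, z)) (pdz u (s, z)) z :=
  hu.hasFDerivAt.comp_hasDerivAt z ((hasDerivAt_const z s).prodMk (hasDerivAt_id' z))

lemma pds_pdz_comm {u : ℝ × ℝ → ℝ} {U : Set (ℝ × ℝ)} {q : ℝ × ℝ} (hU : IsOpen U)
    (hu : ContDiffOn ℝ ∞ u U) (hq : q ∈ U) : pds (pdz u) q = pdz (pds u) q := by
  have hu' := hu.contDiffAt (hU.mem_nhds hq)
  have hd : DifferentiableAt ℝ (fderiv ℝ u) q :=
    ((hu.fderiv_of_isOpen (m := ∞) hU (by simp)).contDiffAt (hU.mem_nhds hq)).differentiableAt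
      (by simp)
  have key : ∀ v w, fderiv ℝ (fun q => fderiv ℝ u q v) q w = fderiv ℝ (fderiv ℝ u) q w v := by
    intro v w
    rw [(hd.hasFDerivAt.clm_apply (hasFDerivAt_const v q)).fderiv]
    simp
  have hs := (hu'.isSymmSndFDerivAt (by simpa using ENat.LEInfty.out)) (1, 0) (0, 1)
  show fderiv ℝ (fun q => fderiv ℝ u q (0, 1)) q (1, 0)
    = fderiv ℝ (fun q => fderiv ℝ u q (1, 0)) q (0, 1)
  rw [key, key, hs]

/-- This removes the contributions of `w` and `l` to the metric, which carry at least a factor `ε²`.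
-/
lemma hasDerivAt_pow_mul {g : ℝ → ℝ} {g' : ℝ} (hg : HasDerivAt g g' 0) {m : ℕ} (hm : 2 ≤ m) :
    HasDerivAt (fun ε => ε ^ m * g ε) 0 0 := by
  refine ((hasDerivAt_pow m (0 : ℝ)).fun_mul hg).congr_deriv ?_
  rw [zero_pow (by omega), zero_pow (by omega)]
  ring

lemma hasDerivAt_self_mul {g : ℝ → ℝ} {g' : ℝ} (hg : HasDerivAt g g' 0) :
    HasDerivAt (fun ε => ε * g ε) (g 0) 0 :=
  ((hasDerivAt_id' (0 : ℝ)).fun_mul hg).congr_deriv (by ring)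

namespace HorizonData

variable (E : HorizonData)

lemma hasDerivAt_shift (x : ℝ) : HasDerivAt E.shift (E.shiftDeriv x) x := by
  have h := (((hasDerivAt_id' x).const_mul E.p₁).const_add E.p₀).fun_add
    ((hasDerivAt_sq x).const_mul E.p₂)
  exact h.congr_deriv (by simp only [shiftDeriv]; ring)

lemma hasDerivAt_delay (x : ℝ) : HasDerivAt E.delay (E.delayDeriv x) x := by
  have h := ((E.hasDerivAt_shift x).const_mul (E.rp ^ 4 / E.V₀)).fun_sub
    ((hasDerivAt_sq x).const_mul (E.K₃ / 4))
  exact h.congr_deriv (by simp only [delayDeriv]; ring)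

lemma hasDerivAt_bend (x : ℝ) : HasDerivAt E.bend (E.bendDeriv x) x := by
  have h1 : HasDerivAt E.delayDeriv (E.rp ^ 4 / E.V₀ * (2 * E.p₂) - E.K₃ / 2) x := by
    have h := ((((hasDerivAt_id' x).const_mul (2 * E.p₂)).const_add E.p₁).const_mul
      (E.rp ^ 4 / E.V₀)).fun_sub ((hasDerivAt_id' x).const_mul (E.K₃ / 2))
    exact h.congr_deriv (by ring)
  have h := ((h1.fun_mul (hasDerivAt_one_sub_sq x)).fun_neg).div_const (E.rp ^ 2)
  exact h.congr_deriv (by simp only [bendDeriv]; ring)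

lemma dist_zero (r x : ℝ) : E.dist 0 r x = r * E.slope := by simp [dist]

lemma point_zero (r x : ℝ) : E.point 0 r x = (0, x) := by simp [point]

lemma hasDerivAt_dist (r x : ℝ) :
    HasDerivAt (fun ε => E.dist ε r x) (r ^ 2 * E.shift x) 0 := by
  have h := ((((hasDerivAt_id' (0 : ℝ)).mul_const r).const_mul (E.shift x)).const_add
    E.slope).const_mul r
  exact h.congr_deriv (by ring)

lemma hasDerivAt_point (r x : ℝ) :
    HasDerivAt (fun ε => E.point ε r x) (r * E.slope, r * E.bend x) 0 := by
  have h1 := hasDerivAt_self_mul (E.hasDerivAt_dist r x)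
  rw [dist_zero] at h1
  have h2 : HasDerivAt (fun ε : ℝ => x + ε * r * E.bend x) (r * E.bend x) 0 :=
    ((((hasDerivAt_id' (0 : ℝ)).mul_const r).mul_const (E.bend x)).const_add x).congr_deriv
      (by ring)
  exact h1.prodMk h2

variable {E}

lemma hasDerivAt_comp_point {u : ℝ × ℝ → ℝ} {r x us uz : ℝ} (hu : DifferentiableAt ℝ u (0, x))
    (hs : HasDerivAt (fun s => u (s, x)) us 0) (hz : HasDerivAt (fun z => u (0, z)) uz x) :
    HasDerivAt (fun ε => u (E.point ε r x)) (r * (E.slope * us + E.bend x * uz)) 0 := by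
  have hu' : HasFDerivAt u (fderiv ℝ u (0, x)) (E.point 0 r x) := by
    rw [point_zero]; exact hu.hasFDerivAt
  refine (hu'.comp_hasDerivAt 0 (E.hasDerivAt_point r x)).congr_deriv ?_
  rw [hs.unique (hasDerivAt_pds hu), hz.unique (hasDerivAt_pdz hu)]
  have : ((r * E.slope, r * E.bend x) : ℝ × ℝ)
      = (r * E.slope) • ((1, 0) : ℝ × ℝ) + (r * E.bend x) • ((0, 1) : ℝ × ℝ) := by
    ext <;> simp
  rw [this, map_add, map_smul, map_smul]
  simp only [pds, pdz, smul_eq_mul]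
  ring

/-- The derivative of `frame` with respect to the scaling parameter. -/
def frameDeriv (E : HorizonData) (r x : ℝ) : Matrix (Fin 4) (Fin 4) ℝ :=
  !![0, 0, E.delayDeriv x, 0;
     0, 2 * E.shift x * r, r ^ 2 * E.shiftDeriv x, 0;
     0, E.bend x, r * E.bendDeriv x, 0;
     0, 0, 0, 0]

lemma hasDerivAt_frame (r x : ℝ) (a μ : Fin 4) :
    HasDerivAt (fun ε => E.frame ε r x a μ) (E.frameDeriv r x a μ) 0 := by
  have hid := hasDerivAt_id' (0 : ℝ)
  revert a μ
  refine forall_fin_four ?_ ?_ ?_ ?_ <;> refine forall_fin_four ?_ ?_ ?_ ?_ <;>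
    simp only [frame, frameDeriv, Matrix.of_apply, Matrix.cons_val] <;>
    try exact hasDerivAt_const _ _
  · exact (hid.mul_const _).congr_deriv (by ring)
  · exact (((hid.mul_const r).const_mul (2 * E.shift x)).const_add E.slope).congr_deriv (by ring)
  · exact ((hid.mul_const (r ^ 2)).mul_const _).congr_deriv (by ring)
  · exact (hid.mul_const _).congr_deriv (by ring)
  · exact (((hid.mul_const r).mul_const _).const_add 1).congr_deriv (by ring)

lemma hasDerivAt_pull {T : ℝ → ℝ → ℝ × ℝ → Matrix (Fin 4) (Fin 4) ℝ}
    {T' : Matrix (Fin 4) (Fin 4) ℝ} {r x : ℝ}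
    (hT : ∀ a b, HasDerivAt (fun ε => T ε (E.dist ε r x) (E.point ε r x) a b) (T' a b) 0)
    (μ ν : Fin 4) :
    HasDerivAt (fun ε => E.pull T ε r x μ ν)
      (∑ a, ∑ b, ((E.frameDeriv r x a μ * E.frame 0 r x b ν
        + E.frame 0 r x a μ * E.frameDeriv r x b ν) * T 0 (r * E.slope) (0, x) a b
        + E.frame 0 r x a μ * E.frame 0 r x b ν * T' a b)) 0 := by
  simp only [pull, Matrix.of_apply]
  refine HasDerivAt.fun_sum fun a _ => HasDerivAt.fun_sum fun b _ => ?_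
  have h := ((E.hasDerivAt_frame r x a μ).fun_mul (E.hasDerivAt_frame r x b ν)).fun_mul (hT a b)
  rwa [dist_zero, point_zero] at h

end HorizonData

namespace HorizonData

variable {E : HorizonData} {η : ℝ}

namespace IsRegular

lemma slope_pos (h : E.IsRegular η) : 0 < E.slope :=
  div_pos h.V₀_pos (pow_pos h.rp_pos 2)

lemma differentiableAt_comp_point (h : E.IsRegular η) {u : ℝ × ℝ → ℝ}
    (hu : ContDiffOn ℝ ∞ u (collar η)) (r : ℝ) {x : ℝ} (hx : x ∈ Set.Ioo (-1 : ℝ) 1) :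
    DifferentiableAt ℝ (fun ε => u (E.point ε r x)) 0 := by
  have hu' : DifferentiableAt ℝ u (0, x) :=
    ContDiffOn.differentiableAt_of_isOpen hu (isOpen_collar η) (mem_collar_zero h.η_pos hx)
  exact (hasDerivAt_comp_point hu' (hasDerivAt_pds hu') (hasDerivAt_pdz hu')).differentiableAt

/-- The derivative along the scaling of a coefficient with known derivatives at the horizon. -/
lemma hasDerivAt_coeff (h : E.IsRegular η) {u : ℝ × ℝ → ℝ}
    (hu : ContDiffOn ℝ ∞ u (collar η)) (r : ℝ) {x us uz : ℝ} (hx : x ∈ Set.Ioo (-1 : ℝ) 1)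
    (hs : HasDerivAt (fun s => u (s, x)) us 0) (hz : HasDerivAt (fun z => u (0, z)) uz x) :
    HasDerivAt (fun ε => u (E.point ε r x)) (r * (E.slope * us + E.bend x * uz)) 0 :=
  hasDerivAt_comp_point
    (ContDiffOn.differentiableAt_of_isOpen hu (isOpen_collar η) (mem_collar_zero h.η_pos hx)) hs hz

lemma hasDerivAt_V (h : E.IsRegular η) (r x : ℝ) :
    HasDerivAt (fun ε => E.V (E.point ε r x).1) (r * E.slope * (E.K₂ + E.K₃ / 3)) 0 := by
  have h1 : HasDerivAt (fun ε => (E.point ε r x).1) (r * E.slope) 0 :=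
    (E.hasDerivAt_point r x).fst
  have h2 : HasDerivAt E.V (E.K₂ + E.K₃ / 3) (E.point 0 r x).1 := by
    rw [point_zero]; exact h.V_deriv
  exact (h2.comp 0 h1).congr_deriv (by ring)

lemma pdz_α_zero (h : E.IsRegular η) {z : ℝ} (hz : z ∈ Set.Ioo (-1 : ℝ) 1) :
    pdz E.α (0, z) = E.qm / E.k :=
  (hasDerivAt_pdz (ContDiffOn.differentiableAt_of_isOpen (h.smooth E.α (by simp))
    (isOpen_collar η) (mem_collar_zero h.η_pos hz))).unique (h.α_zero z hz)

lemma pdz_β_zero (h : E.IsRegular η) {z : ℝ} (hz : z ∈ Set.Ioo (-1 : ℝ) 1) :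
    pdz E.β (0, z) = -(E.qe / E.k) :=
  (hasDerivAt_pdz (ContDiffOn.differentiableAt_of_isOpen (h.smooth E.β (by simp))
    (isOpen_collar η) (mem_collar_zero h.η_pos hz))).unique (h.β_zero z hz)

lemma pds_α_zero (h : E.IsRegular η) {z : ℝ} (hz : z ∈ Set.Ioo (-1 : ℝ) 1) :
    pds E.α (0, z) = -(E.qm / E.k) * E.bend z / E.slope :=
  (hasDerivAt_pds (ContDiffOn.differentiableAt_of_isOpen (h.smooth E.α (by simp))
    (isOpen_collar η) (mem_collar_zero h.η_pos hz))).unique (h.α_deriv z hz)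

lemma pds_β_zero (h : E.IsRegular η) {z : ℝ} (hz : z ∈ Set.Ioo (-1 : ℝ) 1) :
    pds E.β (0, z) = E.qe / E.k * E.bend z / E.slope :=
  (hasDerivAt_pds (ContDiffOn.differentiableAt_of_isOpen (h.smooth E.β (by simp))
    (isOpen_collar η) (mem_collar_zero h.η_pos hz))).unique (h.β_deriv z hz)

/-- The derivative of `∂_z u` along the scaling, where `∂_z u` is constant at the horizon. -/
lemma hasDerivAt_pdz_comp_point (h : E.IsRegular η) {u : ℝ × ℝ → ℝ}
    (hu : ContDiffOn ℝ ∞ u (collar η)) (r : ℝ) {x c d : ℝ} (hx : x ∈ Set.Ioo (-1 : ℝ) 1)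
    (hc : ∀ z ∈ Set.Ioo (-1 : ℝ) 1, pdz u (0, z) = c)
    (hd : ∀ z ∈ Set.Ioo (-1 : ℝ) 1, pds u (0, z) = d * E.bend z) :
    HasDerivAt (fun ε => pdz u (E.point ε r x)) (r * (E.slope * (d * E.bendDeriv x))) 0 := by
  have hU := isOpen_collar η
  have hx0 := mem_collar_zero h.η_pos hx
  have hnhds : ∀ᶠ z in 𝓝 x, z ∈ Set.Ioo (-1 : ℝ) 1 := isOpen_Ioo.mem_nhds hx
  have hz : HasDerivAt (fun z => pdz u (0, z)) 0 x :=
    (hasDerivAt_const x c).congr_of_eventuallyEq (hnhds.mono hc)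
  -- The normal derivative of `∂_z u` is a mixed second derivative; in the other order it only needs
  -- `∂_s u` along the horizon.
  have h1 : HasDerivAt (fun z => pds u (0, z)) (d * E.bendDeriv x) x :=
    ((E.hasDerivAt_bend x).const_mul d).congr_of_eventuallyEq (hnhds.mono hd)
  have h2 := hasDerivAt_pds (ContDiffOn.differentiableAt_of_isOpen (contDiffOn_pdz hU hu) hU hx0)
  rw [pds_pdz_comm hU hu hx0, ← h1.unique (hasDerivAt_pdz
    (ContDiffOn.differentiableAt_of_isOpen (contDiffOn_pds hU hu) hU hx0))] at h2
  exact (h.hasDerivAt_coeff (contDiffOn_pdz hU hu) r hx h2 hz).congr_deriv (by ring)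

/-- The derivative of `metricForm` along the scaling. -/
def _root_.ExtremeHorizon.HorizonData.metricFormDeriv (E : HorizonData) (r x n' Q' X' : ℝ) :
    Matrix (Fin 4) (Fin 4) ℝ :=
  !![-(2 * (r * E.slope) * (r ^ 2 * E.shift x) * E.n (0, x) + (r * E.slope) ^ 2 * n'),
      n' * E.V₀ + E.n (0, x) * (r * E.slope * (E.K₂ + E.K₃ / 3)), 0, 0;
     n' * E.V₀ + E.n (0, x) * (r * E.slope * (E.K₂ + E.K₃ / 3)), 0, 0, 0;
     0, 0, Q', 0;
     0, 0, 0, X']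

/-- Only `n`, `V`, `Q`, `X` and the distance matter. The angular velocity is of order `s³`, so it
drops out at first order despite the weight `ε⁻¹` of `dt`. -/
lemma hasDerivAt_metricForm (h : E.IsRegular η) (r : ℝ) {x n' Q' X' : ℝ}
    (hx : x ∈ Set.Ioo (-1 : ℝ) 1)
    (hn : HasDerivAt (fun ε => E.n (E.point ε r x)) n' 0)
    (hQ : HasDerivAt (fun ε => E.Q (E.point ε r x)) Q' 0)
    (hX : HasDerivAt (fun ε => E.X (E.point ε r x)) X' 0) (a b : Fin 4) :
    HasDerivAt (fun ε => E.metricForm ε (E.dist ε r x) (E.point ε r x) a b)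
      (E.metricFormDeriv r x n' Q' X' a b) 0 := by
  have hV := h.hasDerivAt_V r x
  have hS := E.hasDerivAt_dist r x
  have hw := (h.differentiableAt_comp_point (h.smooth E.w (by simp)) r hx).hasDerivAt
  have hl := (h.differentiableAt_comp_point (h.smooth E.l (by simp)) r hx).hasDerivAt
  have h00 := ((hS.fun_pow 2).fun_mul hn).fun_neg.fun_add
    (hasDerivAt_pow_mul (((hS.fun_pow 6).fun_mul hX).fun_mul (hw.fun_pow 2)) (m := 4) (by norm_num))
  have h01 := (hn.fun_mul hV).fun_sub (hasDerivAt_pow_mul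
    ((((hS.fun_pow 4).fun_mul hX).fun_mul (hw.fun_pow 2)).fun_mul hV) (m := 4) (by norm_num))
  have h03 := (hasDerivAt_pow_mul (((hS.fun_pow 3).fun_mul hX).fun_mul hw) (m := 2)
    le_rfl).fun_neg
  have h11 := (hasDerivAt_pow_mul hl (m := 2) le_rfl).fun_add (hasDerivAt_pow_mul
    ((((hS.fun_pow 2).fun_mul hX).fun_mul (hw.fun_pow 2)).fun_mul (hV.fun_pow 2)) (m := 4)
    (by norm_num))
  have h13 := hasDerivAt_pow_mul (((hS.fun_mul hX).fun_mul hw).fun_mul hV) (m := 2) le_rfl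
  have e00 := h00.congr_deriv (g' := -(2 * (r * E.slope) * (r ^ 2 * E.shift x) * E.n (0, x)
    + (r * E.slope) ^ 2 * n')) (by simp only [dist_zero, point_zero]; push_cast; ring)
  have e01 := h01.congr_deriv (g' := n' * E.V₀
    + E.n (0, x) * (r * E.slope * (E.K₂ + E.K₃ / 3)))
    (by simp only [point_zero, h.V_zero]; ring)
  have e03 := h03.congr_deriv neg_zero
  have e11 := h11.congr_deriv (add_zero 0)
  revert a b
  refine forall_fin_four ?_ ?_ ?_ ?_ <;> refine forall_fin_four ?_ ?_ ?_ ?_ <;>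
    simp only [metricForm, metricFormDeriv, Matrix.of_apply, Matrix.cons_val] <;>
    first | exact hasDerivAt_const _ _ | assumption

/-- The derivative of `maxwellForm` along the scaling. -/
def _root_.ExtremeHorizon.HorizonData.maxwellFormDeriv (E : HorizonData) (r e₁ e₂ a b : ℝ) :
    Matrix (Fin 4) (Fin 4) ℝ :=
  !![0, -e₁, -((r * E.slope) ^ 2 * e₂), 0;
     e₁, 0, E.V₀ * e₂, a;
     (r * E.slope) ^ 2 * e₂, -(E.V₀ * e₂), 0, b;
     0, -a, -b, 0]

/-- The twist terms carry powers of `s = ε S`, and the remaining off-diagonal terms carry an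
explicit `ε`. Hence the latter contribute their values on the horizon, and only `μ`, `∂_z α` and
`∂_z β` have to be differentiated. -/
lemma hasDerivAt_maxwellForm (h : E.IsRegular η) (r : ℝ) {x μ' α' β' : ℝ}
    (hx : x ∈ Set.Ioo (-1 : ℝ) 1)
    (hμ : HasDerivAt (fun ε => E.μ (E.point ε r x)) μ' 0)
    (hα : HasDerivAt (fun ε => pdz E.α (E.point ε r x)) α' 0)
    (hβ : HasDerivAt (fun ε => pdz E.β (E.point ε r x)) β' 0) (a b : Fin 4) :
    HasDerivAt (fun ε => E.maxwellForm ε (E.dist ε r x) (E.point ε r x) a b)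
      (E.maxwellFormDeriv r (-(μ' * pdz E.β (0, x) + E.μ (0, x) * β'))
        (E.ν (0, x) * pds E.β (0, x)) (pds E.α (0, x)) α' a b) 0 := by
  have hU := isOpen_collar η
  have hV := h.hasDerivAt_V r x
  have hS := E.hasDerivAt_dist r x
  have hεS := (hasDerivAt_id' (0 : ℝ)).fun_mul hS
  have hw := (h.differentiableAt_comp_point (h.smooth E.w (by simp)) r hx).hasDerivAt
  have hν := (h.differentiableAt_comp_point (h.smooth E.ν (by simp)) r hx).hasDerivAt
  have hαs := (h.differentiableAt_comp_point
    (contDiffOn_pds hU (h.smooth E.α (by simp))) r hx).hasDerivAt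
  have hβs := (h.differentiableAt_comp_point
    (contDiffOn_pds hU (h.smooth E.β (by simp))) r hx).hasDerivAt
  have hS' := ((hεS.fun_pow 3).fun_mul (hw.fun_mul hαs)).fun_neg.fun_sub (hμ.fun_mul hβ)
  have hZ := (hεS.fun_mul (hw.fun_mul hα)).fun_neg.fun_add (hν.fun_mul hβs)
  have e1 : HasDerivAt (fun ε => E.electricS (ε * E.dist ε r x) (E.point ε r x))
      (-(μ' * pdz E.β (0, x) + E.μ (0, x) * β')) 0 :=
    hS'.congr_deriv (by simp only [point_zero]; ring)
  have e2 : HasDerivAt (fun ε => ε * (E.dist ε r x ^ 2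
      * E.electricZ (ε * E.dist ε r x) (E.point ε r x)))
      ((r * E.slope) ^ 2 * (E.ν (0, x) * pds E.β (0, x))) 0 :=
    (hasDerivAt_self_mul ((hS.fun_pow 2).fun_mul hZ)).congr_deriv
      (by simp only [point_zero, dist_zero]; ring)
  have e3 : HasDerivAt (fun ε => ε * (E.V (E.point ε r x).1
      * E.electricZ (ε * E.dist ε r x) (E.point ε r x)))
      (E.V₀ * (E.ν (0, x) * pds E.β (0, x))) 0 :=
    (hasDerivAt_self_mul (hV.fun_mul hZ)).congr_deriv
      (by simp only [point_zero, h.V_zero]; ring)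
  have e4 : HasDerivAt (fun ε => ε * pds E.α (E.point ε r x)) (pds E.α (0, x)) 0 :=
    (hasDerivAt_self_mul hαs).congr_deriv (by simp only [point_zero])
  have f1 := e1.fun_neg
  have f2 := e2.fun_neg
  have f3 := e3.fun_neg
  have f4 := e4.fun_neg
  have f5 := hα.fun_neg
  revert a b
  refine forall_fin_four ?_ ?_ ?_ ?_ <;> refine forall_fin_four ?_ ?_ ?_ ?_ <;>
    simp only [maxwellForm, maxwellFormDeriv, Matrix.of_apply, Matrix.cons_val] <;>
    first | exact hasDerivAt_const _ _ | assumption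

lemma pull_metricForm_zero (h : E.IsRegular η) {p : Pt} (hp : p ∈ patch) (μ ν : Fin 4) :
    E.pull E.metricForm 0 (p 1) (p 2) μ ν = nhMetric E.rp p μ ν := by
  have hx : p 2 ∈ Set.Ioo (-1 : ℝ) 1 := hp
  have hk := h.k_pos.ne'
  have hV := h.V₀_pos.ne'
  have hr := h.rp_pos.ne'
  revert μ ν
  refine forall_fin_four ?_ ?_ ?_ ?_ <;> refine forall_fin_four ?_ ?_ ?_ ?_ <;>
    simp only [pull, frame, metricForm, nhMetric, dist_zero, point_zero, Fin.sum_univ_four,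
      h.n_zero _ hx, h.Q_zero _ hx, h.X_zero _ hx, h.V_zero, slope, Matrix.of_apply,
      Matrix.cons_val] <;>
    (try field_simp) <;> (try ring1)

lemma pull_maxwellForm_zero (h : E.IsRegular η) (r : ℝ) {x : ℝ} (hx : x ∈ Set.Ioo (-1 : ℝ) 1)
    (p : Pt) (μ ν : Fin 4) :
    E.pull E.maxwellForm 0 r x μ ν = nhMaxwell E.qe E.qm E.rp p μ ν := by
  have hk := h.k_pos.ne'
  have hV := h.V₀_pos.ne'
  have hr := h.rp_pos.ne'
  revert μ ν
  refine forall_fin_four ?_ ?_ ?_ ?_ <;> refine forall_fin_four ?_ ?_ ?_ ?_ <;>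
    simp only [pull, frame, maxwellForm, electricS, electricZ, nhMaxwell, point_zero,
      Fin.sum_univ_four, h.pdz_α_zero hx, h.pdz_β_zero hx, h.μ_zero x hx, slope, Matrix.of_apply,
      Matrix.cons_val] <;>
    (try field_simp) <;> (try ring1)

end IsRegular

end HorizonData

namespace HorizonData

variable {E : HorizonData} {η : ℝ}

namespace IsRegular

/-- The transverse deformation of a regular horizon. -/
abbrev _root_.ExtremeHorizon.HorizonData.deformation (E : HorizonData) : FirstOrderData :=
  normalForm E.qe E.qm E.rp 0 E.K₂ E.K₃

set_option maxHeartbeats 1600000 in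
-- The product rule with the regularity conditions inserted. The outcome is the normal form itself,
-- so no further gauge transformation is needed for the examples.
lemma hasDerivAt_pull_metricForm (h : E.IsRegular η) {p : Pt} (hp : p ∈ patch) (μ ν : Fin 4) :
    HasDerivAt (fun ε => E.pull E.metricForm ε (p 1) (p 2) μ ν)
      (E.deformation.metric p μ ν) 0 := by
  have hx : p 2 ∈ Set.Ioo (-1 : ℝ) 1 := hp
  have hc : (1 - p 2 ^ 2) ≠ 0 := by nlinarith [hx.1, hx.2]
  have hk := h.k_pos.ne'
  have hV := h.V₀_pos.ne'
  have hr := h.rp_pos.ne'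
  have hs := h.slope_pos.ne'
  have hnhds : ∀ᶠ z in 𝓝 (p 2), z ∈ Set.Ioo (-1 : ℝ) 1 := isOpen_Ioo.mem_nhds hx
  have hn := h.hasDerivAt_coeff (h.smooth E.n (by simp)) (p 1) hx (h.n_deriv _ hx)
    ((hasDerivAt_const (p 2) _).congr_of_eventuallyEq (hnhds.mono h.n_zero))
  have hQ := h.hasDerivAt_coeff (h.smooth E.Q (by simp)) (p 1) hx (h.Q_deriv _ hx)
    (((hasDerivAt_inv_one_sub_sq hc).const_mul (E.rp ^ 2)).congr_of_eventuallyEq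
      (hnhds.mono h.Q_zero))
  have hX := h.hasDerivAt_coeff (h.smooth E.X (by simp)) (p 1) hx (h.X_deriv _ hx)
    (((hasDerivAt_one_sub_sq (p 2)).const_mul (E.rp ^ 2 / E.k ^ 2)).congr_of_eventuallyEq
      (hnhds.mono h.X_zero))
  refine (hasDerivAt_pull (h.hasDerivAt_metricForm (p 1) hx hn hQ hX) μ ν).congr_deriv ?_
  clear hn hQ hX
  revert μ ν
  refine forall_fin_four ?_ ?_ ?_ ?_ <;> refine forall_fin_four ?_ ?_ ?_ ?_ <;>
    simp only [frame, frameDeriv, metricForm, metricFormDeriv, Fin.sum_univ_four,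
      FirstOrderData.metric, normalForm, FirstOrderData.F, FirstOrderData.h, FirstOrderData.γ,
      h.n_zero _ hx, h.Q_zero _ hx, h.X_zero _ hx, h.V_zero, Matrix.of_apply,
      Matrix.cons_val, mul_zero, zero_mul, add_zero, zero_add, mul_one, one_mul, neg_zero,
      zero_div, bend, delayDeriv, bendDeriv, slope] <;>
    (try field_simp) <;> (try ring1)

set_option maxHeartbeats 1600000 in
lemma hasDerivAt_pull_maxwellForm (h : E.IsRegular η) {p : Pt} (hp : p ∈ patch) (μ ν : Fin 4) :
    HasDerivAt (fun ε => E.pull E.maxwellForm ε (p 1) (p 2) μ ν)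
      (E.deformation.maxwell p μ ν) 0 := by
  have hx : p 2 ∈ Set.Ioo (-1 : ℝ) 1 := hp
  have hc : (1 - p 2 ^ 2) ≠ 0 := by nlinarith [hx.1, hx.2]
  have hk := h.k_pos.ne'
  have hV := h.V₀_pos.ne'
  have hr := h.rp_pos.ne'
  have hs := h.slope_pos.ne'
  have hnhds : ∀ᶠ z in 𝓝 (p 2), z ∈ Set.Ioo (-1 : ℝ) 1 := isOpen_Ioo.mem_nhds hx
  have hμ := h.hasDerivAt_coeff (h.smooth E.μ (by simp)) (p 1) hx (h.μ_deriv _ hx)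
    ((hasDerivAt_const (p 2) _).congr_of_eventuallyEq (hnhds.mono h.μ_zero))
  have hα := h.hasDerivAt_pdz_comp_point (h.smooth E.α (by simp)) (p 1) hx
    (fun z hz => h.pdz_α_zero hz) (d := -(E.qm / E.k) / E.slope)
    (fun z hz => by rw [h.pds_α_zero hz]; ring)
  have hβ := h.hasDerivAt_pdz_comp_point (h.smooth E.β (by simp)) (p 1) hx
    (fun z hz => h.pdz_β_zero hz) (d := E.qe / E.k / E.slope)
    (fun z hz => by rw [h.pds_β_zero hz]; ring)
  refine (hasDerivAt_pull (h.hasDerivAt_maxwellForm (p 1) hx hμ hα hβ) μ ν).congr_deriv ?_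
  clear hμ hα hβ
  revert μ ν
  refine forall_fin_four ?_ ?_ ?_ ?_ <;> refine forall_fin_four ?_ ?_ ?_ ?_ <;>
    simp only [frame, frameDeriv, maxwellForm, maxwellFormDeriv, electricS, electricZ,
      Fin.sum_univ_four, FirstOrderData.maxwell, normalForm, FirstOrderData.Ψ, FirstOrderData.W,
      FirstOrderData.Z, FirstOrderData.B, h.μ_zero _ hx, h.ν_zero _ hx, h.pdz_α_zero hx,
      h.pdz_β_zero hx, h.pds_α_zero hx, h.pds_β_zero hx, Matrix.of_apply,
      Matrix.cons_val, mul_zero, zero_mul, add_zero, zero_add, mul_one, one_mul, neg_zero,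
      zero_div, bend, delayDeriv, bendDeriv, slope] <;>
    (try field_simp) <;> (try ring1)

/-- For `ε ≠ 0` the quotient is the difference quotient at `0` of the regular family `E.pull T`. -/
lemma tendsto_inv_mul_pullback {T : ℝ → ℝ → ℝ × ℝ → Matrix (Fin 4) (Fin 4) ℝ}
    (hT : ∀ ε ≠ 0, ∀ S q a b, weight ε a * weight ε b * T 1 (ε * S) q a b = T ε S q a b)
    {p : Pt} {μ ν : Fin 4} {c d : ℝ} (hd : HasDerivAt (fun ε => E.pull T ε (p 1) (p 2) μ ν) d 0)
    (hc : E.pull T 0 (p 1) (p 2) μ ν = c) :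
    Filter.Tendsto (fun ε : ℝ => ε⁻¹ * (pullback (scaling ε)
      (fun q => E.pull T 1 (q 1) (q 2)) p μ ν - c)) (𝓝[≠] 0) (𝓝 d) := by
  have h := hasDerivAt_iff_tendsto_slope_zero.mp hd
  refine h.congr' ?_
  filter_upwards [self_mem_nhdsWithin] with ε hε
  rw [pullback_scaling (fun q => E.pull T 1 q.1 q.2), E.pull_scale hε (hT ε hε), zero_add,
    hc, smul_eq_mul]

lemma tendsto_nullMetric (h : E.IsRegular η) {p : Pt} (hp : p ∈ patch) (μ ν : Fin 4) :
    Filter.Tendsto (fun ε : ℝ => ε⁻¹ * (pullback (scaling ε)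
      (fun q => E.nullMetric (q 1, q 2)) p μ ν - nhMetric E.rp p μ ν)) (𝓝[≠] 0)
      (𝓝 (E.deformation.metric p μ ν)) :=
  tendsto_inv_mul_pullback (fun _ hε => E.metricForm_scale hε)
    (h.hasDerivAt_pull_metricForm hp μ ν) (h.pull_metricForm_zero hp μ ν)

lemma tendsto_nullMaxwell (h : E.IsRegular η) {p : Pt} (hp : p ∈ patch) (μ ν : Fin 4) :
    Filter.Tendsto (fun ε : ℝ => ε⁻¹ * (pullback (scaling ε)
      (fun q => E.nullMaxwell (q 1, q 2)) p μ ν - nhMaxwell E.qe E.qm E.rp p μ ν)) (𝓝[≠] 0)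
      (𝓝 (E.deformation.maxwell p μ ν)) :=
  tendsto_inv_mul_pullback (fun _ hε => E.maxwellForm_scale hε)
    (h.hasDerivAt_pull_maxwellForm hp μ ν) (h.pull_maxwellForm_zero (p 1) hp p μ ν)

end IsRegular

end HorizonData

/-! #### Smoothness of the fields in the coordinates `(r, x)` -/

namespace HorizonData

variable {E : HorizonData} {η : ℝ}

lemma contDiff_shift : ContDiff ℝ ∞ E.shift := by unfold shift; fun_prop

lemma contDiff_delay : ContDiff ℝ ∞ E.delay := by unfold delay shift; fun_prop

lemma contDiff_bend : ContDiff ℝ ∞ E.bend := by unfold bend delayDeriv shiftDeriv; fun_prop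

lemma contDiff_dist : ContDiff ℝ ∞ (fun q : ℝ × ℝ => E.dist 1 q.1 q.2) := by
  unfold dist shift; fun_prop

lemma contDiff_point : ContDiff ℝ ∞ (fun q : ℝ × ℝ => E.point 1 q.1 q.2) := by
  have h := E.contDiff_dist
  have hb : ContDiff ℝ ∞ (fun q : ℝ × ℝ => E.bend q.2) := E.contDiff_bend.comp contDiff_snd
  unfold point
  exact (contDiff_const.mul h).prodMk
    (contDiff_snd.add ((contDiff_const.mul contDiff_fst).mul hb))

lemma contDiff_frame (a μ : Fin 4) : ContDiff ℝ ∞ (fun q : ℝ × ℝ => E.frame 1 q.1 q.2 a μ) := by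
  revert a μ
  refine forall_fin_four ?_ ?_ ?_ ?_ <;> refine forall_fin_four ?_ ?_ ?_ ?_ <;>
    simp only [frame, Matrix.of_apply, Matrix.cons_val, bend, bendDeriv, delayDeriv, shift,
      shiftDeriv] <;> fun_prop

lemma contDiffOn_pull {T : ℝ → ℝ → ℝ × ℝ → Matrix (Fin 4) (Fin 4) ℝ} {U : Set (ℝ × ℝ)}
    (hT : ∀ a b, ContDiffOn ℝ ∞ (fun q : ℝ × ℝ => T 1 (E.dist 1 q.1 q.2) (E.point 1 q.1 q.2) a b) U)
    (μ ν : Fin 4) : ContDiffOn ℝ ∞ (fun q : ℝ × ℝ => E.pull T 1 q.1 q.2 μ ν) U := by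
  simp only [pull, Matrix.of_apply]
  exact ContDiffOn.sum fun a _ => ContDiffOn.sum fun b _ =>
    ((E.contDiff_frame a μ).contDiffOn.mul (E.contDiff_frame b ν).contDiffOn).mul (hT a b)

namespace IsRegular

variable {U : Set (ℝ × ℝ)}

lemma contDiffOn_comp {u : ℝ × ℝ → ℝ} (hu : ContDiffOn ℝ ∞ u (collar η))
    (hU : Set.MapsTo (fun q : ℝ × ℝ => E.point 1 q.1 q.2) U (collar η)) :
    ContDiffOn ℝ ∞ (fun q : ℝ × ℝ => u (E.point 1 q.1 q.2)) U :=
  hu.comp E.contDiff_point.contDiffOn hU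

lemma contDiffOn_V (h : E.IsRegular η)
    (hU : Set.MapsTo (fun q : ℝ × ℝ => E.point 1 q.1 q.2) U (collar η)) :
    ContDiffOn ℝ ∞ (fun q : ℝ × ℝ => E.V (E.point 1 q.1 q.2).1) U :=
  h.smooth_V.comp (contDiff_fst.comp E.contDiff_point).contDiffOn fun _ hq => (hU hq).1

lemma contDiffOn_nullMetric (h : E.IsRegular η)
    (hU : Set.MapsTo (fun q : ℝ × ℝ => E.point 1 q.1 q.2) U (collar η)) (μ ν : Fin 4) :
    ContDiffOn ℝ ∞ (fun q => E.nullMetric q μ ν) U := by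
  refine E.contDiffOn_pull (fun a b => ?_) μ ν
  have hn := contDiffOn_comp (h.smooth E.n (by simp)) hU
  have hl := contDiffOn_comp (h.smooth E.l (by simp)) hU
  have hQ := contDiffOn_comp (h.smooth E.Q (by simp)) hU
  have hX := contDiffOn_comp (h.smooth E.X (by simp)) hU
  have hw := contDiffOn_comp (h.smooth E.w (by simp)) hU
  have hV := h.contDiffOn_V hU
  have hS : ContDiffOn ℝ ∞ (fun q : ℝ × ℝ => E.dist 1 q.1 q.2) U := E.contDiff_dist.contDiffOn
  have hc : ∀ c : ℝ, ContDiffOn ℝ ∞ (fun _ : ℝ × ℝ => c) U := fun c => contDiffOn_const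
  revert a b
  refine forall_fin_four ?_ ?_ ?_ ?_ <;> refine forall_fin_four ?_ ?_ ?_ ?_ <;>
    simp only [metricForm, Matrix.of_apply, Matrix.cons_val] <;>
    first
    | exact hc _
    | exact hQ
    | exact hX
    | exact ((hS.pow 2).mul hn).neg.add
        ((hc _).mul (((hS.pow 6).mul hX).mul (hw.pow 2)))
    | exact (hn.mul hV).sub ((hc _).mul ((((hS.pow 4).mul hX).mul (hw.pow 2)).mul hV))
    | exact ((hc _).mul (((hS.pow 3).mul hX).mul hw)).neg
    | exact ((hc _).mul hl).add
        ((hc _).mul ((((hS.pow 2).mul hX).mul (hw.pow 2)).mul (hV.pow 2)))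
    | exact (hc _).mul (((hS.mul hX).mul hw).mul hV)

lemma contDiffOn_nullMaxwell (h : E.IsRegular η)
    (hU : Set.MapsTo (fun q : ℝ × ℝ => E.point 1 q.1 q.2) U (collar η)) (μ ν : Fin 4) :
    ContDiffOn ℝ ∞ (fun q => E.nullMaxwell q μ ν) U := by
  refine E.contDiffOn_pull (fun a b => ?_) μ ν
  have hC := isOpen_collar η
  have hμ := contDiffOn_comp (h.smooth E.μ (by simp)) hU
  have hν := contDiffOn_comp (h.smooth E.ν (by simp)) hU
  have hw := contDiffOn_comp (h.smooth E.w (by simp)) hU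
  have hαs := contDiffOn_comp (contDiffOn_pds hC (h.smooth E.α (by simp))) hU
  have hαz := contDiffOn_comp (contDiffOn_pdz hC (h.smooth E.α (by simp))) hU
  have hβs := contDiffOn_comp (contDiffOn_pds hC (h.smooth E.β (by simp))) hU
  have hβz := contDiffOn_comp (contDiffOn_pdz hC (h.smooth E.β (by simp))) hU
  have hV := h.contDiffOn_V hU
  have hS : ContDiffOn ℝ ∞ (fun q : ℝ × ℝ => E.dist 1 q.1 q.2) U := E.contDiff_dist.contDiffOn
  have hc : ∀ c : ℝ, ContDiffOn ℝ ∞ (fun _ : ℝ × ℝ => c) U := fun c => contDiffOn_const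
  have h1S := (hc 1).mul hS
  have e1 : ContDiffOn ℝ ∞ (fun q : ℝ × ℝ => E.electricS (1 * E.dist 1 q.1 q.2)
      (E.point 1 q.1 q.2)) U := ((h1S.pow 3).mul (hw.mul hαs)).neg.sub (hμ.mul hβz)
  have e2 : ContDiffOn ℝ ∞ (fun q : ℝ × ℝ => E.electricZ (1 * E.dist 1 q.1 q.2)
      (E.point 1 q.1 q.2)) U := (h1S.mul (hw.mul hαz)).neg.add (hν.mul hβs)
  revert a b
  refine forall_fin_four ?_ ?_ ?_ ?_ <;> refine forall_fin_four ?_ ?_ ?_ ?_ <;>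
    simp only [maxwellForm, Matrix.of_apply, Matrix.cons_val] <;>
    first
    | exact hc _
    | exact e1
    | exact e1.neg
    | exact hαz
    | exact hαz.neg
    | exact (hc _).mul ((hS.pow 2).mul e2)
    | exact ((hc _).mul ((hS.pow 2).mul e2)).neg
    | exact (hc _).mul (hV.mul e2)
    | exact ((hc _).mul (hV.mul e2)).neg
    | exact (hc _).mul hαs
    | exact ((hc _).mul hαs).neg

end IsRegular

/-! #### The coordinate change -/

lemma exists_bound {f : ℝ → ℝ} (hf : ContDiff ℝ ∞ f) :
    ∃ C, 0 < C ∧ ∀ x ∈ Set.Ioo (-1 : ℝ) 1, |f x| ≤ C ∧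
      ∀ y ∈ Set.Ioo (-1 : ℝ) 1, |f x - f y| ≤ C * |x - y| := by
  have hd : Continuous (deriv f) := hf.continuous_deriv (by simp)
  obtain ⟨A, hA⟩ := (isCompact_Icc (a := (-1 : ℝ)) (b := 1)).exists_bound_of_continuousOn
    hf.continuous.continuousOn
  obtain ⟨B, hB⟩ := (isCompact_Icc (a := (-1 : ℝ)) (b := 1)).exists_bound_of_continuousOn
    hd.continuousOn
  refine ⟨max (max A B) 1, lt_max_of_lt_right one_pos, fun x hx => ⟨?_, fun y hy => ?_⟩⟩
  · exact (hA x (Set.Ioo_subset_Icc_self hx)).trans ((le_max_left A B).trans (le_max_left _ _))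
  · have h := (convex_Icc (-1 : ℝ) 1).norm_image_sub_le_of_norm_deriv_le (f := f)
      (fun z _ => (hf.differentiable (by simp)) z) hB (Set.Ioo_subset_Icc_self hy)
      (Set.Ioo_subset_Icc_self hx)
    refine h.trans (mul_le_mul_of_nonneg_right ?_ (norm_nonneg _))
    exact (le_max_right A B).trans (le_max_left _ _)

lemma eventually_mul_lt (c : ℝ) {d : ℝ} (hd : 0 < d) : ∀ᶠ δ in 𝓝[>] (0 : ℝ), δ * c < d := by
  have h : Filter.Tendsto (fun δ : ℝ => δ * c) (𝓝 0) (𝓝 (0 * c)) :=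
    (continuous_id.mul continuous_const).tendsto 0
  rw [zero_mul] at h
  exact (h.mono_left nhdsWithin_le_nhds).eventually (gt_mem_nhds hd)

/-- Near the horizon `(r, x) ↦ (s, z)` is an injective map to the collar. -/
lemma IsRegular.exists_box (h : E.IsRegular η) : ∃ δ : ℝ, 0 < δ ∧
    Set.MapsTo (fun q : ℝ × ℝ => E.point 1 q.1 q.2) (Set.Ioo (-δ) δ ×ˢ Set.Ioo (-1) 1)
      (collar η) ∧
    (∀ r ∈ Set.Ioo 0 δ, ∀ x ∈ Set.Ioo (-1 : ℝ) 1, 0 < E.dist 1 r x) ∧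
    Set.InjOn (fun q : ℝ × ℝ => E.point 1 q.1 q.2) (Set.Ioo 0 δ ×ˢ Set.Ioo (-1) 1) := by
  have hs := h.slope_pos
  obtain ⟨A, hA0, hA⟩ := exists_bound E.contDiff_shift
  obtain ⟨B, hB0, hB⟩ := exists_bound E.contDiff_bend
  have hdd : ContDiff ℝ ∞ (fun x => E.delayDeriv x / E.rp ^ 2) := by
    unfold delayDeriv shiftDeriv; fun_prop
  obtain ⟨C, hC0, hC⟩ := exists_bound hdd
  -- The second condition keeps `|s| < η`, the third gives `s > 0` for `r > 0`, the fourth keeps `z`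
  -- in `(-1, 1)`; the first and the last two are for injectivity.
  have hev : ∀ᶠ δ in 𝓝[>] (0 : ℝ), δ * 1 < 1 ∧ δ * (E.slope + A) < η ∧ δ * A < E.slope ∧
      δ * (2 * C) < 1 ∧ δ * B < 1 / 2 ∧ δ * (2 * A + 2 * A * B) < E.slope :=
    (eventually_mul_lt _ one_pos).and ((eventually_mul_lt _ h.η_pos).and
      ((eventually_mul_lt _ hs).and ((eventually_mul_lt _ one_pos).and
      ((eventually_mul_lt _ (by norm_num)).and (eventually_mul_lt _ hs)))))
  obtain ⟨δ, ⟨h1, h2, h3, h4, h5, h6⟩, hδ⟩ := (hev.and self_mem_nhdsWithin).exists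
  have hδ : 0 < δ := hδ
  rw [mul_one] at h1
  refine ⟨δ, hδ, ?_, ?_, ?_⟩
  · rintro ⟨r, x⟩ ⟨hr, hx⟩
    have hr : |r| < δ := abs_lt.mpr hr
    have hx : x ∈ Set.Ioo (-1 : ℝ) 1 := hx
    have ha := (hA x hx).1
    refine ⟨abs_lt.mp ?_, ?_⟩
    · show |1 * (r * (E.slope + E.shift x * (1 * r)))| < η
      rw [one_mul, one_mul, abs_mul]
      have : |E.slope + E.shift x * r| ≤ E.slope + A := by
        refine (abs_add_le _ _).trans ?_
        rw [abs_of_pos hs, abs_mul]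
        nlinarith [abs_nonneg r, abs_nonneg (E.shift x)]
      calc |r| * |E.slope + E.shift x * r| ≤ δ * (E.slope + A) :=
            mul_le_mul hr.le this (abs_nonneg _) hδ.le
        _ < η := h2
    · have hc := (hC x hx).1
      have hrc : |r * (E.delayDeriv x / E.rp ^ 2)| < 1 / 2 := by
        rw [abs_mul]
        have : |r| * |E.delayDeriv x / E.rp ^ 2| ≤ δ * C :=
          mul_le_mul hr.le hc (abs_nonneg _) hδ.le
        linarith
      obtain ⟨hl, hu⟩ := abs_lt.mp hrc
      -- The factor `1 - x²` in `bend` prevents `z` from crossing a pole, for `r` small uniformly in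
      -- `x`.
      have hb : x + 1 * r * E.bend x
          = x - r * (E.delayDeriv x / E.rp ^ 2) * ((1 - x) * (1 + x)) := by
        simp only [bend]; ring
      have hx1 : 0 < 1 - x := by linarith [hx.2]
      have hx2 : 0 < 1 + x := by linarith [hx.1]
      show x + 1 * r * E.bend x ∈ Set.Ioo (-1 : ℝ) 1
      rw [hb]
      constructor
      · nlinarith [mul_pos hx1 hx2]
      · nlinarith [mul_pos hx1 hx2]
  · intro r hr x hx
    have ha := (abs_le.mp (hA x hx).1).1
    have : r * A < E.slope := (mul_lt_mul_of_pos_right hr.2 hA0).trans h3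
    refine mul_pos hr.1 ?_
    nlinarith [hr.1]
  · rintro ⟨r, x⟩ ⟨hr, hx⟩ ⟨r', x'⟩ ⟨hr', hx'⟩ heq
    have hr : r ∈ Set.Ioo 0 δ := hr
    have hr' : r' ∈ Set.Ioo 0 δ := hr'
    have hx : x ∈ Set.Ioo (-1 : ℝ) 1 := hx
    have hx' : x' ∈ Set.Ioo (-1 : ℝ) 1 := hx'
    have e1 : 1 * (r * (E.slope + E.shift x * (1 * r)))
      = 1 * (r' * (E.slope + E.shift x' * (1 * r'))) := congrArg Prod.fst heq
    have e2 : x + 1 * r * E.bend x = x' + 1 * r' * E.bend x' := congrArg Prod.snd heq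
    -- Subtracting the equations for `z` bounds `|x - x'|` by `2 B |r - r'|`. Inserted into the
    -- difference of the equations for `s`, this forces `r = r'`, because `slope` dominates for
    -- small `δ`.
    have hdx : |x - x'| ≤ |r - r'| * B + δ * (B * |x - x'|) := by
      have : |x - x'| = |(r - r') * E.bend x + r' * (E.bend x - E.bend x')| := by
        rw [← abs_neg]
        congr 1
        linarith
      refine this.le.trans ((abs_add_le _ _).trans ?_)
      rw [abs_mul, abs_mul, abs_of_pos hr'.1]
      exact add_le_add (mul_le_mul_of_nonneg_left (hB x hx).1 (abs_nonneg _))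
        (mul_le_mul hr'.2.le ((hB x hx).2 x' hx') (abs_nonneg _) hδ.le)
    have hdr : |r - r'| * E.slope ≤ |r - r'| * (2 * δ) * A + δ * δ * (A * |x - x'|) := by
      have : (r - r') * E.slope = -((r - r') * (r + r') * E.shift x
          + r' * r' * (E.shift x - E.shift x')) := by linarith
      rw [← abs_of_pos hs, ← abs_mul, this, abs_neg]
      refine (abs_add_le _ _).trans ?_
      rw [abs_mul, abs_mul, abs_mul, abs_of_pos (mul_pos hr'.1 hr'.1),
        abs_of_pos (add_pos hr.1 hr'.1)]
      refine add_le_add (mul_le_mul (mul_le_mul_of_nonneg_left ?_ (abs_nonneg _)) (hA x hx).1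
        (abs_nonneg _) ?_) (mul_le_mul ?_ ((hA x hx).2 x' hx') (abs_nonneg _) ?_)
      · linarith [hr.2, hr'.2]
      · positivity
      · exact mul_le_mul hr'.2.le hr'.2.le hr'.1.le hδ.le
      · positivity
    have hX := abs_nonneg (x - x')
    have hR := abs_nonneg (r - r')
    have hdx' : |x - x'| ≤ 2 * B * |r - r'| := by nlinarith
    have hr0 : |r - r'| = 0 := by
      by_contra hne
      have hpos := lt_of_le_of_ne hR (Ne.symm hne)
      have k1 : δ * δ * (A * |x - x'|) ≤ δ * (2 * A * B) * |r - r'| := by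
        have : A * |x - x'| ≤ A * (2 * B * |r - r'|) := mul_le_mul_of_nonneg_left hdx' hA0.le
        have hdd : δ * δ ≤ δ := by nlinarith
        calc δ * δ * (A * |x - x'|) ≤ δ * (A * (2 * B * |r - r'|)) :=
              mul_le_mul hdd this (by positivity) hδ.le
          _ = _ := by ring
      have k2 : |r - r'| * (δ * (2 * A + 2 * A * B)) < |r - r'| * E.slope :=
        mul_lt_mul_of_pos_left h6 hpos
      linarith
    have hx0 : |x - x'| = 0 := le_antisymm (by rw [hr0] at hdx'; linarith) hX
    rw [Prod.mk.injEq]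
    exact ⟨sub_eq_zero.mp (abs_eq_zero.mp hr0), sub_eq_zero.mp (abs_eq_zero.mp hx0)⟩

/-- A smooth primitive of a smooth function on an interval. -/
lemma exists_primitive {a b : ℝ} (hab : a < b) {f : ℝ → ℝ} (hf : ContDiffOn ℝ ∞ f (Set.Ioo a b)) :
    ∃ F : ℝ → ℝ, ContDiffOn ℝ ∞ F (Set.Ioo a b) ∧ ∀ s ∈ Set.Ioo a b, HasDerivAt F (f s) s := by
  have hm : (a + b) / 2 ∈ Set.Ioo a b := ⟨by linarith, by linarith⟩
  have hd : ∀ s ∈ Set.Ioo a b,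
      HasDerivAt (fun s => ∫ y in ((a + b) / 2)..s, f y) (f s) s := by
    intro s hs
    have hsub : Set.uIcc ((a + b) / 2) s ⊆ Set.Ioo a b := Set.ordConnected_Ioo.uIcc_subset hm hs
    exact intervalIntegral.integral_hasDerivAt_right
      ((hf.continuousOn.mono hsub).intervalIntegrable)
      (hf.continuousOn.stronglyMeasurableAtFilter isOpen_Ioo s hs)
      (hf.continuousOn.continuousAt (isOpen_Ioo.mem_nhds hs))
  refine ⟨_, ?_, hd⟩
  rw [contDiffOn_infty_iff_deriv_of_isOpen isOpen_Ioo]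
  exact ⟨fun s hs => (hd s hs).differentiableAt.differentiableWithinAt,
    hf.congr fun s hs => (hd s hs).deriv⟩

end HorizonData

/-- The Jacobian of a stationary and axisymmetric change of coordinates. -/
lemma pd_chart {T R Y : ℝ × ℝ → ℝ} {k T₁ T₂ R₁ R₂ Y₁ Y₂ : ℝ} {p : Pt}
    (hT₁ : HasDerivAt (fun r => T (r, p 2)) T₁ (p 1))
    (hT₂ : HasDerivAt (fun x => T (p 1, x)) T₂ (p 2))
    (hR₁ : HasDerivAt (fun r => R (r, p 2)) R₁ (p 1))
    (hR₂ : HasDerivAt (fun x => R (p 1, x)) R₂ (p 2))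
    (hY₁ : HasDerivAt (fun r => Y (r, p 2)) Y₁ (p 1))
    (hY₂ : HasDerivAt (fun x => Y (p 1, x)) Y₂ (p 2)) (a μ : Fin 4) :
    pd μ (fun q => (![q 0 + T (q 1, q 2), R (q 1, q 2), Y (q 1, q 2), k * q 3 + 0 * q 0 + 0] : Pt) a)
      p = !![1, T₁, T₂, 0; 0, R₁, R₂, 0; 0, Y₁, Y₂, 0; 0, 0, 0, k] a μ := by
  revert a μ
  refine forall_fin_four ?_ ?_ ?_ ?_ <;> refine forall_fin_four ?_ ?_ ?_ ?_ <;>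
    simp [pd, hT₁.deriv, hT₂.deriv, hR₁.deriv, hR₂.deriv, hY₁.deriv, hY₂.deriv]

namespace HorizonData

variable {E : HorizonData} {η : ℝ}

/-- The components of the metric in the coordinates `(t, ϱ₀ + s, m z, ψ)`, where `m' = d`. -/
def staticMetric (E : HorizonData) (d s : ℝ) (q : ℝ × ℝ) : Matrix (Fin 4) (Fin 4) ℝ :=
  !![-(s ^ 2 * E.n q) + E.X q * (s ^ 3 * E.w q) ^ 2, 0, 0, -(E.X q * (s ^ 3 * E.w q));
     0, E.n q * E.V q.1 ^ 2 / s ^ 2 + E.l q, 0, 0;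
     0, 0, E.Q q / d ^ 2, 0;
     -(E.X q * (s ^ 3 * E.w q)), 0, 0, E.X q]

/-- The components of the Maxwell field in the coordinates `(t, ϱ₀ + s, m z, ψ)`. -/
def staticMaxwell (E : HorizonData) (d s : ℝ) (q : ℝ × ℝ) : Matrix (Fin 4) (Fin 4) ℝ :=
  !![0, -E.electricS s q, -(s ^ 2 * E.electricZ s q / d), 0;
     E.electricS s q, 0, 0, pds E.α q;
     s ^ 2 * E.electricZ s q / d, 0, 0, pdz E.α q / d;
     0, -pds E.α q, -(pdz E.α q / d), 0]

/-- The Jacobian of the change of coordinates from `(t, ϱ, y, ψ)` to `(v, r, x, φ)`. -/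
def jacobian (E : HorizonData) (d r x : ℝ) : Matrix (Fin 4) (Fin 4) ℝ :=
  Matrix.of fun a μ => ![E.frame 1 r x 0 μ
    - E.V (E.dist 1 r x) / E.dist 1 r x ^ 2 * E.frame 1 r x 1 μ,
    E.frame 1 r x 1 μ, d * E.frame 1 r x 2 μ, E.frame 1 r x 3 μ] a

/-- With `dt = θ - (V/s²) ds` one has `-s² n dt² + (n V²/s²) ds² = -s² n θ² + 2 n V θ ds`: the
double pole cancels, and only `l ds²` is left of the radial term. The twist form `s³ w dt` becomes
`s³ w θ - s w V ds`, which is regular too. -/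
lemma sum_jacobian_staticMetric {d r x : ℝ} (hd : d ≠ 0) (hs : E.dist 1 r x ≠ 0) (μ ν : Fin 4) :
    ∑ a, ∑ b, E.jacobian d r x a μ * E.jacobian d r x b ν
      * E.staticMetric d (E.dist 1 r x) (E.point 1 r x) a b = E.nullMetric (r, x) μ ν := by
  have h1 : (E.point 1 r x).1 = E.dist 1 r x := one_mul _
  simp only [nullMetric, pull, jacobian, staticMetric, metricForm, Fin.sum_univ_four,
    Matrix.of_apply, Matrix.cons_val, h1]
  generalize E.frame 1 r x = f
  generalize E.point 1 r x = q
  generalize E.V (E.dist 1 r x) = V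
  generalize E.dist 1 r x = s at *
  field_simp
  ring

/-- The `dt ∧ ds` term is unaffected by `dt = θ - (V/s²) ds`, and in the `dt ∧ dz` term the factor
`s²` of the field cancels the pole. -/
lemma sum_jacobian_staticMaxwell {d r x : ℝ} (hd : d ≠ 0) (hs : E.dist 1 r x ≠ 0) (μ ν : Fin 4) :
    ∑ a, ∑ b, E.jacobian d r x a μ * E.jacobian d r x b ν
      * E.staticMaxwell d (E.dist 1 r x) (E.point 1 r x) a b = E.nullMaxwell (r, x) μ ν := by
  have h1 : (E.point 1 r x).1 = E.dist 1 r x := one_mul _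
  simp only [nullMaxwell, pull, jacobian, staticMaxwell, maxwellForm, Fin.sum_univ_four,
    Matrix.of_apply, Matrix.cons_val, h1, one_mul]
  generalize E.frame 1 r x = f
  generalize E.electricS (E.dist 1 r x) (E.point 1 r x) = e₁
  generalize E.electricZ (E.dist 1 r x) (E.point 1 r x) = e₂
  generalize E.point 1 r x = q
  generalize E.V (E.dist 1 r x) = V
  generalize E.dist 1 r x = s at *
  field_simp
  ring

/-- The transverse deformation of a circular spacetime with a regular extreme horizon. -/
theorem IsRegular.hasTransverseDeformation (h : E.IsRegular η) {g F : TensorField}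
    {ext : Set (ℝ × ℝ)} {ϱ₀ : ℝ} {m m' : ℝ → ℝ} (hm : ContDiffOn ℝ ∞ m (Set.Ioo (-1) 1))
    (hm' : ∀ z ∈ Set.Ioo (-1 : ℝ) 1, HasDerivAt m (m' z) z)
    (hm0 : ∀ z ∈ Set.Ioo (-1 : ℝ) 1, m' z ≠ 0) (hinj : Set.InjOn m (Set.Ioo (-1) 1))
    (hext : ∀ s ∈ Set.Ioo 0 η, ∀ z ∈ Set.Ioo (-1 : ℝ) 1, (ϱ₀ + s, m z) ∈ ext)
    (hg : ∀ s ∈ Set.Ioo 0 η, ∀ z ∈ Set.Ioo (-1 : ℝ) 1, ∀ t ψ,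
      g ![t, ϱ₀ + s, m z, ψ] = E.staticMetric (m' z) s (s, z))
    (hF : ∀ s ∈ Set.Ioo 0 η, ∀ z ∈ Set.Ioo (-1 : ℝ) 1, ∀ t ψ,
      F ![t, ϱ₀ + s, m z, ψ] = E.staticMaxwell (m' z) s (s, z)) :
    HasTransverseDeformation g F ext ϱ₀ E.qe E.qm E.rp E.deformation := by
  obtain ⟨δ, hδ, hmaps, hdist, hinj'⟩ := h.exists_box
  have hη := h.η_pos
  have hV : ContDiffOn ℝ ∞ (fun s => -(E.V s / s ^ 2)) (Set.Ioo 0 η) :=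
    ((h.smooth_V.mono (Set.Ioo_subset_Ioo_left (by linarith))).div
      (contDiff_id.pow 2).contDiffOn fun s hs => pow_ne_zero 2 hs.1.ne').neg
  -- The singular part of `t - v`. It exists outside the horizon only, but the extended fields see
  -- nothing but its derivative.
  obtain ⟨P, hP, hP'⟩ := exists_primitive hη hV
  have hsub : Set.Ioo 0 δ ×ˢ Set.Ioo (-1 : ℝ) 1 ⊆ Set.Ioo (-δ) δ ×ˢ Set.Ioo (-1 : ℝ) 1 :=
    Set.prod_mono (Set.Ioo_subset_Ioo_left (by linarith)) subset_rfl
  have hS : Set.MapsTo (fun q : ℝ × ℝ => E.dist 1 q.1 q.2) (Set.Ioo 0 δ ×ˢ Set.Ioo (-1) 1)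
      (Set.Ioo 0 η) := fun q hq =>
    ⟨hdist _ hq.1 _ hq.2, by simpa [point] using (hmaps (hsub hq)).1.2⟩
  have hZ : Set.MapsTo (fun q : ℝ × ℝ => (E.point 1 q.1 q.2).2) (Set.Ioo 0 δ ×ˢ Set.Ioo (-1) 1)
      (Set.Ioo (-1) 1) := fun q hq => (hmaps (hsub hq)).2
  have hpt : ∀ q : ℝ × ℝ, E.point 1 q.1 q.2 = (E.dist 1 q.1 q.2, (E.point 1 q.1 q.2).2) :=
    fun q => Prod.ext (one_mul _) rfl
  have hsZ : ContDiff ℝ ∞ (fun q : ℝ × ℝ => (E.point 1 q.1 q.2).2) :=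
    contDiff_snd.comp E.contDiff_point
  -- The angle needs neither a rotation nor a shift: the angular velocity vanishes to third order at
  -- the horizon, so `Ω = 0` and `S = 0` suffice.
  refine ⟨δ, E.k, 0, fun q => E.delay q.2 + P (E.dist 1 q.1 q.2),
    fun q => ϱ₀ + E.dist 1 q.1 q.2, fun q => m (E.point 1 q.1 q.2).2, fun _ => 0,
    E.nullMetric, E.nullMaxwell, hδ, h.k_pos, ?_, ?_, ?_, ?_, ?_, ?_, ?_, ?_⟩
  · intro u hu
    simp only [List.mem_cons, List.not_mem_nil, or_false] at hu
    rcases hu with rfl | rfl | rfl | rfl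
    · exact (E.contDiff_delay.comp contDiff_snd).contDiffOn.add
        (hP.comp E.contDiff_dist.contDiffOn hS)
    · exact (contDiff_const.add E.contDiff_dist).contDiffOn
    · exact hm.comp hsZ.contDiffOn hZ
    · exact contDiffOn_const
  · intro q hq q' hq' heq
    have h1 := congrArg Prod.fst heq
    have h2 := congrArg Prod.snd heq
    refine hinj' hq hq' ?_
    simp only
    rw [hpt q, hpt q', Prod.mk.injEq]
    exact ⟨by simpa using h1, hinj (hZ hq) (hZ hq') h2⟩
  · exact fun q hq => hext _ (hS hq) _ (hZ hq)
  · intro x _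
    have hc : Continuous fun r => ϱ₀ + E.dist 1 r x :=
      continuous_const.add (E.contDiff_dist.continuous.comp (by fun_prop : Continuous
        fun r : ℝ => (r, x)))
    have := (hc.tendsto 0).mono_left (nhdsWithin_le_nhds (s := Set.Ioi 0))
    simpa [dist] using this
  · exact h.contDiffOn_nullMetric hmaps
  · exact h.contDiffOn_nullMaxwell hmaps
  · intro χ p hp hr
    have hq : (p 1, p 2) ∈ Set.Ioo 0 δ ×ˢ Set.Ioo (-1 : ℝ) 1 := ⟨hr, hp⟩
    have hs := hS hq
    have hz := hZ hq
    simp only at hs hz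
    have hs₁ : HasDerivAt (fun r => E.dist 1 r (p 2)) (E.slope + 2 * E.shift (p 2) * (1 * p 1))
        (p 1) := by
      have := (hasDerivAt_id' (p 1)).fun_mul ((((hasDerivAt_id' (p 1)).const_mul (1 : ℝ)).const_mul
        (E.shift (p 2))).const_add E.slope)
      exact this.congr_deriv (by ring)
    have hs₂ : HasDerivAt (fun x => E.dist 1 (p 1) x) (1 * p 1 ^ 2 * E.shiftDeriv (p 2)) (p 2) := by
      have := (((E.hasDerivAt_shift (p 2)).mul_const (1 * p 1)).const_add E.slope).const_mul (p 1)
      exact this.congr_deriv (by ring)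
    have hz₁ : HasDerivAt (fun r => (E.point 1 r (p 2)).2) (1 * E.bend (p 2)) (p 1) :=
      ((((hasDerivAt_id' (p 1)).const_mul (1 : ℝ)).mul_const (E.bend (p 2))).const_add
        (p 2)).congr_deriv (by ring)
    have hz₂ : HasDerivAt (fun x => (E.point 1 (p 1) x).2) (1 + 1 * p 1 * E.bendDeriv (p 2))
        (p 2) :=
      (hasDerivAt_id' (p 2)).fun_add ((E.hasDerivAt_bend (p 2)).const_mul (1 * p 1))
    have hPs := hP' _ hs
    have hmz := hm' _ hz
    have hJ : ∀ a μ, pd μ (fun q => χ q a) p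
        = E.jacobian (m' (E.point 1 (p 1) (p 2)).2) (p 1) (p 2) a μ := by
      intro a μ
      refine (pd_chart (T := fun q => E.delay q.2 + P (E.dist 1 q.1 q.2))
        (R := fun q => ϱ₀ + E.dist 1 q.1 q.2) (Y := fun q => m (E.point 1 q.1 q.2).2) (k := E.k)
        ((hPs.comp (p 1) hs₁).const_add (E.delay (p 2)))
        ((E.hasDerivAt_delay (p 2)).fun_add (hPs.comp (p 2) hs₂))
        (hs₁.const_add ϱ₀) (hs₂.const_add ϱ₀) (hmz.comp (p 1) hz₁) (hmz.comp (p 2) hz₂)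
        a μ).trans ?_
      revert a μ
      refine forall_fin_four ?_ ?_ ?_ ?_ <;> refine forall_fin_four ?_ ?_ ?_ ?_ <;>
        simp only [jacobian, frame, Matrix.of_apply, Matrix.cons_val] <;> ring
    have hχ : χ p = ![p 0 + (E.delay (p 2) + P (E.dist 1 (p 1) (p 2))),
        ϱ₀ + E.dist 1 (p 1) (p 2), m (E.point 1 (p 1) (p 2)).2, E.k * p 3 + 0 * p 0 + 0] := rfl
    have hpt' := hpt (p 1, p 2)
    simp only at hpt'
    constructor
    · ext μ ν
      rw [← E.sum_jacobian_staticMetric (hm0 _ hz) hs.1.ne']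
      simp only [pullback, Matrix.of_apply, hJ]
      rw [hχ, hg _ hs _ hz, ← hpt']
    · ext μ ν
      rw [← E.sum_jacobian_staticMaxwell (hm0 _ hz) hs.1.ne']
      simp only [pullback, Matrix.of_apply, hJ]
      rw [hχ, hF _ hs _ hz, ← hpt']
  · exact fun p hp μ ν => ⟨h.tendsto_nullMetric hp μ ν, h.tendsto_nullMaxwell hp μ ν⟩

end HorizonData

/-- The deformation obtained from the scaling limit is already the normal form with `K₁ = 0`, so the
trivial gauge transformation is enough. -/
lemma isContainedInModuliSpace_of_hasTransverseDeformation {qe qm rp K₂ K₃ : ℝ} (hrp : 0 < rp)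
    (hq : qe ^ 2 + qm ^ 2 = rp ^ 2) {g F : TensorField} {ext : Set (ℝ × ℝ)} {ϱ₀ : ℝ}
    (h : HasTransverseDeformation g F ext ϱ₀ qe qm rp (normalForm qe qm rp 0 K₂ K₃)) :
    IsContainedInModuliSpace g F ext ϱ₀ qe qm rp K₂ K₃ := by
  have h0 : GaugeEquivalent qe qm rp (normalForm qe qm rp 0 K₂ K₃)
      (normalForm qe qm rp 0 K₂ K₃) := by
    rw [GaugeEquivalent, sub_self]
    exact isPureGauge_zero qe qm rp
  have hm := normalForm_mem 0 K₂ K₃ hrp hq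
  exact ⟨_, ⟨hm, (isStatic_iff_of_gaugeEquivalent hrp hq hm h0).2 rfl⟩, h, h0⟩

namespace HorizonData

variable {E : HorizonData} {η : ℝ}

lemma circularMetric_eq_staticMetric {N P Q X w : ℝ → ℝ → ℝ} {d s ϱ y z : ℝ}
    (hN : N ϱ y = s ^ 2 * E.n (s, z)) (hP : P ϱ y = E.n (s, z) * E.V s ^ 2 / s ^ 2 + E.l (s, z))
    (hQ : Q ϱ y = E.Q (s, z) / d ^ 2) (hX : X ϱ y = E.X (s, z))
    (hw : w ϱ y = -(s ^ 3 * E.w (s, z))) (t ψ : ℝ) :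
    circularMetric N P Q X w ![t, ϱ, y, ψ] = E.staticMetric d s (s, z) := by
  ext a b
  revert a b
  refine forall_fin_four ?_ ?_ ?_ ?_ <;> refine forall_fin_four ?_ ?_ ?_ ?_ <;>
    simp only [circularMetric, staticMetric, Matrix.of_apply, Matrix.cons_val, hN, hP, hQ, hX,
      hw] <;> ring

/-- The factor `d` is the derivative of `y` with respect to `z` and converts `y`-derivatives. The
two square roots are hypotheses because each solution has its own rational form for them. -/
lemma circularMaxwell_eq_staticMaxwell {N P Q X w : ℝ → ℝ → ℝ} {Φ : ℝ → ℝ → ℂ} {d s ϱ y z : ℝ}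
    (hd : d ≠ 0) (hw : w ϱ y = -(s ^ 3 * E.w (s, z)))
    (hμ : √(N ϱ y * P ϱ y / (Q ϱ y * X ϱ y)) = E.μ (s, z) * d)
    (hν : √(N ϱ y * Q ϱ y / (P ϱ y * X ϱ y)) = s ^ 2 * E.ν (s, z) / d)
    (hαs : HasDerivAt (fun ϱ => (Φ ϱ y).re) (pds E.α (s, z)) ϱ)
    (hαz : HasDerivAt (fun y => (Φ ϱ y).re) (pdz E.α (s, z) / d) y)
    (hβs : HasDerivAt (fun ϱ => (Φ ϱ y).im) (pds E.β (s, z)) ϱ)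
    (hβz : HasDerivAt (fun y => (Φ ϱ y).im) (pdz E.β (s, z) / d) y) (t ψ : ℝ) :
    circularMaxwell N P Q X w Φ ![t, ϱ, y, ψ] = E.staticMaxwell d s (s, z) := by
  ext a b
  revert a b
  refine forall_fin_four ?_ ?_ ?_ ?_ <;> refine forall_fin_four ?_ ?_ ?_ ?_ <;>
    simp only [circularMaxwell, staticMaxwell, electricS, electricZ, Matrix.of_apply,
      Matrix.cons_val, hμ, hν, hw, hαs.deriv, hαz.deriv, hβs.deriv, hβz.deriv] <;>
    (try field_simp)

end HorizonData

/-! #### Extreme Reissner–Nordström -/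

/-- The horizon of the extreme Reissner–Nordström solution. -/
def rnHorizon (qe qm rp : ℝ) : HorizonData where
  n q := 1 / (rp + q.1) ^ 2
  l _ := 0
  Q q := (rp + q.1) ^ 2 / (1 - q.2 ^ 2)
  X q := (rp + q.1) ^ 2 * (1 - q.2 ^ 2)
  w _ := 0
  μ q := 1 / (rp + q.1) ^ 2
  -- Only the value at `s = 0` is prescribed; off the horizon `ν` multiplies `∂_s β`, which vanishes
  -- here, so it need not be the actual root.
  ν q := 1 / (rp ^ 2 * (1 - q.2 ^ 2))
  α q := qm * q.2
  β q := -(qe * q.2)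
  V s := (rp + s) ^ 2
  k := 1
  V₀ := rp ^ 2
  p₀ := 0
  p₁ := 0
  p₂ := 0
  qe := qe
  qm := qm
  rp := rp
  K₂ := 2 * rp
  K₃ := 0

/-- No shift, delay or bending is needed, since the standard ingoing coordinates already have the
required form. The modulus `K₂ = 2 rp` is the derivative of `V = (rp + s)²` at the horizon. -/
lemma isRegular_rnHorizon {qe qm rp : ℝ} (hrp : 0 < rp) :
    (rnHorizon qe qm rp).IsRegular rp := by
  have hc : ∀ q ∈ collar rp, 1 - q.2 ^ 2 ≠ 0 := fun q hq => (one_sub_sq_pos hq.2).ne'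
  have hϱ : ∀ q ∈ collar rp, (rp + q.1) ^ 2 ≠ 0 := fun q hq =>
    pow_ne_zero 2 (by linarith [hq.1.1])
  have hνc : ∀ q ∈ collar rp, rp ^ 2 * (1 - q.2 ^ 2) ≠ 0 := fun q hq =>
    mul_ne_zero (pow_ne_zero 2 hrp.ne') (hc q hq)
  have hsq : HasDerivAt (fun s : ℝ => (rp + s) ^ 2) (2 * rp) 0 :=
    (((hasDerivAt_id' (0 : ℝ)).const_add rp).fun_pow 2).congr_deriv (by ring)
  have hbend : ∀ z, (rnHorizon qe qm rp).bend z = 0 := fun z => by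
    simp [rnHorizon, HorizonData.bend, HorizonData.delayDeriv, HorizonData.shiftDeriv]
  have hbend' : ∀ z, (rnHorizon qe qm rp).bendDeriv z = 0 := fun z => by
    simp [rnHorizon, HorizonData.bendDeriv, HorizonData.delayDeriv, HorizonData.shiftDeriv]
  have hshift : ∀ z, (rnHorizon qe qm rp).shift z = 0 := fun z => by
    simp [rnHorizon, HorizonData.shift]
  have hslope : (rnHorizon qe qm rp).slope = 1 := div_self (pow_ne_zero 2 hrp.ne')
  have hinv : HasDerivAt (fun s : ℝ => 1 / (rp + s) ^ 2) (-(2 / rp ^ 3)) 0 :=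
    (((hasDerivAt_const (0 : ℝ) (1 : ℝ)).fun_div hsq (by simpa using hrp.ne')).congr_deriv (by
      field_simp
      ring))
  refine
    { η_pos := hrp
      k_pos := one_pos
      V₀_pos := pow_pos hrp 2
      rp_pos := hrp
      smooth := ?_
      smooth_V := by unfold rnHorizon; fun_prop
      V_zero := by simp [rnHorizon]
      V_deriv := hsq.congr_deriv (by simp [rnHorizon])
      n_zero := fun z _ => ?_
      Q_zero := fun z _ => by simp [rnHorizon, div_eq_mul_inv]
      X_zero := fun z _ => by simp [rnHorizon]
      μ_zero := fun z _ => by simp [rnHorizon]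
      ν_zero := fun z _ => by simp [rnHorizon]
      α_zero := fun z _ => ((hasDerivAt_id' z).const_mul qm).congr_deriv (by simp [rnHorizon])
      β_zero := fun z _ => ((hasDerivAt_id' z).const_mul qe).fun_neg.congr_deriv
        (by simp [rnHorizon])
      n_deriv := fun z _ => hinv.congr_deriv ?_
      Q_deriv := fun z hz => (hsq.div_const (1 - z ^ 2)).congr_deriv ?_
      X_deriv := fun z _ => (hsq.mul_const (1 - z ^ 2)).congr_deriv ?_
      μ_deriv := fun z _ => hinv.congr_deriv ?_
      α_deriv := fun z _ => (hasDerivAt_const (0 : ℝ) (qm * z)).congr_deriv ?_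
      β_deriv := fun z _ => (hasDerivAt_const (0 : ℝ) (-(qe * z))).congr_deriv ?_ }
  · intro u hu
    simp only [List.mem_cons, List.not_mem_nil, or_false, rnHorizon] at hu
    rcases hu with rfl | rfl | rfl | rfl | rfl | rfl | rfl | rfl | rfl <;>
      fun_prop (disch := first | exact hϱ | exact hc | exact hνc)
  all_goals
    try simp only [hbend, hbend', hshift, hslope]
    simp only [rnHorizon]
    try field_simp
    try ring1

/-- Extreme Reissner–Nordström. -/
theorem isContainedInModuliSpace_rn {qe qm rp : ℝ} (hrp : 0 < rp)
    (hq : qe ^ 2 + qm ^ 2 = rp ^ 2) :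
    IsContainedInModuliSpace (rnMetric rp) (rnMaxwell qe qm) (rnExterior rp) rp
      qe qm rp (2 * rp) 0 := by
  refine isContainedInModuliSpace_of_hasTransverseDeformation hrp hq
    ((isRegular_rnHorizon (qe := qe) (qm := qm) hrp).hasTransverseDeformation (m := fun z => z)
    (m' := fun _ => 1) contDiffOn_id (fun z _ => hasDerivAt_id' z) (fun _ _ => one_ne_zero)
    (fun _ _ _ _ h => h) (fun s hs z hz => ⟨by simpa using hs.1, hz⟩) ?_ ?_)
  · intro s hs z hz t ψ
    have h1 : rp + s ≠ 0 := by linarith [hs.1]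
    have h2 := hs.1.ne'
    have h3 : 1 - rp / (rp + s) = s / (rp + s) := by field_simp; ring
    refine HorizonData.circularMetric_eq_staticMetric ?_ ?_ ?_ ?_ ?_ t ψ <;>
      simp only [rnHorizon, h3] <;> (try field_simp) <;> (try ring1)
  · intro s hs z hz t ψ
    have h1 : rp + s ≠ 0 := by linarith [hs.1]
    have hα : fderiv ℝ (fun q : ℝ × ℝ => qm * q.2) (s, z) = qm • ContinuousLinearMap.snd ℝ ℝ ℝ :=
      (hasFDerivAt_snd.const_mul qm).fderiv
    have hβ : fderiv ℝ (fun q : ℝ × ℝ => -(qe * q.2)) (s, z)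
        = -(qe • ContinuousLinearMap.snd ℝ ℝ ℝ) :=
      (hasFDerivAt_snd.const_mul qe).fun_neg.fderiv
    ext a b
    revert a b
    refine forall_fin_four ?_ ?_ ?_ ?_ <;> refine forall_fin_four ?_ ?_ ?_ ?_ <;>
      simp [rnMaxwell, HorizonData.staticMaxwell, HorizonData.electricS, HorizonData.electricZ,
        rnHorizon, pds, pdz, hα, hβ] <;> (try field_simp)

/-! #### Extreme Kerr–Melvin -/

/-- The real part of `Λ` for `a² b² = 1`. -/
def kmRe (a r x : ℝ) : ℝ := 1 + km𝒜 a r x * (1 - x ^ 2) / (4 * a ^ 2 * kmρsq a r x)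

/-- The imaginary part of `Λ` for `a² b² = 1`. -/
def kmIm (a r x : ℝ) : ℝ := -(x / 2) * (3 - x ^ 2 + a ^ 2 / kmρsq a r x * (1 - x ^ 2) ^ 2)

/-- `|Λ|²` for `a² b² = 1`. -/
def kmNormSq (a r x : ℝ) : ℝ := kmRe a r x ^ 2 + kmIm a r x ^ 2

/-- The quotient of `ω` by `(r - a)³` for `a² b² = 1`. -/
def kmTwist (a r x : ℝ) : ℝ :=
  ((3 + 6 * x ^ 2 - x ^ 4) * (r ^ 4 + a * r ^ 3 + a ^ 3 * r)
    + (5 + 18 * x ^ 2 + x ^ 4) * (a ^ 2 * r ^ 2) + (2 + 12 * x ^ 2 + 2 * x ^ 4) * a ^ 4)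
    / (8 * a ^ 2 * (r ^ 2 + a ^ 2) * km𝒜 a r x)

section

variable {a b : ℝ}

lemma inv_sq_of_sq_mul_sq_eq_one (ha : 0 < a) (hab : a ^ 2 * b ^ 2 = 1) : b ^ 2 = 1 / a ^ 2 := by
  field_simp
  linarith

lemma kmΛ_eq (ha : 0 < a) (hab : a ^ 2 * b ^ 2 = 1) (r x : ℝ) :
    kmΛ a b r x = ⟨kmRe a r x, kmIm a r x⟩ := by
  have hb := inv_sq_of_sq_mul_sq_eq_one ha hab
  apply Complex.ext
  · simp only [kmΛ, kmRe, hb]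
    ring
  · simp only [kmΛ, kmIm]
    linear_combination (-(1 / 2) * x * (3 - x ^ 2 + a ^ 2 / kmρsq a r x * (1 - x ^ 2) ^ 2)) * hab

lemma normSq_kmΛ (ha : 0 < a) (hab : a ^ 2 * b ^ 2 = 1) (r x : ℝ) :
    Complex.normSq (kmΛ a b r x) = kmNormSq a r x := by
  rw [kmΛ_eq ha hab, Complex.normSq_mk, kmNormSq]
  ring

lemma kmρsq_pos {r x : ℝ} (hr : 0 < r) : 0 < kmρsq a r x := by
  have := sq_nonneg (a * x)
  have := pow_pos hr 2
  simp only [kmρsq]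
  nlinarith

lemma km𝒜_pos (ha : 0 < a) {r x : ℝ} (hr : 0 < r) : 0 < km𝒜 a r x := by
  have h1 : 0 < r ^ 2 + a ^ 2 := by positivity
  have h2 : (r - a) ^ 2 ≤ r ^ 2 + a ^ 2 := by nlinarith [mul_pos ha hr]
  have h3 : 0 ≤ (r - a) ^ 2 := sq_nonneg _
  have h4 : (r - a) ^ 2 * a ^ 2 ≤ (r ^ 2 + a ^ 2) * a ^ 2 :=
    mul_le_mul_of_nonneg_right h2 (sq_nonneg a)
  have h5 : 0 ≤ (r - a) ^ 2 * a ^ 2 * x ^ 2 := by positivity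
  have h6 : 0 < (r ^ 2 + a ^ 2) * r ^ 2 := by positivity
  simp only [km𝒜, kmΔ]
  nlinarith

lemma kmRe_pos (ha : 0 < a) {r x : ℝ} (hr : 0 < r) (hx : x ∈ Set.Ioo (-1 : ℝ) 1) :
    0 < kmRe a r x := by
  have h1 := kmρsq_pos (a := a) (x := x) hr
  have h2 := km𝒜_pos ha (x := x) hr
  have h3 := one_sub_sq_pos hx
  simp only [kmRe]
  positivity

lemma kmNormSq_pos (ha : 0 < a) {r x : ℝ} (hr : 0 < r) (hx : x ∈ Set.Ioo (-1 : ℝ) 1) :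
    0 < kmNormSq a r x := by
  have h1 := kmRe_pos ha hr hx
  simp only [kmNormSq]
  positivity

/-- For `a⁴ b⁴ = 1` the constant term of `ω` disappears and the bracket multiplying `(r - a)²` has a
further zero at `r = a`. This triple zero is what makes the near-horizon geometry, and its first
correction, static. -/
lemma kmω_eq (ha : 0 < a) (hab : a ^ 2 * b ^ 2 = 1) {r : ℝ} (hr : 0 < r) (x : ℝ) :
    kmω a b r x = (r - a) ^ 3 * kmTwist a r x := by
  have hA := (km𝒜_pos ha (x := x) hr).ne'
  have hV : r ^ 2 + a ^ 2 ≠ 0 := by positivity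
  have hb : b ^ 4 = 1 / a ^ 4 := by
    rw [show b ^ 4 = (b ^ 2) ^ 2 by ring, inv_sq_of_sq_mul_sq_eq_one ha hab]
    field_simp
  simp only [kmω, kmTwist, hb, kmΔ, kmρsq]
  rw [one_div, inv_mul_cancel₀ (by positivity), sub_self, zero_sub]
  field_simp
  simp only [km𝒜, kmΔ]
  ring

/-- The horizon of the extreme Kerr–Melvin solution. -/
def kmHorizon (qe qm a : ℝ) : HorizonData where
  n q := kmNormSq a (a + q.1) q.2 * kmρsq a (a + q.1) q.2 / km𝒜 a (a + q.1) q.2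
  -- The function `V` may depend on `s` alone. The choice `V = r² + a²` leaves a remainder, by `V² =
  -- 𝒜 + Δ a² (1 - x²)`, and this remainder goes into `l`.
  l q := -(kmNormSq a (a + q.1) q.2 * kmρsq a (a + q.1) q.2 * (a ^ 2 * (1 - q.2 ^ 2))
    / km𝒜 a (a + q.1) q.2)
  Q q := kmNormSq a (a + q.1) q.2 * kmρsq a (a + q.1) q.2 / (1 - q.2 ^ 2)
  X q := km𝒜 a (a + q.1) q.2 * (1 - q.2 ^ 2)
    / (kmρsq a (a + q.1) q.2 * kmNormSq a (a + q.1) q.2)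
  w q := kmTwist a (a + q.1) q.2
  μ q := kmNormSq a (a + q.1) q.2 * kmρsq a (a + q.1) q.2 / km𝒜 a (a + q.1) q.2
  ν q := kmNormSq a (a + q.1) q.2 * kmρsq a (a + q.1) q.2
    / (km𝒜 a (a + q.1) q.2 * (1 - q.2 ^ 2))
  α q := qe * (1 - kmRe a (a + q.1) q.2 / kmNormSq a (a + q.1) q.2)
    - qm * (kmIm a (a + q.1) q.2 / kmNormSq a (a + q.1) q.2)
  β q := qe * (kmIm a (a + q.1) q.2 / kmNormSq a (a + q.1) q.2)
    + qm * (1 - kmRe a (a + q.1) q.2 / kmNormSq a (a + q.1) q.2)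
  V s := (a + s) ^ 2 + a ^ 2
  k := 2
  V₀ := 2 * a ^ 2
  -- The shift is `-(1 - z²)/(8a)`; it is read off from the condition `n_deriv`, as `∂_s n = -z²/a³`
  -- on the horizon.
  p₀ := -1 / (8 * a)
  p₁ := 0
  p₂ := 1 / (8 * a)
  qe := qe
  qm := qm
  rp := 2 * a
  K₂ := 0
  K₃ := 6 * a

/-- On the horizon `Λ = 2/(1 + i z)`. Hence `1 - 1/Λ = (1 - i z)/2` is affine in `z`, which is the
homogeneous field of the near-horizon geometry. -/
lemma kmRe_horizon (ha : 0 < a) (z : ℝ) : kmRe a a z = 2 / (1 + z ^ 2) := by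
  have : 0 < 1 + z ^ 2 := by positivity
  simp only [kmRe, km𝒜, kmΔ, kmρsq]
  field_simp
  ring

lemma kmIm_horizon (ha : 0 < a) (z : ℝ) : kmIm a a z = -(2 * z) / (1 + z ^ 2) := by
  have : 0 < 1 + z ^ 2 := by positivity
  simp only [kmIm, kmρsq]
  field_simp
  ring

lemma kmNormSq_horizon (ha : 0 < a) (z : ℝ) : kmNormSq a a z = 4 / (1 + z ^ 2) := by
  have : 0 < 1 + z ^ 2 := by positivity
  simp only [kmNormSq, kmRe_horizon ha, kmIm_horizon ha]
  field_simp
  ring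

lemma kmρsq_horizon (a z : ℝ) : kmρsq a a z = a ^ 2 * (1 + z ^ 2) := by
  simp only [kmρsq]; ring

lemma km𝒜_horizon (a z : ℝ) : km𝒜 a a z = 4 * a ^ 4 := by
  simp only [km𝒜, kmΔ]; ring

lemma hasDerivAt_kmρsq (a z : ℝ) : HasDerivAt (fun s => kmρsq a (a + s) z) (2 * a) 0 :=
  ((((hasDerivAt_id' (0 : ℝ)).const_add a).fun_pow 2).add_const (a ^ 2 * z ^ 2)).congr_deriv
    (by ring)

lemma hasDerivAt_km𝒜 (a z : ℝ) : HasDerivAt (fun s => km𝒜 a (a + s) z) (8 * a ^ 3) 0 := by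
  have h := (hasDerivAt_id' (0 : ℝ)).const_add a
  exact ((((h.fun_pow 2).add_const (a ^ 2)).fun_pow 2).fun_sub
    ((((h.sub_const a).fun_pow 2).mul_const (a ^ 2)).mul_const (1 - z ^ 2))).congr_deriv
    (by simp only [add_zero]; push_cast; ring)

lemma hasDerivAt_kmRe (ha : 0 < a) (z : ℝ) : HasDerivAt (fun s => kmRe a (a + s) z)
    (2 * z ^ 2 * (1 - z ^ 2) / (a * (1 + z ^ 2) ^ 2)) 0 := by
  have hz : 0 < 1 + z ^ 2 := by positivity
  have h := (((hasDerivAt_km𝒜 a z).mul_const (1 - z ^ 2)).fun_div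
    ((hasDerivAt_kmρsq a z).const_mul (4 * a ^ 2))
    (by rw [add_zero, kmρsq_horizon]; positivity)).const_add 1
  refine h.congr_deriv ?_
  rw [add_zero, kmρsq_horizon, km𝒜_horizon]
  field_simp
  ring

lemma hasDerivAt_kmIm (ha : 0 < a) (z : ℝ) : HasDerivAt (fun s => kmIm a (a + s) z)
    (z * (1 - z ^ 2) ^ 2 / (a * (1 + z ^ 2) ^ 2)) 0 := by
  have hz : 0 < 1 + z ^ 2 := by positivity
  have h := (((((hasDerivAt_const (0 : ℝ) (a ^ 2)).fun_div (hasDerivAt_kmρsq a z)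
    (by rw [add_zero, kmρsq_horizon]; positivity)).mul_const ((1 - z ^ 2) ^ 2)).const_add
    (3 - z ^ 2))).const_mul (-(z / 2))
  refine h.congr_deriv ?_
  rw [add_zero, kmρsq_horizon]
  field_simp
  ring

lemma hasDerivAt_kmNormSq (ha : 0 < a) (z : ℝ) : HasDerivAt (fun s => kmNormSq a (a + s) z)
    (4 * z ^ 2 * (1 - z ^ 2) / (a * (1 + z ^ 2) ^ 2)) 0 := by
  have hz : 0 < 1 + z ^ 2 := by positivity
  refine (((hasDerivAt_kmRe ha z).fun_pow 2).fun_add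
    ((hasDerivAt_kmIm ha z).fun_pow 2)).congr_deriv ?_
  rw [add_zero, kmRe_horizon ha, kmIm_horizon ha]
  push_cast
  field_simp
  ring

/-- Smoothness near the horizon. -/
lemma contDiffOn_kmHorizon (qe qm : ℝ) (ha : 0 < a) : ∀ u ∈ [(kmHorizon qe qm a).n,
    (kmHorizon qe qm a).l, (kmHorizon qe qm a).Q, (kmHorizon qe qm a).X, (kmHorizon qe qm a).w,
    (kmHorizon qe qm a).μ, (kmHorizon qe qm a).ν, (kmHorizon qe qm a).α, (kmHorizon qe qm a).β],
    ContDiffOn ℝ ∞ u (collar a) := by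
  have hr : ∀ q ∈ collar a, 0 < a + q.1 := fun q hq => by linarith [hq.1.1]
  have hρ : ContDiffOn ℝ ∞ (fun q : ℝ × ℝ => kmρsq a (a + q.1) q.2) (collar a) := by
    unfold kmρsq; fun_prop
  have hA : ContDiffOn ℝ ∞ (fun q : ℝ × ℝ => km𝒜 a (a + q.1) q.2) (collar a) := by
    unfold km𝒜 kmΔ; fun_prop
  have hρ0 : ∀ q ∈ collar a, kmρsq a (a + q.1) q.2 ≠ 0 := fun q hq => (kmρsq_pos (hr q hq)).ne'
  have hA0 : ∀ q ∈ collar a, km𝒜 a (a + q.1) q.2 ≠ 0 := fun q hq => (km𝒜_pos ha (hr q hq)).ne'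
  have hc : ContDiffOn ℝ ∞ (fun q : ℝ × ℝ => 1 - q.2 ^ 2) (collar a) := by fun_prop
  have hc0 : ∀ q ∈ collar a, 1 - q.2 ^ 2 ≠ 0 := fun q hq => (one_sub_sq_pos hq.2).ne'
  have hk : ∀ c : ℝ, ContDiffOn ℝ ∞ (fun _ : ℝ × ℝ => c) (collar a) := fun _ => contDiffOn_const
  have hx : ContDiffOn ℝ ∞ (fun q : ℝ × ℝ => q.2) (collar a) := contDiffOn_snd
  have hRe : ContDiffOn ℝ ∞ (fun q : ℝ × ℝ => kmRe a (a + q.1) q.2) (collar a) :=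
    (hk 1).add ((hA.mul hc).div ((hk (4 * a ^ 2)).mul hρ) fun q hq =>
      mul_ne_zero (by positivity) (hρ0 q hq))
  have hIm : ContDiffOn ℝ ∞ (fun q : ℝ × ℝ => kmIm a (a + q.1) q.2) (collar a) :=
    (hx.div_const 2).neg.mul (((hk 3).sub (hx.pow 2)).add
      (((hk (a ^ 2)).div hρ hρ0).mul (hc.pow 2)))
  have hM : ContDiffOn ℝ ∞ (fun q : ℝ × ℝ => kmNormSq a (a + q.1) q.2) (collar a) :=
    (hRe.pow 2).add (hIm.pow 2)
  have hM0 : ∀ q ∈ collar a, kmNormSq a (a + q.1) q.2 ≠ 0 := fun q hq =>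
    (kmNormSq_pos ha (hr q hq) hq.2).ne'
  have hp : ContDiffOn ℝ ∞ (fun q : ℝ × ℝ => (3 + 6 * q.2 ^ 2 - q.2 ^ 4)
      * ((a + q.1) ^ 4 + a * (a + q.1) ^ 3 + a ^ 3 * (a + q.1))
      + (5 + 18 * q.2 ^ 2 + q.2 ^ 4) * (a ^ 2 * (a + q.1) ^ 2)
      + (2 + 12 * q.2 ^ 2 + 2 * q.2 ^ 4) * a ^ 4) (collar a) := by fun_prop
  have hV : ContDiffOn ℝ ∞ (fun q : ℝ × ℝ => 8 * a ^ 2 * ((a + q.1) ^ 2 + a ^ 2))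
      (collar a) := by fun_prop
  intro u hu
  simp only [List.mem_cons, List.not_mem_nil, or_false, kmHorizon] at hu
  rcases hu with rfl | rfl | rfl | rfl | rfl | rfl | rfl | rfl | rfl
  · exact (hM.mul hρ).div hA hA0
  · exact (((hM.mul hρ).mul ((hk _).mul hc)).div hA hA0).neg
  · exact (hM.mul hρ).div hc hc0
  · exact (hA.mul hc).div (hρ.mul hM) fun q hq => mul_ne_zero (hρ0 q hq) (hM0 q hq)
  · exact hp.div (hV.mul hA) fun q hq => mul_ne_zero (by positivity) (hA0 q hq)
  · exact (hM.mul hρ).div hA hA0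
  · exact (hM.mul hρ).div (hA.mul hc) fun q hq => mul_ne_zero (hA0 q hq) (hc0 q hq)
  · exact ((hk qe).mul ((hk 1).sub (hRe.div hM hM0))).sub ((hk qm).mul (hIm.div hM hM0))
  · exact ((hk qe).mul (hIm.div hM hM0)).add ((hk qm).mul ((hk 1).sub (hRe.div hM hM0)))

/-- On the horizon `|Λ|² ρ² = 4a²` and `𝒜 = 4a⁴` are independent of `z`, so the horizon is a round
sphere of radius `2a` once the angle is rescaled by `k = 2`. All conditions become rational
identities in `a` and `z`. -/
lemma isRegular_kmHorizon (qe qm : ℝ) (ha : 0 < a) : (kmHorizon qe qm a).IsRegular a := by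
  have ha' := ha.ne'
  have hV : HasDerivAt (fun s : ℝ => (a + s) ^ 2 + a ^ 2) (2 * a) 0 :=
    ((((hasDerivAt_id' (0 : ℝ)).const_add a).fun_pow 2).add_const (a ^ 2)).congr_deriv (by ring)
  have hRe0 : ∀ z, kmRe a (a + 0) z / kmNormSq a (a + 0) z = 1 / 2 := fun z => by
    have : 0 < 1 + z ^ 2 := by positivity
    rw [add_zero, kmRe_horizon ha, kmNormSq_horizon ha]
    field_simp
    norm_num
  have hIm0 : ∀ z, kmIm a (a + 0) z / kmNormSq a (a + 0) z = -(z / 2) := fun z => by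
    have : 0 < 1 + z ^ 2 := by positivity
    rw [add_zero, kmIm_horizon ha, kmNormSq_horizon ha]
    field_simp
    ring
  have hM0 : ∀ z, kmNormSq a (a + 0) z ≠ 0 := fun z => by
    rw [add_zero, kmNormSq_horizon ha]; positivity
  have hA0 : ∀ z, km𝒜 a (a + 0) z ≠ 0 := fun z => by
    rw [add_zero, km𝒜_horizon]; positivity
  have hρ0 : ∀ z, kmρsq a (a + 0) z ≠ 0 := fun z => by
    rw [add_zero, kmρsq_horizon]; positivity
  have hn := fun z => ((hasDerivAt_kmNormSq ha z).fun_mul (hasDerivAt_kmρsq a z))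
  have hnA := fun z => (hn z).fun_div (hasDerivAt_km𝒜 a z) (hA0 z)
  have hRe := fun z => (hasDerivAt_kmRe ha z).fun_div (hasDerivAt_kmNormSq ha z) (hM0 z)
  have hIm := fun z => (hasDerivAt_kmIm ha z).fun_div (hasDerivAt_kmNormSq ha z) (hM0 z)
  refine
    { η_pos := ha
      k_pos := two_pos
      V₀_pos := by simp only [kmHorizon]; positivity
      rp_pos := by simp only [kmHorizon]; positivity
      smooth := contDiffOn_kmHorizon qe qm ha
      smooth_V := by simp only [kmHorizon]; fun_prop
      V_zero := by simp only [kmHorizon]; ring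
      V_deriv := hV.congr_deriv (by simp only [kmHorizon]; ring)
      n_zero := ?_
      Q_zero := ?_
      X_zero := ?_
      μ_zero := ?_
      ν_zero := ?_
      α_zero := fun z _ => ?_
      β_zero := fun z _ => ?_
      n_deriv := fun z hz => (hnA z).congr_deriv ?_
      Q_deriv := fun z hz => ((hn z).div_const (1 - z ^ 2)).congr_deriv ?_
      X_deriv := fun z hz => (((hasDerivAt_km𝒜 a z).mul_const (1 - z ^ 2)).fun_div
        ((hasDerivAt_kmρsq a z).fun_mul (hasDerivAt_kmNormSq ha z))
        (mul_ne_zero (hρ0 z) (hM0 z))).congr_deriv ?_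
      μ_deriv := fun z hz => (hnA z).congr_deriv ?_
      α_deriv := fun z hz => ((((hRe z).const_sub 1).const_mul qe).fun_sub
        ((hIm z).const_mul qm)).congr_deriv ?_
      β_deriv := fun z hz => (((hIm z).const_mul qe).fun_add
        (((hRe z).const_sub 1).const_mul qm)).congr_deriv ?_ }
  iterate 5
    · intro z hz
      have h1 : 0 < 1 + z ^ 2 := by positivity
      have h2 := (one_sub_sq_pos hz).ne'
      simp only [kmHorizon, add_zero, kmNormSq_horizon ha, kmρsq_horizon, km𝒜_horizon]
      field_simp
      try ring1
  · simp only [kmHorizon, hRe0, hIm0]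
    exact (((hasDerivAt_id' z).div_const 2).fun_neg.const_mul qm |>.const_sub _).congr_deriv
      (by ring)
  · simp only [kmHorizon, hRe0, hIm0]
    exact ((((hasDerivAt_id' z).div_const 2).fun_neg.const_mul qe).add_const _).congr_deriv
      (by ring)
  all_goals
    have h1 : 0 < 1 + z ^ 2 := by positivity
    have h2 := (one_sub_sq_pos hz).ne'
    simp only [HorizonData.slope, HorizonData.bend, HorizonData.bendDeriv, HorizonData.delayDeriv,
      HorizonData.shift, HorizonData.shiftDeriv, kmHorizon, add_zero, kmRe_horizon ha,
      kmIm_horizon ha, kmNormSq_horizon ha, kmρsq_horizon, km𝒜_horizon]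
    field_simp
    ring1

end

/-- The duality factor is chosen so that `b` cancels: the potential is `(qe + i qm)(1 - 1/Λ)`, which
depends on `b` only through `a² b² = 1`. -/
lemma kmPotential_eq {a b qe qm : ℝ} (ha : 0 < a) (hab : a ^ 2 * b ^ 2 = 1) (r x : ℝ) :
    (a * b * ((qe + qm * Complex.I) / (2 * a : ℝ)) * (2 / b * (1 - 1 / kmΛ a b r x)) : ℂ)
      = ⟨(kmHorizon qe qm a).α (r - a, x), (kmHorizon qe qm a).β (r - a, x)⟩ := by
  have hb : (b : ℂ) ≠ 0 := by
    rw [Ne, Complex.ofReal_eq_zero]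
    rintro rfl
    norm_num at hab
  have ha' : (a : ℂ) ≠ 0 := Complex.ofReal_ne_zero.mpr ha.ne'
  have h1 : (a * b * ((qe + qm * Complex.I) / (2 * a : ℝ)) * (2 / b * (1 - 1 / kmΛ a b r x)) : ℂ)
      = (qe + qm * Complex.I) * (1 - (kmΛ a b r x)⁻¹) := by
    push_cast
    field_simp
  rw [h1]
  have h2 := normSq_kmΛ ha hab r x
  have h3 := kmΛ_eq ha hab r x
  have hre : (kmΛ a b r x).re = kmRe a r x := by rw [h3]
  have him : (kmΛ a b r x).im = kmIm a r x := by rw [h3]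
  apply Complex.ext <;>
    simp only [Complex.mul_re, Complex.mul_im, Complex.add_re, Complex.add_im, Complex.sub_re,
      Complex.sub_im, Complex.ofReal_re, Complex.ofReal_im, Complex.I_re, Complex.I_im,
      Complex.one_re, Complex.one_im, Complex.inv_re, Complex.inv_im, h2, hre, him, kmHorizon,
      add_sub_cancel] <;> ring

/-- Extreme Kerr–Melvin with a static near-horizon geometry. -/
theorem isContainedInModuliSpace_kerrMelvin {a b qe qm : ℝ} (ha : 0 < a)
    (hab : a ^ 2 * b ^ 2 = 1) (hq : qe ^ 2 + qm ^ 2 = (2 * a) ^ 2) :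
    IsContainedInModuliSpace (kerrMelvinMetric a b)
      (kerrMelvinMaxwell (a * b * ((qe + qm * Complex.I) / (2 * a : ℝ))) a b)
      (kerrMelvinExterior a) a qe qm (2 * a) 0 (6 * a) := by
  have h := isRegular_kmHorizon qe qm ha
  have hpos : ∀ s ∈ Set.Ioo 0 a, ∀ z ∈ Set.Ioo (-1 : ℝ) 1, 0 < kmρsq a (a + s) z ∧
      0 < km𝒜 a (a + s) z ∧ 0 < kmNormSq a (a + s) z := fun s hs z hz => by
    have hr : 0 < a + s := by linarith [hs.1]
    exact ⟨kmρsq_pos hr, km𝒜_pos ha hr, kmNormSq_pos ha hr hz⟩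
  have hw : ∀ s ∈ Set.Ioo 0 a, ∀ z,
      -kmω a b (a + s) z = -(s ^ 3 * (kmHorizon qe qm a).w (s, z)) := fun s hs z => by
    rw [kmω_eq ha hab (by linarith [hs.1]), add_sub_cancel_left]
    rfl
  refine isContainedInModuliSpace_of_hasTransverseDeformation (by positivity) hq
    (h.hasTransverseDeformation (m := fun z => z)
    (m' := fun _ => 1) contDiffOn_id (fun z _ => hasDerivAt_id' z) (fun _ _ => one_ne_zero)
    (fun _ _ _ _ h => h) (fun s hs z hz => ⟨by simpa using hs.1, hz⟩) ?_ ?_)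
  · intro s hs z hz t ψ
    obtain ⟨hρ, hA, hM⟩ := hpos s hs z hz
    have h0 := hs.1.ne'
    have hc := (one_sub_sq_pos hz).ne'
    refine HorizonData.circularMetric_eq_staticMetric ?_ ?_ ?_ ?_ (hw s hs z) t ψ <;>
      simp only [kmCoeffN, kmCoeffP, kmCoeffQ, kmCoeffX, normSq_kmΛ ha hab, kmHorizon, kmΔ,
        add_sub_cancel_left]
    · ring
    · field_simp
      simp only [km𝒜, kmΔ]
      ring
    · ring
  · intro s hs z hz t ψ
    obtain ⟨hρ, hA, hM⟩ := hpos s hs z hz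
    have h0 := hs.1
    have hc := one_sub_sq_pos hz
    have hmem : (s, z) ∈ collar a := ⟨⟨by linarith [hs.1], hs.2⟩, hz⟩
    have hα := ContDiffOn.differentiableAt_of_isOpen
      (h.smooth (kmHorizon qe qm a).α (by simp)) (isOpen_collar a) hmem
    have hβ := ContDiffOn.differentiableAt_of_isOpen
      (h.smooth (kmHorizon qe qm a).β (by simp)) (isOpen_collar a) hmem
    refine HorizonData.circularMaxwell_eq_staticMaxwell one_ne_zero (hw s hs z) ?_ ?_ ?_ ?_ ?_ ?_
      t ψ
    -- The radicand is a perfect square, so the root is verified by squaring a positive candidate.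
    · rw [Real.sqrt_eq_iff_mul_self_eq_of_pos] <;>
        simp only [kmCoeffN, kmCoeffP, kmCoeffQ, kmCoeffX, normSq_kmΛ ha hab, kmHorizon, kmΔ,
          add_sub_cancel_left]
      · field_simp
      · positivity
    · rw [Real.sqrt_eq_iff_mul_self_eq_of_pos] <;>
        simp only [kmCoeffN, kmCoeffP, kmCoeffQ, kmCoeffX, normSq_kmΛ ha hab, kmHorizon, kmΔ,
          add_sub_cancel_left]
      · field_simp
      · positivity
    all_goals simp only [kmPotential_eq ha hab, div_one]
    · refine HasDerivAt.comp_sub_const (a + s) a (f := fun s => (kmHorizon qe qm a).α (s, z)) ?_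
      simpa using hasDerivAt_pds hα
    · simpa using hasDerivAt_pdz hα
    · refine HasDerivAt.comp_sub_const (a + s) a (f := fun s => (kmHorizon qe qm a).β (s, z)) ?_
      simpa using hasDerivAt_pds hβ
    · simpa using hasDerivAt_pdz hβ

/-! #### Extreme Ernst

The external field is `b = 2 t / e`. -/

/-- The denominator of `ernstMobius`. -/
def ernstDenom (t z : ℝ) : ℝ := 1 + t ^ 2 - 2 * t * z

/-- The Möbius transformation that maps the round coordinate of the horizon to the coordinate `y`
of the Ernst solution. -/
def ernstMobius (t z : ℝ) : ℝ := ((1 + t ^ 2) * z - 2 * t) / ernstDenom t z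

def ernstMobiusDeriv (t z : ℝ) : ℝ := (1 - t ^ 2) ^ 2 / ernstDenom t z ^ 2

/-- The real Ernst potential, up to duality rotations. -/
def ernstPotential (e b r x : ℝ) : ℝ :=
  (e * x + b / 2 * (ernstX₀ e b r x + e ^ 2 * x ^ 2)) / ernstD e b r x

/-- The horizon of the extreme Ernst solution. -/
def ernstHorizon (qe qm e t : ℝ) : HorizonData where
  n q := ernstD e (2 * t / e) (e + q.1) (ernstMobius t q.2) ^ 2
    * (1 - ernstA e (2 * t / e) ^ 2 * (e + q.1) ^ 2)
    / ((e + q.1) ^ 2 * (1 + ernstA e (2 * t / e) * (e + q.1) * ernstMobius t q.2) ^ 2)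
  l _ := 0
  Q q := ernstD e (2 * t / e) (e + q.1) (ernstMobius t q.2) ^ 2 * (e + q.1) ^ 2
    / (ernstP e (2 * t / e) (ernstMobius t q.2) * (1 - ernstMobius t q.2 ^ 2)
      * (1 + ernstA e (2 * t / e) * (e + q.1) * ernstMobius t q.2) ^ 2)
    * ernstMobiusDeriv t q.2 ^ 2
  X q := ernstX₀ e (2 * t / e) (e + q.1) (ernstMobius t q.2)
    / ernstD e (2 * t / e) (e + q.1) (ernstMobius t q.2) ^ 2
  w _ := 0
  μ q := ernstD e (2 * t / e) (e + q.1) (ernstMobius t q.2) ^ 2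
    / ((e + q.1) ^ 2 * ernstMobiusDeriv t q.2)
  ν q := ernstMobiusDeriv t q.2 * (ernstD e (2 * t / e) (e + q.1) (ernstMobius t q.2) ^ 2
    * (1 - ernstA e (2 * t / e) ^ 2 * (e + q.1) ^ 2)
    / ((e + q.1) ^ 2 * (ernstP e (2 * t / e) (ernstMobius t q.2) * (1 - ernstMobius t q.2 ^ 2))))
  α q := qm * (1 - t ^ 2) / (e * (1 + t ^ 2) ^ 2)
    * ernstPotential e (2 * t / e) (e + q.1) (ernstMobius t q.2)
  β q := -(qe * (1 - t ^ 2) / (e * (1 + t ^ 2) ^ 2))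
    * ernstPotential e (2 * t / e) (e + q.1) (ernstMobius t q.2)
  V s := (e + s) ^ 2 / (1 - ernstA e (2 * t / e) ^ 2 * (e + s) ^ 2)
  k := (1 + t ^ 2) ^ 2
  V₀ := e ^ 2 * (1 + t ^ 2) ^ 2 / (1 - t ^ 2) ^ 2
  -- The coefficients of the shift are solved for from `n_deriv`: in the coordinate `z` the
  -- derivative of `n` on the horizon is a quadratic polynomial.
  p₀ := -(2 * t ^ 2 * (1 + t ^ 2) + 4 * t ^ 2) / (e * (1 + t ^ 2) ^ 4 * (1 - t ^ 2) ^ 2)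
  p₁ := 2 * t / (e * (1 + t ^ 2) ^ 3 * (1 - t ^ 2) ^ 2)
  p₂ := 2 * t ^ 2 / (e * (1 + t ^ 2) ^ 3 * (1 - t ^ 2) ^ 2)
  qe := qe
  qm := qm
  rp := e * (1 + t ^ 2) ^ 2 / (1 - t ^ 2)
  K₂ := 2 * e * (1 + t ^ 2) ^ 3 / (1 - t ^ 2) ^ 3
  K₃ := 12 * e * t ^ 2 * (1 + t ^ 2) ^ 3 / (1 - t ^ 2) ^ 4

section

variable {e t z : ℝ}

/-- In terms of `t` all horizon quantities are rational; for instance `1 ± A e = (1 ± t)²/(1 + t²)`.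
-/
lemma ernstA_eq (he : 0 < e) (t : ℝ) : ernstA e (2 * t / e) = 2 * t / (e * (1 + t ^ 2)) := by
  have : 0 < 1 + t ^ 2 := by positivity
  have h : e ^ 2 * (2 * t / e) ^ 2 / 4 = t ^ 2 := by field_simp; ring
  rw [ernstA, h]
  field_simp

/-- The denominator equals `(t - z)² + (1 - z²)`. -/
lemma ernstDenom_pos (t : ℝ) (hz : z ∈ Set.Ioo (-1 : ℝ) 1) : 0 < ernstDenom t z := by
  rw [ernstDenom]
  nlinarith [sq_nonneg (t - z), one_sub_sq_pos hz]

lemma one_sub_ernstMobius_sq (h : 0 < ernstDenom t z) :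
    1 - ernstMobius t z ^ 2 = (1 - t ^ 2) ^ 2 * (1 - z ^ 2) / ernstDenom t z ^ 2 := by
  rw [ernstMobius]
  field_simp
  simp only [ernstDenom]
  ring

lemma ernstMobius_mem (ht : t ^ 2 < 1) (hz : z ∈ Set.Ioo (-1 : ℝ) 1) :
    ernstMobius t z ∈ Set.Ioo (-1 : ℝ) 1 := by
  have h := ernstDenom_pos t hz
  have h1 : 0 < 1 - ernstMobius t z ^ 2 := by
    rw [one_sub_ernstMobius_sq h]
    have := one_sub_sq_pos hz
    have : 0 < 1 - t ^ 2 := by linarith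
    positivity
  exact abs_lt.mp (by rw [← sq_lt_one_iff_abs_lt_one]; linarith)

lemma hasDerivAt_ernstMobius (h : 0 < ernstDenom t z) :
    HasDerivAt (ernstMobius t) (ernstMobiusDeriv t z) z := by
  have hd : HasDerivAt (ernstDenom t) (-(2 * t)) z :=
    (((hasDerivAt_id' z).const_mul (2 * t)).const_sub (1 + t ^ 2)).congr_deriv (by ring)
  refine ((((hasDerivAt_id' z).const_mul (1 + t ^ 2)).sub_const (2 * t)).fun_div hd
    h.ne').congr_deriv ?_
  rw [ernstMobiusDeriv]
  field_simp
  simp only [ernstDenom]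
  ring

lemma injOn_ernstMobius (ht : t ^ 2 < 1) : Set.InjOn (ernstMobius t) (Set.Ioo (-1) 1) := by
  intro z hz z' hz' heq
  have h := ernstDenom_pos t hz
  have h' := ernstDenom_pos t hz'
  simp only [ernstMobius] at heq
  rw [div_eq_div_iff h.ne' h'.ne'] at heq
  have hne : (1 - t ^ 2) ^ 2 ≠ 0 := pow_ne_zero 2 (by linarith)
  have : (1 - t ^ 2) ^ 2 * (z - z') = 0 := by simp only [ernstDenom] at heq; linear_combination heq
  exact sub_eq_zero.mp ((mul_eq_zero.mp this).resolve_left hne)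

/-- `1 + A ϱ y` at the horizon. -/
lemma one_add_ernstA_mul (he : 0 < e) (h : 0 < ernstDenom t z) :
    1 + ernstA e (2 * t / e) * e * ernstMobius t z
      = (1 - t ^ 2) ^ 2 / ((1 + t ^ 2) * ernstDenom t z) := by
  have : 0 < 1 + t ^ 2 := by positivity
  rw [ernstA_eq he, ernstMobius]
  field_simp
  simp only [ernstDenom]
  ring

lemma one_sub_ernstA_sq_mul (he : 0 < e) :
    1 - ernstA e (2 * t / e) ^ 2 * e ^ 2 = (1 - t ^ 2) ^ 2 / (1 + t ^ 2) ^ 2 := by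
  have : 0 < 1 + t ^ 2 := by positivity
  rw [ernstA_eq he]
  field_simp
  ring

lemma ernstX₀_horizon (he : 0 < e) (ht : t ^ 2 < 1) (h : 0 < ernstDenom t z) :
    ernstX₀ e (2 * t / e) e (ernstMobius t z)
      = e ^ 2 * ((1 - t ^ 2) ^ 2 * (1 - z ^ 2) / ernstDenom t z ^ 2) := by
  have h1 : 0 < 1 + t ^ 2 := by positivity
  have h2 : 0 < 1 - t ^ 2 := by linarith
  rw [ernstX₀, ernstP, one_sub_ernstMobius_sq h, one_add_ernstA_mul he h]
  field_simp

/-- In the Möbius coordinate both `D` and `1 + A e y` are constants divided by the same linear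
function `ernstDenom`. Its powers cancel in `n`, `Q` and `X`, and the horizon becomes round. -/
lemma ernstD_horizon (he : 0 < e) (ht : t ^ 2 < 1) (h : 0 < ernstDenom t z) :
    ernstD e (2 * t / e) e (ernstMobius t z) = (1 - t ^ 2) ^ 2 / ernstDenom t z := by
  rw [ernstD, ernstX₀_horizon he ht h, ernstMobius]
  field_simp
  simp only [ernstDenom]
  ring

/-- The potential is affine in `z`, so the Maxwell field is homogeneous on the round horizon. -/
lemma ernstPotential_horizon (he : 0 < e) (ht : t ^ 2 < 1) (h : 0 < ernstDenom t z) :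
    ernstPotential e (2 * t / e) e (ernstMobius t z) = e * (z - t) / (1 - t ^ 2) := by
  have h2 : 0 < 1 - t ^ 2 := by linarith
  rw [ernstPotential, ernstD_horizon he ht h, ernstX₀_horizon he ht h, ernstMobius]
  field_simp
  simp only [ernstDenom]
  ring

lemma hasDerivAt_ernstX₀ (he : 0 < e) (ht : t ^ 2 < 1) (h : 0 < ernstDenom t z) :
    HasDerivAt (fun s => ernstX₀ e (2 * t / e) (e + s) (ernstMobius t z))
      (2 * e * (1 + t ^ 2) * (1 - z ^ 2) / ernstDenom t z) 0 := by
  have h1 : 0 < 1 + t ^ 2 := by positivity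
  have h2 : 0 < 1 - t ^ 2 := by linarith
  have hid := (hasDerivAt_id' (0 : ℝ)).const_add e
  have h' := (((hid.fun_pow 2).const_mul (ernstP e (2 * t / e) (ernstMobius t z))).mul_const
    (1 - ernstMobius t z ^ 2)).fun_div ((((hid.const_mul (ernstA e (2 * t / e))).mul_const
    (ernstMobius t z)).const_add 1).fun_pow 2)
    (by rw [add_zero, one_add_ernstA_mul he h]; positivity)
  refine h'.congr_deriv ?_
  rw [add_zero, ernstP, one_sub_ernstMobius_sq h, one_add_ernstA_mul he h, ernstA_eq he,
    ernstMobius]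
  push_cast
  field_simp
  simp only [ernstDenom]
  ring

lemma hasDerivAt_ernstD (he : 0 < e) (ht : t ^ 2 < 1) (h : 0 < ernstDenom t z) :
    HasDerivAt (fun s => ernstD e (2 * t / e) (e + s) (ernstMobius t z))
      (2 * t ^ 2 * (1 + t ^ 2) * (1 - z ^ 2) / (e * ernstDenom t z)) 0 := by
  refine (((hasDerivAt_ernstX₀ he ht h).const_mul ((2 * t / e) ^ 2 / 4)).const_add
    ((1 + e * (2 * t / e) * ernstMobius t z / 2) ^ 2)).congr_deriv ?_
  field_simp
  ring

lemma hasDerivAt_ernstPotential (he : 0 < e) (ht : t ^ 2 < 1) (h : 0 < ernstDenom t z) :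
    HasDerivAt (fun s => ernstPotential e (2 * t / e) (e + s) (ernstMobius t z))
      (2 * t * (1 + t ^ 2) * (1 - z ^ 2) * (1 - t * z) / (1 - t ^ 2) ^ 3) 0 := by
  have h2 : 0 < 1 - t ^ 2 := by linarith
  have hD := ernstD_horizon he ht h
  have h' := ((((hasDerivAt_ernstX₀ he ht h).add_const (e ^ 2 * ernstMobius t z ^ 2)).const_mul
    (2 * t / e / 2)).const_add (e * ernstMobius t z)).fun_div (hasDerivAt_ernstD he ht h)
    (by rw [add_zero, hD]; positivity)
  refine h'.congr_deriv ?_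
  rw [add_zero, hD, ernstX₀_horizon he ht h, ernstMobius]
  field_simp
  simp only [ernstDenom]
  ring

end

/-- The width of the collar of the extreme Ernst horizon. -/
def ernstWidth (e t : ℝ) : ℝ := e * (1 - t ^ 2) ^ 2 / (4 * (1 + t ^ 2) ^ 2)

section

variable {e t : ℝ}

lemma ernstWidth_pos (he : 0 < e) (ht : t ^ 2 < 1) : 0 < ernstWidth e t := by
  have h2 : 0 < 1 - t ^ 2 := by linarith
  rw [ernstWidth]
  positivity

/-- The acceleration horizon lies at distance `1/|A| - e = e (1 - |t|)²/(2|t|)` from the black hole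
horizon. The width of the collar is smaller than this and than `e`. -/
lemma ernst_bounds (he : 0 < e) (ht : t ^ 2 < 1) {s : ℝ}
    (hs : s ∈ Set.Ioo (-ernstWidth e t) (ernstWidth e t)) :
    0 < e + s ∧ |ernstA e (2 * t / e)| * (e + s) < 1 := by
  have h1 : 0 < 1 + t ^ 2 := by positivity
  have h2 : 0 < 1 - t ^ 2 := by linarith
  have hwd : ernstWidth e t * (4 * (1 + t ^ 2) ^ 2) = e * (1 - t ^ 2) ^ 2 := by
    rw [ernstWidth]; field_simp
  have hle : (1 - t ^ 2) ^ 2 ≤ (1 + t ^ 2) ^ 2 := by nlinarith [sq_nonneg t]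
  have hw : ernstWidth e t < e := by
    have : 0 < (1 + t ^ 2) ^ 2 := by positivity
    by_contra hcon
    push Not at hcon
    nlinarith [mul_le_mul_of_nonneg_right hcon this.le, mul_le_mul_of_nonneg_left hle he.le,
      mul_pos he this]
  refine ⟨by linarith [hs.1], ?_⟩
  rw [ernstA_eq he, abs_div, abs_of_pos (mul_pos he h1), div_mul_eq_mul_div, div_lt_one
    (mul_pos he h1), abs_mul, abs_two]
  have hT : |t| ^ 2 = t ^ 2 := sq_abs t
  have hT1 : |t| < 1 := by
    rw [← sq_lt_one_iff_abs_lt_one]; exact ht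
  have hT0 := abs_nonneg t
  have hlt : e + s < e + ernstWidth e t := by linarith [hs.2]
  have hq : 2 * |t| * ernstWidth e t * (4 * (1 + t ^ 2) ^ 2)
      ≤ e * (1 - |t|) ^ 2 * (4 * (1 + t ^ 2) ^ 2) := by
    have e1 : 2 * |t| * ernstWidth e t * (4 * (1 + t ^ 2) ^ 2)
        = e * (1 - |t|) ^ 2 * (2 * |t| * (1 + |t|) ^ 2) := by
      rw [mul_assoc, hwd, ← hT]; ring
    rw [e1]
    refine mul_le_mul_of_nonneg_left ?_ (by positivity)
    have : (1 + t ^ 2) ^ 2 ≥ 1 := by nlinarith [sq_nonneg t]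
    nlinarith [mul_nonneg hT0 hT0]
  have hq' := le_of_mul_le_mul_right hq (by positivity)
  -- For `t = 0` there is no acceleration horizon, and strictness cannot be obtained by multiplying
  -- with `|t|`.
  rcases hT0.eq_or_lt with h0 | h0
  · rw [← h0]; nlinarith
  · have : 2 * |t| * (e + s) < 2 * |t| * (e + ernstWidth e t) :=
      mul_lt_mul_of_pos_left hlt (by positivity)
    nlinarith

lemma one_add_ernstA_mul_pos {b r y : ℝ} (hr : 0 < r) (h : |ernstA e b| * r < 1)
    (hy : y ∈ Set.Ioo (-1 : ℝ) 1) : 0 < 1 + ernstA e b * r * y := by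
  have h1 : |ernstA e b * r * y| < 1 := by
    rw [abs_mul, abs_mul, abs_of_pos hr]
    have : |y| ≤ 1 := (abs_lt.mpr hy).le
    nlinarith [abs_nonneg y, mul_nonneg (abs_nonneg (ernstA e b)) hr.le]
  linarith [(abs_lt.mp h1).1]

lemma one_sub_ernstA_sq_mul_pos {b r : ℝ} (hr : 0 < r) (h : |ernstA e b| * r < 1) :
    0 < 1 - ernstA e b ^ 2 * r ^ 2 := by
  have h1 : |ernstA e b * r| < 1 := by rwa [abs_mul, abs_of_pos hr]
  have := (sq_lt_one_iff_abs_lt_one _).2 h1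
  rw [mul_pow] at this
  linarith

lemma abs_ernstA_mul_lt (he : 0 < e) (ht : t ^ 2 < 1) : |ernstA e (2 * t / e)| * e < 1 := by
  simpa using (ernst_bounds he ht (s := 0) ⟨by linarith [ernstWidth_pos he ht],
    ernstWidth_pos he ht⟩).2

lemma ernstP_pos (he : 0 < e) (ht : t ^ 2 < 1) {y : ℝ} (hy : y ∈ Set.Ioo (-1 : ℝ) 1) :
    0 < ernstP e (2 * t / e) y :=
  pow_pos (one_add_ernstA_mul_pos he (abs_ernstA_mul_lt he ht) hy) 2

lemma ernstX₀_pos (he : 0 < e) (ht : t ^ 2 < 1) {r y : ℝ} (hr : 0 < r)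
    (h : |ernstA e (2 * t / e)| * r < 1) (hy : y ∈ Set.Ioo (-1 : ℝ) 1) :
    0 < ernstX₀ e (2 * t / e) r y := by
  have h1 := ernstP_pos he ht hy
  have h2 := one_add_ernstA_mul_pos hr h hy
  have h3 := one_sub_sq_pos hy
  rw [ernstX₀]
  positivity

lemma ernstD_pos (he : 0 < e) (ht : t ^ 2 < 1) {r y : ℝ} (hr : 0 < r)
    (h : |ernstA e (2 * t / e)| * r < 1) (hy : y ∈ Set.Ioo (-1 : ℝ) 1) :
    0 < ernstD e (2 * t / e) r y := by
  have h1 := ernstX₀_pos he ht hr h hy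
  have h2 : 0 < 1 + e * (2 * t / e) * y / 2 := by
    have e1 : e * (2 * t / e) * y / 2 = t * y := by field_simp
    rw [e1]
    have ht1 : |t| < 1 := (sq_lt_one_iff_abs_lt_one t).1 ht
    have h3 : |t * y| < 1 := by
      rw [abs_mul]
      nlinarith [abs_nonneg y, abs_nonneg t, abs_lt.mpr hy]
    linarith [(abs_lt.mp h3).1]
  rw [ernstD]
  positivity

lemma ernstMobiusDeriv_pos (ht : t ^ 2 < 1) {z : ℝ} (hz : z ∈ Set.Ioo (-1 : ℝ) 1) :
    0 < ernstMobiusDeriv t z := by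
  have h1 := ernstDenom_pos t hz
  have h2 : 0 < 1 - t ^ 2 := by linarith
  rw [ernstMobiusDeriv]
  positivity

lemma contDiffOn_ernstMobius (t : ℝ) : ContDiffOn ℝ ∞ (ernstMobius t) (Set.Ioo (-1) 1) := by
  have h : ContDiff ℝ ∞ (ernstDenom t) := by unfold ernstDenom; fun_prop
  have h' : ContDiff ℝ ∞ (fun z : ℝ => (1 + t ^ 2) * z - 2 * t) := by fun_prop
  exact h'.contDiffOn.div h.contDiffOn fun z hz => (ernstDenom_pos t hz).ne'

/-- Smoothness near the horizon. -/
lemma contDiffOn_ernstHorizon (qe qm : ℝ) (he : 0 < e) (ht : t ^ 2 < 1) :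
    ∀ u ∈ [(ernstHorizon qe qm e t).n, (ernstHorizon qe qm e t).l, (ernstHorizon qe qm e t).Q,
      (ernstHorizon qe qm e t).X, (ernstHorizon qe qm e t).w, (ernstHorizon qe qm e t).μ,
      (ernstHorizon qe qm e t).ν, (ernstHorizon qe qm e t).α, (ernstHorizon qe qm e t).β],
    ContDiffOn ℝ ∞ u (collar (ernstWidth e t)) := by
  set U := collar (ernstWidth e t) with hU
  have hb : ∀ q ∈ U, 0 < e + q.1 ∧ |ernstA e (2 * t / e)| * (e + q.1) < 1 := fun q hq =>
    ernst_bounds he ht hq.1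
  have hy : ∀ q ∈ U, ernstMobius t q.2 ∈ Set.Ioo (-1 : ℝ) 1 := fun q hq =>
    ernstMobius_mem ht hq.2
  have hk : ∀ c : ℝ, ContDiffOn ℝ ∞ (fun _ : ℝ × ℝ => c) U := fun _ => contDiffOn_const
  have hm : ContDiffOn ℝ ∞ (fun q : ℝ × ℝ => ernstMobius t q.2) U :=
    (contDiffOn_ernstMobius t).comp contDiffOn_snd fun q hq => hq.2
  have hG : ContDiff ℝ ∞ (fun q : ℝ × ℝ => ernstDenom t q.2) := by unfold ernstDenom; fun_prop
  have hm' : ContDiffOn ℝ ∞ (fun q : ℝ × ℝ => ernstMobiusDeriv t q.2) U :=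
    (hk _).div (hG.contDiffOn.pow 2) fun q hq => pow_ne_zero 2 (ernstDenom_pos t hq.2).ne'
  have hm'0 : ∀ q ∈ U, ernstMobiusDeriv t q.2 ≠ 0 := fun q hq => (ernstMobiusDeriv_pos ht hq.2).ne'
  have hr : ContDiffOn ℝ ∞ (fun q : ℝ × ℝ => e + q.1) U := by fun_prop
  have hr0 : ∀ q ∈ U, (e + q.1) ^ 2 ≠ 0 := fun q hq => pow_ne_zero 2 (hb q hq).1.ne'
  have hσ : ContDiffOn ℝ ∞
      (fun q : ℝ × ℝ => (1 + ernstA e (2 * t / e) * (e + q.1) * ernstMobius t q.2) ^ 2) U :=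
    ((hk 1).add (((hk _).mul hr).mul hm)).pow 2
  have hσ0 : ∀ q ∈ U, (1 + ernstA e (2 * t / e) * (e + q.1) * ernstMobius t q.2) ^ 2 ≠ 0 :=
    fun q hq => pow_ne_zero 2 (one_add_ernstA_mul_pos (hb q hq).1 (hb q hq).2 (hy q hq)).ne'
  have hA : ContDiffOn ℝ ∞
      (fun q : ℝ × ℝ => 1 - ernstA e (2 * t / e) ^ 2 * (e + q.1) ^ 2) U :=
    (hk 1).sub ((hk _).mul (hr.pow 2))
  have hP : ContDiffOn ℝ ∞ (fun q : ℝ × ℝ => ernstP e (2 * t / e) (ernstMobius t q.2)) U :=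
    ((hk 1).add ((hk _).mul hm)).pow 2
  have hc : ContDiffOn ℝ ∞ (fun q : ℝ × ℝ => 1 - ernstMobius t q.2 ^ 2) U :=
    (hk 1).sub (hm.pow 2)
  have hPc := hP.mul hc
  have hPc0 : ∀ q ∈ U, ernstP e (2 * t / e) (ernstMobius t q.2) * (1 - ernstMobius t q.2 ^ 2) ≠ 0 :=
    fun q hq => mul_ne_zero (ernstP_pos he ht (hy q hq)).ne' (one_sub_sq_pos (hy q hq)).ne'
  have hX : ContDiffOn ℝ ∞
      (fun q : ℝ × ℝ => ernstX₀ e (2 * t / e) (e + q.1) (ernstMobius t q.2)) U :=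
    ((hP.mul (hr.pow 2)).mul hc).div hσ hσ0
  have hD : ContDiffOn ℝ ∞
      (fun q : ℝ × ℝ => ernstD e (2 * t / e) (e + q.1) (ernstMobius t q.2)) U :=
    (((hk 1).add (((hk _).mul hm).div_const 2)).pow 2).add ((hk _).mul hX)
  have hD0 : ∀ q ∈ U, ernstD e (2 * t / e) (e + q.1) (ernstMobius t q.2) ≠ 0 := fun q hq =>
    (ernstD_pos he ht (hb q hq).1 (hb q hq).2 (hy q hq)).ne'
  have hφ : ContDiffOn ℝ ∞
      (fun q : ℝ × ℝ => ernstPotential e (2 * t / e) (e + q.1) (ernstMobius t q.2)) U :=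
    (((hk _).mul hm).add ((hk _).mul (hX.add ((hk _).mul (hm.pow 2))))).div hD hD0
  intro u hu
  simp only [List.mem_cons, List.not_mem_nil, or_false, ernstHorizon] at hu
  rcases hu with rfl | rfl | rfl | rfl | rfl | rfl | rfl | rfl | rfl
  · exact ((hD.pow 2).mul hA).div ((hr.pow 2).mul hσ) fun q hq =>
      mul_ne_zero (hr0 q hq) (hσ0 q hq)
  · exact hk 0
  · exact (((hD.pow 2).mul (hr.pow 2)).div (hPc.mul hσ) fun q hq =>
      mul_ne_zero (hPc0 q hq) (hσ0 q hq)).mul (hm'.pow 2)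
  · exact hX.div (hD.pow 2) fun q hq => pow_ne_zero 2 (hD0 q hq)
  · exact hk 0
  · exact (hD.pow 2).div ((hr.pow 2).mul hm') fun q hq => mul_ne_zero (hr0 q hq) (hm'0 q hq)
  · exact hm'.mul (((hD.pow 2).mul hA).div ((hr.pow 2).mul hPc) fun q hq =>
      mul_ne_zero (hr0 q hq) (hPc0 q hq))
  · exact (hk _).mul hφ
  · exact (hk _).mul hφ

end

/-- Once the horizon values are inserted, each condition is an identity of rational functions in
`e`, `t` and `z`. The factor `k = (1 + t²)²` rescales the angle so that the horizon metric is the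
standard round one. -/
lemma isRegular_ernstHorizon (qe qm : ℝ) {e t : ℝ} (he : 0 < e) (ht : t ^ 2 < 1) :
    (ernstHorizon qe qm e t).IsRegular (ernstWidth e t) := by
  have h1 : 0 < 1 + t ^ 2 := by positivity
  have h2 : 0 < 1 - t ^ 2 := by linarith
  have hid := (hasDerivAt_id' (0 : ℝ)).const_add e
  have hA := ((hid.fun_pow 2).const_mul (ernstA e (2 * t / e) ^ 2)).const_sub 1
  have hA0 : 1 - ernstA e (2 * t / e) ^ 2 * (e + 0) ^ 2 ≠ 0 := by
    rw [add_zero, one_sub_ernstA_sq_mul he]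
    positivity
  have hσ := fun z => (((hid.const_mul (ernstA e (2 * t / e))).mul_const
    (ernstMobius t z)).const_add 1).fun_pow 2
  have hσ0 : ∀ z ∈ Set.Ioo (-1 : ℝ) 1,
      (1 + ernstA e (2 * t / e) * (e + 0) * ernstMobius t z) ^ 2 ≠ 0 := fun z hz => by
    have hG := ernstDenom_pos t hz
    rw [add_zero, one_add_ernstA_mul he hG]
    positivity
  have hr0 : (e + 0) ^ 2 ≠ 0 := by rw [add_zero]; positivity
  have hD := fun z hz => (hasDerivAt_ernstD he ht (ernstDenom_pos t (z := z) hz)).fun_pow 2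
  have hD0 : ∀ z ∈ Set.Ioo (-1 : ℝ) 1,
      ernstD e (2 * t / e) (e + 0) (ernstMobius t z) ^ 2 ≠ 0 := fun z hz => by
    have hG := ernstDenom_pos t hz
    rw [add_zero, ernstD_horizon he ht hG]
    positivity
  have hPc0 : ∀ z ∈ Set.Ioo (-1 : ℝ) 1,
      ernstP e (2 * t / e) (ernstMobius t z) * (1 - ernstMobius t z ^ 2) ≠ 0 := fun z hz =>
    mul_ne_zero (ernstP_pos he ht (ernstMobius_mem ht hz)).ne'
      (one_sub_sq_pos (ernstMobius_mem ht hz)).ne'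
  have hφ0 : ∀ z ∈ Set.Ioo (-1 : ℝ) 1, HasDerivAt
      (fun z => ernstPotential e (2 * t / e) (e + 0) (ernstMobius t z)) (e / (1 - t ^ 2)) z := by
    intro z hz
    have hev : (fun z => ernstPotential e (2 * t / e) (e + 0) (ernstMobius t z)) =ᶠ[𝓝 z]
        fun z => e * (z - t) / (1 - t ^ 2) :=
      Filter.eventuallyEq_of_mem (isOpen_Ioo.mem_nhds hz) fun y hy => by
        simp only [add_zero]
        exact ernstPotential_horizon he ht (ernstDenom_pos t hy)
    refine HasDerivAt.congr_of_eventuallyEq ?_ hev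
    exact ((((hasDerivAt_id' z).sub_const t).const_mul e).div_const (1 - t ^ 2)).congr_deriv
      (by ring)
  refine
    { η_pos := ernstWidth_pos he ht
      k_pos := by simp only [ernstHorizon]; positivity
      V₀_pos := by simp only [ernstHorizon]; positivity
      rp_pos := by simp only [ernstHorizon]; positivity
      smooth := contDiffOn_ernstHorizon qe qm he ht
      smooth_V := ?_
      V_zero := ?_
      V_deriv := ((hid.fun_pow 2).fun_div hA hA0).congr_deriv ?_
      n_zero := fun z hz => ?_
      Q_zero := fun z hz => ?_
      X_zero := fun z hz => ?_
      μ_zero := fun z hz => ?_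
      ν_zero := fun z hz => ?_
      α_zero := fun z hz => ((hφ0 z hz).const_mul
        (qm * (1 - t ^ 2) / (e * (1 + t ^ 2) ^ 2))).congr_deriv ?_
      β_zero := fun z hz => ((hφ0 z hz).const_mul
        (-(qe * (1 - t ^ 2) / (e * (1 + t ^ 2) ^ 2)))).congr_deriv ?_
      n_deriv := fun z hz => (((hD z hz).fun_mul hA).fun_div ((hid.fun_pow 2).fun_mul (hσ z))
        (mul_ne_zero hr0 (hσ0 z hz))).congr_deriv ?_
      Q_deriv := fun z hz => ((((hD z hz).fun_mul (hid.fun_pow 2)).fun_div ((hσ z).const_mul _)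
        (mul_ne_zero (hPc0 z hz) (hσ0 z hz))).mul_const (ernstMobiusDeriv t z ^ 2)).congr_deriv ?_
      X_deriv := fun z hz => ((hasDerivAt_ernstX₀ he ht (ernstDenom_pos t hz)).fun_div (hD z hz)
        (hD0 z hz)).congr_deriv ?_
      μ_deriv := fun z hz => ((hD z hz).fun_div ((hid.fun_pow 2).mul_const
        (ernstMobiusDeriv t z))
        (mul_ne_zero hr0 (ernstMobiusDeriv_pos ht hz).ne')).congr_deriv ?_
      α_deriv := fun z hz => ((hasDerivAt_ernstPotential he ht (ernstDenom_pos t hz)).const_mul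
        (qm * (1 - t ^ 2) / (e * (1 + t ^ 2) ^ 2))).congr_deriv ?_
      β_deriv := fun z hz => ((hasDerivAt_ernstPotential he ht (ernstDenom_pos t hz)).const_mul
        (-(qe * (1 - t ^ 2) / (e * (1 + t ^ 2) ^ 2)))).congr_deriv ?_ }
  · refine ContDiffOn.div (by fun_prop) (by fun_prop) fun s hs => ?_
    exact (one_sub_ernstA_sq_mul_pos (ernst_bounds he ht hs).1 (ernst_bounds he ht hs).2).ne'
  · simp only [ernstHorizon, add_zero, one_sub_ernstA_sq_mul he]
    field_simp
  · simp only [ernstHorizon, add_zero, one_sub_ernstA_sq_mul he]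
    rw [ernstA_eq he]
    push_cast
    field_simp
    ring
  iterate 5
    · have hG := ernstDenom_pos t hz
      have hc := (one_sub_sq_pos hz).ne'
      simp only [ernstHorizon, add_zero, one_sub_ernstA_sq_mul he, ernstD_horizon he ht hG,
        ernstX₀_horizon he ht hG, one_add_ernstA_mul he hG, ernstP, one_sub_ernstMobius_sq hG,
        ernstMobiusDeriv]
      field_simp
  · simp only [ernstHorizon]
    field_simp
  · simp only [ernstHorizon]
    field_simp
  all_goals
    have hG := ernstDenom_pos t hz
    have hc := (one_sub_sq_pos hz).ne'
    simp only [HorizonData.slope, HorizonData.bend, HorizonData.bendDeriv, HorizonData.delayDeriv,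
      HorizonData.shift, HorizonData.shiftDeriv, ernstHorizon, add_zero, one_sub_ernstA_sq_mul he,
      ernstD_horizon he ht hG, ernstX₀_horizon he ht hG, one_add_ernstA_mul he hG, ernstP,
      one_sub_ernstMobius_sq hG, ernstMobiusDeriv]
    try rw [ernstA_eq he]
    try rw [ernstMobius]
    push_cast
    field_simp
    try simp only [ernstDenom]
    ring1

lemma ernstMaxwell_potential_re (qe qm rp x : ℝ) :
    ((qm - qe * Complex.I) / rp * (x : ℂ) : ℂ).re = qm / rp * x := by
  rw [Complex.re_mul_ofReal, Complex.div_ofReal_re]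
  simp

lemma ernstMaxwell_potential_im (qe qm rp x : ℝ) :
    ((qm - qe * Complex.I) / rp * (x : ℂ) : ℂ).im = -(qe / rp) * x := by
  rw [Complex.im_mul_ofReal, Complex.div_ofReal_im]
  simp [neg_div]

lemma differentiableAt_ernstPotential {e b r y : ℝ} (hσ : 1 + ernstA e b * r * y ≠ 0)
    (hD : ernstD e b r y ≠ 0) : DifferentiableAt ℝ (ernstPotential e b r) y := by
  have hX : DifferentiableAt ℝ (ernstX₀ e b r) y := by
    unfold ernstX₀ ernstP
    exact DifferentiableAt.fun_div (by fun_prop) (by fun_prop) (pow_ne_zero 2 hσ)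
  have hdD : DifferentiableAt ℝ (ernstD e b r) y := by
    unfold ernstD
    fun_prop
  unfold ernstPotential
  exact DifferentiableAt.fun_div (by fun_prop) hdD hD

/-- Extreme Ernst. -/
theorem isContainedInModuliSpace_ernst {qe qm e t : ℝ} (he : 0 < e) (ht : t ^ 2 < 1)
    (hq : qe ^ 2 + qm ^ 2 = (e * (1 + t ^ 2) ^ 2 / (1 - t ^ 2)) ^ 2) :
    IsContainedInModuliSpace (ernstMetric e (2 * t / e))
      (ernstMaxwell ((qm - qe * Complex.I) / (e * (1 + t ^ 2) ^ 2 / (1 - t ^ 2) : ℝ)) e (2 * t / e))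
      (ernstExterior e (2 * t / e)) e qe qm (e * (1 + t ^ 2) ^ 2 / (1 - t ^ 2))
      (2 * e * (1 + t ^ 2) ^ 3 / (1 - t ^ 2) ^ 3)
      (12 * e * t ^ 2 * (1 + t ^ 2) ^ 3 / (1 - t ^ 2) ^ 4) := by
  have h1 : 0 < 1 + t ^ 2 := by positivity
  have h2 : 0 < 1 - t ^ 2 := by linarith
  have h := isRegular_ernstHorizon qe qm he ht
  have hb : ∀ s ∈ Set.Ioo 0 (ernstWidth e t),
      0 < e + s ∧ |ernstA e (2 * t / e)| * (e + s) < 1 := fun s hs =>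
    ernst_bounds he ht ⟨by linarith [hs.1, hs.2], hs.2⟩
  have hpos : ∀ s ∈ Set.Ioo 0 (ernstWidth e t), ∀ z ∈ Set.Ioo (-1 : ℝ) 1,
      0 < 1 - ernstA e (2 * t / e) ^ 2 * (e + s) ^ 2 ∧
      0 < 1 + ernstA e (2 * t / e) * (e + s) * ernstMobius t z ∧
      0 < ernstP e (2 * t / e) (ernstMobius t z) ∧
      0 < ernstD e (2 * t / e) (e + s) (ernstMobius t z) ∧
      0 < 1 - ernstMobius t z ^ 2 ∧ 0 < ernstMobiusDeriv t z := fun s hs z hz => by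
    have hy := ernstMobius_mem ht hz
    exact ⟨one_sub_ernstA_sq_mul_pos (hb s hs).1 (hb s hs).2,
      one_add_ernstA_mul_pos (hb s hs).1 (hb s hs).2 hy, ernstP_pos he ht hy,
      ernstD_pos he ht (hb s hs).1 (hb s hs).2 hy, one_sub_sq_pos hy, ernstMobiusDeriv_pos ht hz⟩
  have hm : ∀ z ∈ Set.Ioo (-1 : ℝ) 1, HasDerivAt (ernstMobius t) (ernstMobiusDeriv t z) z :=
    fun z hz => hasDerivAt_ernstMobius (ernstDenom_pos t hz)
  refine isContainedInModuliSpace_of_hasTransverseDeformation (by positivity) hq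
    (h.hasTransverseDeformation (m := ernstMobius t) (m' := ernstMobiusDeriv t)
    (contDiffOn_ernstMobius t) hm (fun z hz => (ernstMobiusDeriv_pos ht hz).ne')
    (injOn_ernstMobius ht)
    (fun s hs z hz => ⟨⟨by simpa using hs.1, (hb s hs).2⟩, ernstMobius_mem ht hz⟩) ?_ ?_)
  · intro s hs z hz τ ψ
    obtain ⟨hA, hσ, hP, hD, hc, hd⟩ := hpos s hs z hz
    have hr := (hb s hs).1
    have hs0 := hs.1.ne'
    refine HorizonData.circularMetric_eq_staticMetric ?_ ?_ ?_ ?_ ?_ τ ψ <;>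
      simp only [ernstCoeffN, ernstCoeffP, ernstCoeffQ, ernstCoeffX, ernstQ, ernstHorizon,
        add_sub_cancel_left, mul_zero, neg_zero, add_zero] <;> field_simp
  · intro s hs z hz τ ψ
    obtain ⟨hA, hσ, hP, hD, hc, hd⟩ := hpos s hs z hz
    have hr := (hb s hs).1
    have hs0 := hs.1
    have hmem : (s, z) ∈ collar (ernstWidth e t) := ⟨⟨by linarith [hs.1, hs.2], hs.2⟩, hz⟩
    have hα := ContDiffOn.differentiableAt_of_isOpen
      (h.smooth (ernstHorizon qe qm e t).α (by simp)) (isOpen_collar _) hmem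
    have hβ := ContDiffOn.differentiableAt_of_isOpen
      (h.smooth (ernstHorizon qe qm e t).β (by simp)) (isOpen_collar _) hmem
    -- The horizon data know the potential only composed with the Möbius map. Differentiability in
    -- `y` itself allows the chain rule to be divided by the nonzero derivative of that map.
    have hφ := (differentiableAt_ernstPotential hσ.ne' hD.ne').hasDerivAt
    have hcα : qm / (e * (1 + t ^ 2) ^ 2 / (1 - t ^ 2))
        = qm * (1 - t ^ 2) / (e * (1 + t ^ 2) ^ 2) := by field_simp
    have hcβ : qe / (e * (1 + t ^ 2) ^ 2 / (1 - t ^ 2))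
        = qe * (1 - t ^ 2) / (e * (1 + t ^ 2) ^ 2) := by field_simp
    have hX₀ : ∀ r y, ernstX₀ e (2 * t / e) r y = ernstP e (2 * t / e) y * r ^ 2 * (1 - y ^ 2)
        / (1 + ernstA e (2 * t / e) * r * y) ^ 2 := fun r y => rfl
    refine HorizonData.circularMaxwell_eq_staticMaxwell hd.ne' ?_ ?_ ?_ ?_ ?_ ?_ ?_ τ ψ
    · simp [ernstHorizon]
    · rw [Real.sqrt_eq_iff_mul_self_eq_of_pos] <;>
        simp only [ernstCoeffN, ernstCoeffP, ernstCoeffQ, ernstCoeffX, ernstQ, ernstHorizon,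
          add_sub_cancel_left, hX₀]
      · clear hφ
        -- These two factors only have to be nonzero in the identity; as opaque symbols they are not
        -- expanded.
        generalize 1 + ernstA e (2 * t / e) * (e + s) * ernstMobius t z = σ at hσ ⊢
        generalize 1 - ernstA e (2 * t / e) ^ 2 * (e + s) ^ 2 = κ at hA ⊢
        field_simp
      · positivity
    · rw [Real.sqrt_eq_iff_mul_self_eq_of_pos] <;>
        simp only [ernstCoeffN, ernstCoeffP, ernstCoeffQ, ernstCoeffX, ernstQ, ernstHorizon,
          add_sub_cancel_left, hX₀]
      · clear hφ
        generalize 1 + ernstA e (2 * t / e) * (e + s) * ernstMobius t z = σ at hσ ⊢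
        generalize 1 - ernstA e (2 * t / e) ^ 2 * (e + s) ^ 2 = κ at hA ⊢
        field_simp
      · positivity
    all_goals
      simp only [ernstMaxwell_potential_re, ernstMaxwell_potential_im, hcα, hcβ]
    · have e1 := hasDerivAt_pds hα
      have e2 := HasDerivAt.comp_sub_const (e + s) e
        (f := fun s => (ernstHorizon qe qm e t).α (s, z)) (by rwa [add_sub_cancel_left])
      refine e2.congr_of_eventuallyEq (Filter.Eventually.of_forall fun ϱ => ?_)
      simp only [ernstHorizon, add_sub_cancel]
      rfl
    · have e1 := hasDerivAt_pdz hα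
      have e2 := (hφ.comp z (hm z hz)).const_mul (qm * (1 - t ^ 2) / (e * (1 + t ^ 2) ^ 2))
      rw [e1.unique e2]
      exact (hφ.const_mul _).congr_deriv (by field_simp)
    · have e1 := hasDerivAt_pds hβ
      have e2 := HasDerivAt.comp_sub_const (e + s) e
        (f := fun s => (ernstHorizon qe qm e t).β (s, z)) (by rwa [add_sub_cancel_left])
      refine e2.congr_of_eventuallyEq (Filter.Eventually.of_forall fun ϱ => ?_)
      simp only [ernstHorizon, add_sub_cancel]
      rfl
    · have e1 := hasDerivAt_pdz hβ
      have e2 := (hφ.comp z (hm z hz)).const_mul (-(qe * (1 - t ^ 2) / (e * (1 + t ^ 2) ^ 2)))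
      rw [e1.unique e2]
      exact (hφ.const_mul _).congr_deriv (by field_simp)

end ExtremeHorizon

end

/-! ### The main theorem. -/

theorem theorem1 (qe qm rp : ℝ) (hrp : 0 < rp) (hq : qe ^ 2 + qm ^ 2 = rp ^ 2) :
    -- the moduli spaces of axisymmetric and of static axisymmetric deformations
    (∃ 𝒟 𝒮 𝒢 : Submodule ℝ FirstOrderData,
      (𝒟 : Set FirstOrderData) = axisymmetricDeformations qe qm rp ∧
      (𝒮 : Set FirstOrderData) = staticDeformations qe qm rp ∧
      (𝒢 : Set FirstOrderData) = {D | IsPureGauge qe qm rp D} ∧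
      Module.finrank ℝ (𝒟 ⧸ 𝒢.submoduleOf 𝒟) = 3 ∧
      Module.finrank ℝ (𝒮 ⧸ 𝒢.submoduleOf 𝒮) = 2) ∧
    -- they are parametrised by `(K₁, K₂, K₃)`, and static means `K₁ = 0`
    (∀ K₁ K₂ K₃ : ℝ, normalForm qe qm rp K₁ K₂ K₃ ∈ axisymmetricDeformations qe qm rp) ∧
    (∀ D ∈ axisymmetricDeformations qe qm rp, ∃! K : ℝ × ℝ × ℝ,
      GaugeEquivalent qe qm rp D (normalForm qe qm rp K.1 K.2.1 K.2.2)) ∧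
    (∀ D ∈ axisymmetricDeformations qe qm rp, ∀ K₁ K₂ K₃ : ℝ,
      GaugeEquivalent qe qm rp D (normalForm qe qm rp K₁ K₂ K₃) → (D.IsStatic ↔ K₁ = 0)) ∧
    -- extreme Reissner–Nordström
    IsContainedInModuliSpace (rnMetric rp) (rnMaxwell qe qm) (rnExterior rp) rp
      qe qm rp (2 * rp) 0 ∧
    -- extreme Ernst
    (∀ e b : ℝ, 0 < e → e ^ 2 * b ^ 2 < 4 → ernstRadius e b = rp →
      IsContainedInModuliSpace (ernstMetric e b)
        (ernstMaxwell ((qm - qe * Complex.I) / rp) e b) (ernstExterior e b) e qe qm rp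
        (2 * e * (4 + b ^ 2 * e ^ 2) ^ 3 / (4 - b ^ 2 * e ^ 2) ^ 3)
        (12 * b ^ 2 * e ^ 3 * (4 + b ^ 2 * e ^ 2) ^ 3 / (4 - b ^ 2 * e ^ 2) ^ 4)) ∧
    -- extreme Kerr–Melvin with a static near-horizon geometry
    (∀ a b : ℝ, 0 < a → a ^ 2 * b ^ 2 = 1 → 2 * a = rp →
      IsContainedInModuliSpace (kerrMelvinMetric a b)
        (kerrMelvinMaxwell (a * b * ((qe + qm * Complex.I) / rp)) a b)
        (kerrMelvinExterior a) a qe qm rp 0 (6 * a)) := by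
  refine ⟨exists_moduli_spaces hrp hq, fun K₁ K₂ K₃ => normalForm_mem K₁ K₂ K₃ hrp hq,
    fun D hD => existsUnique_moduli hrp hq hD,
    fun D hD K₁ K₂ K₃ h => isStatic_iff_of_gaugeEquivalent hrp hq hD h, ?_, ?_, ?_⟩
  · exact isContainedInModuliSpace_rn hrp hq
  · intro e b he hb hr
    -- With `t = b e/2` the condition `e² b² < 4` reads `t² < 1`, and the factors `4 ± b² e²` become
    -- `4 (1 ± t²)`.
    obtain ⟨t, rfl⟩ : ∃ t, b = 2 * t / e := ⟨b * e / 2, by field_simp⟩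
    have h1 : e ^ 2 * (2 * t / e) ^ 2 = 4 * t ^ 2 := by field_simp; ring
    have ht : t ^ 2 < 1 := by linarith
    have h2 : (2 * t / e) ^ 2 * e ^ 2 = 4 * t ^ 2 := by rw [mul_comm, h1]
    have h3 : (2 * t / e) ^ 2 * e ^ 3 = 4 * t ^ 2 * e := by rw [← h2]; ring
    have h4 : 0 < 1 - t ^ 2 := by linarith
    have h5 : rp = e * (1 + t ^ 2) ^ 2 / (1 - t ^ 2) := by
      rw [← hr, ernstRadius, h2, show 4 - 4 * t ^ 2 = 4 * (1 - t ^ 2) by ring]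
      field_simp
    have h := isContainedInModuliSpace_ernst he ht (h5 ▸ hq)
    rw [← h5] at h
    convert h using 1
    · rw [h2, show 4 - 4 * t ^ 2 = 4 * (1 - t ^ 2) by ring]
      field_simp
    · rw [mul_assoc 12, h3, h2, show 4 - 4 * t ^ 2 = 4 * (1 - t ^ 2) by ring]
      field_simp
  · rintro a b ha hab rfl
    exact isContainedInModuliSpace_kerrMelvin ha hab hq
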